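/- Let $(\Omega,\mathcal F,(\mathcal F_t)_{t\ge 0},\mathbb P)$ be a filtered probability space carrying a $d$-dimensional $(\mathcal F_t)$-Brownian motion $W$ and an $(\mathcal F_t)$-Poisson point process on $(0,\infty)\times\mathbf Z$ ($\mathbf Z$ a Polish space) with counting measure $N$ and intensity $dt\,\nu(dz)$, $\nu$ $\sigma$-finite, independent of $W$. Let $\mathbf Z_0\subset\mathbf Z$ be Borel with $\nu(\mathbf Z\setminus\mathbf Z_0)<\infty$, and let $\bar N(dt,dz)=N(dt,dz)-\nu(dz)dt$ on $\mathbf Z_0$ and $\bar N=N$ on $\mathbf Z\setminus\mathbf Z_0$. The factor process $X$ is the continuous adapted $\mathbb R^n$-valued process with $$dX(t)=(b+BX(t))\,dt+\Lambda\,dW(t),\qquad X(0)\sim N(m_0,P_0)\ \text{independent of } (W,N).$$ Let $a_0\in\mathbb R$, $a\in\mathbb R^m$, $A\in\mathbb R^{m\times n}$, $\Sigma=(\sigma_{ik})\in\mathbb R^{m\times d}$, and let $\gamma:\mathbf Z\to\mathbb R^m$ be Borel with $\gamma_i>-1$ $\nu$-a.e., $\int_{\mathbf Z_0}\gamma_i^2\,d\nu<\infty$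 and $\int_{\mathbf Z_0}|\ln(1+\gamma_i)-\gamma_i|\,d\nu<\infty$ for $i=1,\dots,m$. The asset prices $S=(S_0,\dots,S_m)$ are càdlàg, adapted and satisfy $dS_0=a_0S_0\,dt$, $S_0(0)=s_0$, and, for $i=1,\dots,m$, $$\frac{dS_i(t)}{S_i(t^-)}=(a+AX(t))_i\,dt+\sum_{k=1}^d\sigma_{ik}\,dW_k(t)+\int_{\mathbf Z}\gamma_i(z)\,\bar N(dt,dz),\qquad S_i(0)=s_i>0 .$$ Define $\mathbb R^m$-valued processes $Y^1,Y^2$ by $$dY^1(t)=AX(t)\,dt+\Sigma\,dW(t),\quad Y^1(0)=0,$$ $$dY^2_i(t)=c_i\,dt+\int_{\mathbf Z}\ln(1+\gamma_i(z))\,\bar N(dt,dz),\quad Y^2_i(0)=\log s_i,$$ $$c_i=a_i-\tfrac12(\Sigma\Sigma^T)_{ii}+\int_{\mathbf Z_0}\{\ln(1+\gamma_i(z))-\gamma_i(z)\}\,\nu(dz).$$ Let $\mathcal F^S_t=\sigma\{S_j(u):0\le u\le t,\ 0\le j\le m\}$ and $\mathcal Y_{1t}=\sigma\{Y^1(u):0\le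 u\le t\}$. Then, almost surely, $S_i(t)>0$ and $Y_i(t):=\log S_i(t)=Y^1_i(t)+Y^2_i(t)$ for all $t\ge0$ and $1\le i\le m$, and (i) $Y^1$ and $Y^2$ are adapted to the filtration $(\mathcal F^S_t)$ augmented by the $\mathbb P$-null sets; (ii) for every $t\ge 0$ and every bounded measurable $f:\mathbb R^n\to\mathbb R$, $\mathbf E[f(X(t))\mid\mathcal F^S_t]=\mathbf E[f(X(t))\mid\mathcal Y_{1t}]$ almost surely; the same holds when both $\sigma$-algebras are augmented by the $\mathbb P$-null sets. -/

import Mathlib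

open MeasureTheory ProbabilityTheory Filter Topology Set
open scoped NNReal ENNReal

noncomputable section

namespace JumpMarket

variable {Ω Z : Type*} {mΩ : MeasurableSpace Ω} [MeasurableSpace Z]

/-! ### σ-algebras generated by processes -/

/-- The σ-algebra `σ{Y(u) : 0 ≤ u ≤ t}`. -/
def history {E : Type*} [mE : MeasurableSpace E] (Y : ℝ≥0 → Ω → E) (t : ℝ≥0) :
    MeasurableSpace Ω :=
  ⨆ u ∈ Set.Iic t, MeasurableSpace.comap (Y u) mE

/-- The σ-algebra generated by the whole process `Y`. -/
def processSigma {E : Type*} [mE : MeasurableSpace E] (Y : ℝ≥0 → Ω → E) :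
    MeasurableSpace Ω :=
  ⨆ u, MeasurableSpace.comap (Y u) mE

/-- The σ-algebra `m` augmented by all (measurable) `P`-null sets. -/
def augment (P : Measure Ω) (m : MeasurableSpace Ω) : MeasurableSpace Ω :=
  m ⊔ MeasurableSpace.generateFrom {A : Set Ω | MeasurableSet[mΩ] A ∧ P A = 0}

/-- Right-continuous paths with left limits. -/
def IsCadlag (y : ℝ≥0 → ℝ) : Prop :=
  ∀ t, ContinuousWithinAt y (Set.Ici t) t ∧ ∃ l, Tendsto y (𝓝[<] t) (𝓝 l)

/-! ### Driving noises -/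

/-- `W` is a `d`-dimensional standard Brownian motion relative to the filtration `𝓕`. -/
structure IsBrownianMotion {d : ℕ} (𝓕 : Filtration ℝ≥0 mΩ) (P : Measure Ω)
    (W : ℝ≥0 → Ω → Fin d → ℝ) : Prop where
  adapted : Adapted 𝓕 W
  component : ∀ k, IsBrownianReal (fun t ω => W t ω k) P
  indep_components : iIndepFun (fun (k : Fin d) (ω : Ω) (t : ℝ≥0) => W t ω k) P
  indep_past : ∀ s t : ℝ≥0, s ≤ t →
    Indep (MeasurableSpace.comap (fun ω => W t ω - W s ω) inferInstance) (𝓕 s) P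

/-- The counting measure of a point function `q` on `(0, ∞)` with values in `Z`
(`q s = none` means that there is no point at time `s`): the number of points
`(s, q s)` lying in `B`. -/
def pointCount (q : ℝ → Option Z) (B : Set (ℝ × Z)) : ℕ∞ :=
  {s : ℝ | ∃ z, q s = some z ∧ (s, z) ∈ B}.encard

/-- The intensity `dt ⊗ ν(dz)` on `(0, ∞) × Z`. -/
def intensity (ν : Measure Z) : Measure (ℝ × Z) :=
  (volume.restrict (Set.Ioi (0 : ℝ))).prod ν

/-- `p` is a (stationary) Poisson point process relative to the filtration `𝓕`, with
characteristic measure `ν`: a random point function whose counting measure is an adapted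
Poisson random measure with intensity `dt ⊗ ν(dz)` and whose restriction to `(t, ∞) × Z`
is independent of `𝓕 t`, for all `t`. -/
structure IsPoissonPointProcess (𝓕 : Filtration ℝ≥0 mΩ) (P : Measure Ω) (ν : Measure Z)
    (p : Ω → ℝ → Option Z) : Prop where
  dom_pos : ∀ ω s, s ≤ 0 → p ω s = none
  dom_countable : ∀ ω, {s : ℝ | p ω s ≠ none}.Countable
  measurable_count : ∀ B : Set (ℝ × Z), MeasurableSet B →
    Measurable (fun ω => pointCount (p ω) B)
  poisson : ∀ B : Set (ℝ × Z), MeasurableSet B → intensity ν B ≠ ∞ →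
    HasLaw (fun ω => pointCount (p ω) B)
      ((poissonMeasure (intensity ν B).toNNReal).map (Nat.cast : ℕ → ℕ∞)) P
  indep_disjoint : ∀ (l : ℕ) (B : Fin l → Set (ℝ × Z)), (∀ i, MeasurableSet (B i)) →
    Pairwise (fun i j => Disjoint (B i) (B j)) →
    iIndepFun (fun i ω => pointCount (p ω) (B i)) P
  adapted : ∀ (t : ℝ≥0) (B : Set (ℝ × Z)), MeasurableSet B →
    B ⊆ Set.Iic (t : ℝ) ×ˢ Set.univ → Measurable[𝓕 t] (fun ω => pointCount (p ω) B)
  indep_past : ∀ t : ℝ≥0,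
    Indep (⨆ B ∈ {B : Set (ℝ × Z) | MeasurableSet B ∧ B ⊆ Set.Ioi (t : ℝ) ×ˢ Set.univ},
      MeasurableSpace.comap (fun ω => pointCount (p ω) B) inferInstance) (𝓕 t) P

/-- The σ-algebra generated by the point process `p`. -/
def pointSigma (p : Ω → ℝ → Option Z) : MeasurableSpace Ω :=
  ⨆ B ∈ {B : Set (ℝ × Z) | MeasurableSet B},
    MeasurableSpace.comap (fun ω => pointCount (p ω) B) inferInstance

/-! ### Stochastic integrals -/

/-- `∫_{(0,t]} ∫_U f(z) N(ds, dz)`, where `N` is the counting measure of `q` and only finitely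
many points of `q` up to time `t` lie in `U`. -/
def jumpSum (q : ℝ → Option Z) (U : Set Z) (f : Z → ℝ) (t : ℝ≥0) : ℝ :=
  ∑ᶠ s ∈ {s : ℝ | s ≤ t ∧ ∃ z ∈ U, q s = some z}, (q s).elim 0 f

/-- `J` is (a càdlàg version of) the process `t ↦ ∫_{(0,t]} ∫_Z f(z) N̄(ds, dz)`, where `N̄` is
`N(ds, dz) - ν(dz) ds` on `Z₀` and `N(ds, dz)` off `Z₀`. The compensated integral over `Z₀` is
the limit in probability, as `k → ∞`, of the compensated integrals over
`Z₀ ∩ {|f| > 1 / (k + 1)}`. -/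
structure IsJumpIntegral (P : Measure Ω) (ν : Measure Z) (Z₀ : Set Z) (p : Ω → ℝ → Option Z)
    (f : Z → ℝ) (J : ℝ≥0 → Ω → ℝ) : Prop where
  measurable : ∀ t, Measurable (J t)
  cadlag : ∀ᵐ ω ∂P, IsCadlag (fun t => J t ω)
  limit : ∀ t : ℝ≥0, TendstoInMeasure P
    (fun (k : ℕ) ω =>
      jumpSum (p ω) {z | z ∉ Z₀ ∨ 1 / ((k : ℝ) + 1) < |f z|} f t
        - (t : ℝ) * ∫ z in Z₀ ∩ {z | 1 / ((k : ℝ) + 1) < |f z|}, f z ∂ν)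
    atTop (J t)

/-- A sequence of partitions `0 = τ k 0 ≤ τ k 1 ≤ ⋯ ≤ τ k (l k) = t` of `[0, t]` whose mesh
tends to `0` as `k → ∞`. -/
structure IsPartitionSeq (t : ℝ≥0) (l : ℕ → ℕ) (τ : ℕ → ℕ → ℝ≥0) : Prop where
  start : ∀ k, τ k 0 = 0
  finish : ∀ k, τ k (l k) = t
  mono : ∀ k, Monotone (τ k)
  mesh : ∀ ε : ℝ≥0, 0 < ε → ∀ᶠ k in atTop, ∀ j < l k, τ k (j + 1) ≤ τ k j + ε

/-- `I(t) = ∫_{(0,t]} H(u-) dR(u)` for all `t`, for a càdlàg adapted integrand `H` and a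
semimartingale `R`: the limit in probability of the left-point Riemann sums along any sequence
of partitions of `[0, t]` whose mesh tends to `0`. -/
def IsStochIntegral (P : Measure Ω) (H R I : ℝ≥0 → Ω → ℝ) : Prop :=
  ∀ (t : ℝ≥0) (l : ℕ → ℕ) (τ : ℕ → ℕ → ℝ≥0), IsPartitionSeq t l τ →
    TendstoInMeasure P
      (fun k ω => ∑ j ∈ Finset.range (l k),
        H (τ k j) ω * (R (τ k (j + 1)) ω - R (τ k j) ω))
      atTop (I t)

/-! ### Factors, prices and the two parts of the log-prices -/

/-- `dX = (b + B X) dt + Λ dW`, with continuous adapted `X`. -/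
structure IsFactorProcess {n d : ℕ} (𝓕 : Filtration ℝ≥0 mΩ) (P : Measure Ω)
    (b : Fin n → ℝ) (B : Matrix (Fin n) (Fin n) ℝ) (Lam : Matrix (Fin n) (Fin d) ℝ)
    (W : ℝ≥0 → Ω → Fin d → ℝ) (X : ℝ≥0 → Ω → EuclideanSpace ℝ (Fin n)) : Prop where
  adapted : Adapted 𝓕 X
  continuous : ∀ᵐ ω ∂P, Continuous (fun t => X t ω)
  sde : ∀ᵐ ω ∂P, ∀ (t : ℝ≥0) (i : Fin n),
    X t ω i = X 0 ω i + (∫ u in (0 : ℝ)..t, (b i + ∑ j, B i j * X u.toNNReal ω j))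
      + ∑ k, Lam i k * W t ω k

/-- The cumulative return
`R_i(t) = ∫₀ᵗ (a + A X)_i ds + ∑_k σ_{ik} W_k(t) + ∫₀ᵗ ∫_Z γ_i(z) N̄(ds, dz)`
of security `i`, where `G i` is the last integral. -/
def cumulativeReturn {m n d : ℕ} (a : Fin m → ℝ) (A : Matrix (Fin m) (Fin n) ℝ)
    (Sig : Matrix (Fin m) (Fin d) ℝ) (X : ℝ≥0 → Ω → EuclideanSpace ℝ (Fin n))
    (W : ℝ≥0 → Ω → Fin d → ℝ) (G : Fin m → ℝ≥0 → Ω → ℝ) (i : Fin m) (t : ℝ≥0) (ω : Ω) : ℝ :=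
  (∫ u in (0 : ℝ)..t, (a i + ∑ j, A i j * X u.toNNReal ω j))
    + ∑ k, Sig i k * W t ω k + G i t ω

/-- The asset prices. Component `0` is the money market account, `dS₀ = a₀ S₀ dt`; component
`i.succ` is the price of the risky security `i`, `dS_i(t) = S_i(t-) dR_i(t)`; initial values `s`. -/
structure IsPriceProcess {m : ℕ} (𝓕 : Filtration ℝ≥0 mΩ) (P : Measure Ω) (a₀ : ℝ)
    (s : Fin (m + 1) → ℝ) (R : Fin m → ℝ≥0 → Ω → ℝ) (S : ℝ≥0 → Ω → Fin (m + 1) → ℝ) : Prop where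
  adapted : Adapted 𝓕 S
  cadlag : ∀ᵐ ω ∂P, ∀ i, IsCadlag (fun t => S t ω i)
  money : ∀ᵐ ω ∂P, ∀ t : ℝ≥0, S t ω 0 = s 0 + ∫ u in (0 : ℝ)..t, a₀ * S u.toNNReal ω 0
  risky : ∀ i : Fin m, IsStochIntegral P (fun t ω => S t ω i.succ) (R i)
    (fun t ω => S t ω i.succ - s i.succ)

/-- `dY¹ = A X dt + Σ dW`, `Y¹(0) = 0`. -/
structure IsContinuousPart {m n d : ℕ} (P : Measure Ω) (A : Matrix (Fin m) (Fin n) ℝ)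
    (Sig : Matrix (Fin m) (Fin d) ℝ) (X : ℝ≥0 → Ω → EuclideanSpace ℝ (Fin n))
    (W : ℝ≥0 → Ω → Fin d → ℝ) (Y₁ : ℝ≥0 → Ω → Fin m → ℝ) : Prop where
  measurable : ∀ t, Measurable (Y₁ t)
  eq : ∀ᵐ ω ∂P, ∀ (t : ℝ≥0) (i : Fin m),
    Y₁ t ω i = (∫ u in (0 : ℝ)..t, ∑ j, A i j * X u.toNNReal ω j) + ∑ k, Sig i k * W t ω k

/-- `c_i = a_i - (ΣΣᵀ)_{ii} / 2 + ∫_{Z₀} (ln (1 + γ_i(z)) - γ_i(z)) ν(dz)`. -/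
def logDrift {m d : ℕ} (ν : Measure Z) (Z₀ : Set Z) (a : Fin m → ℝ)
    (Sig : Matrix (Fin m) (Fin d) ℝ) (γ : Z → Fin m → ℝ) (i : Fin m) : ℝ :=
  a i - (Sig * Sig.transpose) i i / 2 + ∫ z in Z₀, (Real.log (1 + γ z i) - γ z i) ∂ν

/-- `Y²_i(t) = log s_i + c_i t + ∫₀ᵗ ∫_Z ln (1 + γ_i(z)) N̄(ds, dz)`, where `L i` is the last
integral. -/
structure IsJumpPart {m : ℕ} (P : Measure Ω) (s : Fin (m + 1) → ℝ) (c : Fin m → ℝ)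
    (L : Fin m → ℝ≥0 → Ω → ℝ) (Y₂ : ℝ≥0 → Ω → Fin m → ℝ) : Prop where
  measurable : ∀ t, Measurable (Y₂ t)
  eq : ∀ᵐ ω ∂P, ∀ (t : ℝ≥0) (i : Fin m),
    Y₂ t ω i = Real.log (s i.succ) + c i * t + L i t ω

end JumpMarket

end

noncomputable section

namespace JumpMarket

set_option linter.unusedSectionVars false

section

/-! ### Convergence in probability, measurability up to null sets, orthogonal increments. -/

section Generic

variable {Ω : Type*} {mΩ : MeasurableSpace Ω} {P : Measure Ω}

/-! The price equation is linear, so each price is its initial value times the stochastic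
exponential of its return, and that exponential works out to be `exp (Y¹ + Y²)`. Once this is known
the two parts can be separated. Since `Y¹` is continuous, the jumps of `log S` are those of `Y²`,
and `Y²` is a deterministic drift plus a limit of compensated sums of its jumps. Hence `Y²`, and
then `Y¹ = log S - Y²`, are functionals of the observed prices up to null sets. Conversely `S` is a
function of `Y¹` and `Y²`, the money market account being deterministic, so the price history and
the joint history of the two parts have the same augmentation. Finally `X` and `Y¹` are functionals
of `X 0` and `W`, while `Y²` is a functional of the point process, and these sources are
independent. Observing `Y²` besides `Y¹` therefore adds nothing to the estimation of `X t`.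

The exponential formula is the long step, because stochastic integrals are given only as limits in
probability of Riemann sums. In place of Itô's formula, the product of a solution and the inverse
exponential is telescoped over a coarse grid. By `exp_step_bound` each cell contributes two centred
martingale increments and products of small factors. `tendsto_integral_compBound` makes the total
vanish, by orthogonality and Cauchy-Schwarz, and `exists_fine_mesh` refines the grid inside the
cells until the Riemann sums are accurate. The outcome, `IsExpPair.eq_exp`, needs moment bounds and
independence of increments from the past. The moments come from explicit Laplace functionals of
Brownian and Poisson sums (`integral_exp_noise`, `expPair_moments`). The independence comes from
`charIndep_noise`, and both pass to infinitely many small jumps in `isExpPair_of_tendstoInMeasure`.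
Large jumps may have no moments. They are discarded on the event that all jumps up to time `t` are
bounded by `K`, where they do not occur (`stochExp_eq_of_bounded_jumps`), and almost every path lies
in such an event for some `K` (`stochExp_eq`).

The jumps are read off a path by summing a Lipschitz function that vanishes near zero over dyadic
increments (`tendsto_sum_increments`). Kolmogorov's inequality makes the small jumps uniformly
negligible (`IsJumpSize.ae_smallJumpPart_le`), and soft cutoffs rebuild the compensated integral
(`IsJumpSize.tendsto_softCut`, `IsJumpSize.aestronglyMeasurable_jumpIntegral`). The filtering
statement rests on `condExp_sup_of_indep` and `condExp_augment`. Throughout,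
`AEStronglyMeasurable[m]` plays the part of measurability with respect to `m` augmented by null
sets. -/

lemma aestronglyMeasurable_sub_of_tendsto_ae {m : MeasurableSpace Ω} {f : ℕ → Ω → ℝ} {g : Ω → ℝ}
    (hf : ∀ n, AEStronglyMeasurable[m] (f n) P)
    (h : ∀ᵐ ω ∂P, Tendsto (fun n => f n ω) atTop (𝓝 (g ω))) : AEStronglyMeasurable[m] g P := by
  refine ⟨fun ω => limUnder atTop (fun n => (hf n).mk (f n) ω),
    StronglyMeasurable.limUnder (fun n => (hf n).stronglyMeasurable_mk), ?_⟩
  filter_upwards [h, ae_all_iff.2 fun n => (hf n).ae_eq_mk] with ω h1 h2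
  simp only [h2] at h1
  exact h1.limUnder_eq.symm

lemma aestronglyMeasurable_sub_of_tendstoInMeasure {m : MeasurableSpace Ω} {f : ℕ → Ω → ℝ}
    {g : Ω → ℝ} (hf : ∀ n, AEStronglyMeasurable[m] (f n) P)
    (h : TendstoInMeasure P f atTop g) : AEStronglyMeasurable[m] g P := by
  obtain ⟨ns, -, hns⟩ := h.exists_seq_tendsto_ae
  exact aestronglyMeasurable_sub_of_tendsto_ae (fun n => hf (ns n)) hns

lemma indepFun_of_aestronglyMeasurable {E F : Type*} [TopologicalSpace E]
    [TopologicalSpace.PseudoMetrizableSpace E] [MeasurableSpace E] [BorelSpace E]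
    [TopologicalSpace F] [TopologicalSpace.PseudoMetrizableSpace F] [MeasurableSpace F]
    [BorelSpace F] {m₁ m₂ : MeasurableSpace Ω} {f : Ω → E} {g : Ω → F}
    (h : Indep m₁ m₂ P) (hf : AEStronglyMeasurable[m₁] f P) (hg : AEStronglyMeasurable[m₂] g P) :
    IndepFun f g P := by
  have : IndepFun (hf.mk f) (hg.mk g) P :=
    indep_of_indep_of_le_left (indep_of_indep_of_le_right h
      hg.stronglyMeasurable_mk.measurable.comap_le) hf.stronglyMeasurable_mk.measurable.comap_le
  exact this.congr hf.ae_eq_mk.symm hg.ae_eq_mk.symm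

lemma TendstoInMeasure.add' {f g : ℕ → Ω → ℝ} {f' g' : Ω → ℝ}
    (hf : TendstoInMeasure P f atTop f') (hg : TendstoInMeasure P g atTop g') :
    TendstoInMeasure P (fun n ω => f n ω + g n ω) atTop (fun ω => f' ω + g' ω) := by
  rw [tendstoInMeasure_iff_norm] at *
  intro ε hε
  have := (hf (ε / 2) (by positivity)).add (hg (ε / 2) (by positivity))
  rw [add_zero] at this
  refine tendsto_of_tendsto_of_tendsto_of_le_of_le tendsto_const_nhds this (fun _ => zero_le)
    (fun n => (measure_mono ?_).trans (measure_union_le _ _))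
  intro ω hω
  simp only [mem_ofPred_eq, mem_union, Real.norm_eq_abs] at *
  by_contra! hcon
  have := abs_add_le (f n ω - f' ω) (g n ω - g' ω)
  rw [show f n ω - f' ω + (g n ω - g' ω) = f n ω + g n ω - (f' ω + g' ω) by ring] at this
  linarith

lemma TendstoInMeasure.neg' {f : ℕ → Ω → ℝ} {f' : Ω → ℝ}
    (hf : TendstoInMeasure P f atTop f') :
    TendstoInMeasure P (fun n ω => - f n ω) atTop (fun ω => - f' ω) := by
  rw [tendstoInMeasure_iff_norm] at *
  intro ε hε
  refine (hf ε hε).congr fun n => ?_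
  congr 1
  ext ω
  simp only [mem_ofPred_eq]
  rw [← norm_neg, show -(f n ω - f' ω) = -f n ω - -f' ω by ring]

lemma TendstoInMeasure.sub' {f g : ℕ → Ω → ℝ} {f' g' : Ω → ℝ}
    (hf : TendstoInMeasure P f atTop f') (hg : TendstoInMeasure P g atTop g') :
    TendstoInMeasure P (fun n ω => f n ω - g n ω) atTop (fun ω => f' ω - g' ω) := by
  simpa [sub_eq_add_neg] using TendstoInMeasure.add' hf (TendstoInMeasure.neg' hg)

lemma tendstoInMeasure_of_tendsto {c : ℕ → ℝ} {c' : ℝ} (h : Tendsto c atTop (𝓝 c')) :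
    TendstoInMeasure P (fun n (_ : Ω) => c n) atTop (fun _ => c') := by
  rw [tendstoInMeasure_iff_norm]
  intro ε hε
  refine tendsto_const_nhds.congr' ?_
  have := (Metric.tendsto_nhds.1 h) ε hε
  filter_upwards [this] with n hn
  rw [Real.dist_eq] at hn
  simp [Real.norm_eq_abs, not_le.2 hn]

lemma tendstoInMeasure_const (f : Ω → ℝ) :
    TendstoInMeasure P (fun (_ : ℕ) => f) atTop f := by
  rw [tendstoInMeasure_iff_norm]
  intro ε hε
  simp [not_le.2 hε]

lemma TendstoInMeasure.congr_ev {f g : ℕ → Ω → ℝ} {f' : Ω → ℝ}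
    (hf : TendstoInMeasure P f atTop f') (h : ∀ᶠ n in atTop, f n =ᵐ[P] g n) :
    TendstoInMeasure P g atTop f' := by
  intro ε hε
  refine (hf ε hε).congr' ?_
  filter_upwards [h] with n hn
  refine measure_congr ?_
  filter_upwards [hn] with ω hω
  change (ε ≤ edist (f n ω) (f' ω)) = (ε ≤ edist (g n ω) (f' ω))
  rw [hω]

/-- Chebyshev: second moments tending to zero give convergence in probability. -/
lemma tendstoInMeasure_zero_of_sq [IsFiniteMeasure P] {f : ℕ → Ω → ℝ}
    (hf : ∀ n, MemLp (f n) 2 P) (h : Tendsto (fun n => ∫ ω, f n ω ^ 2 ∂P) atTop (𝓝 0)) :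
    TendstoInMeasure P f atTop (fun _ => 0) := by
  rw [tendstoInMeasure_iff_measureReal_norm]
  intro ε hε
  have h2 : Tendsto (fun n => (∫ ω, f n ω ^ 2 ∂P) / ε ^ 2) atTop (𝓝 0) := by
    simpa using h.div_const (ε ^ 2)
  refine squeeze_zero (fun _ => measureReal_nonneg) (fun n => ?_) h2
  have := mul_meas_ge_le_integral_of_nonneg (μ := P) (f := fun ω => f n ω ^ 2)
    (ae_of_all _ fun ω => sq_nonneg _) (hf n).integrable_sq (ε ^ 2)
  rw [le_div_iff₀ (by positivity), mul_comm]
  refine le_trans (le_of_eq ?_) this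
  congr 2
  ext ω
  simp only [mem_ofPred_eq, Real.norm_eq_abs, sub_zero]
  rw [← sq_abs (f n ω)]
  exact ⟨fun h => by gcongr, fun h => by
    exact le_of_sq_le_sq h (abs_nonneg _) ⟩

lemma chebyshev_real [IsFiniteMeasure P] {f : Ω → ℝ} (hf : MemLp f 2 P) {ε : ℝ} (hε : 0 < ε) :
    P.real {ω | ε ≤ |f ω|} ≤ (∫ ω, f ω ^ 2 ∂P) / ε ^ 2 := by
  have := mul_meas_ge_le_integral_of_nonneg (μ := P) (f := fun ω => f ω ^ 2)
    (ae_of_all _ fun ω => sq_nonneg _) hf.integrable_sq (ε ^ 2)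
  rw [le_div_iff₀ (by positivity), mul_comm]
  refine le_trans (le_of_eq ?_) this
  congr 2
  ext ω
  simp only [mem_ofPred_eq]
  rw [← sq_abs (f ω)]
  exact ⟨fun h => by gcongr, fun h => le_of_sq_le_sq h (abs_nonneg _) ⟩

/-- Square-bounded centered variables converging in probability: the limit is centered and
satisfies the limiting bound. -/
lemma memLp_two_of_tendstoInMeasure [IsProbabilityMeasure P] {f : ℕ → Ω → ℝ} {g : Ω → ℝ} {V : ℝ}
    (hf : ∀ n, MemLp (f n) 2 P) (hV : ∀ n, ∫ ω, f n ω ^ 2 ∂P ≤ V)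
    (h : TendstoInMeasure P f atTop g) :
    MemLp g 2 P ∧ ∫ ω, g ω ^ 2 ∂P ≤ V := by
  have hV0 : 0 ≤ V := le_trans (integral_nonneg fun _ => sq_nonneg _) (hV 0)
  have key : ∀ {q : Ω → ℝ}, AEStronglyMeasurable q P →
      ∫⁻ ω, ‖q ω‖ₑ ^ 2 ∂P = ∫⁻ ω, ENNReal.ofReal (q ω ^ 2) ∂P := by
    intro q hq
    refine lintegral_congr fun ω => ?_
    rw [← sq_abs, ← Real.norm_eq_abs, ENNReal.ofReal_pow (norm_nonneg _), ofReal_norm]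
  obtain ⟨ns, hns, hae⟩ := h.exists_seq_tendsto_ae
  have hg : AEStronglyMeasurable g P := h.aestronglyMeasurable fun n => (hf n).1
  have hle : ∫⁻ ω, ENNReal.ofReal (g ω ^ 2) ∂P ≤ ENNReal.ofReal V := by
    calc ∫⁻ ω, ENNReal.ofReal (g ω ^ 2) ∂P
        = ∫⁻ ω, liminf (fun n => ENNReal.ofReal (f (ns n) ω ^ 2)) atTop ∂P := by
          refine lintegral_congr_ae ?_
          filter_upwards [hae] with ω hω
          exact (Tendsto.liminf_eq (ENNReal.tendsto_ofReal (hω.pow 2))).symm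
      _ ≤ liminf (fun n => ∫⁻ ω, ENNReal.ofReal (f (ns n) ω ^ 2) ∂P) atTop :=
          lintegral_liminf_le' fun n => ((hf _).1.aemeasurable.pow_const 2).ennreal_ofReal
      _ ≤ ENNReal.ofReal V := by
          refine liminf_le_of_le (by isBoundedDefault) fun b hb => ?_
          obtain ⟨n, hn⟩ := hb.exists
          refine hn.trans ?_
          rw [← ofReal_integral_eq_lintegral_ofReal (hf _).integrable_sq
            (ae_of_all _ fun _ => sq_nonneg _)]
          exact ENNReal.ofReal_le_ofReal (hV _)
  have hmem : MemLp g 2 P := by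
    refine (memLp_two_iff_integrable_sq hg).2 ⟨hg.pow 2, ?_⟩
    rw [hasFiniteIntegral_iff_ofReal (ae_of_all _ fun _ => sq_nonneg _)]
    exact hle.trans_lt ENNReal.ofReal_lt_top
  refine ⟨hmem, ?_⟩
  rw [integral_eq_lintegral_of_nonneg_ae (ae_of_all _ fun _ => sq_nonneg _)
    hmem.integrable_sq.1]
  exact ENNReal.toReal_le_of_le_ofReal hV0 hle

/-- A common second moment bound gives uniform integrability. The difference is small off an event
of small probability, and on that event it is controlled by its square over `2a` plus `a / 2`. The
constant `a` is chosen first, so that the second moments cost at most `ε / 8`, and only then is the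
probability of the event made small. -/
lemma tendsto_integral_of_tendstoInMeasure [IsProbabilityMeasure P] {f : ℕ → Ω → ℝ} {g : Ω → ℝ}
    {V : ℝ} (hf : ∀ n, MemLp (f n) 2 P) (hV : ∀ n, ∫ ω, f n ω ^ 2 ∂P ≤ V)
    (h : TendstoInMeasure P f atTop g) :
    Tendsto (fun n => ∫ ω, f n ω ∂P) atTop (𝓝 (∫ ω, g ω ∂P)) := by
  have hV0 : 0 ≤ V := le_trans (integral_nonneg fun _ => sq_nonneg _) (hV 0)
  obtain ⟨hg, hgV⟩ := memLp_two_of_tendstoInMeasure hf hV h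
  rw [Metric.tendsto_nhds]
  intro ε hε
  set a : ℝ := 16 * (V + 1) / ε with ha
  have ha0 : 0 < a := by positivity
  -- `|x| ≤ ε / 4 + x ^ 2 / (2 a) + (a / 2) 1_{|x| ≥ ε / 4}`
  have hprob := (tendstoInMeasure_iff_measureReal_norm.1 h) (ε / 4) (by positivity)
  have hδ : 0 < ε / (4 * a) := by positivity
  filter_upwards [(hprob.eventually (gt_mem_nhds hδ))] with n hn
  set D := fun ω => f n ω - g ω
  have hD : MemLp D 2 P := (hf n).sub hg
  have hD2 : ∫ ω, D ω ^ 2 ∂P ≤ 4 * V := by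
    calc ∫ ω, D ω ^ 2 ∂P ≤ ∫ ω, (2 * f n ω ^ 2 + 2 * g ω ^ 2) ∂P := by
          refine integral_mono hD.integrable_sq
            (((hf n).integrable_sq.const_mul 2).add (hg.integrable_sq.const_mul 2)) fun ω => ?_
          simp only [D]; nlinarith [sq_nonneg (f n ω + g ω)]
      _ = 2 * ∫ ω, f n ω ^ 2 ∂P + 2 * ∫ ω, g ω ^ 2 ∂P := by
          rw [integral_add ((hf n).integrable_sq.const_mul 2) (hg.integrable_sq.const_mul 2),
            integral_const_mul, integral_const_mul]
      _ ≤ 4 * V := by linarith [hV n]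
  set A := {ω | ε / 4 ≤ ‖f n ω - g ω‖} with hA
  have hAm : NullMeasurableSet A P :=
    nullMeasurableSet_le aemeasurable_const (hD.1.norm.aemeasurable)
  have hint1 : Integrable (fun ω => A.indicator (fun _ => (1:ℝ)) ω) P :=
    (integrable_const (1:ℝ)).indicator₀ hAm
  have hbound : ∫ ω, |D ω| ∂P ≤ ε / 4 + (4 * V) / (2 * a) + (a / 2) * P.real A := by
    calc ∫ ω, |D ω| ∂P ≤ ∫ ω, (ε / 4 + D ω ^ 2 / (2 * a)
          + (a / 2) * A.indicator (fun _ => (1:ℝ)) ω) ∂P := by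
          refine integral_mono (hD.integrable (by norm_num)).abs
            (((integrable_const _).add (hD.integrable_sq.div_const _)).add
              (hint1.const_mul _)) fun ω => ?_
          by_cases hω : ω ∈ A
          · simp only [indicator_of_mem hω]
            have : |D ω| ≤ D ω ^ 2 / (2 * a) + a / 2 := by
              have h0 : D ω ^ 2 / (2 * a) + a / 2 - |D ω| = (|D ω| - a) ^ 2 / (2 * a) := by
                rw [← sq_abs (D ω)]; field_simp; ring
              have : 0 ≤ (|D ω| - a) ^ 2 / (2 * a) := by positivity
              linarith
            linarith
          · simp only [indicator_of_notMem hω]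
            have : |D ω| < ε / 4 := by simpa [hA, D] using hω
            have : 0 ≤ D ω ^ 2 / (2 * a) := by positivity
            linarith
      _ = ε / 4 + (∫ ω, D ω ^ 2 ∂P) / (2 * a) + (a / 2) * P.real A := by
          have i1 : Integrable (fun ω => ε / 4 + D ω ^ 2 / (2 * a)) P :=
            (integrable_const _).add (hD.integrable_sq.div_const _)
          rw [integral_add i1 (hint1.const_mul _),
            integral_add (integrable_const _) (hD.integrable_sq.div_const _),
            integral_const_mul, integral_const, integral_indicator₀ hAm]
          simp [integral_div]
      _ ≤ _ := by gcongr
  rw [Real.dist_eq, ← integral_sub ((hf n).integrable (by norm_num)) (hg.integrable (by norm_num))]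
  refine lt_of_le_of_lt (abs_integral_le_integral_abs) (lt_of_le_of_lt hbound ?_)
  have e1 : (4 * V) / (2 * a) ≤ ε / 8 := by
    rw [ha, div_le_div_iff₀ (by positivity) (by positivity)]
    field_simp; nlinarith
  have e2 : (a / 2) * P.real A < ε / 4 := by
    calc (a / 2) * P.real A < (a / 2) * (ε / (4 * a)) := by gcongr
      _ = ε / 8 := by field_simp; norm_num
      _ < ε / 4 := by linarith
  linarith

/-- `X` is independent of the σ-algebra `m`, up to null sets. -/
def IndepPast {E : Type*} [MeasurableSpace E] (P : Measure Ω) (m : MeasurableSpace Ω)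
    (X : Ω → E) : Prop :=
  ∀ f : Ω → ℝ, AEStronglyMeasurable[m] f P → IndepFun f X P

lemma IndepPast.comp {E F : Type*} [MeasurableSpace E] [MeasurableSpace F]
    {m : MeasurableSpace Ω} {X : Ω → E} (h : IndepPast P m X) {φ : E → F} (hφ : Measurable φ) :
    IndepPast P m (fun ω => φ (X ω)) :=
  fun f hf => (h f hf).comp measurable_id hφ

lemma indepPast_of_indep {m m' : MeasurableSpace Ω} {X : Ω → ℝ} (h : Indep m m' P)
    (hX : AEStronglyMeasurable[m'] X P) : IndepPast P m X :=
  fun _ hf => indepFun_of_aestronglyMeasurable h hf hX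

/-- Orthogonality of sums of centered increments with previsible bounded coefficients. -/
lemma integral_sq_sum_le [IsProbabilityMeasure P] {m : ℕ → MeasurableSpace Ω} (hm : Monotone m)
    (hle : ∀ i, m i ≤ mΩ) {c ξ : ℕ → Ω → ℝ} {V : ℕ → ℝ}
    (hc : ∀ i, AEStronglyMeasurable[m i] (c i) P) (hcb : ∀ i, ∃ C, ∀ ω, |c i ω| ≤ C)
    (hξm : ∀ i, AEStronglyMeasurable[m (i + 1)] (ξ i) P) (hξ : ∀ i, MemLp (ξ i) 2 P)
    (hind : ∀ i, IndepPast P (m i) (ξ i)) (h0 : ∀ i, ∫ ω, ξ i ω ∂P = 0)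
    (hV : ∀ i, ∫ ω, ξ i ω ^ 2 ∂P ≤ V i) (n : ℕ) :
    MemLp (fun ω => ∑ i ∈ Finset.range n, c i ω * ξ i ω) 2 P ∧
      AEStronglyMeasurable[m n] (fun ω => ∑ i ∈ Finset.range n, c i ω * ξ i ω) P ∧
      ∫ ω, (∑ i ∈ Finset.range n, c i ω * ξ i ω) ^ 2 ∂P
        ≤ ∑ i ∈ Finset.range n, (∫ ω, c i ω ^ 2 ∂P) * V i := by
  induction n with
  | zero =>
    refine ⟨by simp, ?_, by simp⟩
    simpa using (aestronglyMeasurable_const (b := (0:ℝ)) : AEStronglyMeasurable[m 0] _ P)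
  | succ n ih =>
    obtain ⟨h1, h2, h3⟩ := ih
    obtain ⟨C, hC⟩ := hcb n
    have hc' : AEStronglyMeasurable (c n) P := (hc n).mono (hle n)
    have hcξ : MemLp (fun ω => c n ω * ξ n ω) 2 P :=
      (hξ n).of_le_mul (c := C) (hc'.mul (hξ n).1) (ae_of_all _ fun ω => by
        rw [norm_mul]; exact mul_le_mul_of_nonneg_right (hC ω) (norm_nonneg _))
    have hcL : MemLp (c n) 2 P := MemLp.of_bound hc' C (ae_of_all _ hC)
    simp only [Finset.sum_range_succ]
    refine ⟨h1.add hcξ, ?_, ?_⟩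
    · exact (h2.mono (hm n.le_succ)).add (((hc n).mono (hm n.le_succ)).mul (hξm n))
    -- The cross term vanishes: everything in front of `ξ n` is known at stage `n`, and `ξ n` is
    -- centred and independent of that stage.
    have hmix : ∫ ω, (∑ i ∈ Finset.range n, c i ω * ξ i ω) * c n ω * ξ n ω ∂P = 0 := by
      have := (hind n _ (h2.mul (hc n))).integral_fun_mul_eq_mul_integral
        ((h2.mul (hc n)).mono (hle n)) (hξ n).1
      simp only [Pi.mul_apply] at this
      rw [this, h0, mul_zero]
    have hsq : ∫ ω, (c n ω * ξ n ω) ^ 2 ∂P ≤ (∫ ω, c n ω ^ 2 ∂P) * V n := by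
      have hi : IndepFun (fun ω => c n ω ^ 2) (fun ω => ξ n ω ^ 2) P :=
        (hind n _ (hc n)).comp (φ := fun x => x ^ 2) (ψ := fun x => x ^ 2)
          (by fun_prop) (by fun_prop)
      have := hi.integral_fun_mul_eq_mul_integral (hc'.pow 2) ((hξ n).1.pow 2)
      simp only [mul_pow]
      rw [this]
      exact mul_le_mul_of_nonneg_left (hV n) (integral_nonneg fun _ => sq_nonneg _)
    have i1 := h1.integrable_sq
    have i2 := hcξ.integrable_sq
    have i3 : Integrable (fun ω => 2 * ((∑ i ∈ Finset.range n, c i ω * ξ i ω)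
        * c n ω * ξ n ω)) P := by
      refine (h1.integrable_mul hcξ).const_mul 2 |>.congr (ae_of_all _ fun ω => ?_)
      simp only [Pi.mul_apply]; ring
    have i13 : Integrable (fun ω => (∑ i ∈ Finset.range n, c i ω * ξ i ω) ^ 2
          + 2 * ((∑ i ∈ Finset.range n, c i ω * ξ i ω) * c n ω * ξ n ω)) P := i1.add i3
    calc _ = ∫ ω, ((∑ i ∈ Finset.range n, c i ω * ξ i ω) ^ 2
          + 2 * ((∑ i ∈ Finset.range n, c i ω * ξ i ω) * c n ω * ξ n ω)
          + (c n ω * ξ n ω) ^ 2) ∂P := by congr 1; ext ω; ring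
      _ = _ := by
          rw [integral_add i13 i2, integral_add i1 i3, integral_const_mul, hmix]
      _ ≤ _ := by linarith

/-- Kolmogorov's maximal inequality. -/
lemma measure_max_partial_sums_le [IsProbabilityMeasure P] {m : ℕ → MeasurableSpace Ω}
    (hm : Monotone m) (hle : ∀ i, m i ≤ mΩ) {ξ : ℕ → Ω → ℝ} {V : ℕ → ℝ}
    (hξm : ∀ i, AEStronglyMeasurable[m (i + 1)] (ξ i) P) (hξ : ∀ i, MemLp (ξ i) 2 P)
    (hind : ∀ i, IndepPast P (m i) (ξ i)) (h0 : ∀ i, ∫ ω, ξ i ω ∂P = 0)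
    (hV : ∀ i, ∫ ω, ξ i ω ^ 2 ∂P ≤ V i) (n : ℕ) {ε : ℝ} (hε : 0 < ε) :
    P.real {ω | ∃ k ≤ n, ε ≤ |∑ i ∈ Finset.range k, ξ i ω|}
      ≤ (∑ i ∈ Finset.range n, V i) / ε ^ 2 := by
  have hV0 : ∀ i, 0 ≤ V i := fun i => le_trans (integral_nonneg fun _ => sq_nonneg _) (hV i)
  set M : ℕ → Ω → ℝ := fun k ω => ∑ i ∈ Finset.range k, ξ i ω with hM
  have hMm : ∀ k, AEStronglyMeasurable[m k] (M k) P := by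
    intro k
    have := (integral_sq_sum_le hm hle (c := fun _ _ => 1) (V := V)
      (fun i => (aestronglyMeasurable_const : AEStronglyMeasurable[m i] (fun _ => (1:ℝ)) P))
      (fun _ => ⟨1, by simp⟩) hξm hξ hind h0 hV k).2.1
    simpa [hM] using this
  -- the stopped coefficients
  let c : ℕ → Ω → ℝ := fun i ω => ∏ k ∈ Finset.range (i + 1), if |M k ω| < ε then 1 else 0
  have hc01 : ∀ i ω, c i ω = if (∀ k ≤ i, |M k ω| < ε) then 1 else 0 := by
    intro i ω
    simp only [c]
    rw [Finset.prod_ite_zero]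
    simp
  have hcm : ∀ i, AEStronglyMeasurable[m i] (c i) P := by
    intro i
    refine ⟨fun ω => ∏ k ∈ Finset.range (i + 1), if |(hMm k).mk _ ω| < ε then 1 else 0, ?_, ?_⟩
    · refine (Finset.measurable_fun_prod _ fun k hk => ?_).stronglyMeasurable
      refine Measurable.ite ?_ measurable_const measurable_const
      exact measurableSet_lt (((hMm k).stronglyMeasurable_mk.mono
        (hm (by simpa [Nat.lt_succ_iff] using hk))).norm.measurable) measurable_const
    · filter_upwards [ae_all_iff.2 fun k => (hMm k).ae_eq_mk] with ω hω
      exact Finset.prod_congr rfl fun k _ => by rw [hω k]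
  have hcb : ∀ i ω, |c i ω| ≤ 1 := by
    intro i ω; rw [hc01]; split_ifs <;> simp
  obtain ⟨h1, -, h3⟩ := integral_sq_sum_le hm hle hcm (fun i => ⟨1, hcb i⟩) hξm hξ hind h0 hV n
  -- If the level is reached, the stopped sum at stage `n` equals the partial sum at the first
  -- passage time. Chebyshev for the stopped sum then bounds the maximum.
  have hsub : {ω | ∃ k ≤ n, ε ≤ |M k ω|} ⊆
      {ω | ε ≤ |∑ i ∈ Finset.range n, c i ω * ξ i ω|} := by
    rintro ω ⟨k, hk, hkε⟩
    classical
    have hex : ∃ k, ε ≤ |M k ω| := ⟨k, hkε⟩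
    set τ := Nat.find hex
    have hτ : ε ≤ |M τ ω| := Nat.find_spec hex
    have hτn : τ ≤ n := (Nat.find_min' hex hkε).trans hk
    have hlt : ∀ j < τ, |M j ω| < ε := fun j hj => not_le.1 (Nat.find_min hex hj)
    have hceq : ∀ i, c i ω = if i < τ then 1 else 0 := by
      intro i
      rw [hc01]
      refine if_congr ⟨fun h => ?_, fun h k hk => hlt k (lt_of_le_of_lt hk h)⟩ rfl rfl
      by_contra hi
      exact absurd hτ (not_le.2 (h τ (not_lt.1 hi)))
    have : ∑ i ∈ Finset.range n, c i ω * ξ i ω = M τ ω := by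
      simp only [hceq, ite_mul, one_mul, zero_mul, hM]
      rw [← Finset.sum_filter]
      congr 1
      ext i; simp; omega
    simp only [mem_ofPred_eq]
    rwa [this]
  calc P.real {ω | ∃ k ≤ n, ε ≤ |M k ω|}
      ≤ P.real {ω | ε ≤ |∑ i ∈ Finset.range n, c i ω * ξ i ω|} := measureReal_mono hsub
    _ ≤ (∫ ω, (∑ i ∈ Finset.range n, c i ω * ξ i ω) ^ 2 ∂P) / ε ^ 2 := chebyshev_real h1 hε
    _ ≤ _ := by
      gcongr
      refine h3.trans (Finset.sum_le_sum fun i _ => ?_)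
      refine mul_le_of_le_one_left (hV0 i) ?_
      calc ∫ ω, c i ω ^ 2 ∂P ≤ ∫ _, (1:ℝ) ∂P := by
            refine integral_mono_of_nonneg (ae_of_all _ fun _ => sq_nonneg _)
              (integrable_const _) (ae_of_all _ fun ω => ?_)
            have := hcb i ω
            simpa using (sq_le_one_iff_abs_le_one _).2 this
        _ = 1 := by simp

end Generic

end

section

/-! ### Oscillation of càdlàg paths along grids. -/

section Paths

/-- Near `x` the path has two branches, one close to the left limit and one close to the value at
`x`. For `u ≤ v`, the condition `x ∉ Ioc u v` says exactly that both times lie on the same branch.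
-/
lemma IsCadlag.exists_local {y : ℝ≥0 → ℝ} (h : IsCadlag y) (x : ℝ≥0) {ε : ℝ} (hε : 0 < ε) :
    ∃ δ : ℝ, 0 < δ ∧ ∀ u v, u ∈ Metric.ball x δ → v ∈ Metric.ball x δ → u ≤ v →
      x ∉ Ioc u v → |y v - y u| ≤ ε := by
  obtain ⟨hr, l, hl⟩ := h x
  have h1 := (Metric.tendsto_nhds.1 hr) (ε / 2) (by positivity)
  have h2 := (Metric.tendsto_nhds.1 hl) (ε / 2) (by positivity)
  rw [eventually_nhdsWithin_iff, Metric.eventually_nhds_iff] at h1 h2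
  obtain ⟨δ₁, hδ₁, h1⟩ := h1
  obtain ⟨δ₂, hδ₂, h2⟩ := h2
  refine ⟨min δ₁ δ₂, lt_min hδ₁ hδ₂, fun u v hu hv huv hx => ?_⟩
  rw [Metric.mem_ball, lt_min_iff] at hu hv
  rcases le_or_gt x u with hxu | hxu
  · have a1 := h1 hu.1 hxu
    have a2 := h1 hv.1 (hxu.trans huv)
    rw [Real.dist_eq] at a1 a2
    have := abs_sub_lt_iff.1 a1
    have := abs_sub_lt_iff.1 a2
    rw [abs_le]; constructor <;> linarith
  · have hvx : v < x := by
      by_contra hc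
      exact hx ⟨hxu, not_lt.1 hc⟩
    have a1 := h2 hu.2 hxu
    have a2 := h2 hv.2 hvx
    rw [Real.dist_eq] at a1 a2
    have := abs_sub_lt_iff.1 a1
    have := abs_sub_lt_iff.1 a2
    rw [abs_le]; constructor <;> linarith

/-- A càdlàg path has small oscillation on short intervals avoiding a finite set. -/
lemma IsCadlag.exists_osc {y : ℝ≥0 → ℝ} (h : IsCadlag y) (t : ℝ≥0) {ε : ℝ} (hε : 0 < ε) :
    ∃ δ : ℝ, 0 < δ ∧ ∃ F : Finset ℝ≥0, ∀ u v, u ≤ v → v ≤ t → ((v : ℝ) - u < δ) →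
      (∀ x ∈ F, x ∉ Ioc u v) → |y v - y u| ≤ ε := by
  choose δ hδ hδ' using fun x => h.exists_local x hε
  obtain ⟨F, -, hF⟩ := (isCompact_Icc (a := (0 : ℝ≥0)) (b := t)).elim_nhds_subcover
    (fun x => Metric.ball x (δ x)) fun x _ => Metric.ball_mem_nhds x (hδ x)
  obtain ⟨η, hη, hη'⟩ := lebesgue_number_lemma_of_metric (ι := F)
    (isCompact_Icc (a := (0 : ℝ≥0)) (b := t)) (c := fun x => Metric.ball (x : ℝ≥0) (δ x))
    (fun _ => Metric.isOpen_ball) (by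
      refine hF.trans fun z hz => ?_
      obtain ⟨x, hx, hz⟩ := mem_iUnion₂.1 hz
      exact mem_iUnion.2 ⟨⟨x, hx⟩, hz⟩)
  refine ⟨η, hη, F, fun u v huv hvt hd hx => ?_⟩
  obtain ⟨⟨x, hxF⟩, hball⟩ := hη' u ⟨zero_le, huv.trans hvt⟩
  refine hδ' x u v (hball (Metric.mem_ball_self hη)) (hball ?_) huv (hx x hxF)
  rw [Metric.mem_ball, NNReal.dist_eq, abs_of_nonneg (sub_nonneg.2 (NNReal.coe_le_coe.2 huv))]
  exact hd

lemma IsCadlag.bounded {y : ℝ≥0 → ℝ} (h : IsCadlag y) (t : ℝ≥0) :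
    ∃ C, ∀ u ≤ t, |y u| ≤ C := by
  have hloc : ∀ x : ℝ≥0, ∃ δ : ℝ, 0 < δ ∧ ∃ C, ∀ u ∈ Metric.ball x δ, |y u| ≤ C := by
    intro x
    obtain ⟨hr, l, hl⟩ := h x
    have h1 := (Metric.tendsto_nhds.1 hr) 1 one_pos
    have h2 := (Metric.tendsto_nhds.1 hl) 1 one_pos
    rw [eventually_nhdsWithin_iff, Metric.eventually_nhds_iff] at h1 h2
    obtain ⟨δ₁, hδ₁, h1⟩ := h1
    obtain ⟨δ₂, hδ₂, h2⟩ := h2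
    refine ⟨min δ₁ δ₂, lt_min hδ₁ hδ₂, max (|y x| + 1) (|l| + 1), fun u hu => ?_⟩
    rw [Metric.mem_ball, lt_min_iff] at hu
    rcases le_or_gt x u with hxu | hxu
    · have := h1 hu.1 hxu
      rw [Real.dist_eq] at this
      have := abs_sub_abs_le_abs_sub (y u) (y x)
      exact le_max_of_le_left (by linarith)
    · have := h2 hu.2 hxu
      rw [Real.dist_eq] at this
      have := abs_sub_abs_le_abs_sub (y u) l
      exact le_max_of_le_right (by linarith)
  choose δ hδ C hC using hloc
  obtain ⟨F, -, hF⟩ := (isCompact_Icc (a := (0 : ℝ≥0)) (b := t)).elim_nhds_subcover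
    (fun x => Metric.ball x (δ x)) fun x _ => Metric.ball_mem_nhds x (hδ x)
  refine ⟨∑ x ∈ F, |C x|, fun u hu => ?_⟩
  obtain ⟨x, hx, hux⟩ := mem_iUnion₂.1 (hF (show u ∈ Icc 0 t from ⟨zero_le, hu⟩))
  exact (hC x u hux).trans ((le_abs_self _).trans
    (Finset.single_le_sum (f := fun x => |C x|) (fun _ _ => abs_nonneg _) hx))

/-- The point of index `k` in the grid of mesh `t / (N r)`. -/
def gridPt (t : ℝ≥0) (N r k : ℕ) : ℝ≥0 := t * k / (N * r)

lemma gridPt_mono (t : ℝ≥0) (N r : ℕ) : Monotone (gridPt t N r) := by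
  intro i j hij
  unfold gridPt
  gcongr

lemma gridPt_zero (t : ℝ≥0) (N r : ℕ) : gridPt t N r 0 = 0 := by simp [gridPt]

lemma gridPt_last (t : ℝ≥0) {N r : ℕ} (hN : 0 < N) (hr : 0 < r) :
    gridPt t N r (N * r) = t := by
  have : (N : ℝ≥0) * r ≠ 0 := by positivity
  unfold gridPt; push_cast
  field_simp

lemma coe_gridPt (t : ℝ≥0) (N r k : ℕ) :
    (gridPt t N r k : ℝ) = (t : ℝ) * k / (N * r) := by simp [gridPt]

lemma gridPt_sub (t : ℝ≥0) (N r k j : ℕ) :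
    (gridPt t N r (k + j) : ℝ) - gridPt t N r k = j * (t / (N * r)) := by
  rw [coe_gridPt, coe_gridPt]; push_cast; ring

lemma sum_range_mul_block {M : Type*} [AddCommMonoid M] (f : ℕ → M) (N r : ℕ) :
    ∑ k ∈ Finset.range (N * r), f k
      = ∑ J ∈ Finset.range N, ∑ i ∈ Finset.range r, f (J * r + i) := by
  induction N with
  | zero => simp
  | succ N ih => rw [Nat.succ_mul, Finset.sum_range_add, ih, Finset.sum_range_succ]

/-- Fine-grid oscillations of a càdlàg path around a coarse grid vanish on average. -/
lemma IsCadlag.tendsto_grid_osc {y : ℝ≥0 → ℝ} (h : IsCadlag y) (t : ℝ≥0) {b : ℝ} (hb : 0 ≤ b)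
    (r : ℕ → ℕ) (hr : ∀ n, 0 < r n) :
    Tendsto (fun n => ∑ J ∈ Finset.range (n + 1), ∑ i ∈ Finset.range (r n),
      (t : ℝ) / ((n + 1 : ℕ) * r n) * min |y (gridPt t (n + 1) (r n) (J * r n + i))
        - y (gridPt t (n + 1) (r n) (J * r n))| b ^ 2) atTop (𝓝 0) := by
  rw [Metric.tendsto_nhds]
  intro ε hε
  -- The threshold is a square root so that its square, weighted by the total mass `t` of the grid,
  -- costs at most `ε / 2`.
  obtain ⟨δ, hδ, F, hF⟩ := h.exists_osc t (ε := √(ε / (2 * (t + 1)))) (by positivity)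
  have l1 : Tendsto (fun n : ℕ => (t : ℝ) / ((n : ℝ) + 1)) atTop (𝓝 0) :=
    tendsto_const_nhds.div_atTop (tendsto_atTop_add_const_right _ _ tendsto_natCast_atTop_atTop)
  have l2 : Tendsto (fun n : ℕ => F.card * b ^ 2 * ((t : ℝ) / ((n : ℝ) + 1))) atTop (𝓝 0) := by
    simpa using l1.const_mul (F.card * b ^ 2)
  filter_upwards [l1.eventually (gt_mem_nhds hδ),
    l2.eventually (gt_mem_nhds (show 0 < ε / 2 by positivity))] with n hn1 hn2
  set N := n + 1 with hN
  have hNr : (N : ℝ) = (n : ℝ) + 1 := by rw [hN]; push_cast; ring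
  have hrn : (0 : ℝ) < r n := by exact_mod_cast hr n
  have hNpos : (0 : ℝ) < N := by rw [hNr]; positivity
  rw [Real.dist_eq, sub_zero, abs_of_nonneg (Finset.sum_nonneg fun _ _ =>
    Finset.sum_nonneg fun _ _ => by positivity)]
  -- Coarse cells with both ends excluded. They are disjoint, so each exceptional point of `F`
  -- spoils at most one cell, and together these points cost at most `F.card * b ^ 2 * (t / N)`. The
  -- right end may be excluded because the fine index satisfies `i < r n`.
  let cell : ℝ≥0 → ℕ → Prop := fun x J =>
    (t : ℝ) * J / N < x ∧ (x : ℝ) < t * (J + 1) / N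
  classical
  have hterm : ∀ J ∈ Finset.range N, ∀ i ∈ Finset.range (r n),
      min |y (gridPt t N (r n) (J * r n + i)) - y (gridPt t N (r n) (J * r n))| b ^ 2
        ≤ ε / (2 * (t + 1)) + ∑ x ∈ F, b ^ 2 * (if cell x J then 1 else 0) := by
    intro J hJ i hi
    rw [Finset.mem_range] at hJ hi
    have hi' : (i : ℝ) < r n := by exact_mod_cast hi
    have hgap : (gridPt t N (r n) (J * r n + i) : ℝ) - gridPt t N (r n) (J * r n) ≤ t / N := by
      rw [gridPt_sub]
      calc (i : ℝ) * (t / (N * r n)) ≤ r n * (t / (N * r n)) := by gcongr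
        _ = t / N := by field_simp
    by_cases hx : ∃ x ∈ F, x ∈ Ioc (gridPt t N (r n) (J * r n)) (gridPt t N (r n) (J * r n + i))
    · obtain ⟨x, hxF, hx1, hx2⟩ := hx
      have hc : cell x J := by
        have h1 : (gridPt t N (r n) (J * r n) : ℝ) < x := by exact_mod_cast hx1
        have h2 : (x : ℝ) ≤ gridPt t N (r n) (J * r n + i) := by exact_mod_cast hx2
        have e1 : (gridPt t N (r n) (J * r n) : ℝ) = t * J / N := by
          rw [coe_gridPt]; push_cast; field_simp
        refine ⟨e1 ▸ h1, ?_⟩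
        rcases (zero_le (a := t)).eq_or_lt with ht | ht
        · rw [← ht] at h1 h2
          simp [coe_gridPt] at h1 h2
          linarith
        · have ht' : (0 : ℝ) < t := by exact_mod_cast ht
          have : (gridPt t N (r n) (J * r n + i) : ℝ) - gridPt t N (r n) (J * r n) < t / N := by
            rw [gridPt_sub]
            calc (i : ℝ) * (t / (N * r n)) < r n * (t / (N * r n)) := by gcongr
              _ = t / N := by field_simp
          rw [e1] at this
          calc (x : ℝ) ≤ _ := h2
            _ < t * J / N + t / N := by linarith
            _ = t * (J + 1) / N := by ring
      have h1 : min |y (gridPt t N (r n) (J * r n + i)) - y (gridPt t N (r n) (J * r n))| b ^ 2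
          ≤ b ^ 2 := by gcongr; exact min_le_right _ _
      have h2 : b ^ 2 ≤ ∑ x ∈ F, b ^ 2 * (if cell x J then (1 : ℝ) else 0) := by
        refine le_trans ?_ (Finset.single_le_sum
          (f := fun x => b ^ 2 * (if cell x J then (1 : ℝ) else 0)) (fun _ _ => ?_) hxF)
        · simp [hc]
        · positivity
      have : 0 ≤ ε / (2 * ((t : ℝ) + 1)) := by positivity
      linarith
    · push Not at hx
      have h1 : |y (gridPt t N (r n) (J * r n + i)) - y (gridPt t N (r n) (J * r n))|
          ≤ √(ε / (2 * (t + 1))) := by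
        refine hF _ _ (gridPt_mono _ _ _ (by omega)) ?_ (lt_of_le_of_lt hgap (hNr ▸ hn1)) hx
        refine le_of_le_of_eq (gridPt_mono _ _ _ ?_)
          (gridPt_last t (N := N) (r := r n) (by omega) (hr n))
        calc J * r n + i ≤ J * r n + r n := by omega
          _ = (J + 1) * r n := by ring
          _ ≤ N * r n := Nat.mul_le_mul_right _ (by omega)
      have h2 : min |y (gridPt t N (r n) (J * r n + i)) - y (gridPt t N (r n) (J * r n))| b ^ 2
          ≤ √(ε / (2 * (t + 1))) ^ 2 := by
        gcongr; exact (min_le_left _ _).trans h1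
      rw [Real.sq_sqrt (by positivity)] at h2
      have : 0 ≤ ∑ x ∈ F, b ^ 2 * (if cell x J then (1 : ℝ) else 0) := by positivity
      linarith
  have hcount : ∀ x, ∑ J ∈ Finset.range N, (if cell x J then (1 : ℝ) else 0) ≤ 1 := by
    intro x
    rw [Finset.sum_boole]
    have : (Finset.filter (fun J => cell x J) (Finset.range N)).card ≤ 1 := by
      rw [Finset.card_le_one]
      intro J hJ K hK
      obtain ⟨hJ1, hJ2⟩ := (Finset.mem_filter.1 hJ).2
      obtain ⟨hK1, hK2⟩ := (Finset.mem_filter.1 hK).2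
      have key : ∀ J K : ℕ, (t : ℝ) * J / N < x → (x : ℝ) < t * (K + 1) / N → J ≤ K := by
        intro J K h1 h2
        have h3 := h1.trans h2
        rw [div_lt_div_iff_of_pos_right hNpos] at h3
        have h4 : (J : ℝ) < K + 1 := lt_of_mul_lt_mul_left h3 t.2
        have : J < K + 1 := by exact_mod_cast h4
        omega
      exact le_antisymm (key J K hJ1 hK2) (key K J hK1 hJ2)
    exact_mod_cast this
  calc _ ≤ ∑ J ∈ Finset.range N, ∑ i ∈ Finset.range (r n), (t : ℝ) / (N * r n) *
        (ε / (2 * (t + 1)) + ∑ x ∈ F, b ^ 2 * (if cell x J then 1 else 0)) := by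
        refine Finset.sum_le_sum fun J hJ => Finset.sum_le_sum fun i hi => ?_
        exact mul_le_mul_of_nonneg_left (hterm J hJ i hi) (by positivity)
    _ = t * (ε / (2 * (t + 1)))
        + (t / N) * ∑ x ∈ F, b ^ 2 * ∑ J ∈ Finset.range N, (if cell x J then (1 : ℝ) else 0) := by
        simp only [Finset.sum_const, Finset.card_range, nsmul_eq_mul, Finset.mul_sum]
        rw [Finset.sum_comm]
        have e : ∀ J, (r n : ℝ) * (t / (N * r n) * (ε / (2 * (t + 1))
            + ∑ x ∈ F, b ^ 2 * (if cell x J then 1 else 0)))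
            = t / N * (ε / (2 * (t + 1)))
              + ∑ x ∈ F, t / N * (b ^ 2 * (if cell x J then 1 else 0)) := by
          intro J
          have e0 : (r n : ℝ) * (t / (N * r n)) = t / N := by field_simp
          rw [← mul_assoc, e0, mul_add, Finset.mul_sum]
        simp only [e, Finset.sum_add_distrib]
        congr 1
        · simp; field_simp
    _ ≤ ε / 2 + (t / N) * ∑ x ∈ F, b ^ 2 * 1 := by
        gcongr with x hx
        · rw [mul_div_assoc', div_le_div_iff₀ (by positivity) (by positivity)]
          nlinarith [t.2]
        · exact hcount x
    _ < ε := by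
        simp only [Finset.sum_const, nsmul_eq_mul, mul_one]
        rw [hNr]
        linarith

end Paths

end

section

/-! ### Truncation, a Cauchy-Schwarz limit, and the one-cell comparison with the exponential. -/

section Uniqueness

variable {Ω : Type*} {mΩ : MeasurableSpace Ω} {P : Measure Ω}

/-- Truncation of a real number to `[-b, b]`. -/
def clip (b z : ℝ) : ℝ := max (-b) (min z b)

lemma abs_clip {b : ℝ} (hb : 0 ≤ b) (z : ℝ) : |clip b z| = min |z| b := by
  rcases le_or_gt |z| b with h | h
  · have h' := abs_le.1 h
    rw [min_eq_left h, clip, min_eq_left h'.2, max_eq_right h'.1]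
  · rw [min_eq_right h.le, clip]
    rcases lt_abs.1 h with h' | h'
    · rw [min_eq_right h'.le, max_eq_right (by linarith), abs_of_nonneg hb]
    · rw [min_eq_left (by linarith), max_eq_left (by linarith), abs_neg, abs_of_nonneg hb]

lemma clip_of_abs_le {b z : ℝ} (h : |z| ≤ b) : clip b z = z := by
  rw [abs_le] at h
  simp [clip, h.1, h.2]

lemma abs_clip_le {b : ℝ} (hb : 0 ≤ b) (z : ℝ) : |clip b z| ≤ b := by
  rw [abs_clip hb]; exact min_le_right _ _

lemma continuous_clip (b : ℝ) : Continuous (clip b) := by unfold clip; fun_prop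

/-- Cauchy-Schwarz in the weighted form `|a b| ≤ c a² / 2 + b² / (2 c)`. The weight `c` is small
enough that the bounded sum of squares costs at most `ε / 2`; the vanishing sum then pays for the
division by `c`. -/
lemma tendsto_integral_sum_mul {ι : Type*} {s : ℕ → Finset ι}
    {a b : ℕ → ι → Ω → ℝ} (ha : ∀ n i, MemLp (a n i) 2 P) (hb : ∀ n i, MemLp (b n i) 2 P) (B : ℝ)
    (hB : ∀ᶠ n in atTop, ∑ i ∈ s n, ∫ ω, a n i ω ^ 2 ∂P ≤ B)
    (hb0 : Tendsto (fun n => ∑ i ∈ s n, ∫ ω, b n i ω ^ 2 ∂P) atTop (𝓝 0)) :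
    Tendsto (fun n => ∫ ω, ∑ i ∈ s n, |a n i ω| * |b n i ω| ∂P) atTop (𝓝 0) := by
  rw [Metric.tendsto_nhds]
  intro ε hε
  set c : ℝ := ε / (|B| + 1) with hc
  have hc0 : 0 < c := by positivity
  filter_upwards [hB, hb0.eventually (gt_mem_nhds (show 0 < ε * c by positivity))] with n h1 h2
  rw [Real.dist_eq, sub_zero, abs_of_nonneg (integral_nonneg fun _ =>
    Finset.sum_nonneg fun _ _ => by positivity)]
  have hab : ∀ i, Integrable (fun ω => |a n i ω| * |b n i ω|) P := fun i =>
    ((ha n i).abs).integrable_mul (hb n i).abs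
  rw [integral_finsetSum _ fun i _ => hab i]
  calc ∑ i ∈ s n, ∫ ω, |a n i ω| * |b n i ω| ∂P
      ≤ ∑ i ∈ s n, (c / 2 * ∫ ω, a n i ω ^ 2 ∂P + (1 / (2 * c)) * ∫ ω, b n i ω ^ 2 ∂P) := by
        refine Finset.sum_le_sum fun i _ => ?_
        rw [← integral_const_mul, ← integral_const_mul, ← integral_add
          ((ha n i).integrable_sq.const_mul _) ((hb n i).integrable_sq.const_mul _)]
        refine integral_mono (hab i) (((ha n i).integrable_sq.const_mul _).add
          ((hb n i).integrable_sq.const_mul _)) fun ω => ?_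
        have : c / 2 * a n i ω ^ 2 + 1 / (2 * c) * b n i ω ^ 2 - |a n i ω| * |b n i ω|
            = (c * |a n i ω| - |b n i ω|) ^ 2 / (2 * c) := by
          rw [← sq_abs (a n i ω), ← sq_abs (b n i ω)]; field_simp; ring
        have h0 : 0 ≤ (c * |a n i ω| - |b n i ω|) ^ 2 / (2 * c) := by positivity
        simp only
        linarith
    _ = c / 2 * (∑ i ∈ s n, ∫ ω, a n i ω ^ 2 ∂P)
        + (1 / (2 * c)) * ∑ i ∈ s n, ∫ ω, b n i ω ^ 2 ∂P := by
        rw [Finset.sum_add_distrib, Finset.mul_sum, Finset.mul_sum]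
    _ ≤ c / 2 * |B| + (1 / (2 * c)) * ∑ i ∈ s n, ∫ ω, b n i ω ^ 2 ∂P := by
        gcongr; exact h1.trans (le_abs_self B)
    _ < c / 2 * |B| + (1 / (2 * c)) * (ε * c) := by gcongr
    _ ≤ ε := by
        have e1 : (1 / (2 * c)) * (ε * c) = ε / 2 := by field_simp
        have e2 : c / 2 * |B| ≤ ε / 2 := by
          rw [hc, div_div, div_mul_eq_mul_div, div_le_div_iff₀ (by positivity) (by positivity)]
          nlinarith [abs_nonneg B]
        linarith

set_option maxHeartbeats 1000000 in
/-- One step of the comparison of a solution of the linear equation with the exponential. -/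
lemma exp_step_bound {C δ η₀ a a' e e' ξ q K Q X η r : ℝ} (hC : 1 ≤ C) (hδ : 0 ≤ δ)
    (hCδ : C * δ ≤ 1) (ha : |a| ≤ C) (he : 0 < e) (heC : e ≤ C) (he' : 0 < e') (he'C : e' ≤ C)
    (hee : e' * (Real.exp ξ * (1 + q)) = e)
    (hξ : |ξ| ≤ C * δ) (hη : |η| ≤ η₀) (hX : |X| ≤ 2 * C ^ 2 * δ) (hK : K = q - r)
    (ha' : a' = a + η + Q + X + a * (r + ξ)) :
    |a' * e' - a * e - (e * Q - e * a * K)| ≤ C * η₀ + C * |X|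
      + 3 * C ^ 2 * ((δ + |q|) * (η₀ + |Q| + C * |K| + 4 * C ^ 2 * δ + 2 * C ^ 2 * δ * |q|)) := by
  -- Here `ρ = e / e'` is the growth of the exponential over the cell, `κ = ρ - 1 - q - ξ` is its
  -- second-order remainder, and `D = a' - a ρ` is the amount by which the solution fails to grow by
  -- the same factor.
  set ρ := Real.exp ξ * (1 + q) with hρ
  set κ := (Real.exp ξ - 1) * q + (Real.exp ξ - 1 - ξ) with hκ
  set D := η + Q + X - a * (K + κ) with hD
  have hξ1 : |ξ| ≤ 1 := hξ.trans hCδ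
  have hx1 : |Real.exp ξ - 1| ≤ 2 * C * δ := by
    have := Real.abs_exp_sub_one_le hξ1
    linarith
  have hx2 : |Real.exp ξ - 1 - ξ| ≤ C ^ 2 * δ ^ 2 := by
    have := Real.abs_exp_sub_one_sub_id_le hξ1
    calc _ ≤ ξ ^ 2 := this
      _ = |ξ| ^ 2 := (sq_abs ξ).symm
      _ ≤ (C * δ) ^ 2 := by gcongr
      _ = _ := by ring
  have hκb : |κ| ≤ 2 * C * δ * |q| + C ^ 2 * δ ^ 2 := by
    calc |κ| ≤ |(Real.exp ξ - 1) * q| + |Real.exp ξ - 1 - ξ| := abs_add_le _ _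
      _ ≤ _ := by rw [abs_mul]; gcongr
  have hρb : |ρ - 1| ≤ 3 * C * (δ + |q|) := by
    have e1 : ρ - 1 = (Real.exp ξ - 1) + (Real.exp ξ - 1) * q + q := by rw [hρ]; ring
    calc |ρ - 1| ≤ |Real.exp ξ - 1| + |(Real.exp ξ - 1) * q| + |q| := by
          rw [e1]; exact (abs_add_le _ _).trans (add_le_add_left (abs_add_le _ _) _)
      _ ≤ 2 * C * δ + 2 * C * δ * |q| + |q| := by rw [abs_mul]; gcongr
      _ ≤ 2 * C * δ + 2 * 1 * |q| + C * |q| := by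
          have : C * δ * |q| ≤ 1 * |q| := by gcongr
          have : 1 * |q| ≤ C * |q| := by gcongr
          nlinarith
      _ ≤ _ := by
          have : 1 * |q| ≤ C * |q| := by gcongr
          nlinarith [mul_nonneg (show 0 ≤ C by linarith) hδ]
  -- Since `a ρ e' = a e`, only `e' D` survives. Writing it with the weight `e` of the left end
  -- isolates `e Q - e a K`, whose coefficients are known before the cell, and leaves `(e' - e) D`,
  -- a product of two small factors.
  have hmain : a' * e' - a * e = e * D + (e' - e) * D := by
    have : a' = a * ρ + D := by rw [ha', hD, hK, hκ, hρ]; ring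
    rw [← hee, this]; ring
  have hdiff : |e' - e| ≤ C * (3 * C * (δ + |q|)) := by
    have : e' - e = e' * (1 - ρ) := by rw [← hee]; ring
    rw [this, abs_mul, abs_of_pos he', abs_sub_comm]
    exact mul_le_mul he'C hρb (abs_nonneg _) (by linarith)
  have haκ : |a * κ| ≤ 2 * C ^ 2 * δ * |q| + C ^ 2 * δ := by
    rw [abs_mul]
    calc |a| * |κ| ≤ C * (2 * C * δ * |q| + C ^ 2 * δ ^ 2) := by gcongr
      _ = 2 * C ^ 2 * δ * |q| + C ^ 2 * δ * (C * δ) := by ring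
      _ ≤ 2 * C ^ 2 * δ * |q| + C ^ 2 * δ * 1 := by gcongr
      _ = _ := by ring
  have hDb : |D| ≤ η₀ + |Q| + C * |K| + 3 * C ^ 2 * δ + 2 * C ^ 2 * δ * |q| := by
    have e1 : D = η + Q + X - a * K - a * κ := by rw [hD]; ring
    have : |a * K| ≤ C * |K| := by rw [abs_mul]; gcongr
    calc |D| ≤ |η| + |Q| + |X| + |a * K| + |a * κ| := by
          rw [e1]
          exact (abs_sub _ _).trans (add_le_add_left ((abs_sub _ _).trans (add_le_add_left
            ((abs_add_le _ _).trans (add_le_add_left (abs_add_le _ _) _)) _)) _)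
      _ ≤ η₀ + |Q| + 2 * C ^ 2 * δ + C * |K| + (2 * C ^ 2 * δ * |q| + C ^ 2 * δ) := by gcongr
      _ = _ := by ring
  have e2 : a' * e' - a * e - (e * Q - e * a * K) = e * η + e * X - e * (a * κ) + (e' - e) * D := by
    rw [hmain, hD]; ring
  have heabs : |e| ≤ C := by rw [abs_of_pos he]; exact heC
  have t3 : |e * (a * κ)| ≤ 3 * C ^ 2 * ((δ + |q|) * (C ^ 2 * δ)) := by
    rw [abs_mul]
    calc |e| * |a * κ| ≤ C * (C * |κ|) := by
          rw [abs_mul]; gcongr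
      _ ≤ C * (C * (2 * C * δ * |q| + C ^ 2 * δ ^ 2)) := by gcongr
      _ = 2 * (C ^ 3 * δ * |q|) + C ^ 4 * δ ^ 2 := by ring
      _ ≤ 2 * (C ^ 4 * δ * |q|) + C ^ 4 * δ ^ 2 := by gcongr; norm_num
      _ ≤ 3 * (C ^ 4 * δ * |q|) + 3 * (C ^ 4 * δ ^ 2) := by
          have h1 : 0 ≤ C ^ 4 * δ * |q| := by positivity
          have h2 : 0 ≤ C ^ 4 * δ ^ 2 := by positivity
          linarith
      _ = _ := by ring
  calc _ ≤ |e * η| + |e * X| + |e * (a * κ)| + |(e' - e) * D| := by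
        rw [e2]
        exact (abs_add_le _ _).trans (add_le_add_left ((abs_sub _ _).trans (add_le_add_left
            (abs_add_le _ _) _)) _)
    _ ≤ C * η₀ + C * |X| + 3 * C ^ 2 * ((δ + |q|) * (C ^ 2 * δ))
        + C * (3 * C * (δ + |q|)) *
          (η₀ + |Q| + C * |K| + 3 * C ^ 2 * δ + 2 * C ^ 2 * δ * |q|) := by
        rw [abs_mul e η, abs_mul e X, abs_mul (e' - e) D]
        gcongr
    _ = _ := by ring

end Uniqueness

end

section

/-! ### Second moment estimates for the grid sums of the comparison. -/

section Uniqueness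

variable {Ω : Type*} {mΩ : MeasurableSpace Ω} {P : Measure Ω}

/-- `Y` and `R` have jointly stationary independent increments relative to `𝓕`, in the sense of
moment bounds, `R` is a square integrable martingale and `exp (Y u - Y s) - 1 - (R u - R s)` is
centered and of second order: `exp Y` is the stochastic exponential of `R`. -/
structure IsExpPair (𝓕 : Filtration ℝ≥0 mΩ) (P : Measure Ω) (Y R : ℝ≥0 → Ω → ℝ) (v : ℝ) :
    Prop where
  nonneg : 0 ≤ v
  adapted_left : ∀ s, AEStronglyMeasurable[𝓕 s] (Y s) P
  adapted_right : ∀ s, AEStronglyMeasurable[𝓕 s] (R s) P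
  indep : ∀ s u, s ≤ u → IndepPast P (𝓕 s) (fun ω => (Y u ω - Y s ω, R u ω - R s ω))
  memLp : ∀ s u, s ≤ u → MemLp (fun ω => R u ω - R s ω) 2 P
  mean : ∀ s u, s ≤ u → ∫ ω, (R u ω - R s ω) ∂P = 0
  sq : ∀ s u : ℝ≥0, s ≤ u → ∫ ω, (R u ω - R s ω) ^ 2 ∂P ≤ v * (u - s)
  memLp' : ∀ s u, s ≤ u → MemLp (fun ω => Real.exp (Y u ω - Y s ω) - 1 - (R u ω - R s ω)) 2 P
  mean' : ∀ s u, s ≤ u → ∫ ω, (Real.exp (Y u ω - Y s ω) - 1 - (R u ω - R s ω)) ∂P = 0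
  sq' : ∀ s u : ℝ≥0, s ≤ u → (u : ℝ) - s ≤ 1 →
    ∫ ω, (Real.exp (Y u ω - Y s ω) - 1 - (R u ω - R s ω)) ^ 2 ∂P ≤ v * (u - s) ^ 2

namespace IsExpPair

variable [IsProbabilityMeasure P] {𝓕 : Filtration ℝ≥0 mΩ} {Y R : ℝ≥0 → Ω → ℝ} {v : ℝ}

lemma memLp_exp (h : IsExpPair 𝓕 P Y R v) {s u : ℝ≥0} (hsu : s ≤ u) :
    MemLp (fun ω => Real.exp (Y u ω - Y s ω) - 1) 2 P :=
  ((h.memLp' s u hsu).add (h.memLp s u hsu)).ae_eq (ae_of_all _ fun ω => by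
    simp only [Pi.add_apply]; ring)

lemma sq_exp (h : IsExpPair 𝓕 P Y R v) {s u : ℝ≥0} (hsu : s ≤ u) (hsu' : (u : ℝ) - s ≤ 1) :
    ∫ ω, (Real.exp (Y u ω - Y s ω) - 1) ^ 2 ∂P ≤ 4 * v * (u - s) := by
  have h0 : (0 : ℝ) ≤ u - s := sub_nonneg.2 (NNReal.coe_le_coe.2 hsu)
  calc ∫ ω, (Real.exp (Y u ω - Y s ω) - 1) ^ 2 ∂P
      ≤ ∫ ω, (2 * (Real.exp (Y u ω - Y s ω) - 1 - (R u ω - R s ω)) ^ 2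
          + 2 * (R u ω - R s ω) ^ 2) ∂P := by
        refine integral_mono (h.memLp_exp hsu).integrable_sq
          (((h.memLp' s u hsu).integrable_sq.const_mul 2).add
            ((h.memLp s u hsu).integrable_sq.const_mul 2)) fun ω => ?_
        simp only
        nlinarith [sq_nonneg (Real.exp (Y u ω - Y s ω) - 1 - (R u ω - R s ω)
          - (R u ω - R s ω))]
    _ = 2 * ∫ ω, (Real.exp (Y u ω - Y s ω) - 1 - (R u ω - R s ω)) ^ 2 ∂P
          + 2 * ∫ ω, (R u ω - R s ω) ^ 2 ∂P := by
        rw [integral_add ((h.memLp' s u hsu).integrable_sq.const_mul 2)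
            ((h.memLp s u hsu).integrable_sq.const_mul 2), integral_const_mul, integral_const_mul]
    _ ≤ 2 * (v * (u - s) ^ 2) + 2 * (v * (u - s)) := by
        gcongr
        · exact h.sq' s u hsu hsu'
        · exact h.sq s u hsu
    _ ≤ 2 * (v * ((u - s) * 1)) + 2 * (v * (u - s)) := by
        have := h.nonneg
        rw [pow_two]; gcongr
    _ = _ := by ring

lemma indep_right (h : IsExpPair 𝓕 P Y R v) {s u : ℝ≥0} (hsu : s ≤ u) :
    IndepPast P (𝓕 s) (fun ω => R u ω - R s ω) :=
  (h.indep s u hsu).comp (φ := Prod.snd) measurable_snd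

lemma indep_exp (h : IsExpPair 𝓕 P Y R v) {s u : ℝ≥0} (hsu : s ≤ u) :
    IndepPast P (𝓕 s) (fun ω => Real.exp (Y u ω - Y s ω) - 1 - (R u ω - R s ω)) :=
  (h.indep s u hsu).comp (φ := fun z => Real.exp z.1 - 1 - z.2) (by fun_prop)

lemma adapted_incr (h : IsExpPair 𝓕 P Y R v) {s u : ℝ≥0} (hsu : s ≤ u) :
    AEStronglyMeasurable[𝓕 u] (fun ω => R u ω - R s ω) P :=
  (h.adapted_right u).sub ((h.adapted_right s).mono (𝓕.mono hsu))

lemma adapted_exp (h : IsExpPair 𝓕 P Y R v) {s u : ℝ≥0} (hsu : s ≤ u) :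
    AEStronglyMeasurable[𝓕 u]
      (fun ω => Real.exp (Y u ω - Y s ω) - 1 - (R u ω - R s ω)) P :=
  ((Real.continuous_exp.comp_aestronglyMeasurable
    ((h.adapted_left u).sub ((h.adapted_left s).mono (𝓕.mono hsu)))).sub
    aestronglyMeasurable_const).sub (h.adapted_incr hsu)

end IsExpPair

/-! Grid sums in the comparison argument: coarse mesh `t / N`, fine mesh `t / (N r)`. -/

/-- Truncated fine-grid oscillation of `S` in the coarse cell `J`. -/
def oscCoef (C : ℝ) (S : ℝ≥0 → Ω → ℝ) (t : ℝ≥0) (N r J i : ℕ) (ω : Ω) : ℝ :=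
  clip (2 * C) (S (gridPt t N r (J * r + i)) ω - S (gridPt t N r (J * r)) ω)

/-- Truncation of `exp (-(Z u - Z 0))`. -/
def invExp (C : ℝ) (Z : ℝ≥0 → Ω → ℝ) (u : ℝ≥0) (ω : Ω) : ℝ :=
  min (Real.exp (-(Z u ω - Z 0 ω))) C

/-- The part of the Riemann sum of `S dR` over the coarse cell `J` due to the oscillation. -/
def oscSum (C : ℝ) (S R : ℝ≥0 → Ω → ℝ) (t : ℝ≥0) (N r J : ℕ) (ω : Ω) : ℝ :=
  ∑ i ∈ Finset.range r, oscCoef C S t N r J i ω *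
    (R (gridPt t N r (J * r + i + 1)) ω - R (gridPt t N r (J * r + i)) ω)

/-- `exp (ΔY) - 1 - ΔR` over the coarse cell `J`. -/
def expDefect (Y R : ℝ≥0 → Ω → ℝ) (t : ℝ≥0) (N r J : ℕ) (ω : Ω) : ℝ :=
  Real.exp (Y (gridPt t N r ((J + 1) * r)) ω - Y (gridPt t N r (J * r)) ω) - 1
    - (R (gridPt t N r ((J + 1) * r)) ω - R (gridPt t N r (J * r)) ω)

/-- `exp (ΔY) - 1` over the coarse cell `J`. -/
def expIncr (Y : ℝ≥0 → Ω → ℝ) (t : ℝ≥0) (N r J : ℕ) (ω : Ω) : ℝ :=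
  Real.exp (Y (gridPt t N r ((J + 1) * r)) ω - Y (gridPt t N r (J * r)) ω) - 1

/-- Mean square of the fine-grid oscillations. -/
def meanOsc (P : Measure Ω) (C : ℝ) (S : ℝ≥0 → Ω → ℝ) (t : ℝ≥0) (N r : ℕ) : ℝ :=
  ∑ J ∈ Finset.range N, ∑ i ∈ Finset.range r,
    (t : ℝ) / (N * r) * ∫ ω, oscCoef C S t N r J i ω ^ 2 ∂P

section Estimates

variable [IsProbabilityMeasure P] {𝓕 : Filtration ℝ≥0 mΩ} {Y R S Z : ℝ≥0 → Ω → ℝ} {v C : ℝ}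

lemma oscCoef_aesm (hS : ∀ s, AEStronglyMeasurable[𝓕 s] (S s) P) (t : ℝ≥0) (N r J i : ℕ) :
    AEStronglyMeasurable[𝓕 (gridPt t N r (J * r + i))] (oscCoef C S t N r J i) P :=
  (continuous_clip _).comp_aestronglyMeasurable ((hS _).sub
    ((hS _).mono (𝓕.mono (gridPt_mono _ _ _ (by omega)))))

lemma invExp_aesm (hZ : ∀ s, AEStronglyMeasurable[𝓕 s] (Z s) P) (u : ℝ≥0) :
    AEStronglyMeasurable[𝓕 u] (invExp C Z u) P :=
  (show Continuous fun z : ℝ => min (Real.exp (-z)) C by fun_prop).comp_aestronglyMeasurable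
    ((hZ _).sub ((hZ _).mono (𝓕.mono zero_le)))

lemma abs_invExp_le (hC : 0 ≤ C) (u : ℝ≥0) (ω : Ω) : |invExp C Z u ω| ≤ C := by
  unfold invExp
  rw [abs_of_nonneg (le_min (Real.exp_pos _).le hC)]
  exact min_le_right _ _

lemma abs_oscCoef_le (hC : 0 ≤ C) (t : ℝ≥0) (N r J i : ℕ) (ω : Ω) :
    |oscCoef C S t N r J i ω| ≤ 2 * C := abs_clip_le (by linarith) _

/-- Inside a cell this sum is a martingale transform: bounded coefficients known at the left fine
points multiply centred increments of variance at most `v` times the fine mesh. Orthogonality adds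
up the variances. -/
lemma oscSum_est (h : IsExpPair 𝓕 P Y R v) (hC : 0 ≤ C)
    (hS : ∀ s, AEStronglyMeasurable[𝓕 s] (S s) P) (t : ℝ≥0) (N r J : ℕ) :
    MemLp (oscSum C S R t N r J) 2 P ∧ ∫ ω, oscSum C S R t N r J ω ^ 2 ∂P
      ≤ v * ∑ i ∈ Finset.range r, (t : ℝ) / (N * r) * ∫ ω, oscCoef C S t N r J i ω ^ 2 ∂P := by
  have hstep : ∀ i, gridPt t N r (J * r + i) ≤ gridPt t N r (J * r + i + 1) :=
    fun i => gridPt_mono _ _ _ (by omega)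
  obtain ⟨h1, -, h3⟩ := integral_sq_sum_le (P := P) (m := fun i => 𝓕 (gridPt t N r (J * r + i)))
    (fun i j hij => 𝓕.mono (gridPt_mono _ _ _ (by omega))) (fun i => 𝓕.le _)
    (c := fun i => oscCoef C S t N r J i)
    (ξ := fun i ω => R (gridPt t N r (J * r + i + 1)) ω - R (gridPt t N r (J * r + i)) ω)
    (V := fun _ => v * (t / (N * r)))
    (fun i => oscCoef_aesm hS t N r J i) (fun i => ⟨2 * C, abs_oscCoef_le hC _ _ _ _ _⟩)
    (fun i => h.adapted_incr (hstep i)) (fun i => h.memLp _ _ (hstep i))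
    (fun i => h.indep_right (hstep i)) (fun i => h.mean _ _ (hstep i))
    (fun i => by
      have := h.sq _ _ (hstep i)
      rw [gridPt_sub] at this
      simpa using this) r
  refine ⟨h1, h3.trans (le_of_eq ?_)⟩
  rw [Finset.mul_sum]
  exact Finset.sum_congr rfl fun i _ => by ring

lemma sum_oscSum_est (h : IsExpPair 𝓕 P Y R v) (hC : 0 ≤ C)
    (hS : ∀ s, AEStronglyMeasurable[𝓕 s] (S s) P) (t : ℝ≥0) (N r : ℕ) :
    ∑ J ∈ Finset.range N, ∫ ω, oscSum C S R t N r J ω ^ 2 ∂P ≤ v * meanOsc P C S t N r := by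
  rw [meanOsc, Finset.mul_sum]
  exact Finset.sum_le_sum fun J _ => (oscSum_est h hC hS t N r J).2

/-- The weight of a coarse cell is known at its left end, hence at every fine point of the cell. The
double sum is thus a single martingale transform along the fine grid, and the orthogonality estimate
applies to it directly. -/
lemma weighted_oscSum_est (h : IsExpPair 𝓕 P Y R v) (hC : 0 ≤ C)
    (hS : ∀ s, AEStronglyMeasurable[𝓕 s] (S s) P) (hZ : ∀ s, AEStronglyMeasurable[𝓕 s] (Z s) P)
    (t : ℝ≥0) (N r : ℕ) (hr : 0 < r) :
    MemLp (fun ω => ∑ J ∈ Finset.range N,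
      invExp C Z (gridPt t N r (J * r)) ω * oscSum C S R t N r J ω) 2 P ∧
    ∫ ω, (∑ J ∈ Finset.range N,
      invExp C Z (gridPt t N r (J * r)) ω * oscSum C S R t N r J ω) ^ 2 ∂P
      ≤ C ^ 2 * v * meanOsc P C S t N r := by
  have hstep : ∀ i, gridPt t N r i ≤ gridPt t N r (i + 1) :=
    fun i => gridPt_mono _ _ _ (by omega)
  have hdm : ∀ k, k / r * r + k % r = k := fun k => Nat.div_add_mod' k r
  -- Division with remainder by `r` recovers the coarse index and the position inside the cell from
  -- the flat index `k`.
  let c : ℕ → Ω → ℝ := fun k ω => invExp C Z (gridPt t N r (k / r * r)) ω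
    * oscCoef C S t N r (k / r) (k % r) ω
  obtain ⟨h1, -, h3⟩ := integral_sq_sum_le (P := P) (m := fun i => 𝓕 (gridPt t N r i))
    (fun i j hij => 𝓕.mono (gridPt_mono _ _ _ hij)) (fun i => 𝓕.le _)
    (c := c)
    (ξ := fun i ω => R (gridPt t N r (i + 1)) ω - R (gridPt t N r i) ω)
    (V := fun _ => v * (t / (N * r)))
    (fun k => by
      have := oscCoef_aesm (C := C) hS t N r (k / r) (k % r)
      rw [hdm] at this
      exact ((invExp_aesm hZ _).mono (𝓕.mono (gridPt_mono _ _ _ (Nat.div_mul_le_self k r)))).mul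
        this)
    (fun i => ⟨C * (2 * C), fun ω => by
      rw [abs_mul]
      exact mul_le_mul (abs_invExp_le hC _ _) (abs_oscCoef_le hC _ _ _ _ _ _) (abs_nonneg _) hC⟩)
    (fun i => h.adapted_incr (hstep i)) (fun i => h.memLp _ _ (hstep i))
    (fun i => h.indep_right (hstep i)) (fun i => h.mean _ _ (hstep i))
    (fun i => by
      have := h.sq _ _ (hstep i)
      rw [gridPt_sub] at this
      simpa using this) (N * r)
  have hdiv : ∀ J, ∀ i ∈ Finset.range r, (J * r + i) / r = J ∧ (J * r + i) % r = i := by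
    intro J i hi
    rw [Finset.mem_range] at hi
    constructor
    · rw [mul_comm, Nat.mul_add_div hr, Nat.div_eq_of_lt hi, add_zero]
    · rw [mul_comm, Nat.mul_add_mod, Nat.mod_eq_of_lt hi]
  have heq : (fun ω => ∑ k ∈ Finset.range (N * r),
      c k ω * (R (gridPt t N r (k + 1)) ω - R (gridPt t N r k) ω))
      = fun ω => ∑ J ∈ Finset.range N,
      invExp C Z (gridPt t N r (J * r)) ω * oscSum C S R t N r J ω := by
    funext ω
    rw [sum_range_mul_block]
    refine Finset.sum_congr rfl fun J _ => ?_
    rw [oscSum, Finset.mul_sum]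
    refine Finset.sum_congr rfl fun i hi => ?_
    simp only [c, (hdiv J i hi).1, (hdiv J i hi).2]
    ring
  rw [heq] at h1
  simp only [funext_iff] at heq
  simp only [heq] at h3
  refine ⟨h1, h3.trans ?_⟩
  rw [sum_range_mul_block, meanOsc, Finset.mul_sum]
  refine Finset.sum_le_sum fun J _ => ?_
  rw [Finset.mul_sum]
  refine Finset.sum_le_sum fun i hi => ?_
  have hcle : ∫ ω, c (J * r + i) ω ^ 2 ∂P ≤ C ^ 2 * ∫ ω, oscCoef C S t N r J i ω ^ 2 ∂P := by
    rw [← integral_const_mul]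
    have hm : MemLp (oscCoef C S t N r J i) 2 P := MemLp.of_bound
      ((oscCoef_aesm hS t N r J i).mono (𝓕.le _)) (2 * C)
      (ae_of_all _ fun ω => abs_oscCoef_le hC _ _ _ _ _ _)
    refine integral_mono_of_nonneg (ae_of_all _ fun _ => sq_nonneg _)
      (hm.integrable_sq.const_mul _) (ae_of_all _ fun ω => ?_)
    simp only [c, (hdiv J i hi).1, (hdiv J i hi).2, mul_pow]
    refine mul_le_mul_of_nonneg_right ?_ (sq_nonneg _)
    rw [← sq_abs]
    gcongr
    exact abs_invExp_le hC _ _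
  have hv := h.nonneg
  calc _ ≤ C ^ 2 * (∫ ω, oscCoef C S t N r J i ω ^ 2 ∂P) * (v * (t / (N * r))) := by gcongr
    _ = _ := by ring

lemma expDefect_est (h : IsExpPair 𝓕 P Y R v) {t : ℝ≥0} {N r : ℕ} (hr : 0 < r)
    (hN : (t : ℝ) / N ≤ 1) (J : ℕ) :
    MemLp (expDefect Y R t N r J) 2 P ∧
      ∫ ω, expDefect Y R t N r J ω ^ 2 ∂P ≤ v * (t / N) ^ 2 ∧
      MemLp (expIncr Y t N r J) 2 P ∧ ∫ ω, expIncr Y t N r J ω ^ 2 ∂P ≤ 4 * v * (t / N) := by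
  have hstep : gridPt t N r (J * r) ≤ gridPt t N r ((J + 1) * r) :=
    gridPt_mono _ _ _ (by gcongr; omega)
  have hr' : (r : ℝ) ≠ 0 := by positivity
  have hgap : (gridPt t N r ((J + 1) * r) : ℝ) - gridPt t N r (J * r) = t / N := by
    rw [show (J + 1) * r = J * r + r by ring, gridPt_sub]
    rcases eq_or_ne (N : ℝ) 0 with h0 | h0
    · simp [h0]
    · field_simp
  refine ⟨h.memLp' _ _ hstep, ?_, h.memLp_exp hstep, ?_⟩
  · have := h.sq' _ _ hstep (by rw [hgap]; exact hN)
    rwa [hgap] at this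
  · have := h.sq_exp hstep (by rw [hgap]; exact hN)
    rwa [hgap] at this

/-- The defects of different cells are orthogonal and each has variance at most `v (t / N)²`, so `N`
of them have total variance of order `1 / N`. The truncations `invExp` and `clip` keep the
coefficients bounded, as orthogonality requires. -/
lemma weighted_expDefect_est (h : IsExpPair 𝓕 P Y R v) (hC : 0 ≤ C)
    (hS : ∀ s, AEStronglyMeasurable[𝓕 s] (S s) P) (hZ : ∀ s, AEStronglyMeasurable[𝓕 s] (Z s) P)
    {t : ℝ≥0} {N r : ℕ} (hr : 0 < r) (hN : (t : ℝ) / N ≤ 1) :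
    MemLp (fun ω => ∑ J ∈ Finset.range N, invExp C Z (gridPt t N r (J * r)) ω
      * clip C (S (gridPt t N r (J * r)) ω) * expDefect Y R t N r J ω) 2 P ∧
    ∫ ω, (∑ J ∈ Finset.range N, invExp C Z (gridPt t N r (J * r)) ω
      * clip C (S (gridPt t N r (J * r)) ω) * expDefect Y R t N r J ω) ^ 2 ∂P
      ≤ N * (C ^ 4 * (v * (t / N) ^ 2)) := by
  have hstep : ∀ J, gridPt t N r (J * r) ≤ gridPt t N r ((J + 1) * r) :=
    fun J => gridPt_mono _ _ _ (by gcongr; omega)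
  have hb : ∀ J ω, |invExp C Z (gridPt t N r (J * r)) ω
      * clip C (S (gridPt t N r (J * r)) ω)| ≤ C * C := fun J ω => by
    rw [abs_mul]
    exact mul_le_mul (abs_invExp_le hC _ _) (abs_clip_le hC _) (abs_nonneg _) hC
  obtain ⟨h1, -, h3⟩ := integral_sq_sum_le (P := P) (m := fun J => 𝓕 (gridPt t N r (J * r)))
    (fun i j hij => 𝓕.mono (gridPt_mono _ _ _ (by gcongr))) (fun i => 𝓕.le _)
    (c := fun J ω => invExp C Z (gridPt t N r (J * r)) ω * clip C (S (gridPt t N r (J * r)) ω))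
    (ξ := fun J => expDefect Y R t N r J)
    (V := fun _ => v * (t / N) ^ 2)
    (fun J => (invExp_aesm hZ _).mul ((continuous_clip C).comp_aestronglyMeasurable (hS _)))
    (fun J => ⟨C * C, hb J⟩)
    (fun J => h.adapted_exp (hstep J)) (fun J => h.memLp' _ _ (hstep J))
    (fun J => h.indep_exp (hstep J)) (fun J => h.mean' _ _ (hstep J))
    (fun J => (expDefect_est h hr hN J).2.1) N
  refine ⟨h1, h3.trans ?_⟩
  calc _ ≤ ∑ J ∈ Finset.range N, C ^ 4 * (v * ((t : ℝ) / N) ^ 2) := by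
        refine Finset.sum_le_sum fun J _ => ?_
        have hv := h.nonneg
        gcongr
        calc _ ≤ ∫ _, C ^ 4 ∂P := by
              refine integral_mono_of_nonneg (ae_of_all _ fun _ => sq_nonneg _)
                (integrable_const _) (ae_of_all _ fun ω => ?_)
              simp only
              rw [← sq_abs, show C ^ 4 = (C * C) ^ 2 by ring]
              gcongr
              exact hb J ω
          _ = C ^ 4 := by simp
    _ = _ := by simp

/-- Pathwise convergence of the grid oscillations, integrated by dominated convergence: the
truncation bounds the sum by `t (2 C)²`. The refinements `r n` are arbitrary, which later leaves
them free to be chosen after the coarse grid. -/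
lemma tendsto_meanOsc (hC : 0 ≤ C)
    (hS : ∀ s, AEStronglyMeasurable[𝓕 s] (S s) P) (hcad : ∀ᵐ ω ∂P, IsCadlag (fun t => S t ω))
    (t : ℝ≥0) (r : ℕ → ℕ) (hr : ∀ n, 0 < r n) :
    Tendsto (fun n => meanOsc P C S t (n + 1) (r n)) atTop (𝓝 0) := by
  have hm : ∀ N r J i, MemLp (oscCoef C S t N r J i) 2 P := fun N r J i => MemLp.of_bound
      ((oscCoef_aesm hS t N r J i).mono (𝓕.le _)) (2 * C)
      (ae_of_all _ fun ω => abs_oscCoef_le hC _ _ _ _ _ _)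
  have hlim : Tendsto (fun n => ∫ ω, ∑ J ∈ Finset.range (n + 1), ∑ i ∈ Finset.range (r n),
      (t : ℝ) / ((n + 1 : ℕ) * r n) * oscCoef C S t (n + 1) (r n) J i ω ^ 2 ∂P) atTop
      (𝓝 (∫ _, (0 : ℝ) ∂P)) := by
    refine tendsto_integral_of_dominated_convergence (fun _ => t * (2 * C) ^ 2) (fun n => ?_)
      (integrable_const _) (fun n => ae_of_all _ fun ω => ?_) ?_
    · refine Finset.aestronglyMeasurable_fun_sum _ fun J _ =>
        Finset.aestronglyMeasurable_fun_sum _ fun i _ => ?_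
      exact ((hm _ _ _ _).1.pow 2).const_mul _
    · rw [Real.norm_eq_abs, abs_of_nonneg (Finset.sum_nonneg fun _ _ =>
        Finset.sum_nonneg fun _ _ => by positivity)]
      calc _ ≤ ∑ J ∈ Finset.range (n + 1), ∑ i ∈ Finset.range (r n),
            (t : ℝ) / ((n + 1 : ℕ) * r n) * (2 * C) ^ 2 := by
            refine Finset.sum_le_sum fun J _ => Finset.sum_le_sum fun i _ => ?_
            rw [← sq_abs]
            gcongr
            exact abs_oscCoef_le hC _ _ _ _ _ _
        _ = t * (2 * C) ^ 2 := by
            have : (r n : ℝ) ≠ 0 := by exact_mod_cast (hr n).ne'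
            simp; field_simp
    · filter_upwards [hcad] with ω hω
      have := hω.tendsto_grid_osc t (b := 2 * C) (by linarith) r hr
      refine this.congr fun n => ?_
      refine Finset.sum_congr rfl fun J _ => Finset.sum_congr rfl fun i _ => ?_
      rw [oscCoef, ← sq_abs (clip _ _), abs_clip (by linarith)]
  simp only [integral_zero] at hlim
  refine hlim.congr fun n => ?_
  rw [meanOsc, integral_finsetSum _ fun J _ => integrable_finsetSum _ fun i _ =>
    (hm _ _ _ _).integrable_sq.const_mul _]
  refine Finset.sum_congr rfl fun J _ => ?_
  rw [integral_finsetSum _ fun i _ => (hm _ _ _ _).integrable_sq.const_mul _]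
  exact Finset.sum_congr rfl fun i _ => integral_const_mul _ _

end Estimates

end Uniqueness

end

section

/-! ### The comparison bound on the whole grid and its vanishing in mean. -/

section Uniqueness

variable {Ω : Type*} {mΩ : MeasurableSpace Ω} {P : Measure Ω}

/-- Defect of the left-point Riemann sum of `S dR'` over the coarse cell `J`. -/
def riemannDefect (S R' : ℝ≥0 → Ω → ℝ) (t : ℝ≥0) (N r J : ℕ) (ω : Ω) : ℝ :=
  S (gridPt t N r ((J + 1) * r)) ω - S (gridPt t N r (J * r)) ω
    - ∑ i ∈ Finset.range r, S (gridPt t N r (J * r + i)) ω *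
      (R' (gridPt t N r (J * r + i + 1)) ω - R' (gridPt t N r (J * r + i)) ω)

/-- Second factor of the error terms of the comparison. -/
def errWeight (C : ℝ) (Y R S : ℝ≥0 → Ω → ℝ) (t : ℝ≥0) (N r J : ℕ) (ω : Ω) : ℝ :=
  1 / (N : ℝ) ^ 2 + |oscSum C S R t N r J ω| + C * |expDefect Y R t N r J ω|
    + 4 * C ^ 2 * (t / N) + 2 * C ^ 2 * (t / N) * |expIncr Y t N r J ω|

/-- Bound for `S t / exp (Z t - Z 0) - S 0` in terms of grid sums. -/
def compBound (C : ℝ) (Y R S Z : ℝ≥0 → Ω → ℝ) (t : ℝ≥0) (N r : ℕ) (ω : Ω) : ℝ :=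
  |∑ J ∈ Finset.range N, invExp C Z (gridPt t N r (J * r)) ω * oscSum C S R t N r J ω|
  + |∑ J ∈ Finset.range N, invExp C Z (gridPt t N r (J * r)) ω
      * clip C (S (gridPt t N r (J * r)) ω) * expDefect Y R t N r J ω|
  + C / N
  + C ^ 2 * ∑ J ∈ Finset.range N, ∑ i ∈ Finset.range r,
      (t : ℝ) / (N * r) * |oscCoef C S t N r J i ω|
  + 3 * C ^ 2 * ∑ J ∈ Finset.range N,
      (t / N + |expIncr Y t N r J ω|) * errWeight C Y R S t N r J ω

lemma gridPt_le (t : ℝ≥0) {N r k : ℕ} (hN : 0 < N) (hr : 0 < r) (hk : k ≤ N * r) :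
    gridPt t N r k ≤ t :=
  le_of_le_of_eq (gridPt_mono _ _ _ hk) (gridPt_last t hN hr)

/-- Telescoping of the product of the solution and the inverse exponential over the coarse points.
On a path where `C` bounds the solution, the inverse exponential and the Lipschitz constant of `x`,
all truncations are inactive and the one-cell estimate applies. The Riemann defects, at most `1 /
N²` in each cell, add up to the term `C / N`. -/
lemma abs_sub_le_compBound {Y R S x : ℝ≥0 → Ω → ℝ} {C : ℝ} {t : ℝ≥0} {N r : ℕ} {ω : Ω}
    (hN : 0 < N) (hr : 0 < r) (hC : 1 ≤ C) (hCN : C * (t / N) ≤ 1)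
    (hS : ∀ u ≤ t, |S u ω| ≤ C)
    (hZ : ∀ u ≤ t, Real.exp (-(Y u ω + x u ω - (Y 0 ω + x 0 ω))) ≤ C)
    (hx : ∀ u w, u ≤ w → w ≤ t → |x w ω - x u ω| ≤ C * (w - u))
    (hη : ∀ J < N, |riemannDefect S (fun u ω => R u ω + x u ω) t N r J ω| ≤ 1 / (N : ℝ) ^ 2) :
    |S t ω * Real.exp (-(Y t ω + x t ω - (Y 0 ω + x 0 ω))) - S 0 ω|
      ≤ compBound C Y R S (fun u ω => Y u ω + x u ω) t N r ω := by
  set Z : ℝ≥0 → Ω → ℝ := fun u ω => Y u ω + x u ω with hZdef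
  have hNpos : (0 : ℝ) < N := by exact_mod_cast hN
  have hrpos : (0 : ℝ) < r := by exact_mod_cast hr
  have hle : ∀ J < N, (J + 1) * r ≤ N * r := fun J hJ => Nat.mul_le_mul_right _ hJ
  have hmon := gridPt_mono t N r
  have hgt : ∀ J ≤ N, gridPt t N r (J * r) ≤ t := fun J hJ =>
    gridPt_le t hN hr (Nat.mul_le_mul_right _ hJ)
  have hgti : ∀ J < N, ∀ i ≤ r, gridPt t N r (J * r + i) ≤ t := fun J hJ i hi =>
    gridPt_le t hN hr ((show J * r + i ≤ (J + 1) * r by rw [add_mul, one_mul]; omega).trans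
      (hle J hJ))
  let T : ℕ → ℝ := fun J => S (gridPt t N r (J * r)) ω *
    Real.exp (-(Z (gridPt t N r (J * r)) ω - Z 0 ω))
  have hinv : ∀ J ≤ N, invExp C Z (gridPt t N r (J * r)) ω
      = Real.exp (-(Z (gridPt t N r (J * r)) ω - Z 0 ω)) := fun J hJ =>
    min_eq_left (hZ _ (hgt J hJ))
  have hclip : ∀ J ≤ N, clip C (S (gridPt t N r (J * r)) ω) = S (gridPt t N r (J * r)) ω :=
    fun J hJ => clip_of_abs_le (hS _ (hgt J hJ))
  have hosc : ∀ J < N, ∀ i < r, oscCoef C S t N r J i ω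
      = S (gridPt t N r (J * r + i)) ω - S (gridPt t N r (J * r)) ω := by
    intro J hJ i hi
    refine clip_of_abs_le ((abs_sub _ _).trans ?_)
    have := hS _ (hgti J hJ i hi.le)
    have := hS _ (hgt J hJ.le)
    linarith
  let X : ℕ → ℝ := fun J => ∑ i ∈ Finset.range r, oscCoef C S t N r J i ω *
    (x (gridPt t N r (J * r + i + 1)) ω - x (gridPt t N r (J * r + i)) ω)
  have hX : ∀ J < N, |X J| ≤ C * ∑ i ∈ Finset.range r,
      (t : ℝ) / (N * r) * |oscCoef C S t N r J i ω| := by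
    intro J hJ
    rw [Finset.mul_sum]
    refine (Finset.abs_sum_le_sum_abs _ _).trans (Finset.sum_le_sum fun i hi => ?_)
    rw [Finset.mem_range] at hi
    have := hx _ _ (hmon (show J * r + i ≤ J * r + i + 1 by omega)) (hgti J hJ (i + 1) hi)
    rw [gridPt_sub] at this
    rw [abs_mul]
    calc _ ≤ |oscCoef C S t N r J i ω| * (C * ((1 : ℕ) * (t / (N * r)))) := by gcongr
      _ = _ := by push_cast; ring
  have hX2 : ∀ J < N, |X J| ≤ 2 * C ^ 2 * (t / N) := by
    intro J hJ
    refine (hX J hJ).trans ?_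
    calc _ ≤ C * ∑ i ∈ Finset.range r, (t : ℝ) / (N * r) * (2 * C) := by
          gcongr; exact abs_oscCoef_le (by linarith) _ _ _ _ _ _
      _ = _ := by simp; field_simp
  have hstep : ∀ J < N, |T (J + 1) - T J - (invExp C Z (gridPt t N r (J * r)) ω
      * oscSum C S R t N r J ω - invExp C Z (gridPt t N r (J * r)) ω
      * clip C (S (gridPt t N r (J * r)) ω) * expDefect Y R t N r J ω)|
      ≤ C * (1 / (N : ℝ) ^ 2) + C * |X J| + 3 * C ^ 2 * ((t / N + |expIncr Y t N r J ω|)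
        * errWeight C Y R S t N r J ω) := by
    intro J hJ
    rw [hinv J hJ.le, hclip J hJ.le]
    -- In the notation of the one-cell estimate, `q` is `expIncr`, `K` is `expDefect`, `Q` is
    -- `oscSum`, `η` is `riemannDefect`, and `X` is the oscillation integrated against the drift.
    refine exp_step_bound (ξ := x (gridPt t N r ((J + 1) * r)) ω - x (gridPt t N r (J * r)) ω)
      (r := R (gridPt t N r ((J + 1) * r)) ω - R (gridPt t N r (J * r)) ω)
      hC (by positivity) hCN (hS _ (hgt J hJ.le)) (Real.exp_pos _)
      (hZ _ (hgt J hJ.le)) (Real.exp_pos _) (hZ _ (hgt (J + 1) hJ)) ?_ ?_ (hη J hJ) (hX2 J hJ)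
      rfl ?_
    · rw [expIncr, add_sub_cancel, ← Real.exp_add, ← Real.exp_add]
      congr 1; simp only [Z]; ring
    · have := hx _ _ (hmon (show J * r ≤ (J + 1) * r by gcongr; omega)) (hgt (J + 1) hJ)
      refine this.trans (le_of_eq ?_)
      rw [show (J + 1) * r = J * r + r by ring, gridPt_sub]
      field_simp
    · have htel : ∀ f : ℝ≥0 → ℝ, ∑ i ∈ Finset.range r, (f (gridPt t N r (J * r + i + 1))
          - f (gridPt t N r (J * r + i)))
          = f (gridPt t N r ((J + 1) * r)) - f (gridPt t N r (J * r)) := by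
        intro f
        have := Finset.sum_range_sub (fun i => f (gridPt t N r (J * r + i))) r
        simp only [add_zero, ← add_assoc] at this
        rw [this, show (J + 1) * r = J * r + r by ring]
      -- Inside the cell the integrand is its value at the left coarse point plus the oscillation.
      -- The first part integrates to the full increments of `R` and `x`.
      have hsum : ∑ i ∈ Finset.range r, S (gridPt t N r (J * r + i)) ω *
          (R (gridPt t N r (J * r + i + 1)) ω + x (gridPt t N r (J * r + i + 1)) ω
            - (R (gridPt t N r (J * r + i)) ω + x (gridPt t N r (J * r + i)) ω))
          = oscSum C S R t N r J ω + X J + S (gridPt t N r (J * r)) ω *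
            (R (gridPt t N r ((J + 1) * r)) ω - R (gridPt t N r (J * r)) ω
              + (x (gridPt t N r ((J + 1) * r)) ω - x (gridPt t N r (J * r)) ω)) := by
        rw [← htel (fun u => R u ω), ← htel (fun u => x u ω), ← Finset.sum_add_distrib,
          Finset.mul_sum, oscSum, ← Finset.sum_add_distrib, ← Finset.sum_add_distrib]
        refine Finset.sum_congr rfl fun i hi => ?_
        rw [hosc J hJ i (Finset.mem_range.1 hi)]
        ring
      rw [riemannDefect, hsum]
      ring
  have hT0 : T 0 = S 0 ω := by simp [T, gridPt_zero]
  have hTN : T N = S t ω * Real.exp (-(Z t ω - Z 0 ω)) := by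
    simp only [T, gridPt_last t hN hr]
  have htele : T N - T 0 = ∑ J ∈ Finset.range N, (T (J + 1) - T J) :=
    (Finset.sum_range_sub T N).symm
  change |S t ω * Real.exp (-(Z t ω - Z 0 ω)) - S 0 ω| ≤ _
  rw [← hTN, ← hT0, htele]
  have hsplit : ∑ J ∈ Finset.range N, (T (J + 1) - T J)
      = ∑ J ∈ Finset.range N, invExp C Z (gridPt t N r (J * r)) ω * oscSum C S R t N r J ω
      - ∑ J ∈ Finset.range N, invExp C Z (gridPt t N r (J * r)) ω
        * clip C (S (gridPt t N r (J * r)) ω) * expDefect Y R t N r J ω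
      + ∑ J ∈ Finset.range N, (T (J + 1) - T J - (invExp C Z (gridPt t N r (J * r)) ω
      * oscSum C S R t N r J ω - invExp C Z (gridPt t N r (J * r)) ω
      * clip C (S (gridPt t N r (J * r)) ω) * expDefect Y R t N r J ω)) := by
    rw [← Finset.sum_sub_distrib, ← Finset.sum_add_distrib]
    exact Finset.sum_congr rfl fun J _ => by ring
  rw [hsplit, compBound]
  refine (abs_add_le _ _).trans ?_
  rw [add_assoc, add_assoc]
  refine add_le_add (abs_sub _ _) ((Finset.abs_sum_le_sum_abs _ _).trans ?_)
  calc _ ≤ ∑ J ∈ Finset.range N, (C * (1 / (N : ℝ) ^ 2) + C * (C * ∑ i ∈ Finset.range r,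
      (t : ℝ) / (N * r) * |oscCoef C S t N r J i ω|)
      + 3 * C ^ 2 * ((t / N + |expIncr Y t N r J ω|)
        * errWeight C Y R S t N r J ω)) := by
        refine Finset.sum_le_sum fun J hJ => (hstep J (Finset.mem_range.1 hJ)).trans ?_
        gcongr
        exact hX J (Finset.mem_range.1 hJ)
    _ = _ := by
        rw [Finset.sum_add_distrib, Finset.sum_add_distrib, Finset.sum_const, Finset.card_range,
          nsmul_eq_mul, Finset.mul_sum, Finset.mul_sum, add_assoc]
        congr 1
        · field_simp
        · congr 1
          exact Finset.sum_congr rfl fun J _ => by ring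

section Limit

variable [IsProbabilityMeasure P] {𝓕 : Filtration ℝ≥0 mΩ} {Y R S Z : ℝ≥0 → Ω → ℝ} {v C : ℝ}

lemma tendsto_integral_abs_of_sq {f : ℕ → Ω → ℝ} (hf : ∀ n, MemLp (f n) 2 P)
    (h : Tendsto (fun n => ∫ ω, f n ω ^ 2 ∂P) atTop (𝓝 0)) :
    Tendsto (fun n => ∫ ω, |f n ω| ∂P) atTop (𝓝 0) := by
  have := tendsto_integral_sum_mul (P := P) (ι := Unit) (s := fun _ => {()})
    (a := fun _ _ _ => 1) (b := fun n _ => f n) (fun _ _ => memLp_const _) (fun n _ => hf n) 1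
    (by simp) (by simpa using h)
  simpa using this

lemma memLp_errWeight {t : ℝ≥0} {N r J : ℕ} (h0 : MemLp (oscSum C S R t N r J) 2 P)
    (h1 : MemLp (expDefect Y R t N r J) 2 P) (h2 : MemLp (expIncr Y t N r J) 2 P) :
    MemLp (errWeight C Y R S t N r J) 2 P := by
  have a1 : MemLp (fun _ : Ω => 1 / (N : ℝ) ^ 2) 2 P := memLp_const _
  have a2 : MemLp (fun ω => |oscSum C S R t N r J ω|) 2 P := h0.abs
  have a3 : MemLp (fun ω => C * |expDefect Y R t N r J ω|) 2 P := h1.abs.const_mul C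
  have a4 : MemLp (fun _ : Ω => 4 * C ^ 2 * ((t : ℝ) / N)) 2 P := memLp_const _
  have a5 : MemLp (fun ω => 2 * C ^ 2 * ((t : ℝ) / N) * |expIncr Y t N r J ω|) 2 P :=
    h2.abs.const_mul _
  exact (((a1.add a2).add a3).add a4).add a5

/-- Each of the five summands is squared separately, at the cost of the factor `5`. Summed over the
cells, the oscillation part gives `v * meanOsc` and all the others are of order `1 / N`. -/
lemma sum_errWeight_sq_le (h : IsExpPair 𝓕 P Y R v) (hC : 0 ≤ C)
    (hS : ∀ s, AEStronglyMeasurable[𝓕 s] (S s) P) {t : ℝ≥0} {N r : ℕ} (hN0 : 0 < N) (hr : 0 < r)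
    (hN : (t : ℝ) / N ≤ 1) :
    ∑ J ∈ Finset.range N, ∫ ω, errWeight C Y R S t N r J ω ^ 2 ∂P
      ≤ 5 * (1 / (N : ℝ) + v * meanOsc P C S t N r
        + (C ^ 2 * v * t + 16 * C ^ 4 * t + 16 * C ^ 4 * v * t) * (t / N)) := by
  have hNpos : (0 : ℝ) < N := by exact_mod_cast hN0
  have hN1 : (1 : ℝ) ≤ N := by exact_mod_cast hN0
  have hv := h.nonneg
  have hd : (0 : ℝ) ≤ t / N := by positivity
  have hone : ∀ J ∈ Finset.range N, ∫ ω, errWeight C Y R S t N r J ω ^ 2 ∂P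
      ≤ 5 * ((1 / (N : ℝ) ^ 2) ^ 2 + (∫ ω, oscSum C S R t N r J ω ^ 2 ∂P)
        + C ^ 2 * (v * (t / N) ^ 2) + (4 * C ^ 2 * (t / N)) ^ 2
        + (2 * C ^ 2 * (t / N)) ^ 2 * (4 * v * (t / N))) := by
    intro J _
    obtain ⟨h1, h2, h3, h4⟩ := expDefect_est h hr hN J
    have h0 := (oscSum_est h hC hS t N r J).1
    have i0 := h0.integrable_sq
    have i1 := h1.integrable_sq.const_mul (C ^ 2)
    have i3 := h3.integrable_sq.const_mul ((2 * C ^ 2 * (t / N)) ^ 2)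
    have j1 : Integrable (fun ω => (1 / (N : ℝ) ^ 2) ^ 2 + oscSum C S R t N r J ω ^ 2) P :=
      (integrable_const _).add i0
    have j2 : Integrable (fun ω => (1 / (N : ℝ) ^ 2) ^ 2 + oscSum C S R t N r J ω ^ 2
      + C ^ 2 * expDefect Y R t N r J ω ^ 2) P := j1.add i1
    have j3 : Integrable (fun ω => (1 / (N : ℝ) ^ 2) ^ 2 + oscSum C S R t N r J ω ^ 2
      + C ^ 2 * expDefect Y R t N r J ω ^ 2 + (4 * C ^ 2 * (t / N)) ^ 2) P :=
      j2.add (integrable_const _)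
    have j4 : Integrable (fun ω => (1 / (N : ℝ) ^ 2) ^ 2 + oscSum C S R t N r J ω ^ 2
      + C ^ 2 * expDefect Y R t N r J ω ^ 2 + (4 * C ^ 2 * (t / N)) ^ 2
      + (2 * C ^ 2 * (t / N)) ^ 2 * expIncr Y t N r J ω ^ 2) P := j3.add i3
    calc _ ≤ ∫ ω, 5 * ((1 / (N : ℝ) ^ 2) ^ 2 + oscSum C S R t N r J ω ^ 2
          + C ^ 2 * expDefect Y R t N r J ω ^ 2 + (4 * C ^ 2 * (t / N)) ^ 2
          + (2 * C ^ 2 * (t / N)) ^ 2 * expIncr Y t N r J ω ^ 2) ∂P := by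
          refine integral_mono (memLp_errWeight h0 h1 h3).integrable_sq
            (j4.const_mul 5) fun ω => ?_
          have hcs : ∀ a b c d e : ℝ, (a + b + c + d + e) ^ 2
              ≤ 5 * (a ^ 2 + b ^ 2 + c ^ 2 + d ^ 2 + e ^ 2) := fun a b c d e => by
            nlinarith [sq_nonneg (a - b), sq_nonneg (a - c), sq_nonneg (a - d), sq_nonneg (a - e),
              sq_nonneg (b - c), sq_nonneg (b - d), sq_nonneg (b - e), sq_nonneg (c - d),
              sq_nonneg (c - e), sq_nonneg (d - e)]
          simp only [errWeight]
          refine (hcs _ _ _ _ _).trans (le_of_eq ?_)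
          simp only [mul_pow, sq_abs]
      _ = 5 * ((1 / (N : ℝ) ^ 2) ^ 2 + (∫ ω, oscSum C S R t N r J ω ^ 2 ∂P)
        + C ^ 2 * (∫ ω, expDefect Y R t N r J ω ^ 2 ∂P) + (4 * C ^ 2 * (t / N)) ^ 2
        + (2 * C ^ 2 * (t / N)) ^ 2 * (∫ ω, expIncr Y t N r J ω ^ 2 ∂P)) := by
          rw [integral_const_mul, integral_add j3 i3, integral_add j2 (integrable_const _),
            integral_add j1 i1, integral_add (integrable_const _) i0, integral_const_mul,
            integral_const_mul]
          simp
      _ ≤ _ := by gcongr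
  have hosc := sum_oscSum_est h hC hS t N r
  have e1 : (N : ℝ) * (1 / (N : ℝ) ^ 2) ^ 2 ≤ 1 / N := by
    rw [show (N : ℝ) * (1 / (N : ℝ) ^ 2) ^ 2 = 1 / N ^ 3 by field_simp]
    exact one_div_le_one_div_of_le hNpos (le_self_pow₀ hN1 (by norm_num))
  have e5 : (t : ℝ) / N * (t / N) * (t / N) ≤ t / N * (t / N) * 1 := by gcongr
  have et : (N : ℝ) * (t / N) = t := by field_simp
  refine (Finset.sum_le_sum hone).trans ?_
  rw [← Finset.mul_sum, Finset.sum_add_distrib, Finset.sum_add_distrib, Finset.sum_add_distrib,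
    Finset.sum_add_distrib]
  simp only [Finset.sum_const, Finset.card_range, nsmul_eq_mul]
  refine mul_le_mul_of_nonneg_left ?_ (by norm_num)
  have e2 : (N : ℝ) * (C ^ 2 * (v * (t / N) ^ 2)) = C ^ 2 * v * t * (t / N) := by
    rw [← et]; field_simp
  have e3 : (N : ℝ) * (4 * C ^ 2 * (t / N)) ^ 2 = 16 * C ^ 4 * t * (t / N) := by
    rw [← et]; field_simp; ring
  have e4 : (N : ℝ) * ((2 * C ^ 2 * (t / N)) ^ 2 * (4 * v * (t / N)))
      ≤ 16 * C ^ 4 * v * t * (t / N) := by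
    calc _ = 16 * C ^ 4 * v * N * (t / N * (t / N) * (t / N)) := by ring
      _ ≤ 16 * C ^ 4 * v * N * (t / N * (t / N) * 1) := by gcongr
      _ = 16 * C ^ 4 * v * (N * (t / N)) * (t / N) := by ring
      _ = _ := by rw [et]
  rw [e2, e3]
  calc _ ≤ 1 / (N : ℝ) + v * meanOsc P C S t N r + C ^ 2 * v * t * (t / N)
        + 16 * C ^ 4 * t * (t / N) + 16 * C ^ 4 * v * t * (t / N) := by gcongr
    _ = _ := by ring

/-- There are `N` cells, each with second moment of order `t / N`. The sum stays bounded without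
tending to zero, so it can only serve as the bounded factor in Cauchy-Schwarz. -/
lemma sum_expIncr_sq_le (h : IsExpPair 𝓕 P Y R v) {t : ℝ≥0} {N r : ℕ} (hN0 : 0 < N) (hr : 0 < r)
    (hN : (t : ℝ) / N ≤ 1) :
    ∑ J ∈ Finset.range N, ∫ ω, (t / N + |expIncr Y t N r J ω|) ^ 2 ∂P
      ≤ 2 * t + 8 * v * t := by
  have hNpos : (0 : ℝ) < N := by exact_mod_cast hN0
  have hd : (0 : ℝ) ≤ t / N := by positivity
  have et : (N : ℝ) * (t / N) = t := by field_simp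
  have hone : ∀ J ∈ Finset.range N, ∫ ω, (t / N + |expIncr Y t N r J ω|) ^ 2 ∂P
      ≤ 2 * (t / N) ^ 2 + 2 * (4 * v * (t / N)) := by
    intro J _
    obtain ⟨-, -, h3, h4⟩ := expDefect_est h hr hN J
    have h5 : MemLp (fun ω => (t : ℝ) / N + |expIncr Y t N r J ω|) 2 P :=
      (memLp_const ((t : ℝ) / N)).add h3.abs
    calc _ ≤ ∫ ω, (2 * ((t : ℝ) / N) ^ 2 + 2 * expIncr Y t N r J ω ^ 2) ∂P := by
          refine integral_mono h5.integrable_sq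
            ((integrable_const _).add (h3.integrable_sq.const_mul 2)) fun ω => ?_
          simp only
          nlinarith [sq_nonneg ((t : ℝ) / N - |expIncr Y t N r J ω|), sq_abs (expIncr Y t N r J ω)]
      _ = 2 * ((t : ℝ) / N) ^ 2 + 2 * ∫ ω, expIncr Y t N r J ω ^ 2 ∂P := by
          rw [integral_add (integrable_const _) (h3.integrable_sq.const_mul 2)]
          simp [integral_const_mul]
      _ ≤ _ := by gcongr
  refine (Finset.sum_le_sum hone).trans ?_
  simp only [Finset.sum_const, Finset.card_range, nsmul_eq_mul]
  calc (N : ℝ) * (2 * ((t : ℝ) / N) ^ 2 + 2 * (4 * v * (t / N)))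
      = 2 * (N * (t / N)) * (t / N) + 8 * v * (N * (t / N)) := by ring
    _ ≤ 2 * t * 1 + 8 * v * t := by rw [et]; gcongr
    _ = _ := by ring

-- The two weighted sums vanish in `L²` by orthogonality. The oscillation against the drift is
-- handled by Cauchy-Schwarz with each fine-grid weight split into two square roots. The error
-- products pair a bounded sum of squares with a vanishing one. Nothing is asked of the refinements
-- `r n` beyond positivity.
set_option maxHeartbeats 2000000 in
lemma tendsto_integral_compBound (h : IsExpPair 𝓕 P Y R v) (hC : 0 ≤ C)
    (hS : ∀ s, AEStronglyMeasurable[𝓕 s] (S s) P) (hcad : ∀ᵐ ω ∂P, IsCadlag (fun t => S t ω))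
    (hZ : ∀ s, AEStronglyMeasurable[𝓕 s] (Z s) P) (t : ℝ≥0) (r : ℕ → ℕ) (hr : ∀ n, 0 < r n) :
    (∀ᶠ n in atTop, Integrable (compBound C Y R S Z t (n + 1) (r n)) P) ∧
    Tendsto (fun n => ∫ ω, compBound C Y R S Z t (n + 1) (r n) ω ∂P) atTop (𝓝 0) := by
  have hosc := tendsto_meanOsc hC hS hcad t r hr
  have hdiv : ∀ c : ℝ, Tendsto (fun n : ℕ => c / ((n + 1 : ℕ) : ℝ)) atTop (𝓝 0) := fun c =>
    (tendsto_const_div_atTop_nhds_zero_nat c).comp (tendsto_add_atTop_nat 1)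
  obtain ⟨n₀, hn₀⟩ : ∃ n₀, ∀ n ≥ n₀, (t : ℝ) / ((n + 1 : ℕ) : ℝ) ≤ 1 := by
    have := (hdiv t).eventually (gt_mem_nhds one_pos)
    obtain ⟨n₀, h0⟩ := eventually_atTop.1 this
    exact ⟨n₀, fun n hn => (h0 n hn).le⟩
  have hev : ∀ᶠ n in atTop, n₀ ≤ n := eventually_ge_atTop n₀
  have hz1 : Tendsto (fun n => ∫ ω, |∑ J ∈ Finset.range (n + 1), invExp C Z
      (gridPt t (n + 1) (r n) (J * r n)) ω * oscSum C S R t (n + 1) (r n) J ω| ∂P)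
      atTop (𝓝 0) := by
    refine tendsto_integral_abs_of_sq
      (fun n => (weighted_oscSum_est h hC hS hZ t (n + 1) (r n) (hr n)).1) ?_
    refine squeeze_zero (fun n => integral_nonneg fun _ => sq_nonneg _)
      (fun n => (weighted_oscSum_est h hC hS hZ t (n + 1) (r n) (hr n)).2) ?_
    simpa using hosc.const_mul (C ^ 2 * v)
  have hM2 : ∀ n J, MemLp (expDefect Y R t (n + 1) (r n) J) 2 P ∧
      MemLp (expIncr Y t (n + 1) (r n) J) 2 P := by
    intro n J
    have hst : gridPt t (n + 1) (r n) (J * r n) ≤ gridPt t (n + 1) (r n) ((J + 1) * r n) :=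
      gridPt_mono _ _ _ (by gcongr; omega)
    exact ⟨h.memLp' _ _ hst, h.memLp_exp hst⟩
  have hZ2 : ∀ n, MemLp (fun ω => ∑ J ∈ Finset.range (n + 1), invExp C Z
      (gridPt t (n + 1) (r n) (J * r n)) ω * clip C (S (gridPt t (n + 1) (r n) (J * r n)) ω)
      * expDefect Y R t (n + 1) (r n) J ω) 2 P := by
    intro n
    refine memLp_finsetSum _ fun J _ => ?_
    refine (hM2 n J).1.of_le_mul (c := C * C) ?_ (ae_of_all _ fun ω => ?_)
    · exact (((invExp_aesm hZ _).mono (𝓕.le _)).mul (((continuous_clip C).comp_aestronglyMeasurable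
        (hS _)).mono (𝓕.le _))).mul (hM2 n J).1.1
    · rw [norm_mul, norm_mul]
      gcongr
      · exact abs_invExp_le hC _ _
      · exact abs_clip_le hC _
  have hz2 : Tendsto (fun n => ∫ ω, |∑ J ∈ Finset.range (n + 1), invExp C Z
      (gridPt t (n + 1) (r n) (J * r n)) ω * clip C (S (gridPt t (n + 1) (r n) (J * r n)) ω)
      * expDefect Y R t (n + 1) (r n) J ω| ∂P) atTop (𝓝 0) := by
    refine tendsto_integral_abs_of_sq hZ2 ?_
    have hlim : Tendsto (fun n : ℕ => C ^ 4 * v * t * ((t : ℝ) / ((n + 1 : ℕ) : ℝ))) atTop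
        (𝓝 0) := by simpa using (hdiv t).const_mul (C ^ 4 * v * t)
    refine squeeze_zero' (Eventually.of_forall fun n => integral_nonneg fun _ => sq_nonneg _)
      ?_ hlim
    filter_upwards [hev] with n hn
    refine (weighted_expDefect_est h hC hS hZ (hr n) (hn₀ n hn)).2.trans (le_of_eq ?_)
    field_simp
  have hz4 : Tendsto (fun n => ∫ ω, ∑ J ∈ Finset.range (n + 1), ∑ i ∈ Finset.range (r n),
      (t : ℝ) / ((n + 1 : ℕ) * r n) * |oscCoef C S t (n + 1) (r n) J i ω| ∂P) atTop (𝓝 0) := by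
    have hm : ∀ N r J i, MemLp (oscCoef C S t N r J i) 2 P := fun N r J i => MemLp.of_bound
      ((oscCoef_aesm hS t N r J i).mono (𝓕.le _)) (2 * C)
      (ae_of_all _ fun ω => abs_oscCoef_le hC _ _ _ _ _ _)
    have := tendsto_integral_sum_mul (P := P) (ι := ℕ × ℕ)
      (s := fun n => Finset.range (n + 1) ×ˢ Finset.range (r n))
      (a := fun n _ _ => √((t : ℝ) / ((n + 1 : ℕ) * r n)))
      (b := fun n p ω => √((t : ℝ) / ((n + 1 : ℕ) * r n)) * oscCoef C S t (n + 1) (r n) p.1 p.2 ω)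
      (fun _ _ => memLp_const _) (fun n p => (hm _ _ _ _).const_mul _) t ?_ ?_
    · refine this.congr fun n => ?_
      refine integral_congr_ae (ae_of_all _ fun ω => ?_)
      simp only
      rw [Finset.sum_product]
      refine Finset.sum_congr rfl fun J _ => Finset.sum_congr rfl fun i _ => ?_
      rw [abs_mul, ← mul_assoc, abs_of_nonneg (Real.sqrt_nonneg _),
        Real.mul_self_sqrt (by positivity)]
    · refine Eventually.of_forall fun n => le_of_eq ?_
      have h1 : (r n : ℝ) ≠ 0 := by exact_mod_cast (hr n).ne'
      have h2 : (0 : ℝ) ≤ (t : ℝ) / ((n + 1 : ℕ) * r n) := by positivity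
      simp only [integral_const, Real.sq_sqrt h2]
      simp
      field_simp
    · refine hosc.congr fun n => ?_
      rw [Finset.sum_product, meanOsc]
      refine Finset.sum_congr rfl fun J _ => Finset.sum_congr rfl fun i _ => ?_
      rw [← integral_const_mul]
      refine integral_congr_ae (ae_of_all _ fun ω => ?_)
      simp only [mul_pow]
      rw [Real.sq_sqrt (by positivity)]
  have hw2 : ∀ n J, MemLp (errWeight C Y R S t (n + 1) (r n) J) 2 P := fun n J =>
    memLp_errWeight (oscSum_est h hC hS t _ _ J).1 (hM2 n J).1 (hM2 n J).2
  have ha2 : ∀ n J, MemLp (fun ω => (t : ℝ) / ((n + 1 : ℕ) : ℝ)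
      + |expIncr Y t (n + 1) (r n) J ω|) 2 P := fun n J =>
    (memLp_const ((t : ℝ) / ((n + 1 : ℕ) : ℝ))).add (hM2 n J).2.abs
  have hwnn : ∀ n J ω, 0 ≤ errWeight C Y R S t (n + 1) (r n) J ω := fun n J ω => by
    unfold errWeight; positivity
  have hz5 : Tendsto (fun n => ∫ ω, ∑ J ∈ Finset.range (n + 1),
      ((t : ℝ) / ((n + 1 : ℕ) : ℝ) + |expIncr Y t (n + 1) (r n) J ω|)
        * errWeight C Y R S t (n + 1) (r n) J ω ∂P) atTop (𝓝 0) := by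
    have := tendsto_integral_sum_mul (P := P) (ι := ℕ)
      (s := fun n => Finset.range (n + 1))
      (a := fun n J ω => (t : ℝ) / ((n + 1 : ℕ) : ℝ) + |expIncr Y t (n + 1) (r n) J ω|)
      (b := fun n J => errWeight C Y R S t (n + 1) (r n) J) ha2 hw2 (2 * t + 8 * v * t) ?_ ?_
    · refine this.congr fun n => integral_congr_ae (ae_of_all _ fun ω => ?_)
      refine Finset.sum_congr rfl fun J _ => ?_
      rw [abs_of_nonneg (hwnn n J ω), abs_of_nonneg (by positivity)]
    · filter_upwards [hev] with n hn
      exact sum_expIncr_sq_le h n.succ_pos (hr n) (hn₀ n hn)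
    · have hlim : Tendsto (fun n : ℕ => 5 * (1 / ((n + 1 : ℕ) : ℝ)
          + v * meanOsc P C S t (n + 1) (r n) + (C ^ 2 * v * t + 16 * C ^ 4 * t
            + 16 * C ^ 4 * v * t) * ((t : ℝ) / ((n + 1 : ℕ) : ℝ)))) atTop (𝓝 0) := by
        simpa using ((((hdiv 1).add (hosc.const_mul v)).add ((hdiv t).const_mul
          (C ^ 2 * v * t + 16 * C ^ 4 * t + 16 * C ^ 4 * v * t))).const_mul 5)
      refine squeeze_zero' (Eventually.of_forall fun n => Finset.sum_nonneg fun _ _ =>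
        integral_nonneg fun _ => sq_nonneg _) ?_ hlim
      filter_upwards [hev] with n hn
      exact sum_errWeight_sq_le h hC hS n.succ_pos (hr n) (hn₀ n hn)
  have i1 : ∀ n, Integrable (fun ω => |∑ J ∈ Finset.range (n + 1), invExp C Z
      (gridPt t (n + 1) (r n) (J * r n)) ω * oscSum C S R t (n + 1) (r n) J ω|) P := fun n =>
    ((weighted_oscSum_est h hC hS hZ t (n + 1) (r n) (hr n)).1.integrable (by norm_num)).abs
  have i2 : ∀ n, Integrable (fun ω => |∑ J ∈ Finset.range (n + 1), invExp C Z
      (gridPt t (n + 1) (r n) (J * r n)) ω * clip C (S (gridPt t (n + 1) (r n) (J * r n)) ω)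
      * expDefect Y R t (n + 1) (r n) J ω|) P := fun n =>
    ((hZ2 n).integrable (by norm_num)).abs
  have i4 : ∀ n, Integrable (fun ω => C ^ 2 * ∑ J ∈ Finset.range (n + 1), ∑ i ∈ Finset.range (r n),
      (t : ℝ) / ((n + 1 : ℕ) * r n) * |oscCoef C S t (n + 1) (r n) J i ω|) P := by
    intro n
    refine (integrable_finsetSum _ fun J _ => integrable_finsetSum _ fun i _ => ?_).const_mul _
    refine Integrable.const_mul ?_ _
    exact (Integrable.of_bound ((oscCoef_aesm hS t _ _ J i).mono (𝓕.le _)) (2 * C)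
      (ae_of_all _ fun ω => abs_oscCoef_le hC _ _ _ _ _ _)).abs
  have i5 : ∀ n, Integrable (fun ω => 3 * C ^ 2 * ∑ J ∈ Finset.range (n + 1),
      ((t : ℝ) / ((n + 1 : ℕ) : ℝ) + |expIncr Y t (n + 1) (r n) J ω|)
        * errWeight C Y R S t (n + 1) (r n) J ω) P := fun n =>
    (integrable_finsetSum _ fun J _ => (ha2 n J).integrable_mul (hw2 n J)).const_mul _
  have j1 : ∀ n, Integrable (fun ω => |∑ J ∈ Finset.range (n + 1), invExp C Z
      (gridPt t (n + 1) (r n) (J * r n)) ω * oscSum C S R t (n + 1) (r n) J ω|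
      + |∑ J ∈ Finset.range (n + 1), invExp C Z
      (gridPt t (n + 1) (r n) (J * r n)) ω * clip C (S (gridPt t (n + 1) (r n) (J * r n)) ω)
      * expDefect Y R t (n + 1) (r n) J ω|) P := fun n => (i1 n).add (i2 n)
  have j2 := fun n => (j1 n).add (integrable_const (C / ((n + 1 : ℕ) : ℝ)))
  have j3 := fun n => (j2 n).add (i4 n)
  have j4 := fun n => (j3 n).add (i5 n)
  refine ⟨Eventually.of_forall j4, ?_⟩
  have := (((hz1.add hz2).add (hdiv C)).add (hz4.const_mul (C ^ 2))).add
    (hz5.const_mul (3 * C ^ 2))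
  simp only [add_zero, mul_zero] at this
  refine this.congr fun n => ?_
  have e := (integral_add (j3 n) (i5 n))
  have e3 := integral_add (j2 n) (i4 n)
  have e2 := integral_add (j1 n) (integrable_const (C / ((n + 1 : ℕ) : ℝ)))
  have e1 := integral_add (i1 n) (i2 n)
  rw [integral_const_mul] at e e3
  have e0 : ∫ _, C / ((n + 1 : ℕ) : ℝ) ∂P = C / ((n + 1 : ℕ) : ℝ) := by simp
  rw [e0] at e2
  rw [← e1, ← e2]
  exact ((congrArg₂ (· + ·) e3.symm rfl).trans e.symm)

end Limit

end Uniqueness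

end

section

/-! ### Choice of the fine mesh and uniqueness of the stochastic exponential. -/

section Uniqueness

variable {Ω : Type*} {mΩ : MeasurableSpace Ω} {P : Measure Ω}

/-- The integral is tested on `[0, u]` for every coarse point `u`, whereas the fine grid covers `[0,
t]`; the minimum stops the grid at `u`. -/
lemma isPartitionSeq_grid (t : ℝ≥0) {N : ℕ} (hN : 0 < N) (J : ℕ) :
    IsPartitionSeq (gridPt t N 1 J) (fun k => J * (k + 1))
      (fun k j => min (gridPt t N (k + 1) j) (gridPt t N 1 J)) := by
  have hend : ∀ k, gridPt t N (k + 1) (J * (k + 1)) = gridPt t N 1 J := by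
    intro k
    have : (N : ℝ≥0) ≠ 0 := by positivity
    unfold gridPt
    push_cast
    field_simp
  refine ⟨fun k => by simp [gridPt_zero], fun k => by rw [hend, min_self],
    fun k i j hij => min_le_min_right _ (gridPt_mono _ _ _ hij), fun ε hε => ?_⟩
  have hlim : Tendsto (fun k : ℕ => (t : ℝ) / ((k + 1 : ℕ) : ℝ)) atTop (𝓝 0) :=
    (tendsto_const_div_atTop_nhds_zero_nat (t : ℝ)).comp (tendsto_add_atTop_nat 1)
  filter_upwards [hlim.eventually (gt_mem_nhds (show (0 : ℝ) < ε from hε))] with k hk j _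
  have h1 : gridPt t N (k + 1) (j + 1) ≤ gridPt t N (k + 1) j + ε := by
    rw [← NNReal.coe_le_coe, NNReal.coe_add, ← sub_le_iff_le_add', gridPt_sub]
    have hN1 : (1 : ℝ) ≤ N := by exact_mod_cast hN
    calc ((1 : ℕ) : ℝ) * (t / (N * ((k + 1 : ℕ) : ℝ))) = (t / ((k + 1 : ℕ) : ℝ)) / N := by
          field_simp; simp
      _ ≤ (t / ((k + 1 : ℕ) : ℝ)) := div_le_self (by positivity) hN1
      _ ≤ ε := hk.le
  calc min (gridPt t N (k + 1) (j + 1)) (gridPt t N 1 J)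
      ≤ min (gridPt t N (k + 1) j + ε) (gridPt t N 1 J + ε) :=
        min_le_min h1 (le_add_of_nonneg_right zero_le)
    _ = _ := min_add_add_right _ _ _

/-- The defect of a coarse cell is the difference of the Riemann sum errors at its two ends. For
fixed `N` there are finitely many ends, and all these errors tend to zero in probability on `A` as
the mesh is refined. -/
lemma exists_fine_mesh {S R' : ℝ≥0 → Ω → ℝ} {A : Set Ω} {t : ℝ≥0}
    (hint : ∀ u ≤ t, ∀ (l : ℕ → ℕ) (τ : ℕ → ℕ → ℝ≥0), IsPartitionSeq u l τ → ∀ ε : ℝ, 0 < ε →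
      Tendsto (fun k => P (A ∩ {ω | ε ≤ |∑ j ∈ Finset.range (l k),
        S (τ k j) ω * (R' (τ k (j + 1)) ω - R' (τ k j) ω) - (S u ω - S 0 ω)|})) atTop (𝓝 0))
    {N : ℕ} (hN : 0 < N) :
    ∃ r, 0 < r ∧ P (A ∩ {ω | ∃ J < N, 1 / (N : ℝ) ^ 2 < |riemannDefect S R' t N r J ω|})
      ≤ ENNReal.ofReal (1 / N) := by
  have hNpos : (0 : ℝ) < N := by exact_mod_cast hN
  set M : ℕ → ℕ → Ω → ℝ := fun k J ω => ∑ j ∈ Finset.range (J * (k + 1)),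
    S (gridPt t N (k + 1) j) ω * (R' (gridPt t N (k + 1) (j + 1)) ω - R' (gridPt t N (k + 1) j) ω)
    - (S (gridPt t N 1 J) ω - S 0 ω) with hM
  have hend : ∀ k J, gridPt t N (k + 1) (J * (k + 1)) = gridPt t N 1 J := by
    intro k J
    have : (N : ℝ≥0) ≠ 0 := by positivity
    unfold gridPt
    push_cast
    field_simp
  -- Half of the target: each defect involves two of the errors.
  have hε : 0 < 1 / (2 * (N : ℝ) ^ 2) := by positivity
  have hlim : ∀ J ∈ Finset.range (N + 1), Tendsto (fun k => P (A ∩ {ω |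
      1 / (2 * (N : ℝ) ^ 2) ≤ |M k J ω|})) atTop (𝓝 0) := by
    intro J hJ
    have hJ' : J ≤ N := by simpa [Nat.lt_succ_iff] using hJ
    refine (hint (gridPt t N 1 J) (gridPt_le t hN one_pos (by omega)) _ _
      (isPartitionSeq_grid t hN J) _ hε).congr fun k => ?_
    congr 2
    ext ω
    simp only [mem_ofPred_eq, hM]
    have : ∀ j ≤ J * (k + 1), min (gridPt t N (k + 1) j) (gridPt t N 1 J)
        = gridPt t N (k + 1) j := fun j hj => by
      rw [← hend k J]; exact min_eq_left (gridPt_mono _ _ _ hj)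
    have hs : ∑ j ∈ Finset.range (J * (k + 1)), S (min (gridPt t N (k + 1) j) (gridPt t N 1 J)) ω *
        (R' (min (gridPt t N (k + 1) (j + 1)) (gridPt t N 1 J)) ω
          - R' (min (gridPt t N (k + 1) j) (gridPt t N 1 J)) ω)
        = ∑ j ∈ Finset.range (J * (k + 1)), S (gridPt t N (k + 1) j) ω *
          (R' (gridPt t N (k + 1) (j + 1)) ω - R' (gridPt t N (k + 1) j) ω) := by
      refine Finset.sum_congr rfl fun j hj => ?_
      rw [Finset.mem_range] at hj
      rw [this j hj.le, this (j + 1) hj]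
    rw [hs]
  have hsum : Tendsto (fun k => ∑ J ∈ Finset.range (N + 1), P (A ∩ {ω |
      1 / (2 * (N : ℝ) ^ 2) ≤ |M k J ω|})) atTop (𝓝 0) := by
    simpa using tendsto_finsetSum _ hlim
  obtain ⟨k, hk⟩ := (hsum.eventually (gt_mem_nhds
    (show (0 : ℝ≥0∞) < ENNReal.ofReal (1 / N) by simpa using hN))).exists
  refine ⟨k + 1, k.succ_pos, le_trans (measure_mono ?_) ((measure_biUnion_finset_le
    (Finset.range (N + 1)) _).trans hk.le)⟩
  rintro ω ⟨hA, J, hJ, hη⟩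
  have hdef : riemannDefect S R' t N (k + 1) J ω = M k J ω - M k (J + 1) ω := by
    simp only [riemannDefect, hM, hend]
    rw [show (J + 1) * (k + 1) = J * (k + 1) + (k + 1) by ring,
      Finset.sum_range_add _ (J * (k + 1)) (k + 1)]
    simp only [add_assoc]
    ring
  by_contra hcon
  simp only [mem_iUnion, mem_inter_iff, mem_ofPred_eq, not_exists, not_and, not_le,
    Finset.mem_range] at hcon
  have h1 := hcon J (by omega) hA
  have h2 := hcon (J + 1) (by omega) hA
  rw [hdef] at hη
  have h3 := abs_sub (M k J ω) (M k (J + 1) ω)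
  have h4 : 1 / (2 * (N : ℝ) ^ 2) + 1 / (2 * (N : ℝ) ^ 2) = 1 / (N : ℝ) ^ 2 := by field_simp; norm_num
  linarith

set_option maxHeartbeats 800000 in
/-- A càdlàg adapted solution of `dS = S₋ d(R + x)`, in the sense of Riemann sums on the event `A`,
is the exponential `S 0 * exp (Y - Y 0 + x - x 0)` on `A`. -/
theorem IsExpPair.eq_exp [IsProbabilityMeasure P] {𝓕 : Filtration ℝ≥0 mΩ}
    {Y R S x : ℝ≥0 → Ω → ℝ} {v : ℝ} (h : IsExpPair 𝓕 P Y R v)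
    (hxm : ∀ s, AEStronglyMeasurable[𝓕 s] (x s) P)
    (hx : ∀ᵐ ω ∂P, ∀ t : ℝ≥0, ∃ C : ℝ, ∀ u w : ℝ≥0, u ≤ w → w ≤ t →
      |x w ω - x u ω| ≤ C * (w - u))
    (hSm : ∀ s, AEStronglyMeasurable[𝓕 s] (S s) P)
    (hS : ∀ᵐ ω ∂P, IsCadlag (fun t => S t ω))
    (hY : ∀ᵐ ω ∂P, ∀ t : ℝ≥0, ∃ C : ℝ, ∀ u ≤ t, |Y u ω| ≤ C)
    {A : Set Ω} {t : ℝ≥0}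
    (hint : ∀ u ≤ t, ∀ (l : ℕ → ℕ) (τ : ℕ → ℕ → ℝ≥0), IsPartitionSeq u l τ → ∀ ε : ℝ, 0 < ε →
      Tendsto (fun k => P (A ∩ {ω | ε ≤ |∑ j ∈ Finset.range (l k),
        S (τ k j) ω * (R (τ k (j + 1)) ω + x (τ k (j + 1)) ω - (R (τ k j) ω + x (τ k j) ω))
          - (S u ω - S 0 ω)|})) atTop (𝓝 0)) :
    ∀ᵐ ω ∂P, ω ∈ A → S t ω = S 0 ω * Real.exp (Y t ω - Y 0 ω + (x t ω - x 0 ω)) := by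
  have hex : ∀ n : ℕ, ∃ r, 0 < r ∧ P (A ∩ {ω | ∃ J < n + 1, 1 / ((n + 1 : ℕ) : ℝ) ^ 2
      < |riemannDefect S (fun u ω => R u ω + x u ω) t (n + 1) r J ω|})
      ≤ ENNReal.ofReal (1 / ((n + 1 : ℕ) : ℝ)) := fun n =>
    exists_fine_mesh (R' := fun u ω => R u ω + x u ω) hint n.succ_pos
  choose r hr hrP using hex
  set Z : ℝ≥0 → Ω → ℝ := fun u ω => Y u ω + x u ω
  have hZm : ∀ s, AEStronglyMeasurable[𝓕 s] (Z s) P := fun s => (h.adapted_left s).add (hxm s)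
  set D : Ω → ℝ := fun ω => S t ω * Real.exp (-(Z t ω - Z 0 ω)) - S 0 ω with hD
  -- The paths on which the bound `C` makes all truncations inactive up to time `t`. Almost every
  -- path lies in some `G (C + 1)`.
  let G : ℕ → Set Ω := fun C => {ω | (∀ u ≤ t, |S u ω| ≤ C) ∧
    (∀ u ≤ t, Real.exp (-(Z u ω - Z 0 ω)) ≤ C) ∧
    ∀ u w, u ≤ w → w ≤ t → |x w ω - x u ω| ≤ C * (w - u)}
  have hdivt : ∀ c : ℝ, Tendsto (fun n : ℕ => c / ((n + 1 : ℕ) : ℝ)) atTop (𝓝 0) := fun c =>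
    (tendsto_const_div_atTop_nhds_zero_nat c).comp (tendsto_add_atTop_nat 1)
  -- On `A` and `G`, and away from the event of inaccurate Riemann sums, the discrepancy is at most
  -- `compBound`; Markov's inequality concludes. Only monotonicity and subadditivity of the outer
  -- measure are applied to `A` and `G`, so neither has to be measurable.
  have hzero : ∀ (C m : ℕ), P (A ∩ G (C + 1) ∩ {ω | 1 / ((m : ℝ) + 1) ≤ |D ω|}) = 0 := by
    intro C m
    have hε : 0 < 1 / ((m : ℝ) + 1) := by positivity
    set K : ℝ := ((C + 1 : ℕ) : ℝ) with hK
    have hK1 : 1 ≤ K := by rw [hK]; push_cast; linarith [C.cast_nonneg (α := ℝ)]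
    obtain ⟨hI, hlim⟩ := tendsto_integral_compBound h (by linarith : 0 ≤ K) hSm hS hZm t r hr
    have hlim2 : Tendsto (fun n : ℕ => ENNReal.ofReal (1 / ((n + 1 : ℕ) : ℝ))
        + ENNReal.ofReal ((∫ ω, compBound K Y R S Z t (n + 1) (r n) ω ∂P)
          / (1 / ((m : ℝ) + 1)))) atTop (𝓝 0) := by
      have h1 := ENNReal.tendsto_ofReal (hdivt 1)
      have h2 := ENNReal.tendsto_ofReal (hlim.div_const (1 / ((m : ℝ) + 1)))
      simpa using h1.add h2
    refine le_antisymm (ge_of_tendsto hlim2 ?_) zero_le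
    have hKt := (hdivt (K * t)).eventually (gt_mem_nhds one_pos)
    filter_upwards [hI, hKt] with n hIn hKn
    have hnn : ∀ ω, 0 ≤ compBound K Y R S Z t (n + 1) (r n) ω := by
      intro ω
      have : 0 ≤ K := by linarith
      have hw : ∀ J, 0 ≤ errWeight K Y R S t (n + 1) (r n) J ω := fun J => by
        unfold errWeight; positivity
      have h5 : 0 ≤ ∑ J ∈ Finset.range (n + 1), ((t : ℝ) / ((n + 1 : ℕ) : ℝ)
          + |expIncr Y t (n + 1) (r n) J ω|) * errWeight K Y R S t (n + 1) (r n) J ω :=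
        Finset.sum_nonneg fun J _ => mul_nonneg (by positivity) (hw J)
      unfold compBound
      positivity
    have hsub : A ∩ G (C + 1) ∩ {ω | 1 / ((m : ℝ) + 1) ≤ |D ω|} ⊆
        (A ∩ {ω | ∃ J < n + 1, 1 / ((n + 1 : ℕ) : ℝ) ^ 2
          < |riemannDefect S (fun u ω => R u ω + x u ω) t (n + 1) (r n) J ω|}) ∪
        {ω | 1 / ((m : ℝ) + 1) ≤ compBound K Y R S Z t (n + 1) (r n) ω} := by
      rintro ω ⟨⟨hA, g1, g2, g3⟩, hω⟩
      by_cases hη : ∃ J < n + 1, 1 / ((n + 1 : ℕ) : ℝ) ^ 2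
          < |riemannDefect S (fun u ω => R u ω + x u ω) t (n + 1) (r n) J ω|
      · exact Or.inl ⟨hA, hη⟩
      · right
        push Not at hη
        refine le_trans hω (abs_sub_le_compBound n.succ_pos (hr n) hK1 ?_ g1 g2 g3 hη)
        rw [mul_div_assoc'] ; exact hKn.le
    refine (measure_mono hsub).trans ((measure_union_le _ _).trans (add_le_add (hrP n) ?_))
    have := mul_meas_ge_le_integral_of_nonneg (ae_of_all _ hnn) hIn (1 / ((m : ℝ) + 1))
    rw [mul_comm, ← le_div_iff₀ hε] at this
    rw [← ofReal_measureReal]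
    exact ENNReal.ofReal_le_ofReal this
  have hall : ∀ᵐ ω ∂P, ∀ C m : ℕ, ω ∉ A ∩ G (C + 1) ∩ {ω | 1 / ((m : ℝ) + 1) ≤ |D ω|} :=
    ae_all_iff.2 fun C => ae_all_iff.2 fun m => measure_eq_zero_iff_ae_notMem.1 (hzero C m)
  filter_upwards [hall, hx, hS, hY] with ω h1 h2 h3 h4 hA
  obtain ⟨C₁, hC₁⟩ := h3.bounded t
  obtain ⟨C₂, hC₂⟩ := h4 t
  obtain ⟨C₃, hC₃⟩ := h2 t
  -- Inside the exponential, `2 * C₂` bounds the variation of `Y` from time zero and `|C₃| * t` that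
  -- of `x`.
  obtain ⟨C, hC⟩ := exists_nat_ge (max C₁ (max (Real.exp (2 * C₂ + |C₃| * t)) |C₃|))
  have hC' : max C₁ (max (Real.exp (2 * C₂ + |C₃| * t)) |C₃|) ≤ ((C + 1 : ℕ) : ℝ) := by
    push_cast; linarith
  rw [max_le_iff, max_le_iff] at hC'
  have hG : ω ∈ G (C + 1) := by
    refine ⟨fun u hu => (hC₁ u hu).trans hC'.1, fun u hu => le_trans ?_ hC'.2.1, fun u w huw hw =>
      (hC₃ u w huw hw).trans ?_⟩
    · rw [Real.exp_le_exp]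
      have a1 := abs_le.1 (hC₂ u hu)
      have a2 := abs_le.1 (hC₂ 0 zero_le)
      have a3 := abs_le.1 (hC₃ 0 u zero_le hu)
      have a4 : C₃ * ((u : ℝ) - (0 : ℝ≥0)) ≤ |C₃| * t := by
        rw [NNReal.coe_zero, sub_zero]
        exact mul_le_mul (le_abs_self _) (NNReal.coe_le_coe.2 hu) u.2 (abs_nonneg _)
      simp only [Z]
      linarith
    · have : (0 : ℝ) ≤ w - u := sub_nonneg.2 (NNReal.coe_le_coe.2 huw)
      gcongr
      exact (le_abs_self _).trans hC'.2.2
  have hD0 : D ω = 0 := by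
    by_contra hne
    obtain ⟨m, hm⟩ := exists_nat_one_div_lt (abs_pos.2 hne)
    exact h1 C m ⟨⟨hA, hG⟩, hm.le⟩
  have hD1 : S 0 ω = S t ω * Real.exp (-(Z t ω - Z 0 ω)) := by
    simp only [hD] at hD0; linarith
  rw [hD1, mul_assoc, ← Real.exp_add]
  simp only [Z]
  rw [show -(Y t ω + x t ω - (Y 0 ω + x 0 ω)) + (Y t ω - Y 0 ω + (x t ω - x 0 ω)) = 0 by ring]
  simp

end Uniqueness

end

section

variable {Ω Z : Type*} {mΩ : MeasurableSpace Ω} [MeasurableSpace Z] {P : Measure Ω}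

/-! ### Sums over the points of a point function -/

/-- `∫_{(s,t]} ∫ f(z) N(dr, dz)`, where `N` is the counting measure of `q`. -/
def incSum (q : ℝ → Option Z) (f : Z → ℝ) (s t : ℝ≥0) : ℝ :=
  ∑ᶠ r ∈ Ioc (s : ℝ) t, (q r).elim 0 f

/-- Only finitely many points of `q` up to any time lie in `V`. -/
def LocFinite (q : ℝ → Option Z) (V : Set Z) : Prop :=
  ∀ t : ℝ≥0, {r : ℝ | r ≤ t ∧ ∃ z ∈ V, q r = some z}.Finite

lemma LocFinite.mono {q : ℝ → Option Z} {U V : Set Z} (h : LocFinite q V) (hUV : U ⊆ V) :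
    LocFinite q U :=
  fun t => (h t).subset fun _ ⟨h1, z, hz, h2⟩ => ⟨h1, z, hUV hz, h2⟩

lemma LocFinite.finite_Ioc {q : ℝ → Option Z} {V : Set Z} (h : LocFinite q V) (s t : ℝ≥0) :
    {r : ℝ | r ∈ Ioc (s : ℝ) t ∧ ∃ z ∈ V, q r = some z}.Finite :=
  (h t).subset fun _ ⟨h1, h2⟩ => ⟨h1.2, h2⟩

lemma incSum_eq_sum {q : ℝ → Option Z} {V : Set Z} (h : LocFinite q V) {f : Z → ℝ}
    (hf : ∀ z ∉ V, f z = 0) (s t : ℝ≥0) :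
    incSum q f s t = ∑ r ∈ (h.finite_Ioc s t).toFinset, (q r).elim 0 f := by
  unfold incSum
  refine finsum_mem_eq_sum_of_inter_support_eq _ ?_
  ext r
  simp only [mem_inter_iff, Function.mem_support, Set.Finite.coe_toFinset, mem_ofPred_eq]
  constructor
  · rintro ⟨h1, h2⟩
    refine ⟨⟨h1, ?_⟩, h2⟩
    cases hq : q r with
    | none => simp [hq] at h2
    | some z =>
      refine ⟨z, ?_, rfl⟩
      by_contra hz
      exact h2 (by simp [hq, hf z hz])
  · rintro ⟨⟨h1, -⟩, h2⟩
    exact ⟨h1, h2⟩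

lemma jumpSum_eq_incSum {q : ℝ → Option Z} (hq : ∀ r ≤ 0, q r = none) (U : Set Z) (f : Z → ℝ)
    (t : ℝ≥0) : jumpSum q U f t = incSum q (U.indicator f) 0 t := by
  unfold jumpSum incSum
  rw [finsum_mem_def, finsum_mem_def]
  congr 1
  ext r
  by_cases hr : r ≤ 0
  · simp [indicator_apply, hq r hr]
  · push Not at hr
    cases hqr : q r with
    | none => simp [indicator_apply, hqr]
    | some z => by_cases hz : z ∈ U <;> by_cases ht : r ≤ t <;> simp [hqr, hz, ht, hr]

lemma incSum_add {q : ℝ → Option Z} {V : Set Z} (h : LocFinite q V) {f g : Z → ℝ}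
    (hf : ∀ z ∉ V, f z = 0) (hg : ∀ z ∉ V, g z = 0) (s t : ℝ≥0) :
    incSum q (fun z => f z + g z) s t = incSum q f s t + incSum q g s t := by
  rw [incSum_eq_sum h hf, incSum_eq_sum h hg, incSum_eq_sum h (f := fun z => f z + g z)
    (fun z hz => by simp [hf z hz, hg z hz]), ← Finset.sum_add_distrib]
  refine Finset.sum_congr rfl fun r _ => ?_
  cases q r <;> simp

lemma incSum_const_mul {q : ℝ → Option Z} {V : Set Z} (h : LocFinite q V) {f : Z → ℝ}
    (hf : ∀ z ∉ V, f z = 0) (c : ℝ) (s t : ℝ≥0) :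
    incSum q (fun z => c * f z) s t = c * incSum q f s t := by
  rw [incSum_eq_sum h hf, incSum_eq_sum h (f := fun z => c * f z)
    (fun z hz => by simp [hf z hz]), Finset.mul_sum]
  refine Finset.sum_congr rfl fun r _ => ?_
  cases q r <;> simp

lemma incSum_sub {q : ℝ → Option Z} {V : Set Z} (h : LocFinite q V) {f g : Z → ℝ}
    (hf : ∀ z ∉ V, f z = 0) (hg : ∀ z ∉ V, g z = 0) (s t : ℝ≥0) :
    incSum q (fun z => f z - g z) s t = incSum q f s t - incSum q g s t := by
  have := incSum_add h hf (g := fun z => (-1) * g z) (fun z hz => by simp [hg z hz]) s t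
  rw [incSum_const_mul h hg] at this
  rw [show (fun z => f z - g z) = fun z => f z + (-1) * g z by ext; ring, this]; ring

lemma incSum_add_incSum {q : ℝ → Option Z} {V : Set Z} (h : LocFinite q V) {f : Z → ℝ}
    (hf : ∀ z ∉ V, f z = 0) {s t u : ℝ≥0} (hst : s ≤ t) (htu : t ≤ u) :
    incSum q f s t + incSum q f t u = incSum q f s u := by
  have hfin : ∀ a b : ℝ≥0, (Ioc (a : ℝ) b ∩ Function.support fun r => (q r).elim 0 f).Finite := by
    intro a b
    refine (h.finite_Ioc a b).subset ?_
    rintro r ⟨h1, h2⟩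
    refine ⟨h1, ?_⟩
    cases hq : q r with
    | none => simp [hq] at h2
    | some z =>
      refine ⟨z, ?_, rfl⟩
      by_contra hz
      exact h2 (by simp [hq, hf z hz])
  unfold incSum
  rw [← finsum_mem_union' (Ioc_disjoint_Ioc_of_le le_rfl) (hfin s t) (hfin t u),
    Ioc_union_Ioc_eq_Ioc (NNReal.coe_le_coe.2 hst) (NNReal.coe_le_coe.2 htu)]

lemma incSum_self (q : ℝ → Option Z) (f : Z → ℝ) (s : ℝ≥0) : incSum q f s s = 0 := by
  simp [incSum]

lemma abs_incSum_le {q : ℝ → Option Z} {V : Set Z} (h : LocFinite q V) {f : Z → ℝ}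
    (hf : ∀ z ∉ V, f z = 0) {C : ℝ} (hC : ∀ z, |f z| ≤ C) (s t : ℝ≥0) :
    |incSum q f s t| ≤ C * (pointCount q (Ioc (s : ℝ) t ×ˢ V)).toNat := by
  have hcard : (pointCount q (Ioc (s : ℝ) t ×ˢ V)).toNat = (h.finite_Ioc s t).toFinset.card := by
    have : {r : ℝ | ∃ z, q r = some z ∧ (r, z) ∈ Ioc (s : ℝ) t ×ˢ V}
        = {r : ℝ | r ∈ Ioc (s : ℝ) t ∧ ∃ z ∈ V, q r = some z} := by
      ext r
      simp only [mem_prod, mem_ofPred_eq]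
      tauto
    rw [pointCount, this, (h.finite_Ioc s t).encard_eq_coe_toFinset_card, ENat.toNat_natCast]
  rw [incSum_eq_sum h hf, hcard]
  refine (Finset.abs_sum_le_sum_abs _ _).trans ((Finset.sum_le_card_nsmul _ _ C fun r hr => ?_).trans
    (by rw [nsmul_eq_mul, mul_comm]))
  simp only [Set.Finite.mem_toFinset, mem_ofPred_eq] at hr
  obtain ⟨-, z, -, hz⟩ := hr
  simpa [hz] using hC z

/-- Grouping the points by the value of `g` turns the sum into a combination of counts.
Measurability, independence and laws of sums are read off from counts in this way. -/
lemma incSum_simpleFunc {q : ℝ → Option Z} {V : Set Z} (h : LocFinite q V) (g : SimpleFunc Z ℝ)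
    (s t : ℝ≥0) :
    incSum q (V.indicator g) s t = ∑ c ∈ g.range,
      c * ((pointCount q (Ioc (s : ℝ) t ×ˢ (V ∩ g ⁻¹' {c}))).toNat : ℝ) := by
  classical
  rw [incSum_eq_sum h (fun z hz => indicator_of_notMem hz _)]
  have hcount : ∀ c, (pointCount q (Ioc (s : ℝ) t ×ˢ (V ∩ g ⁻¹' {c}))).toNat
      = ((h.finite_Ioc s t).toFinset.filter fun r => ∃ z, q r = some z ∧ g z = c).card := by
    intro c
    have : {r : ℝ | ∃ z, q r = some z ∧ (r, z) ∈ Ioc (s : ℝ) t ×ˢ (V ∩ g ⁻¹' {c})}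
        = ((h.finite_Ioc s t).toFinset.filter fun r => ∃ z, q r = some z ∧ g z = c : Finset ℝ) := by
      ext r
      simp only [mem_prod, mem_ofPred_eq, Finset.coe_filter, Set.Finite.mem_toFinset, mem_inter_iff,
        mem_preimage, mem_singleton_iff]
      constructor
      · rintro ⟨z, h1, h2, h3, h4⟩
        exact ⟨⟨h2, z, h3, h1⟩, z, h1, h4⟩
      · rintro ⟨⟨h2, z, h3, h1⟩, z', h1', h4⟩
        rw [h1] at h1'
        obtain rfl := Option.some.inj h1'
        exact ⟨z, h1, h2, h3, h4⟩
    rw [pointCount, this, Set.encard_coe_eq_coe_finsetCard, ENat.toNat_natCast]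
  simp_rw [hcount, Finset.card_filter, Nat.cast_sum, Finset.mul_sum]
  rw [Finset.sum_comm]
  refine Finset.sum_congr rfl fun r hr => ?_
  simp only [Set.Finite.mem_toFinset, mem_ofPred_eq] at hr
  obtain ⟨-, z, hzV, hz⟩ := hr
  simp only [hz, Option.elim_some, Option.some.injEq, exists_eq_left', Nat.cast_ite, Nat.cast_one,
    Nat.cast_zero, mul_ite, mul_one, mul_zero, indicator_of_mem hzV]
  rw [Finset.sum_ite_eq, if_pos (SimpleFunc.mem_range_self g z)]

lemma tendsto_incSum {q : ℝ → Option Z} {V : Set Z} (h : LocFinite q V) {f : ℕ → Z → ℝ}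
    {g : Z → ℝ} (hf : ∀ k, ∀ z ∉ V, f k z = 0)
    (hfg : ∀ z, Tendsto (fun k => f k z) atTop (𝓝 (g z))) (s t : ℝ≥0) :
    Tendsto (fun k => incSum q (f k) s t) atTop (𝓝 (incSum q g s t)) := by
  have hg : ∀ z ∉ V, g z = 0 := fun z hz =>
    tendsto_nhds_unique (hfg z) (by simp [hf _ z hz])
  simp_rw [fun k => incSum_eq_sum h (hf k), incSum_eq_sum h hg]
  refine tendsto_finsetSum _ fun r _ => ?_
  cases q r with
  | none => simp
  | some z => exact hfg z

/-! ### Poisson sums -/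

lemma intensity_Ioc (ν : Measure Z) [SFinite ν] (s t : ℝ≥0) (V : Set Z) :
    intensity ν (Ioc (s : ℝ) t ×ˢ V) = ENNReal.ofReal ((t : ℝ) - s) * ν V := by
  have : Ioc (s : ℝ) t ∩ Ioi 0 = Ioc (s : ℝ) t :=
    inter_eq_left.2 fun r hr => s.2.trans_lt hr.1
  rw [intensity, Measure.prod_prod, Measure.restrict_apply measurableSet_Ioc, this, Real.volume_Ioc]

lemma integral_exp_mul_poissonMeasure (r : ℝ≥0) (c : ℝ) :
    Integrable (fun k : ℕ => Real.exp (c * k)) (poissonMeasure r) ∧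
    ∫ k, Real.exp (c * k) ∂(poissonMeasure r) = Real.exp (r * (Real.exp c - 1)) := by
  have hterm : ∀ k : ℕ, Real.exp (-r) * (r : ℝ) ^ k / k.factorial * Real.exp (c * k)
      = Real.exp (-r) * ((r * Real.exp c) ^ k / k.factorial) := by
    intro k
    rw [mul_comm c, Real.exp_nat_mul, mul_pow]; ring
  have hs : HasSum (fun k : ℕ => Real.exp (-r) * (r : ℝ) ^ k / k.factorial * Real.exp (c * k))
      (Real.exp (r * (Real.exp c - 1))) := by
    simp_rw [hterm]
    have := (NormedSpace.expSeries_div_hasSum_exp ((r : ℝ) * Real.exp c)).mul_left (Real.exp (-r))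
    rw [← Real.exp_eq_exp_ℝ, ← Real.exp_add] at this
    convert! this using 2
    ring
  refine ⟨?_, ?_⟩
  · rw [integrable_poissonMeasure_iff]
    simpa using hs.summable
  · rw [integral_poissonMeasure]
    simpa [smul_eq_mul] using hs.tsum_eq

variable {𝓕 : Filtration ℝ≥0 mΩ} {ν : Measure Z} {p : Ω → ℝ → Option Z}

namespace IsPoissonPointProcess

lemma hasLaw_toNat (hp : IsPoissonPointProcess 𝓕 P ν p) {B : Set (ℝ × Z)} (hB : MeasurableSet B)
    (hfin : intensity ν B ≠ ∞) :
    HasLaw (fun ω => (pointCount (p ω) B).toNat) (poissonMeasure (intensity ν B).toNNReal) P := by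
  have h := hp.poisson B hB hfin
  have hm : Measurable ENat.toNat := measurable_from_top
  refine ⟨hm.comp_aemeasurable h.aemeasurable, ?_⟩
  have := Measure.map_map (μ := poissonMeasure (intensity ν B).toNNReal) (f := (Nat.cast : ℕ → ℕ∞))
    hm measurable_from_top
  rw [← h.map_eq, AEMeasurable.map_map_of_aemeasurable hm.aemeasurable h.aemeasurable] at this
  rw [show (fun ω => (pointCount (p ω) B).toNat) = ENat.toNat ∘ fun ω => pointCount (p ω) B from rfl,
    this, show ENat.toNat ∘ (Nat.cast : ℕ → ℕ∞) = id by ext; simp, Measure.map_id]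

lemma ae_ne_top (hp : IsPoissonPointProcess 𝓕 P ν p) {B : Set (ℝ × Z)} (hB : MeasurableSet B)
    (hfin : intensity ν B ≠ ∞) : ∀ᵐ ω ∂P, pointCount (p ω) B ≠ ⊤ := by
  have h := hp.poisson B hB hfin
  have : ∀ᵐ k ∂(P.map fun ω => pointCount (p ω) B), k ≠ ⊤ := by
    rw [h.map_eq]
    exact (ae_map_iff (p := fun k : ℕ∞ => k ≠ ⊤) measurable_from_top.aemeasurable
      (MeasurableSet.singleton ⊤).compl).2 (ae_of_all _ fun k => ENat.natCast_ne_top k)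
  exact ae_of_ae_map h.aemeasurable this

lemma ae_locFinite [SFinite ν] (hp : IsPoissonPointProcess 𝓕 P ν p) {V : Set Z}
    (hV : MeasurableSet V) (hfin : ν V ≠ ∞) : ∀ᵐ ω ∂P, LocFinite (p ω) V := by
  have h : ∀ n : ℕ, ∀ᵐ ω ∂P, pointCount (p ω) (Ioc ((0 : ℝ≥0) : ℝ) (n : ℝ≥0) ×ˢ V) ≠ ⊤ := fun n =>
    hp.ae_ne_top (measurableSet_Ioc.prod hV) (by
      rw [intensity_Ioc]; exact ENNReal.mul_ne_top ENNReal.ofReal_ne_top hfin)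
  filter_upwards [ae_all_iff.2 h] with ω hω t
  obtain ⟨n, hn⟩ := exists_nat_ge t
  refine (Set.encard_ne_top_iff.1 (hω n)).subset ?_
  rintro r ⟨hr, z, hz, hq⟩
  have h0 : 0 < r := by
    by_contra h0
    simp [hp.dom_pos ω r (not_lt.1 h0)] at hq
  refine ⟨z, hq, ⟨by simpa using h0, hr.trans ?_⟩, hz⟩
  exact_mod_cast hn

/-- Simple functions approximate `f`, and their sums involve only counts of sets inside the strip
over `Ioc s t`. The σ-algebra is left free because the same argument serves the past at `t`, the
future of `s` and the σ-algebra of all points. -/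
lemma incSum_aestronglyMeasurable [SFinite ν] (hp : IsPoissonPointProcess 𝓕 P ν p) {V : Set Z}
    (hV : MeasurableSet V) (hfin : ν V ≠ ∞) {f : Z → ℝ} (hf : Measurable f)
    (hf0 : ∀ z ∉ V, f z = 0) {s t : ℝ≥0} {m : MeasurableSpace Ω}
    (hm : ∀ B : Set (ℝ × Z), MeasurableSet B → B ⊆ Ioc (s : ℝ) t ×ˢ univ →
      Measurable[m] fun ω => pointCount (p ω) B) :
    AEStronglyMeasurable[m] (fun ω => incSum (p ω) f s t) P := by
  have hsm := hf.stronglyMeasurable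
  have hfV : V.indicator f = f := indicator_eq_self.2 fun z hz => by
    by_contra h
    exact hz (hf0 z h)
  refine aestronglyMeasurable_sub_of_tendsto_ae
    (f := fun k ω => incSum (p ω) (V.indicator (hsm.approx k)) s t) (fun k => ?_) ?_
  · refine AEStronglyMeasurable.congr (f := fun ω => ∑ c ∈ (hsm.approx k).range,
      c * ((pointCount (p ω) (Ioc (s : ℝ) t ×ˢ (V ∩ (hsm.approx k) ⁻¹' {c}))).toNat : ℝ)) ?_ ?_
    · refine Measurable.aestronglyMeasurable (Finset.measurable_sum _ fun c _ => ?_)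
      have h1 := hm (Ioc (s : ℝ) t ×ˢ (V ∩ (hsm.approx k) ⁻¹' {c}))
        (measurableSet_Ioc.prod (hV.inter ((hsm.approx k).measurableSet_fiber c)))
        (prod_mono subset_rfl (subset_univ _))
      exact ((measurable_from_top (f := fun n : ℕ∞ => (n.toNat : ℝ))).comp h1).const_mul c
    · filter_upwards [hp.ae_locFinite hV hfin] with ω hω
      exact (incSum_simpleFunc hω _ s t).symm
  · filter_upwards [hp.ae_locFinite hV hfin] with ω hω
    refine tendsto_incSum hω (fun k z hz => indicator_of_notMem hz _) (fun z => ?_) s t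
    by_cases hz : z ∈ V
    · simp only [indicator_of_mem hz]
      exact hsm.tendsto_approx z
    · simp [indicator_of_notMem hz, hf0 z hz]

end IsPoissonPointProcess

end

section

/-! ### Moments from exponential moments -/

/-- This is the derivative at zero of the moment generating function of `X` under the measure with
density `exp H`. -/
lemma hasDerivAt_integral_exp_add {α : Type*} {mα : MeasurableSpace α} {μ : Measure α}
    {H X : α → ℝ} (hH : AEMeasurable H μ)
    (hint : ∀ ε : ℝ, Integrable (fun x => Real.exp (H x + ε * X x)) μ) :
    HasDerivAt (fun ε : ℝ => ∫ x, Real.exp (H x + ε * X x) ∂μ)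
      (∫ x, X x * Real.exp (H x) ∂μ) 0 := by
  have hd : AEMeasurable (fun x => ENNReal.ofReal (Real.exp (H x))) μ :=
    (Real.measurable_exp.comp_aemeasurable hH).ennreal_ofReal
  have htop : ∀ᵐ x ∂μ, ENNReal.ofReal (Real.exp (H x)) < ∞ := by simp
  have hconv : ∀ g : α → ℝ, ∫ x, g x ∂(μ.withDensity fun x => ENNReal.ofReal (Real.exp (H x)))
      = ∫ x, Real.exp (H x) * g x ∂μ := by
    intro g
    rw [integral_withDensity_eq_integral_toReal_smul₀ hd htop]
    simp [ENNReal.toReal_ofReal (Real.exp_pos _).le]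
  have hmem : (0 : ℝ) ∈ interior (integrableExpSet X
      (μ.withDensity fun x => ENNReal.ofReal (Real.exp (H x)))) := by
    have : integrableExpSet X (μ.withDensity fun x => ENNReal.ofReal (Real.exp (H x))) = univ := by
      refine eq_univ_of_forall fun ε => ?_
      rw [integrableExpSet, mem_ofPred_eq, integrable_withDensity_iff_integrable_smul₀' hd htop]
      refine (hint ε).congr (ae_of_all _ fun x => ?_)
      simp only [ENNReal.toReal_ofReal (Real.exp_pos _).le, smul_eq_mul, Real.exp_add]
    rw [this]; simp
  have := hasDerivAt_mgf hmem
  simp only [hconv, zero_mul, Real.exp_zero, mul_one] at this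
  convert! this using 2 with ε
  · simp only [mgf, hconv, Real.exp_add]
  · simp only [mul_comm]

lemma hasDerivAt_integral_mul_exp {α : Type*} {mα : MeasurableSpace α} {μ : Measure α}
    {X : α → ℝ} (hint : ∀ ε : ℝ, Integrable (fun x => Real.exp (ε * X x)) μ) :
    HasDerivAt (fun ε : ℝ => ∫ x, X x * Real.exp (ε * X x) ∂μ) (∫ x, X x ^ 2 ∂μ) 0 := by
  have hmem : (0 : ℝ) ∈ interior (integrableExpSet X μ) := by
    have : integrableExpSet X μ = univ := eq_univ_of_forall hint
    rw [this]; simp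
  simpa using hasDerivAt_integral_pow_mul_exp_real hmem 1

lemma memLp_two_of_integrable_exp {α : Type*} {mα : MeasurableSpace α} {μ : Measure α}
    {X : α → ℝ} (hint : ∀ ε : ℝ, Integrable (fun x => Real.exp (ε * X x)) μ) : MemLp X 2 μ := by
  have hmem : (0 : ℝ) ∈ interior (integrableExpSet X μ) := by
    have : integrableExpSet X μ = univ := eq_univ_of_forall hint
    rw [this]; simp
  exact memLp_of_mem_interior_integrableExpSet hmem 2

variable {Ω Z : Type*} {mΩ : MeasurableSpace Ω} [MeasurableSpace Z] {P : Measure Ω}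
  {𝓕 : Filtration ℝ≥0 mΩ} {ν : Measure Z} {p : Ω → ℝ → Option Z}

namespace IsPoissonPointProcess

lemma integrable_exp_pointCount [SFinite ν] (hp : IsPoissonPointProcess 𝓕 P ν p) {V : Set Z}
    (hV : MeasurableSet V) (hfin : ν V ≠ ∞) (c : ℝ) (s t : ℝ≥0) :
    Integrable (fun ω => Real.exp (c * (pointCount (p ω) (Ioc (s : ℝ) t ×ˢ V)).toNat)) P ∧
    ∫ ω, Real.exp (c * (pointCount (p ω) (Ioc (s : ℝ) t ×ˢ V)).toNat) ∂P
      = Real.exp ((max ((t : ℝ) - s) 0 * ν.real V) * (Real.exp c - 1)) := by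
  have hI : intensity ν (Ioc (s : ℝ) t ×ˢ V) ≠ ∞ := by
    rw [intensity_Ioc]; exact ENNReal.mul_ne_top ENNReal.ofReal_ne_top hfin
  have hl := hp.hasLaw_toNat (measurableSet_Ioc.prod hV) hI
  obtain ⟨h1, h2⟩ := integral_exp_mul_poissonMeasure
    (intensity ν (Ioc (s : ℝ) t ×ˢ V)).toNNReal c
  refine ⟨?_, ?_⟩
  · rw [← hl.map_eq] at h1
    exact h1.comp_aemeasurable hl.aemeasurable
  · have := hl.integral_comp (f := fun k : ℕ => Real.exp (c * k))
      measurable_from_top.aestronglyMeasurable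
    rw [Function.comp_def] at this
    rw [this, h2, intensity_Ioc, ENNReal.coe_toNNReal_eq_toReal, ENNReal.toReal_mul,
      ENNReal.toReal_ofReal', measureReal_def]

/-- The fibres of `g` cut the strip over `V` into disjoint sets, so the counts are independent
Poisson variables and the exponential moment factorizes. -/
lemma integral_exp_incSum_simpleFunc [IsProbabilityMeasure P] [SFinite ν]
    (hp : IsPoissonPointProcess 𝓕 P ν p)
    {V : Set Z} (hV : MeasurableSet V) (hfin : ν V ≠ ∞) (g : SimpleFunc Z ℝ) {s t : ℝ≥0}
    (hst : s ≤ t) :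
    ∫ ω, Real.exp (incSum (p ω) (V.indicator g) s t) ∂P
      = Real.exp (((t : ℝ) - s) * ∫ z in V, (Real.exp (g z) - 1) ∂ν) := by
  have : Fact (ν V < ∞) := ⟨hfin.lt_top⟩
  -- Independence of counts is given for families indexed by `Fin`, so the values of `g` are
  -- enumerated.
  set e := g.range.equivFin
  set B : Fin g.range.card → Set (ℝ × Z) := fun i =>
    Ioc (s : ℝ) t ×ˢ (V ∩ g ⁻¹' {((e.symm i : g.range) : ℝ)}) with hB
  have hBm : ∀ i, MeasurableSet (B i) := fun i =>
    measurableSet_Ioc.prod (hV.inter (g.measurableSet_fiber _))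
  have hdisj : Pairwise fun i j => Disjoint (B i) (B j) := by
    intro i j hij
    rw [Set.disjoint_left]
    rintro ⟨r, z⟩ ⟨-, -, h1⟩ ⟨-, -, h2⟩
    refine hij (e.symm.injective (Subtype.ext ?_))
    simp only [mem_preimage, mem_singleton_iff] at h1 h2
    rw [← h1, ← h2]
  have hind := (hp.indep_disjoint _ B hBm hdisj).comp
    (fun i (k : ℕ∞) => Real.exp (((e.symm i : g.range) : ℝ) * k.toNat)) fun i => measurable_from_top
  have hmeas : ∀ i, AEStronglyMeasurable ((fun (k : ℕ∞) =>
      Real.exp (((e.symm i : g.range) : ℝ) * k.toNat)) ∘ fun ω => pointCount (p ω) (B i)) P :=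
    fun i => (measurable_from_top.comp (hp.measurable_count _ (hBm i))).aestronglyMeasurable
  have hprod := hind.integral_fun_prod_eq_prod_integral hmeas
  have h0 : 0 ≤ (t : ℝ) - s := sub_nonneg.2 (NNReal.coe_le_coe.2 hst)
  calc ∫ ω, Real.exp (incSum (p ω) (V.indicator g) s t) ∂P
      = ∫ ω, ∏ i, ((fun (k : ℕ∞) =>
          Real.exp (((e.symm i : g.range) : ℝ) * k.toNat)) ∘ fun ω => pointCount (p ω) (B i)) ω ∂P := by
        refine integral_congr_ae ?_
        filter_upwards [hp.ae_locFinite hV hfin] with ω hω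
        rw [incSum_simpleFunc hω, ← Finset.sum_coe_sort, Real.exp_sum]
        exact (e.symm.prod_comp fun c : g.range => Real.exp ((c : ℝ) *
          ((pointCount (p ω) (Ioc (s : ℝ) t ×ˢ (V ∩ g ⁻¹' {(c : ℝ)}))).toNat : ℝ))).symm
    _ = ∏ i, Real.exp (((t : ℝ) - s) * (ν.real (V ∩ g ⁻¹' {((e.symm i : g.range) : ℝ)})
          * (Real.exp ((e.symm i : g.range) : ℝ) - 1))) := by
        rw [hprod]
        refine Finset.prod_congr rfl fun i _ => ?_
        have := (hp.integrable_exp_pointCount (V := V ∩ g ⁻¹' {((e.symm i : g.range) : ℝ)})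
          (hV.inter (g.measurableSet_fiber _))
          (ne_top_of_le_ne_top hfin (measure_mono inter_subset_left))
          ((e.symm i : g.range) : ℝ) s t).2
        rw [max_eq_left h0, mul_assoc] at this
        exact this
    _ = _ := by
        rw [← Real.exp_sum, ← Finset.mul_sum]
        congr 2
        have h1 : ∫ z in V, (Real.exp (g z) - 1) ∂ν
            = (g.map fun x => Real.exp x - 1).integral (ν.restrict V) := by
          exact (SimpleFunc.integral_eq_integral (g.map fun x => Real.exp x - 1)
            (SimpleFunc.integrable_of_isFiniteMeasure _)).symm
        rw [h1, SimpleFunc.map_integral _ _ (SimpleFunc.integrable_of_isFiniteMeasure _) (by simp),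
          ← Finset.sum_coe_sort g.range]
        refine Eq.trans ?_ (e.symm.sum_comp _)
        refine Finset.sum_congr rfl fun i _ => ?_
        rw [measureReal_restrict_apply (g.measurableSet_fiber _), inter_comm, smul_eq_mul]

/-- The Laplace functional of a Poisson sum. -/
lemma integral_exp_incSum [IsProbabilityMeasure P] [SFinite ν]
    (hp : IsPoissonPointProcess 𝓕 P ν p)
    {V : Set Z} (hV : MeasurableSet V) (hfin : ν V ≠ ∞) {f : Z → ℝ} (hf : Measurable f)
    (hf0 : ∀ z ∉ V, f z = 0) {C : ℝ} (hC : ∀ z, |f z| ≤ C) {s t : ℝ≥0} (hst : s ≤ t) :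
    Integrable (fun ω => Real.exp (incSum (p ω) f s t)) P ∧
    ∫ ω, Real.exp (incSum (p ω) f s t) ∂P
      = Real.exp (((t : ℝ) - s) * ∫ z in V, (Real.exp (f z) - 1) ∂ν) := by
  have : Fact (ν V < ∞) := ⟨hfin.lt_top⟩
  have hsm := hf.stronglyMeasurable
  have hm : ∀ f : Z → ℝ, Measurable f → (∀ z ∉ V, f z = 0) →
      AEStronglyMeasurable (fun ω => incSum (p ω) f s t) P := fun f hf hf0 =>
    hp.incSum_aestronglyMeasurable hV hfin hf hf0 fun B hB _ => hp.measurable_count B hB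
  have hbound := (hp.integrable_exp_pointCount hV hfin C s t).1
  have hle : ∀ f : Z → ℝ, (∀ z ∉ V, f z = 0) → (∀ z, |f z| ≤ C) → ∀ᵐ ω ∂P,
      ‖Real.exp (incSum (p ω) f s t)‖
        ≤ Real.exp (C * (pointCount (p ω) (Ioc (s : ℝ) t ×ˢ V)).toNat) := by
    intro f hf0 hC
    filter_upwards [hp.ae_locFinite hV hfin] with ω hω
    rw [Real.norm_eq_abs, Real.abs_exp, Real.exp_le_exp]
    exact (le_abs_self _).trans (abs_incSum_le hω hf0 hC s t)
  refine ⟨hbound.mono' (Real.continuous_exp.comp_aestronglyMeasurable (hm f hf hf0))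
    (hle f hf0 hC), ?_⟩
  -- Without marks there are no jumps and both sides equal `1`. Otherwise a point of `Z` shows `0 ≤
  -- C`, which the bounded approximation needs.
  by_cases hne : Nonempty Z
  swap
  · have : IsEmpty Z := not_nonempty_iff.1 hne
    have h1 : ∀ ω, incSum (p ω) f s t = 0 := fun ω => by
      unfold incSum
      refine finsum_mem_eq_zero_of_forall_eq_zero fun r _ => ?_
      cases h : p ω r with
      | none => rfl
      | some z => exact isEmptyElim z
    simp [h1, Measure.eq_zero_of_isEmpty]
  have hC0 : 0 ≤ C := (abs_nonneg _).trans (hC hne.some)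
  set g := hsm.approxBounded C
  have hgC : ∀ k z, |g k z| ≤ C := fun k z => StronglyMeasurable.norm_approxBounded_le hsm hC0 k z
  have hgt : ∀ z, Tendsto (fun k => g k z) atTop (𝓝 (f z)) := fun z =>
    StronglyMeasurable.tendsto_approxBounded_of_norm_le hsm (hC z)
  have hVgC : ∀ k z, |V.indicator (g k) z| ≤ C := fun k z => by
    by_cases hz : z ∈ V
    · simpa [hz] using hgC k z
    · simpa [hz] using hC0
  have hL : Tendsto (fun k => ∫ ω, Real.exp (incSum (p ω) (V.indicator (g k)) s t) ∂P) atTop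
      (𝓝 (∫ ω, Real.exp (incSum (p ω) f s t) ∂P)) := by
    refine tendsto_integral_of_dominated_convergence _ (fun k =>
      Real.continuous_exp.comp_aestronglyMeasurable (hm _ ((g k).measurable.indicator hV)
        fun z hz => indicator_of_notMem hz _)) hbound
      (fun k => hle _ (fun z hz => indicator_of_notMem hz _) (hVgC k)) ?_
    filter_upwards [hp.ae_locFinite hV hfin] with ω hω
    refine (Real.continuous_exp.tendsto _).comp (tendsto_incSum hω
      (fun k z hz => indicator_of_notMem hz _) (fun z => ?_) s t)
    by_cases hz : z ∈ V
    · simpa only [indicator_of_mem hz] using hgt z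
    · simp [indicator_of_notMem hz, hf0 z hz]
  have hR : Tendsto (fun k => ∫ z in V, (Real.exp (g k z) - 1) ∂ν) atTop
      (𝓝 (∫ z in V, (Real.exp (f z) - 1) ∂ν)) := by
    refine tendsto_integral_of_dominated_convergence (fun _ => Real.exp C + 1) (fun k =>
      ((Real.measurable_exp.comp (g k).measurable).sub_const 1).aestronglyMeasurable)
      (integrable_const _) (fun k => ae_of_all _ fun z => ?_) (ae_of_all _ fun z => ?_)
    · rw [Real.norm_eq_abs]
      refine (abs_sub _ _).trans ?_
      rw [Real.abs_exp, abs_one]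
      gcongr
      exact (le_abs_self _).trans (hgC k z)
    · exact ((Real.continuous_exp.tendsto _).comp (hgt z)).sub_const 1
  refine tendsto_nhds_unique hL ?_
  simp_rw [fun k => hp.integral_exp_incSum_simpleFunc hV hfin (g k) hst]
  exact (Real.continuous_exp.tendsto _).comp (hR.const_mul _)

end IsPoissonPointProcess

/-! ### Linear combinations of a Brownian motion -/

/-- `∑ k, c k * W_k(t)`. -/
def linComb {d : ℕ} (W : ℝ≥0 → Ω → Fin d → ℝ) (c : Fin d → ℝ) (t : ℝ≥0) (ω : Ω) : ℝ :=
  ∑ k, c k * W t ω k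

namespace IsBrownianMotion

variable {d : ℕ} {W : ℝ≥0 → Ω → Fin d → ℝ}

lemma measurable_linComb (hW : IsBrownianMotion 𝓕 P W) (c : Fin d → ℝ) (t : ℝ≥0) :
    Measurable[𝓕 t] (linComb W c t) :=
  Finset.measurable_sum _ fun k _ =>
    ((measurable_pi_apply k).comp (hW.adapted t)).const_mul (c k)

lemma measurable_linComb_processSigma (c : Fin d → ℝ) (t : ℝ≥0) :
    Measurable[processSigma W] (linComb W c t) :=
  Finset.measurable_sum _ fun k _ => ((measurable_pi_apply k).comp
    ((comap_measurable (W t)).mono (le_iSup (fun u => MeasurableSpace.comap (W u) _) t)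
      le_rfl)).const_mul (c k)

lemma integral_exp_linComb [IsProbabilityMeasure P] (hW : IsBrownianMotion 𝓕 P W)
    (c : Fin d → ℝ) {s t : ℝ≥0} (hst : s ≤ t) (α : ℝ) :
    Integrable (fun ω => Real.exp (α * (linComb W c t ω - linComb W c s ω))) P ∧
    ∫ ω, Real.exp (α * (linComb W c t ω - linComb W c s ω)) ∂P
      = Real.exp (((t : ℝ) - s) * (α ^ 2 * (∑ k, c k ^ 2) / 2)) := by
  set X : Fin d → Ω → ℝ := fun k ω => c k * (W t ω k - W s ω k) with hX
  have hind : iIndepFun X P := hW.indep_components.comp (fun k (x : ℝ≥0 → ℝ) => c k * (x t - x s))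
    fun k => ((measurable_pi_apply t).sub (measurable_pi_apply s)).const_mul _
  have hXm : ∀ k, Measurable (X k) := fun k =>
    ((((measurable_pi_apply k).comp (hW.adapted t)).mono (𝓕.le t) le_rfl).sub
      (((measurable_pi_apply k).comp (hW.adapted s)).mono (𝓕.le s) le_rfl)).const_mul (c k)
  have hsum : ∀ ω, linComb W c t ω - linComb W c s ω = (∑ k, X k) ω := fun ω => by
    simp only [linComb, hX, Finset.sum_apply, mul_sub, Finset.sum_sub_distrib]
  have h0 : 0 ≤ (t : ℝ) - s := sub_nonneg.2 (NNReal.coe_le_coe.2 hst)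
  have hlaw : ∀ k, HasLaw (fun ω => W t ω k - W s ω k) (gaussianReal 0 (nndist t.1 s.1)) P :=
    fun k => (hW.component k).hasLaw_sub t s
  have hmgf : ∀ k, mgf (X k) P α = Real.exp (((t : ℝ) - s) * (α ^ 2 * c k ^ 2 / 2)) := by
    intro k
    have h1 := mgf_gaussianReal (hlaw k).map_eq (α * c k)
    have h2 : mgf (X k) P α = mgf (fun ω => W t ω k - W s ω k) P (α * c k) := by
      simp only [mgf, hX, mul_assoc]
    rw [h2, h1, coe_nndist, Real.dist_eq]
    congr 1
    rw [show t.1 - s.1 = (t : ℝ) - s from rfl, abs_of_nonneg h0]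
    ring
  have hint : ∀ k, Integrable (fun ω => Real.exp (α * X k ω)) P := fun k => by
    rw [← mgf_pos_iff, hmgf k]
    exact Real.exp_pos _
  simp_rw [hsum]
  refine ⟨hind.integrable_exp_mul_sum hXm fun k _ => hint k, ?_⟩
  have := hind.mgf_sum hXm Finset.univ (t := α)
  rw [mgf] at this
  rw [this]
  rw [Finset.prod_congr rfl fun k _ => hmgf k, ← Real.exp_sum, Finset.mul_sum, Finset.sum_div,
    Finset.mul_sum]

end IsBrownianMotion

end

/-! ### Exponential and polynomial moments of Brownian and Poisson increments. -/

section

variable {Ω Z : Type*} {mΩ : MeasurableSpace Ω} [MeasurableSpace Z] {P : Measure Ω}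
  {𝓕 : Filtration ℝ≥0 mΩ} {ν : Measure Z} {p : Ω → ℝ → Option Z} {d : ℕ}
  {W : ℝ≥0 → Ω → Fin d → ℝ}

/-- The increment over `(s, t]` of `α ∑ c_k W_k + ∫∫ f dN`. -/
def noise (W : ℝ≥0 → Ω → Fin d → ℝ) (c : Fin d → ℝ) (p : Ω → ℝ → Option Z) (s t : ℝ≥0)
    (α : ℝ) (f : Z → ℝ) (ω : Ω) : ℝ :=
  α * (linComb W c t ω - linComb W c s ω) + incSum (p ω) f s t

lemma measurable_pointCount_pointSigma {B : Set (ℝ × Z)} (hB : MeasurableSet B) :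
    Measurable[pointSigma p] fun ω => pointCount (p ω) B :=
  (comap_measurable _).mono (le_iSup₂_of_le B hB le_rfl) le_rfl

section Moments

variable [IsProbabilityMeasure P] [SFinite ν] {V : Set Z} {s t : ℝ≥0}

lemma indepFun_linComb_incSum (hp : IsPoissonPointProcess 𝓕 P ν p)
    (hWp : Indep (processSigma W) (pointSigma p) P) (c : Fin d → ℝ)
    (hV : MeasurableSet V) (hfin : ν V ≠ ∞) {f : Z → ℝ} (hf : Measurable f)
    (hf0 : ∀ z ∉ V, f z = 0) (s t : ℝ≥0) :
    IndepFun (fun ω => linComb W c t ω - linComb W c s ω) (fun ω => incSum (p ω) f s t) P :=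
  indepFun_of_aestronglyMeasurable hWp
    (((IsBrownianMotion.measurable_linComb_processSigma c t).sub
      (IsBrownianMotion.measurable_linComb_processSigma c s)).aestronglyMeasurable)
    (hp.incSum_aestronglyMeasurable hV hfin hf hf0 fun _ hB _ => measurable_pointCount_pointSigma hB)

lemma integral_exp_noise (hW : IsBrownianMotion 𝓕 P W) (hp : IsPoissonPointProcess 𝓕 P ν p)
    (hWp : Indep (processSigma W) (pointSigma p) P) (c : Fin d → ℝ)
    (hV : MeasurableSet V) (hfin : ν V ≠ ∞) (hst : s ≤ t) (α : ℝ) {f : Z → ℝ} (hf : Measurable f)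
    (hf0 : ∀ z ∉ V, f z = 0) (hC : ∃ C, ∀ z, |f z| ≤ C) :
    Integrable (fun ω => Real.exp (noise W c p s t α f ω)) P ∧
    ∫ ω, Real.exp (noise W c p s t α f ω) ∂P
      = Real.exp (((t : ℝ) - s) * (α ^ 2 * (∑ k, c k ^ 2) / 2 + ∫ z in V, (Real.exp (f z) - 1) ∂ν)) := by
  obtain ⟨C, hC⟩ := hC
  obtain ⟨i1, e1⟩ := hW.integral_exp_linComb c hst α
  obtain ⟨i2, e2⟩ := hp.integral_exp_incSum hV hfin hf hf0 hC hst
  have hind := (indepFun_linComb_incSum hp hWp c hV hfin hf hf0 s t).comp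
    (φ := fun x => Real.exp (α * x)) (ψ := Real.exp) (by fun_prop) (by fun_prop)
  simp only [noise, Real.exp_add]
  refine ⟨hind.integrable_mul i1 i2, ?_⟩
  have := hind.integral_fun_mul_eq_mul_integral i1.aestronglyMeasurable i2.aestronglyMeasurable
  simp only [Function.comp_def] at this
  rw [this, e1, e2, ← Real.exp_add, mul_add]

lemma noise_add_mul {q : Ω → ℝ → Option Z} {ω : Ω} (hω : LocFinite (q ω) V) (c : Fin d → ℝ)
    (s t : ℝ≥0) (α β ε : ℝ) {f h : Z → ℝ} (hf0 : ∀ z ∉ V, f z = 0) (hh0 : ∀ z ∉ V, h z = 0) :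
    noise W c q s t (β + ε * α) (fun z => h z + ε * f z) ω
      = noise W c q s t β h ω + ε * noise W c q s t α f ω := by
  unfold noise
  rw [incSum_add hω hh0 (g := fun z => ε * f z) (fun z hz => by simp [hf0 z hz]),
    incSum_const_mul hω hf0]
  ring

lemma bounded_add_mul {f h : Z → ℝ} (hf : ∃ C, ∀ z, |f z| ≤ C) (hh : ∃ C, ∀ z, |h z| ≤ C) (ε : ℝ) :
    ∃ C, ∀ z, |h z + ε * f z| ≤ C := by
  obtain ⟨C, hC⟩ := hf
  obtain ⟨D, hD⟩ := hh
  refine ⟨D + |ε| * C, fun z => (abs_add_le _ _).trans (add_le_add (hD z) ?_)⟩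
  rw [abs_mul]
  exact mul_le_mul_of_nonneg_left (hC z) (abs_nonneg _)

/-- The increment is linear in the pair formed by the Gaussian coefficient and the jump function.
Perturbing one noise by `ε` times another is again a noise, whose Laplace functional is known. -/
lemma integrable_exp_noise_add (hW : IsBrownianMotion 𝓕 P W) (hp : IsPoissonPointProcess 𝓕 P ν p)
    (hWp : Indep (processSigma W) (pointSigma p) P) (c : Fin d → ℝ)
    (hV : MeasurableSet V) (hfin : ν V ≠ ∞) (hst : s ≤ t) (α β : ℝ) {f h : Z → ℝ}
    (hf : Measurable f) (hf0 : ∀ z ∉ V, f z = 0) (hfC : ∃ C, ∀ z, |f z| ≤ C)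
    (hh : Measurable h) (hh0 : ∀ z ∉ V, h z = 0) (hhC : ∃ C, ∀ z, |h z| ≤ C) (ε : ℝ) :
    Integrable (fun ω => Real.exp (noise W c p s t β h ω + ε * noise W c p s t α f ω)) P ∧
    ∫ ω, Real.exp (noise W c p s t β h ω + ε * noise W c p s t α f ω) ∂P
      = Real.exp (((t : ℝ) - s) * ((β + ε * α) ^ 2 * (∑ k, c k ^ 2) / 2
        + ∫ z in V, (Real.exp (h z + ε * f z) - 1) ∂ν)) := by
  obtain ⟨h1, h2⟩ := integral_exp_noise hW hp hWp c hV hfin hst (β + ε * α)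
    (f := fun z => h z + ε * f z) (hh.add (hf.const_mul ε))
    (fun z hz => by simp [hf0 z hz, hh0 z hz]) (bounded_add_mul hfC hhC ε)
  have hae : (fun ω => Real.exp (noise W c p s t (β + ε * α) (fun z => h z + ε * f z) ω))
      =ᵐ[P] fun ω => Real.exp (noise W c p s t β h ω + ε * noise W c p s t α f ω) := by
    filter_upwards [hp.ae_locFinite hV hfin] with ω hω
    rw [noise_add_mul hω c s t α β ε hf0 hh0]
  exact ⟨h1.congr hae, by rw [← h2]; exact (integral_congr_ae hae).symm⟩

lemma integrable_exp_mul_noise (hW : IsBrownianMotion 𝓕 P W) (hp : IsPoissonPointProcess 𝓕 P ν p)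
    (hWp : Indep (processSigma W) (pointSigma p) P) (c : Fin d → ℝ)
    (hV : MeasurableSet V) (hfin : ν V ≠ ∞) (hst : s ≤ t) (α : ℝ) {f : Z → ℝ}
    (hf : Measurable f) (hf0 : ∀ z ∉ V, f z = 0) (hfC : ∃ C, ∀ z, |f z| ≤ C) (ε : ℝ) :
    Integrable (fun ω => Real.exp (ε * noise W c p s t α f ω)) P := by
  have := (integrable_exp_noise_add hW hp hWp c hV hfin hst α 0 hf hf0 hfC
    (h := fun _ => 0) measurable_const (fun _ _ => rfl) ⟨0, by simp⟩ ε).1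
  have h0 : ∀ ω, noise W c p s t 0 (fun _ => (0 : ℝ)) ω = 0 := fun ω => by
    unfold noise incSum
    rw [finsum_mem_eq_zero_of_forall_eq_zero fun r _ => by cases p ω r <;> simp]
    simp
  simpa [h0] using this

lemma integrable_exp_bounded (hV : MeasurableSet V) (hfin : ν V ≠ ∞) {f h : Z → ℝ}
    (hf : Measurable f) (hfC : ∃ C, ∀ z, |f z| ≤ C) (hh : Measurable h) (hhC : ∃ C, ∀ z, |h z| ≤ C)
    (ε : ℝ) : Integrable (fun z => Real.exp (h z + ε * f z)) (ν.restrict V) := by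
  have : Fact (ν V < ∞) := ⟨hfin.lt_top⟩
  obtain ⟨C, hC⟩ := bounded_add_mul hfC hhC ε
  refine Integrable.of_bound (hh.add (hf.const_mul ε)).exp.aestronglyMeasurable
    (Real.exp C) (ae_of_all _ fun z => ?_)
  rw [Real.norm_eq_abs, Real.abs_exp, Real.exp_le_exp]
  exact (le_abs_self _).trans (hC z)

lemma hasDerivAt_exponent (hV : MeasurableSet V) (hfin : ν V ≠ ∞) (Δ σ α β : ℝ) {f h : Z → ℝ}
    (hf : Measurable f) (hfC : ∃ C, ∀ z, |f z| ≤ C) (hh : Measurable h)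
    (hhC : ∃ C, ∀ z, |h z| ≤ C) :
    HasDerivAt (fun ε : ℝ => Real.exp (Δ * ((β + ε * α) ^ 2 * σ / 2
        + ∫ z in V, (Real.exp (h z + ε * f z) - 1) ∂ν)))
      (Real.exp (Δ * (β ^ 2 * σ / 2 + ∫ z in V, (Real.exp (h z) - 1) ∂ν))
        * (Δ * (α * β * σ + ∫ z in V, f z * Real.exp (h z) ∂ν))) 0 := by
  have : Fact (ν V < ∞) := ⟨hfin.lt_top⟩
  have hi := integrable_exp_bounded hV hfin hf hfC hh hhC
  have h1 := hasDerivAt_integral_exp_add (μ := ν.restrict V) hh.aemeasurable hi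
  have h2 : HasDerivAt (fun ε : ℝ => ∫ z in V, (Real.exp (h z + ε * f z) - 1) ∂ν)
      (∫ z in V, f z * Real.exp (h z) ∂ν) 0 := by
    have : (fun ε : ℝ => ∫ z in V, (Real.exp (h z + ε * f z) - 1) ∂ν)
        = fun ε : ℝ => (∫ z in V, Real.exp (h z + ε * f z) ∂ν) - ∫ z in V, (1 : ℝ) ∂ν := by
      ext ε
      rw [integral_sub (hi ε) (integrable_const _)]
    rw [this]
    exact h1.sub_const _
  have h3 : HasDerivAt (fun ε : ℝ => (β + ε * α) ^ 2 * σ / 2) (α * β * σ) 0 := by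
    have := ((((hasDerivAt_id (0 : ℝ)).mul_const α).const_add β).pow 2).mul_const σ |>.div_const 2
    simp only [id] at this
    convert! this using 1
    simp; ring
  have h4 := ((h3.add h2).const_mul Δ).exp
  simpa using h4

/-- The Laplace functional is differentiated at `ε = 0` in the direction of the other noise, once
under the expectation and once in closed form. The two derivatives must agree. -/
lemma integral_noise_mul_exp (hW : IsBrownianMotion 𝓕 P W) (hp : IsPoissonPointProcess 𝓕 P ν p)
    (hWp : Indep (processSigma W) (pointSigma p) P) (c : Fin d → ℝ)
    (hV : MeasurableSet V) (hfin : ν V ≠ ∞) (hst : s ≤ t) (α β : ℝ) {f h : Z → ℝ}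
    (hf : Measurable f) (hf0 : ∀ z ∉ V, f z = 0) (hfC : ∃ C, ∀ z, |f z| ≤ C)
    (hh : Measurable h) (hh0 : ∀ z ∉ V, h z = 0) (hhC : ∃ C, ∀ z, |h z| ≤ C) :
    ∫ ω, noise W c p s t α f ω * Real.exp (noise W c p s t β h ω) ∂P
      = Real.exp (((t : ℝ) - s) * (β ^ 2 * (∑ k, c k ^ 2) / 2 + ∫ z in V, (Real.exp (h z) - 1) ∂ν))
        * (((t : ℝ) - s) * (α * β * (∑ k, c k ^ 2) + ∫ z in V, f z * Real.exp (h z) ∂ν)) := by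
  have hm : AEMeasurable (noise W c p s t β h) P := by
    have := (integral_exp_noise hW hp hWp c hV hfin hst β hh hh0 hhC).1.aemeasurable
    have h2 := Real.measurable_log.comp_aemeasurable this
    simpa [Function.comp_def] using h2
  have hint := integrable_exp_noise_add hW hp hWp c hV hfin hst α β hf hf0 hfC hh hh0 hhC
  have h1 := hasDerivAt_integral_exp_add hm fun ε => (hint ε).1
  simp_rw [fun ε => (hint ε).2] at h1
  exact h1.unique (hasDerivAt_exponent hV hfin _ _ α β hf hfC hh hhC)

/-- The mixed moment of the noise and the exponential of `ε` times itself is known in closed form.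
Its value at `ε = 0` is the mean and its derivative there is the second moment. -/
lemma integral_noise (hW : IsBrownianMotion 𝓕 P W) (hp : IsPoissonPointProcess 𝓕 P ν p)
    (hWp : Indep (processSigma W) (pointSigma p) P) (c : Fin d → ℝ)
    (hV : MeasurableSet V) (hfin : ν V ≠ ∞) (hst : s ≤ t) (α : ℝ) {f : Z → ℝ}
    (hf : Measurable f) (hf0 : ∀ z ∉ V, f z = 0) (hfC : ∃ C, ∀ z, |f z| ≤ C) :
    MemLp (noise W c p s t α f) 2 P ∧
    ∫ ω, noise W c p s t α f ω ∂P = ((t : ℝ) - s) * ∫ z in V, f z ∂ν ∧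
    ∫ ω, noise W c p s t α f ω ^ 2 ∂P = (((t : ℝ) - s) * ∫ z in V, f z ∂ν) ^ 2
      + ((t : ℝ) - s) * (α ^ 2 * (∑ k, c k ^ 2) + ∫ z in V, f z ^ 2 ∂ν) := by
  have : Fact (ν V < ∞) := ⟨hfin.lt_top⟩
  have hint := integrable_exp_mul_noise hW hp hWp c hV hfin hst α hf hf0 hfC
  have hscale : ∀ ε : ℝ, ∀ᵐ ω ∂P, noise W c p s t (ε * α) (fun z => ε * f z) ω
      = ε * noise W c p s t α f ω := fun ε => by
    filter_upwards [hp.ae_locFinite hV hfin] with ω hω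
    unfold noise
    rw [incSum_const_mul hω hf0]; ring
  have hD : ∀ ε : ℝ, ∫ ω, noise W c p s t α f ω * Real.exp (ε * noise W c p s t α f ω) ∂P
      = Real.exp (((t : ℝ) - s) * ((0 + ε * α) ^ 2 * (∑ k, c k ^ 2) / 2
          + ∫ z in V, (Real.exp (0 + ε * f z) - 1) ∂ν))
        * (((t : ℝ) - s) * (ε * (α ^ 2 * (∑ k, c k ^ 2)) + ∫ z in V, f z * Real.exp (ε * f z) ∂ν)) := by
    intro ε
    have hb : ∃ C, ∀ z, |ε * f z| ≤ C := by
      simpa using bounded_add_mul hfC (h := fun _ => (0 : ℝ)) ⟨0, by simp⟩ ε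
    have := integral_noise_mul_exp hW hp hWp c hV hfin hst α (ε * α) hf hf0 hfC
      (h := fun z => ε * f z) (hf.const_mul ε) (fun z hz => by simp [hf0 z hz]) hb
    rw [integral_congr_ae (g := fun ω => noise W c p s t α f ω
      * Real.exp (ε * noise W c p s t α f ω))
      (by filter_upwards [hscale ε] with ω hω; rw [hω])] at this
    rw [this]
    simp only [zero_add]
    ring
  refine ⟨memLp_two_of_integrable_exp hint, ?_, ?_⟩
  · have := hD 0
    simpa using this
  · have h1 := hasDerivAt_integral_mul_exp hint
    simp_rw [hD] at h1
    have h2 := hasDerivAt_exponent hV hfin ((t : ℝ) - s) (∑ k, c k ^ 2) α 0 hf hfC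
      (h := fun _ => 0) measurable_const ⟨0, by simp⟩
    have h3 : HasDerivAt (fun ε : ℝ => ∫ z in V, f z * Real.exp (ε * f z) ∂ν)
        (∫ z in V, f z ^ 2 ∂ν) 0 := hasDerivAt_integral_mul_exp fun ε => by
      simpa using integrable_exp_bounded hV hfin hf hfC (h := fun _ => 0) measurable_const
        ⟨0, by simp⟩ ε
    have h4 := ((((hasDerivAt_id (0 : ℝ)).mul_const (α ^ 2 * (∑ k, c k ^ 2))).add h3).const_mul
      ((t : ℝ) - s))
    have h5 := h1.unique (h2.mul h4)
    rw [h5]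
    simp
    ring

end Moments

end

/-! ### Moments of a Lévy martingale and of its exponential defect, for finitely many jumps. -/

section

variable {Ω Z : Type*} {mΩ : MeasurableSpace Ω} [MeasurableSpace Z] {P : Measure Ω}
  {𝓕 : Filtration ℝ≥0 mΩ} {ν : Measure Z} {p : Ω → ℝ → Option Z} {d : ℕ}
  {W : ℝ≥0 → Ω → Fin d → ℝ}

section Pair

variable [IsProbabilityMeasure P] [SFinite ν] {V : Set Z} {s t : ℝ≥0}

lemma exp_sub_one_bounded {l : Z → ℝ} (hC : ∃ C, ∀ z, |l z| ≤ C) :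
    ∃ C, ∀ z, |Real.exp (l z) - 1| ≤ C := by
  obtain ⟨C, hC⟩ := hC
  refine ⟨Real.exp C + 1, fun z => (abs_sub _ _).trans ?_⟩
  rw [Real.abs_exp, abs_one]
  gcongr
  exact (le_abs_self _).trans (hC z)

lemma integral_sub_const_sq {n : Ω → ℝ} (h : MemLp n 2 P) (c : ℝ) :
    ∫ ω, (n ω - c) ^ 2 ∂P = ∫ ω, n ω ^ 2 ∂P - 2 * c * ∫ ω, n ω ∂P + c ^ 2 := by
  have hi : Integrable (fun ω => 2 * c * n ω) P := (h.integrable one_le_two).const_mul _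
  have h1 : Integrable (fun ω => n ω ^ 2 - 2 * c * n ω) P := h.integrable_sq.sub hi
  have : ∀ ω, (n ω - c) ^ 2 = n ω ^ 2 - 2 * c * n ω + c ^ 2 := fun ω => by ring
  simp_rw [this]
  rw [integral_add h1 (integrable_const _), integral_sub h.integrable_sq hi, integral_const_mul]
  simp

/-- Moments of the increments of a Lévy process `R` with finitely many jumps and of
`exp (ΔY) - 1 - ΔR`, where `exp Y` is the stochastic exponential of `R`. -/
lemma expPair_moments (hW : IsBrownianMotion 𝓕 P W) (hp : IsPoissonPointProcess 𝓕 P ν p)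
    (hWp : Indep (processSigma W) (pointSigma p) P) (c : Fin d → ℝ)
    (hV : MeasurableSet V) (hfin : ν V ≠ ∞) (hst : s ≤ t) {l : Z → ℝ}
    (hl : Measurable l) (hl0 : ∀ z ∉ V, l z = 0) (hlC : ∃ C, ∀ z, |l z| ≤ C)
    {y r : Ω → ℝ} {κ v : ℝ} (hκ : κ = ∫ z in V, (Real.exp (l z) - 1) ∂ν)
    (hv : v = ∑ k, c k ^ 2 + ∫ z in V, (Real.exp (l z) - 1) ^ 2 ∂ν)
    (hy : ∀ ω, y ω = noise W c p s t 1 l ω - ((t : ℝ) - s) * ((∑ k, c k ^ 2) / 2 + κ))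
    (hr : ∀ ω, r ω = noise W c p s t 1 (fun z => Real.exp (l z) - 1) ω - ((t : ℝ) - s) * κ) :
    (MemLp r 2 P ∧ ∫ ω, r ω ∂P = 0 ∧ ∫ ω, r ω ^ 2 ∂P = ((t : ℝ) - s) * v) ∧
    (MemLp (fun ω => Real.exp (y ω) - 1 - r ω) 2 P ∧ ∫ ω, (Real.exp (y ω) - 1 - r ω) ∂P = 0 ∧
      ∫ ω, (Real.exp (y ω) - 1 - r ω) ^ 2 ∂P
        = Real.exp (((t : ℝ) - s) * v) - 1 - ((t : ℝ) - s) * v) := by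
  have hfact : Fact (ν V < ∞) := ⟨hfin.lt_top⟩
  set Δ := (t : ℝ) - s with hΔ
  set σ := ∑ k, c k ^ 2 with hσ
  set γ : Z → ℝ := fun z => Real.exp (l z) - 1 with hγdef
  have hγ : Measurable γ := hl.exp.sub_const 1
  have hγ0 : ∀ z ∉ V, γ z = 0 := fun z hz => by simp [hγdef, hl0 z hz]
  have hγC := exp_sub_one_bounded hlC
  have hγi : Integrable γ (ν.restrict V) := by
    obtain ⟨C, hC⟩ := hγC
    exact Integrable.of_bound hγ.aestronglyMeasurable C (ae_of_all _ hC)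
  have hγ2i : Integrable (fun z => γ z ^ 2) (ν.restrict V) := by
    obtain ⟨C, hC⟩ := hγC
    refine Integrable.of_bound (hγ.pow_const 2).aestronglyMeasurable (C ^ 2) (ae_of_all _ fun z => ?_)
    rw [Real.norm_eq_abs, abs_pow]
    exact pow_le_pow_left₀ (abs_nonneg _) (hC z) 2
  obtain ⟨n1, n2, n3⟩ := integral_noise hW hp hWp c hV hfin hst 1 hγ hγ0 hγC
  rw [← hκ, ← hΔ] at n2 n3
  rw [← hσ] at n3
  set N := noise W c p s t 1 γ with hN
  set M := noise W c p s t 1 l with hM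
  have hrf : r = fun ω => N ω - Δ * κ := funext hr
  have n1i : Integrable N P := n1.integrable one_le_two
  have r1 : MemLp r 2 P := by rw [hrf]; exact n1.sub (memLp_const _)
  have r2 : ∫ ω, r ω ∂P = 0 := by
    rw [hrf, integral_sub n1i (integrable_const _), n2]; simp
  have r3 : ∫ ω, r ω ^ 2 ∂P = Δ * v := by
    simp_rw [hrf]
    rw [integral_sub_const_sq n1, n2, n3, hv]
    ring
  obtain ⟨e1, e2⟩ := integral_exp_noise hW hp hWp c hV hfin hst 1 hl hl0 hlC
  obtain ⟨-, q2⟩ := integrable_exp_noise_add hW hp hWp c hV hfin hst 1 1 hl hl0 hlC hl hl0 hlC 1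
  have q1 := (integrable_exp_noise_add hW hp hWp c hV hfin hst 1 1 hl hl0 hlC hl hl0 hlC 1).1
  have m1 := integral_noise_mul_exp hW hp hWp c hV hfin hst 1 1 hγ hγ0 hγC hl hl0 hlC
  rw [← hκ, ← hΔ, ← hσ] at e2 m1
  rw [← hΔ, ← hσ] at q2
  set k := Δ * (σ / 2 + κ) with hk
  have hexp : ∀ ω, Real.exp (y ω) = Real.exp (-k) * Real.exp (M ω) := fun ω => by
    rw [hy, ← Real.exp_add]; congr 1; ring
  have e1' : Integrable (fun ω => Real.exp (y ω)) P := by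
    simp_rw [hexp]; exact e1.const_mul _
  have e2' : ∫ ω, Real.exp (y ω) ∂P = 1 := by
    simp_rw [hexp]
    rw [integral_const_mul, e2, ← Real.exp_add, Real.exp_eq_one_iff, hk]; ring
  have q0 : ∀ ω, Real.exp (y ω) ^ 2 = Real.exp (-k) ^ 2 * Real.exp (M ω + 1 * M ω) := fun ω => by
    rw [hexp, one_mul, Real.exp_add]; ring
  have q1' : Integrable (fun ω => Real.exp (y ω) ^ 2) P := by
    simp_rw [q0]; exact q1.const_mul _
  -- Doubling the exponent doubles both Gaussian coefficient and jump function. As `exp (2 l) - 1 =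
  -- γ² + 2 γ`, the compensator cancels the linear part and exactly the variance rate `v` remains.
  have q2' : ∫ ω, Real.exp (y ω) ^ 2 ∂P = Real.exp (Δ * v) := by
    simp_rw [q0]
    rw [integral_const_mul, q2, ← Real.exp_nat_mul, ← Real.exp_add]
    have : ∫ z in V, (Real.exp (l z + 1 * l z) - 1) ∂ν = ∫ z in V, γ z ^ 2 ∂ν + 2 * κ := by
      rw [hκ, ← integral_const_mul, ← integral_add hγ2i (hγi.const_mul 2)]
      congr 1
      ext z
      rw [one_mul, Real.exp_add]
      simp only [hγdef]
      ring
    rw [this, hv, hk]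
    congr 1
    push_cast
    ring
  have ey : MemLp (fun ω => Real.exp (y ω)) 2 P :=
    (memLp_two_iff_integrable_sq e1'.aestronglyMeasurable).2 q1'
  have ci : Integrable (fun ω => r ω * Real.exp (y ω)) P := r1.integrable_mul ey
  -- The covariance of the martingale increment and its exponential is again the variance; this is
  -- what cancels the first-order term of the squared defect.
  have cv : ∫ ω, r ω * Real.exp (y ω) ∂P = Δ * v := by
    have hi : Integrable (fun ω => N ω * Real.exp (y ω)) P := n1.integrable_mul ey
    have h1 : ∫ ω, N ω * Real.exp (y ω) ∂P = Real.exp (-k) * ∫ ω, N ω * Real.exp (M ω) ∂P := by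
      rw [← integral_const_mul]
      congr 1; ext ω; rw [hexp]; ring
    have h2 : ∀ ω, r ω * Real.exp (y ω) = N ω * Real.exp (y ω) - Δ * κ * Real.exp (y ω) :=
      fun ω => by rw [hrf]; ring
    have h3 : ∫ z in V, γ z * Real.exp (l z) ∂ν = ∫ z in V, γ z ^ 2 ∂ν + κ := by
      rw [hκ, ← integral_add hγ2i hγi]
      congr 1; ext z; simp only [hγdef]; ring
    simp_rw [h2]
    rw [integral_sub hi (e1'.const_mul _), integral_const_mul, e2', h1, m1, h3, ← mul_assoc,
      ← Real.exp_add, hv, hk]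
    rw [show -(Δ * (σ / 2 + κ)) + Δ * (1 ^ 2 * σ / 2 + κ) = 0 by ring, Real.exp_zero]
    ring
  refine ⟨⟨r1, r2, r3⟩, (ey.sub (memLp_const 1)).sub r1, ?_, ?_⟩
  · have h1 : Integrable (fun ω => Real.exp (y ω) - 1) P := e1'.sub (integrable_const _)
    rw [integral_sub h1 (r1.integrable one_le_two), integral_sub e1' (integrable_const _), e2', r2]
    simp
  -- Expansion of the square. The contributions `exp (Δ v)`, `Δ v`, `-2 Δ v` and `1 - 2` leave a
  -- remainder of second order in `Δ`.
  · have h1 : ∀ ω, (Real.exp (y ω) - 1 - r ω) ^ 2 = Real.exp (y ω) ^ 2 + r ω ^ 2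
        - 2 * (r ω * Real.exp (y ω)) + (1 - 2 * Real.exp (y ω) + 2 * r ω) := fun ω => by ring
    simp_rw [h1]
    have i1 : Integrable (fun ω => Real.exp (y ω) ^ 2 + r ω ^ 2) P := q1'.add r1.integrable_sq
    have i2 : Integrable (fun ω => Real.exp (y ω) ^ 2 + r ω ^ 2 - 2 * (r ω * Real.exp (y ω))) P :=
      i1.sub (ci.const_mul 2)
    have i3 : Integrable (fun ω => 1 - 2 * Real.exp (y ω)) P :=
      (integrable_const 1).sub (e1'.const_mul 2)
    have i4 : Integrable (fun ω => 2 * r ω) P := (r1.integrable one_le_two).const_mul 2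
    have i5 : Integrable (fun ω => 1 - 2 * Real.exp (y ω) + 2 * r ω) P := i3.add i4
    rw [integral_add i2 i5, integral_sub i1 (ci.const_mul 2), integral_add q1' r1.integrable_sq,
      integral_add i3 i4, integral_sub (integrable_const 1) (e1'.const_mul 2), integral_const_mul,
      integral_const_mul, integral_const_mul, q2', r3, cv, e2', r2]
    simp
    ring

/-- The `L²` isometry for compensated Poisson sums. -/
lemma compensated_incSum_moments (hW : IsBrownianMotion 𝓕 P W)
    (hp : IsPoissonPointProcess 𝓕 P ν p)
    (hWp : Indep (processSigma W) (pointSigma p) P)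
    (hV : MeasurableSet V) (hfin : ν V ≠ ∞) (hst : s ≤ t) {f : Z → ℝ}
    (hf : Measurable f) (hf0 : ∀ z ∉ V, f z = 0) (hfC : ∃ C, ∀ z, |f z| ≤ C) :
    MemLp (fun ω => incSum (p ω) f s t - ((t : ℝ) - s) * ∫ z in V, f z ∂ν) 2 P ∧
    ∫ ω, (incSum (p ω) f s t - ((t : ℝ) - s) * ∫ z in V, f z ∂ν) ∂P = 0 ∧
    ∫ ω, (incSum (p ω) f s t - ((t : ℝ) - s) * ∫ z in V, f z ∂ν) ^ 2 ∂P
      = ((t : ℝ) - s) * ∫ z in V, f z ^ 2 ∂ν := by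
  -- Zero coefficients remove the Gaussian part from the general moment formulas.
  obtain ⟨n1, n2, n3⟩ := integral_noise hW hp hWp 0 hV hfin hst 0 hf hf0 hfC
  have h0 : noise W 0 p s t 0 f = fun ω => incSum (p ω) f s t := by
    ext ω; simp [noise]
  rw [h0] at n1 n2 n3
  set κ := ((t : ℝ) - s) * ∫ z in V, f z ∂ν
  have n1i : Integrable (fun ω => incSum (p ω) f s t) P := n1.integrable one_le_two
  refine ⟨n1.sub (memLp_const _), ?_, ?_⟩
  · rw [integral_sub n1i (integrable_const _), n2]; simp
  · rw [integral_sub_const_sq n1, n2, n3]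
    ring

end Pair

end

section

/-! ### Independence through characteristic functions -/

section CharIndep

variable {Ω : Type*} {mΩ : MeasurableSpace Ω} {P : Measure Ω}

/-- The factorization of characteristic functions which characterizes the independence of `D`
and the σ-algebra `m`. -/
def CharIndep (P : Measure Ω) (m : MeasurableSpace Ω) (D : Ω → ℝ) : Prop :=
  ∀ g : Ω → ℝ, AEStronglyMeasurable[m] g P →
    ∫ ω, Complex.exp (g ω * Complex.I) * Complex.exp (D ω * Complex.I) ∂P
      = (∫ ω, Complex.exp (g ω * Complex.I) ∂P) * ∫ ω, Complex.exp (D ω * Complex.I) ∂P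

lemma continuous_cexp_ofReal_mul_I : Continuous fun x : ℝ => Complex.exp (x * Complex.I) := by
  fun_prop

lemma CharIndep.add_const {m : MeasurableSpace Ω} {D : Ω → ℝ} (h : CharIndep P m D) (c : ℝ) :
    CharIndep P m (fun ω => D ω + c) := by
  intro g hg
  have : ∀ ω, Complex.exp (((D ω + c : ℝ) : ℂ) * Complex.I)
      = Complex.exp (D ω * Complex.I) * Complex.exp (c * Complex.I) := fun ω => by
    rw [← Complex.exp_add]; push_cast; ring_nf
  simp_rw [this, ← mul_assoc]
  rw [integral_mul_const, integral_mul_const, h g hg, mul_assoc]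

lemma CharIndep.of_tendstoInMeasure [IsFiniteMeasure P] {m : MeasurableSpace Ω} (hm : m ≤ mΩ)
    {D : ℕ → Ω → ℝ} {D' : Ω → ℝ} (h : ∀ k, CharIndep P m (D k))
    (hDm : ∀ k, AEStronglyMeasurable[mΩ] (D k) P)
    (hD : TendstoInMeasure P D atTop D') : CharIndep P m D' := by
  intro g hg
  obtain ⟨ns, -, hns⟩ := hD.exists_seq_tendsto_ae
  have hgm : AEStronglyMeasurable[mΩ] (fun ω => Complex.exp (g ω * Complex.I)) P :=
    continuous_cexp_ofReal_mul_I.comp_aestronglyMeasurable (hg.mono hm)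
  have hm' : ∀ k, AEStronglyMeasurable[mΩ] (fun ω => Complex.exp (D k ω * Complex.I)) P := fun k =>
    continuous_cexp_ofReal_mul_I.comp_aestronglyMeasurable (hDm k)
  have h1 : Tendsto (fun k => ∫ ω, Complex.exp (D (ns k) ω * Complex.I) ∂P) atTop
      (𝓝 (∫ ω, Complex.exp (D' ω * Complex.I) ∂P)) := by
    refine tendsto_integral_of_dominated_convergence (fun _ => 1) (fun k => hm' _)
      (integrable_const _) (fun k => ae_of_all _ fun ω => ?_) ?_
    · rw [Complex.norm_exp_ofReal_mul_I]
    · filter_upwards [hns] with ω hω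
      exact (continuous_cexp_ofReal_mul_I.tendsto _).comp hω
  have h2 : Tendsto (fun k => ∫ ω, Complex.exp (g ω * Complex.I)
      * Complex.exp (D (ns k) ω * Complex.I) ∂P) atTop
      (𝓝 (∫ ω, Complex.exp (g ω * Complex.I) * Complex.exp (D' ω * Complex.I) ∂P)) := by
    refine tendsto_integral_of_dominated_convergence (fun _ => 1) (fun k => hgm.mul (hm' _))
      (integrable_const _) (fun k => ae_of_all _ fun ω => ?_) ?_
    · rw [norm_mul, Complex.norm_exp_ofReal_mul_I, Complex.norm_exp_ofReal_mul_I, one_mul]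
    · filter_upwards [hns] with ω hω
      exact ((continuous_cexp_ofReal_mul_I.tendsto _).comp hω).const_mul _
  simp_rw [fun k => h (ns k) g hg] at h2
  exact tendsto_nhds_unique h2 (h1.const_mul _)

/-- A linear form on the triple `(f, (X, Y))` is a multiple of `f` plus a combination `a X + b Y`.
The multiple of `f` is again measurable for the past, so factorization for all combinations
factorizes the joint characteristic function. -/
lemma indepPast_pair_of_charIndep [IsProbabilityMeasure P] {m : MeasurableSpace Ω} (hm : m ≤ mΩ)
    {X Y : Ω → ℝ} (hX : AEStronglyMeasurable[mΩ] X P) (hY : AEStronglyMeasurable[mΩ] Y P)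
    (h : ∀ a b : ℝ, CharIndep P m (fun ω => a * X ω + b * Y ω)) :
    IndepPast P m (fun ω => (X ω, Y ω)) := by
  intro f hf
  have hfm : AEMeasurable[mΩ] f P := (hf.mono hm).aemeasurable
  have hXY : AEMeasurable[mΩ] (fun ω => (X ω, Y ω)) P := hX.aemeasurable.prodMk hY.aemeasurable
  rw [indepFun_iff_charFunDual_prod hfm hXY]
  intro L
  set θ := L (1, (0, 0))
  set a := L (0, (1, 0))
  set b := L (0, (0, 1))
  have hL : ∀ x y z : ℝ, L (x, (y, z)) = θ * x + (a * y + b * z) := by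
    intro x y z
    have : ((x, (y, z)) : ℝ × ℝ × ℝ) = x • (1, (0, 0)) + (y • (0, (1, 0)) + z • (0, (0, 1))) := by
      simp
    rw [this, map_add, map_add, map_smul, map_smul, map_smul]
    simp only [smul_eq_mul]
    ring
  have hg : AEStronglyMeasurable[m] (fun ω => θ * f ω) P := hf.const_mul θ
  have h1 := h a b _ hg
  rw [charFunDual_apply, charFunDual_apply, charFunDual_apply,
    integral_map (hfm.prodMk hXY) (by fun_prop), integral_map hfm (by fun_prop),
    integral_map hXY (by fun_prop)]
  simp only [ContinuousLinearMap.comp_apply, ContinuousLinearMap.inl_apply,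
    ContinuousLinearMap.inr_apply]
  simp only [hL, Prod.fst_zero, Prod.snd_zero, mul_zero, add_zero, zero_add]
  beta_reduce at h1
  rw [← h1]
  congr 1
  ext ω
  rw [← Complex.exp_add]
  push_cast
  ring_nf

end CharIndep

/-! ### Joint independence of the increments from the past -/

variable {Ω Z : Type*} {mΩ : MeasurableSpace Ω} [MeasurableSpace Z] {P : Measure Ω}
  {𝓕 : Filtration ℝ≥0 mΩ} {ν : Measure Z} {p : Ω → ℝ → Option Z} {d : ℕ}
  {W : ℝ≥0 → Ω → Fin d → ℝ}

/-- Only pairwise independence is available. Centring `A` and `B` reduces the whole discrepancy to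
the mean of `Γ (A - a) (B - b)`; as `A` and `B` are independent, this is at most a product of two
first moments, each small when `A` and `B` are close to `1`. -/
lemma integral_mul_mul_sub_le [IsProbabilityMeasure P] {m : MeasurableSpace Ω} (hm : m ≤ mΩ)
    {Γ A B : Ω → ℂ} (hΓ : AEStronglyMeasurable[m] Γ P) (hΓ1 : ∀ ω, ‖Γ ω‖ ≤ 1)
    (hA : AEStronglyMeasurable[mΩ] A P) (hA1 : ∀ ω, ‖A ω‖ ≤ 1)
    (hB : AEStronglyMeasurable[mΩ] B P) (hB1 : ∀ ω, ‖B ω‖ ≤ 1)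
    (hΓA : IndepFun Γ A P) (hΓB : IndepFun Γ B P) (hAB : IndepFun A B P) :
    ‖∫ ω, Γ ω * (A ω * B ω) ∂P - (∫ ω, Γ ω ∂P) * ((∫ ω, A ω ∂P) * ∫ ω, B ω ∂P)‖
      ≤ 4 * (∫ ω, ‖A ω - 1‖ ∂P) * ∫ ω, ‖B ω - 1‖ ∂P := by
  have hΓ' := hΓ.mono hm
  have iA : Integrable A P := Integrable.of_bound hA 1 (ae_of_all _ hA1)
  have iB : Integrable B P := Integrable.of_bound hB 1 (ae_of_all _ hB1)
  have iΓ : Integrable Γ P := Integrable.of_bound hΓ' 1 (ae_of_all _ hΓ1)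
  set a := ∫ ω, A ω ∂P with ha
  set b := ∫ ω, B ω ∂P with hb
  have hsub : ∀ (D : Ω → ℂ), Integrable D P →
      ∫ ω, ‖D ω - ∫ ω, D ω ∂P‖ ∂P ≤ 2 * ∫ ω, ‖D ω - 1‖ ∂P := by
    intro D hD
    have h1 : Integrable (fun ω => ‖D ω - 1‖) P := (hD.sub (integrable_const 1)).norm
    have h2 : ‖(1 : ℂ) - ∫ ω, D ω ∂P‖ ≤ ∫ ω, ‖D ω - 1‖ ∂P := by
      have : (1 : ℂ) - ∫ ω, D ω ∂P = ∫ ω, (1 - D ω) ∂P := by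
        rw [integral_sub (integrable_const _) hD]; simp
      rw [this]
      refine (norm_integral_le_integral_norm _).trans (le_of_eq ?_)
      simp_rw [norm_sub_rev]
    calc ∫ ω, ‖D ω - ∫ ω, D ω ∂P‖ ∂P
        ≤ ∫ ω, (‖D ω - 1‖ + ‖(1 : ℂ) - ∫ ω, D ω ∂P‖) ∂P :=
          integral_mono (hD.sub (integrable_const _)).norm (h1.add (integrable_const _)) fun ω => by
            simpa using norm_add_le (D ω - 1) (1 - ∫ ω, D ω ∂P)
      _ = ∫ ω, ‖D ω - 1‖ ∂P + ‖(1 : ℂ) - ∫ ω, D ω ∂P‖ := by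
          rw [integral_add h1 (integrable_const _)]; simp
      _ ≤ _ := by linarith
  have hint : ∀ (D E : Ω → ℂ), AEStronglyMeasurable[mΩ] D P → AEStronglyMeasurable[mΩ] E P →
      (∀ ω, ‖D ω‖ ≤ 1) → (∀ ω, ‖E ω‖ ≤ 1) → Integrable (fun ω => D ω * E ω) P := by
    intro D E hD hE hD1 hE1
    refine Integrable.of_bound (hD.mul hE) 1 (ae_of_all _ fun ω => ?_)
    rw [norm_mul]
    exact mul_le_one₀ (hD1 ω) (norm_nonneg _) (hE1 ω)
  have iΓA := hint Γ A hΓ' hA hΓ1 hA1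
  have iΓB := hint Γ B hΓ' hB hΓ1 hB1
  have iΓAB := hint Γ (fun ω => A ω * B ω) hΓ' (hA.mul hB) hΓ1 fun ω => by
    rw [norm_mul]; exact mul_le_one₀ (hA1 ω) (norm_nonneg _) (hB1 ω)
  have e1 := hΓA.integral_fun_mul_eq_mul_integral hΓ' hA
  have e2 := hΓB.integral_fun_mul_eq_mul_integral hΓ' hB
  have key : ∫ ω, Γ ω * (A ω * B ω) ∂P - (∫ ω, Γ ω ∂P) * (a * b)
      = ∫ ω, Γ ω * ((A ω - a) * (B ω - b)) ∂P := by
    have : ∀ ω, Γ ω * ((A ω - a) * (B ω - b))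
        = Γ ω * (A ω * B ω) - b * (Γ ω * A ω) - (a * (Γ ω * B ω) - a * b * Γ ω) := fun ω => by ring
    simp_rw [this]
    have j1 : Integrable (fun ω => Γ ω * (A ω * B ω) - b * (Γ ω * A ω)) P :=
      iΓAB.sub (iΓA.const_mul b)
    have j2 : Integrable (fun ω => a * (Γ ω * B ω) - a * b * Γ ω) P :=
      (iΓB.const_mul a).sub (iΓ.const_mul _)
    rw [integral_sub j1 j2, integral_sub iΓAB (iΓA.const_mul b),
      integral_sub (iΓB.const_mul a) (iΓ.const_mul _), integral_const_mul, integral_const_mul,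
      integral_const_mul, e1, e2]
    ring
  have hABn : IndepFun (fun ω => ‖A ω - a‖) (fun ω => ‖B ω - b‖) P :=
    hAB.comp (φ := fun z : ℂ => ‖z - a‖) (ψ := fun z : ℂ => ‖z - b‖) (by fun_prop) (by fun_prop)
  have iAn : Integrable (fun ω => ‖A ω - a‖) P := (iA.sub (integrable_const _)).norm
  have iBn : Integrable (fun ω => ‖B ω - b‖) P := (iB.sub (integrable_const _)).norm
  rw [key]
  calc ‖∫ ω, Γ ω * ((A ω - a) * (B ω - b)) ∂P‖
      ≤ ∫ ω, ‖Γ ω * ((A ω - a) * (B ω - b))‖ ∂P := norm_integral_le_integral_norm _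
    _ ≤ ∫ ω, ‖A ω - a‖ * ‖B ω - b‖ ∂P := by
        refine integral_mono_of_nonneg (ae_of_all _ fun _ => norm_nonneg _)
          (hABn.integrable_mul iAn iBn) (ae_of_all _ fun ω => ?_)
        simp only [norm_mul]
        exact mul_le_of_le_one_left (by positivity) (hΓ1 ω)
    _ = (∫ ω, ‖A ω - a‖ ∂P) * ∫ ω, ‖B ω - b‖ ∂P :=
        hABn.integral_fun_mul_eq_mul_integral iAn.aestronglyMeasurable iBn.aestronglyMeasurable
    _ ≤ (2 * ∫ ω, ‖A ω - 1‖ ∂P) * (2 * ∫ ω, ‖B ω - 1‖ ∂P) := by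
        exact mul_le_mul (hsub A iA) (hsub B iB) (integral_nonneg fun _ => norm_nonneg _)
          (mul_nonneg two_pos.le (integral_nonneg fun _ => norm_nonneg _))
    _ = _ := by ring

/-- The σ-algebra generated by the points after time `t`. -/
abbrev futurePoints (p : Ω → ℝ → Option Z) (t : ℝ≥0) : MeasurableSpace Ω :=
  ⨆ B ∈ {B : Set (ℝ × Z) | MeasurableSet B ∧ B ⊆ Set.Ioi (t : ℝ) ×ˢ Set.univ},
      MeasurableSpace.comap (fun ω => pointCount (p ω) B) inferInstance

section Noise

variable [IsProbabilityMeasure P] [SFinite ν] {V : Set Z} {s t : ℝ≥0}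

lemma incSum_aestronglyMeasurable_futurePoints (hp : IsPoissonPointProcess 𝓕 P ν p)
    (hV : MeasurableSet V) (hfin : ν V ≠ ∞) {f : Z → ℝ} (hf : Measurable f)
    (hf0 : ∀ z ∉ V, f z = 0) (s t : ℝ≥0) :
    AEStronglyMeasurable[futurePoints p s] (fun ω => incSum (p ω) f s t) P :=
  hp.incSum_aestronglyMeasurable hV hfin hf hf0 fun B hB hBs =>
    (comap_measurable _).mono (le_iSup₂_of_le (f := fun (B : Set (ℝ × Z)) _ =>
      MeasurableSpace.comap (fun ω => pointCount (p ω) B) inferInstance) B ⟨hB, hBs.trans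
      (prod_mono Ioc_subset_Ioi_self subset_rfl)⟩ le_rfl) le_rfl

lemma incSum_aestronglyMeasurable_past (hp : IsPoissonPointProcess 𝓕 P ν p)
    (hV : MeasurableSet V) (hfin : ν V ≠ ∞) {f : Z → ℝ} (hf : Measurable f)
    (hf0 : ∀ z ∉ V, f z = 0) (s t : ℝ≥0) :
    AEStronglyMeasurable[𝓕 t] (fun ω => incSum (p ω) f s t) P :=
  hp.incSum_aestronglyMeasurable hV hfin hf hf0 fun B hB hBs => hp.adapted t B hB
    (hBs.trans (prod_mono Ioc_subset_Iic_self subset_rfl))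

lemma noise_aestronglyMeasurable (hW : IsBrownianMotion 𝓕 P W)
    (hp : IsPoissonPointProcess 𝓕 P ν p) (c : Fin d → ℝ)
    (hV : MeasurableSet V) (hfin : ν V ≠ ∞) {f : Z → ℝ} (hf : Measurable f)
    (hf0 : ∀ z ∉ V, f z = 0) (hst : s ≤ t) (α : ℝ) :
    AEStronglyMeasurable[𝓕 t] (noise W c p s t α f) P :=
  ((((hW.measurable_linComb c t).sub ((hW.measurable_linComb c s).mono (𝓕.mono hst)
    le_rfl)).const_mul α).aestronglyMeasurable).add
    (incSum_aestronglyMeasurable_past hp hV hfin hf hf0 s t)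

/-- The integrand vanishes when there is no point in the strip and is at most `2` otherwise, and a
Poisson variable of mean `μ` is nonzero with probability `1 - exp (-μ) ≤ μ`. The size is of the
order of the time step. -/
lemma integral_norm_cexp_incSum_sub_one_le (hp : IsPoissonPointProcess 𝓕 P ν p)
    (hV : MeasurableSet V) (hfin : ν V ≠ ∞) {f : Z → ℝ} (hf0 : ∀ z ∉ V, f z = 0) (hst : s ≤ t) :
    ∫ ω, ‖Complex.exp (incSum (p ω) f s t * Complex.I) - 1‖ ∂P
      ≤ 2 * (((t : ℝ) - s) * ν.real V) := by
  have h0 : 0 ≤ (t : ℝ) - s := sub_nonneg.2 (NNReal.coe_le_coe.2 hst)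
  set μ := ((t : ℝ) - s) * ν.real V with hμ
  set N : Ω → ℕ := fun ω => (pointCount (p ω) (Ioc (s : ℝ) t ×ˢ V)).toNat
  have hI : intensity ν (Ioc (s : ℝ) t ×ˢ V) ≠ ∞ := by
    rw [intensity_Ioc]; exact ENNReal.mul_ne_top ENNReal.ofReal_ne_top hfin
  have hl := hp.hasLaw_toNat (measurableSet_Ioc.prod hV) hI
  have hP : ∫ ω, (if N ω = 0 then (0 : ℝ) else 2) ∂P = 2 * (1 - Real.exp (-μ)) := by
    have h1 := hl.integral_comp (f := fun k : ℕ => if k = 0 then (1 : ℝ) else 0)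
      measurable_from_top.aestronglyMeasurable
    have h2 : ∫ k, (if k = 0 then (1 : ℝ) else 0)
        ∂(poissonMeasure (intensity ν (Ioc (s : ℝ) t ×ˢ V)).toNNReal) = Real.exp (-μ) := by
      rw [integral_poissonMeasure, tsum_eq_single 0 (by simp +contextual)]
      rw [intensity_Ioc, ENNReal.coe_toNNReal_eq_toReal, ENNReal.toReal_mul,
        ENNReal.toReal_ofReal h0]
      simp [hμ, measureReal_def]
    rw [h2] at h1
    have h3 : ∀ ω, (if N ω = 0 then (0 : ℝ) else 2)
        = 2 * (1 - ((fun k : ℕ => if k = 0 then (1 : ℝ) else 0) ∘ N) ω) := fun ω => by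
      by_cases h : N ω = 0 <;> simp [h]
    have hi : Integrable ((fun k : ℕ => if k = 0 then (1 : ℝ) else 0) ∘ N) P := by
      refine Integrable.of_bound (measurable_from_top.comp_aemeasurable
        hl.aemeasurable).aestronglyMeasurable 1 (ae_of_all _ fun ω => ?_)
      by_cases h : N ω = 0 <;> simp [h]
    simp_rw [h3]
    rw [integral_const_mul, integral_sub (integrable_const _) hi]
    rw [h1]
    simp
  have hmono : ∫ ω, ‖Complex.exp (incSum (p ω) f s t * Complex.I) - 1‖ ∂P
      ≤ ∫ ω, (if N ω = 0 then (0 : ℝ) else 2) ∂P := by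
    refine integral_mono_of_nonneg (ae_of_all _ fun _ => norm_nonneg _) ?_ ?_
    · refine Integrable.of_bound ((measurable_from_top (f := fun k : ℕ => if k = 0 then (0 : ℝ)
        else 2)).comp_aemeasurable hl.aemeasurable).aestronglyMeasurable 2
        (ae_of_all _ fun ω => ?_)
      by_cases h : N ω = 0 <;> simp [N] at h ⊢ <;> split_ifs <;> simp
    · filter_upwards [hp.ae_locFinite hV hfin] with ω hω
      by_cases h : N ω = 0
      · rw [if_pos h]
        have : incSum (p ω) f s t = 0 := by
          rw [incSum_eq_sum hω hf0]
          refine Finset.sum_eq_zero fun r hr => ?_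
          exfalso
          simp only [Set.Finite.mem_toFinset, mem_ofPred_eq] at hr
          obtain ⟨hr, z, hz, hq⟩ := hr
          have hfin' : {r : ℝ | ∃ z, p ω r = some z ∧ (r, z) ∈ Ioc (s : ℝ) t ×ˢ V}.Finite :=
            (hω.finite_Ioc s t).subset fun r ⟨z, h1, h2, h3⟩ => ⟨h2, z, h3, h1⟩
          have h4 : pointCount (p ω) (Ioc (s : ℝ) t ×ˢ V) = 0 := by
            rcases (ENat.toNat_eq_zero).1 h with h | h
            · exact h
            · exact absurd h (Set.encard_ne_top_iff.2 hfin')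
          rw [pointCount, Set.encard_eq_zero] at h4
          exact (h4 ▸ (show r ∈ {r : ℝ | ∃ z, p ω r = some z ∧ (r, z) ∈ Ioc (s : ℝ) t ×ˢ V}
            from ⟨z, hq, hr, hz⟩) : r ∈ (∅ : Set ℝ))
        simp [this]
      · rw [if_neg h]
        refine (norm_sub_le _ _).trans ?_
        rw [Complex.norm_exp_ofReal_mul_I, norm_one]; norm_num
  rw [hP] at hmono
  have := Real.add_one_le_exp (-μ)
  linarith

/-- The integrand is at most `|X|`, hence at most `δ + X² / δ`; taking `δ` to be the square root of
the time step balances the two terms. The size is of the order of that square root. -/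
lemma integral_norm_cexp_linComb_sub_one_le (hW : IsBrownianMotion 𝓕 P W)
    (hp : IsPoissonPointProcess 𝓕 P ν p) (hWp : Indep (processSigma W) (pointSigma p) P)
    (c : Fin d → ℝ) (hst : s ≤ t) (α : ℝ) :
    ∫ ω, ‖Complex.exp ((α * (linComb W c t ω - linComb W c s ω) : ℝ) * Complex.I) - 1‖ ∂P
      ≤ Real.sqrt ((t : ℝ) - s) * (1 + α ^ 2 * ∑ k, c k ^ 2) := by
  have h0 : 0 ≤ (t : ℝ) - s := sub_nonneg.2 (NNReal.coe_le_coe.2 hst)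
  rcases h0.eq_or_lt with h | h
  · have : s = t := le_antisymm hst (by rw [← NNReal.coe_le_coe]; linarith)
    subst this
    simp
  -- The empty mark set leaves the Gaussian part alone.
  obtain ⟨n1, -, n3⟩ := integral_noise hW hp hWp c (V := ∅) MeasurableSet.empty (by simp) hst α
    (f := fun _ => 0) measurable_const (fun _ _ => rfl) ⟨0, by simp⟩
  have hn : noise W c p s t α (fun _ => 0)
      = fun ω => α * (linComb W c t ω - linComb W c s ω) := by
    ext ω
    unfold noise incSum
    rw [finsum_mem_eq_zero_of_forall_eq_zero fun r _ => by cases p ω r <;> simp]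
    simp
  rw [hn] at n1 n3
  set X : Ω → ℝ := fun ω => α * (linComb W c t ω - linComb W c s ω)
  set δ := Real.sqrt ((t : ℝ) - s) with hδ
  have hδ0 : 0 < δ := Real.sqrt_pos.2 h
  have hδ2 : δ ^ 2 = (t : ℝ) - s := Real.sq_sqrt h0
  have hle : ∀ ω, ‖Complex.exp ((X ω : ℝ) * Complex.I) - 1‖ ≤ δ + δ⁻¹ * X ω ^ 2 := by
    intro ω
    have h1 : ‖Complex.exp ((X ω : ℝ) * Complex.I) - 1‖ ≤ |X ω| := by
      rw [mul_comm]; exact Real.norm_exp_I_mul_ofReal_sub_one_le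
    refine h1.trans ?_
    have h2 : 0 ≤ δ⁻¹ * (|X ω| - δ) ^ 2 := by positivity
    have h3 : δ⁻¹ * (|X ω| - δ) ^ 2 = δ⁻¹ * X ω ^ 2 - 2 * |X ω| + δ := by
      rw [sub_sq, sq_abs]; field_simp
    have := abs_nonneg (X ω)
    linarith
  refine (integral_mono_of_nonneg (ae_of_all _ fun _ => norm_nonneg _)
    ((integrable_const δ).add (n1.integrable_sq.const_mul _)) (ae_of_all _ hle)).trans ?_
  have hi : Integrable (fun ω => δ⁻¹ * X ω ^ 2) P := n1.integrable_sq.const_mul _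
  have h5 : ∫ ω, (δ + δ⁻¹ * X ω ^ 2) ∂P = δ + δ⁻¹ * (δ ^ 2 * (α ^ 2 * ∑ k, c k ^ 2)) := by
    rw [integral_add (integrable_const _) hi, integral_const_mul, n3, hδ2]
    simp
  refine h5.le.trans (le_of_eq ?_)
  field_simp

/-- Brownian and Poisson increments are each independent of the past and of one another, but their
joint independence of the past has to be proved. The interval is cut into `N` pieces. Over one
piece, treating the triple as independent costs a Brownian factor of order `N^(-1/2)` times a
Poisson factor of order `N^(-1)`, so the total cost is of order `N^(-1/2)`. -/
lemma charIndep_noise (hW : IsBrownianMotion 𝓕 P W) (hp : IsPoissonPointProcess 𝓕 P ν p)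
    (hWp : Indep (processSigma W) (pointSigma p) P) (c : Fin d → ℝ)
    (hV : MeasurableSet V) (hfin : ν V ≠ ∞) (hst : s ≤ t) (α : ℝ) {f : Z → ℝ} (hf : Measurable f)
    (hf0 : ∀ z ∉ V, f z = 0) : CharIndep P (𝓕 s) (noise W c p s t α f) := by
  have h0 : 0 ≤ (t : ℝ) - s := sub_nonneg.2 (NNReal.coe_le_coe.2 hst)
  set K : ℝ := 1 + α ^ 2 * ∑ k, c k ^ 2
  have hK : 0 ≤ K := by positivity
  set τ : ℕ → ℕ → ℝ≥0 := fun N j => s + gridPt (t - s) N 1 j with hτ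
  have hτm : ∀ N, Monotone (τ N) := fun N i j hij => add_le_add_right (gridPt_mono _ _ _ hij) s
  have hτ0 : ∀ N, τ N 0 = s := fun N => by simp [hτ, gridPt_zero]
  have hτN : ∀ N, 0 < N → τ N N = t := fun N hN => by
    have := gridPt_last (t - s) hN one_pos
    rw [mul_one] at this
    simp only [hτ, this]
    exact add_tsub_cancel_of_le hst
  have hτd : ∀ N j, (τ N (j + 1) : ℝ) - τ N j = ((t : ℝ) - s) / N := fun N j => by
    have := gridPt_sub (t - s) N 1 j 1
    simp only [hτ, NNReal.coe_add, add_sub_add_left_eq_sub, this, NNReal.coe_sub hst]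
    simp
  set A : ℕ → ℕ → Ω → ℂ := fun N j ω => Complex.exp
    ((α * (linComb W c (τ N (j + 1)) ω - linComb W c (τ N j) ω) : ℝ) * Complex.I) with hA
  set B : ℕ → ℕ → Ω → ℂ := fun N j ω => Complex.exp
    (incSum (p ω) f (τ N j) (τ N (j + 1)) * Complex.I) with hB
  have hA1 : ∀ N j ω, ‖A N j ω‖ = 1 := fun N j ω => Complex.norm_exp_ofReal_mul_I _
  have hB1 : ∀ N j ω, ‖B N j ω‖ = 1 := fun N j ω => Complex.norm_exp_ofReal_mul_I _
  have hAm : ∀ N j, AEStronglyMeasurable[𝓕 (τ N (j + 1))] (A N j) P := fun N j =>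
    continuous_cexp_ofReal_mul_I.comp_aestronglyMeasurable
      (((hW.measurable_linComb c _).sub ((hW.measurable_linComb c _).mono
        (𝓕.mono (hτm N j.le_succ)) le_rfl)).const_mul α).aestronglyMeasurable
  have hBm : ∀ N j, AEStronglyMeasurable[𝓕 (τ N (j + 1))] (B N j) P := fun N j =>
    continuous_cexp_ofReal_mul_I.comp_aestronglyMeasurable
      (incSum_aestronglyMeasurable_past hp hV hfin hf hf0 _ _)
  have hAf : ∀ N j, AEStronglyMeasurable[MeasurableSpace.comap
      (fun ω => W (τ N (j + 1)) ω - W (τ N j) ω) inferInstance] (A N j) P := by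
    intro N j
    refine continuous_cexp_ofReal_mul_I.comp_aestronglyMeasurable
      (Measurable.aestronglyMeasurable ?_)
    have : (fun ω => α * (linComb W c (τ N (j + 1)) ω - linComb W c (τ N j) ω))
        = (fun x : Fin d → ℝ => α * ∑ k, c k * x k)
          ∘ fun ω => W (τ N (j + 1)) ω - W (τ N j) ω := by
      ext ω
      simp only [linComb, Function.comp_apply, Pi.sub_apply, mul_sub, Finset.sum_sub_distrib]
    rw [this]
    exact Measurable.comp (by fun_prop) (comap_measurable _)
  have hstep : ∀ (Γ : Ω → ℂ), AEStronglyMeasurable[𝓕 s] Γ P → (∀ ω, ‖Γ ω‖ ≤ 1) →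
      ∀ N, 0 < N → ∀ n,
      ‖∫ ω, Γ ω * ∏ j ∈ Finset.range n, (A N j ω * B N j ω) ∂P
        - (∫ ω, Γ ω ∂P) * ∏ j ∈ Finset.range n, ((∫ ω, A N j ω ∂P) * ∫ ω, B N j ω ∂P)‖
      ≤ n * (4 * (Real.sqrt (((t : ℝ) - s) / N) * K)
        * (2 * (((t : ℝ) - s) / N * ν.real V))) := by
    intro Γ hΓ hΓ1 N hN n
    induction n with
    | zero => simp
    | succ n ih =>
      -- The factors of earlier pieces join the past: the product is known at `τ N n` and still has
      -- modulus at most `1`, so it plays the part of `Γ` on the next piece.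
      set Γ' : Ω → ℂ := fun ω => Γ ω * ∏ j ∈ Finset.range n, (A N j ω * B N j ω) with hΓ'
      have hΓm : ∀ n, AEStronglyMeasurable[𝓕 (τ N n)]
          (fun ω => Γ ω * ∏ j ∈ Finset.range n, (A N j ω * B N j ω)) P := by
        intro n
        induction n with
        | zero =>
          rw [hτ0]
          simpa using hΓ
        | succ n ihn =>
          have : (fun ω => Γ ω * ∏ j ∈ Finset.range (n + 1), (A N j ω * B N j ω))
              = fun ω => Γ ω * (∏ j ∈ Finset.range n, (A N j ω * B N j ω)) * A N n ω * B N n ω := by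
            ext ω
            rw [Finset.prod_range_succ]
            ring
          rw [this]
          exact ((ihn.mono (𝓕.mono (hτm N n.le_succ))).mul (hAm N n)).mul (hBm N n)
      have hΓ1' : ∀ ω, ‖Γ' ω‖ ≤ 1 := fun ω => by
        simp only [hΓ', norm_mul, norm_prod, hA1, hB1, mul_one, Finset.prod_const_one]
        exact hΓ1 ω
      have hb := integral_mul_mul_sub_le (𝓕.le (τ N n)) (hΓm n) hΓ1' ((hAm N n).mono (𝓕.le (τ N (n + 1))))
        (fun ω => (hA1 N n ω).le) ((hBm N n).mono (𝓕.le (τ N (n + 1)))) (fun ω => (hB1 N n ω).le)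
        (indepFun_of_aestronglyMeasurable (hW.indep_past _ _ (hτm N n.le_succ)).symm (hΓm n)
          (hAf N n))
        (indepFun_of_aestronglyMeasurable (hp.indep_past _).symm (hΓm n)
          (continuous_cexp_ofReal_mul_I.comp_aestronglyMeasurable
            (incSum_aestronglyMeasurable_futurePoints hp hV hfin hf hf0 _ _)))
        ((indepFun_linComb_incSum hp hWp c hV hfin hf hf0 (τ N n) (τ N (n + 1))).comp
          (φ := fun x : ℝ => Complex.exp ((α * x : ℝ) * Complex.I))
          (ψ := fun x : ℝ => Complex.exp (x * Complex.I)) (by fun_prop) (by fun_prop))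
      have hc1 := integral_norm_cexp_linComb_sub_one_le hW hp hWp c (hτm N n.le_succ) α
      have hc2 := integral_norm_cexp_incSum_sub_one_le hp hV hfin hf0 (hτm N n.le_succ)
      rw [Nat.succ_eq_add_one, hτd] at hc1 hc2
      have hb2 : ‖∫ ω, Γ' ω * (A N n ω * B N n ω) ∂P
          - (∫ ω, Γ' ω ∂P) * ((∫ ω, A N n ω ∂P) * ∫ ω, B N n ω ∂P)‖
          ≤ 4 * (Real.sqrt (((t : ℝ) - s) / N) * K) * (2 * (((t : ℝ) - s) / N * ν.real V)) := by
        refine hb.trans ?_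
        gcongr
      have hn : ∀ N j, ‖(∫ ω, A N j ω ∂P) * ∫ ω, B N j ω ∂P‖ ≤ 1 := by
        intro N j
        rw [norm_mul]
        refine mul_le_one₀ ?_ (norm_nonneg _) ?_
        · simpa [hA1] using norm_integral_le_integral_norm (μ := P) (A N j)
        · simpa [hB1] using norm_integral_le_integral_norm (μ := P) (B N j)
      set q := (∫ ω, A N n ω ∂P) * ∫ ω, B N n ω ∂P
      simp_rw [Finset.prod_range_succ, ← mul_assoc (Γ _)]
      calc _ = ‖(∫ ω, Γ' ω * (A N n ω * B N n ω) ∂P - (∫ ω, Γ' ω ∂P) * q)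
            + (∫ ω, Γ' ω ∂P - (∫ ω, Γ ω ∂P) *
              ∏ j ∈ Finset.range n, ((∫ ω, A N j ω ∂P) * ∫ ω, B N j ω ∂P)) * q‖ := by
            congr 1; ring
        _ ≤ _ := by
            refine (norm_add_le _ _).trans ?_
            rw [norm_mul]
            have := mul_le_of_le_one_right (norm_nonneg (∫ ω, Γ' ω ∂P - (∫ ω, Γ ω ∂P) *
              ∏ j ∈ Finset.range n, ((∫ ω, A N j ω ∂P) * ∫ ω, B N j ω ∂P))) (hn N n)
            push_cast
            linarith
  intro g hg
  set Γ : Ω → ℂ := fun ω => Complex.exp (g ω * Complex.I) with hΓdef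
  have hΓ : AEStronglyMeasurable[𝓕 s] Γ P := continuous_cexp_ofReal_mul_I.comp_aestronglyMeasurable hg
  have hΓ1 : ∀ ω, ‖Γ ω‖ ≤ 1 := fun ω => (Complex.norm_exp_ofReal_mul_I _).le
  have hprod : ∀ N, 0 < N → ∀ᵐ ω ∂P, ∏ j ∈ Finset.range N, (A N j ω * B N j ω)
      = Complex.exp (noise W c p s t α f ω * Complex.I) := by
    intro N hN
    filter_upwards [hp.ae_locFinite hV hfin] with ω hω
    have : ∀ n, ∏ j ∈ Finset.range n, (A N j ω * B N j ω)
        = Complex.exp (noise W c p s (τ N n) α f ω * Complex.I) := by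
      intro n
      induction n with
      | zero => simp [noise, hτ0, incSum_self]
      | succ n ih =>
        rw [Finset.prod_range_succ, ih, hA, hB, ← Complex.exp_add, ← Complex.exp_add]
        congr 1
        have := incSum_add_incSum hω hf0 (s := s) (t := τ N n) (u := τ N (n + 1))
          (by rw [← hτ0 N]; exact hτm N n.zero_le) (hτm N n.le_succ)
        simp only [noise, ← this]
        push_cast
        ring
    rw [this N, hτN N hN]
  have hlim : Tendsto (fun N : ℕ => 2 * (((N + 1 : ℕ) : ℝ) *
      (4 * (Real.sqrt (((t : ℝ) - s) / ((N + 1 : ℕ) : ℝ)) * K)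
        * (2 * (((t : ℝ) - s) / ((N + 1 : ℕ) : ℝ) * ν.real V))))) atTop (𝓝 0) := by
    have h1 : Tendsto (fun N : ℕ => ((t : ℝ) - s) / ((N + 1 : ℕ) : ℝ)) atTop (𝓝 0) :=
      (tendsto_const_div_atTop_nhds_zero_nat _).comp (tendsto_add_atTop_nat 1)
    have h2 := (Real.continuous_sqrt.tendsto _).comp h1
    rw [Real.sqrt_zero] at h2
    have h3 := h2.mul_const (16 * K * ((t : ℝ) - s) * ν.real V)
    rw [zero_mul] at h3
    refine h3.congr fun N => ?_
    have : ((N + 1 : ℕ) : ℝ) ≠ 0 := by positivity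
    simp only [Function.comp_apply]
    field_simp
    ring
  have hbound : ∀ N : ℕ, ‖∫ ω, Γ ω * Complex.exp (noise W c p s t α f ω * Complex.I) ∂P
      - (∫ ω, Γ ω ∂P) * ∫ ω, Complex.exp (noise W c p s t α f ω * Complex.I) ∂P‖
      ≤ 2 * (((N + 1 : ℕ) : ℝ) *
      (4 * (Real.sqrt (((t : ℝ) - s) / ((N + 1 : ℕ) : ℝ)) * K)
        * (2 * (((t : ℝ) - s) / ((N + 1 : ℕ) : ℝ) * ν.real V)))) := by
    intro N
    have b1 := hstep Γ hΓ hΓ1 (N + 1) N.succ_pos (N + 1)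
    -- The trivial past identifies the product of the means with the characteristic function of the
    -- whole increment, up to the same error; hence the factor `2` in the bound.
    have b2 := hstep (fun _ => 1) aestronglyMeasurable_const (by simp) (N + 1) N.succ_pos (N + 1)
    rw [integral_congr_ae (g := fun ω => Γ ω * Complex.exp (noise W c p s t α f ω * Complex.I))
      (by filter_upwards [hprod (N + 1) N.succ_pos] with ω hω; rw [hω])] at b1
    rw [integral_congr_ae (g := fun ω => Complex.exp (noise W c p s t α f ω * Complex.I))
      (by filter_upwards [hprod (N + 1) N.succ_pos] with ω hω; rw [hω, one_mul])] at b2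
    simp only [integral_const, probReal_univ, one_smul, one_mul] at b2
    set q := ∏ j ∈ Finset.range (N + 1), ((∫ ω, A (N + 1) j ω ∂P) * ∫ ω, B (N + 1) j ω ∂P)
    set E := ∫ ω, Complex.exp (noise W c p s t α f ω * Complex.I) ∂P
    have hn : ‖∫ ω, Γ ω ∂P‖ ≤ 1 := by
      refine (norm_integral_le_integral_norm _).trans ?_
      simp [hΓdef, Complex.norm_exp_ofReal_mul_I]
    have h3 : ∫ ω, Γ ω * Complex.exp (noise W c p s t α f ω * Complex.I) ∂P - (∫ ω, Γ ω ∂P) * E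
        = (∫ ω, Γ ω * Complex.exp (noise W c p s t α f ω * Complex.I) ∂P - (∫ ω, Γ ω ∂P) * q)
          - (∫ ω, Γ ω ∂P) * (E - q) := by ring
    rw [h3]
    refine (norm_sub_le _ _).trans ?_
    rw [norm_mul]
    have := mul_le_of_le_one_left (norm_nonneg (E - q)) hn
    linarith
  have := ge_of_tendsto' hlim hbound
  exact sub_eq_zero.1 (norm_le_zero_iff.1 this)

end Noise

end

/-! ### Lévy pairs with infinitely many small jumps, as limits. -/

section

variable {Ω Z : Type*} {mΩ : MeasurableSpace Ω} [MeasurableSpace Z] {P : Measure Ω}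
  {𝓕 : Filtration ℝ≥0 mΩ} {ν : Measure Z} {p : Ω → ℝ → Option Z} {d : ℕ}
  {W : ℝ≥0 → Ω → Fin d → ℝ}

/-- The Lévy process with Gaussian part `∑ c_k W_k` and jumps `l`, compensated so that its
exponential is a martingale. -/
def logLevy (W : ℝ≥0 → Ω → Fin d → ℝ) (c : Fin d → ℝ) (p : Ω → ℝ → Option Z) (ν : Measure Z)
    (V : Set Z) (l : Z → ℝ) (t : ℝ≥0) (ω : Ω) : ℝ :=
  noise W c p 0 t 1 l ω - t * ((∑ k, c k ^ 2) / 2 + ∫ z in V, (Real.exp (l z) - 1) ∂ν)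

/-- The Lévy martingale with Gaussian part `∑ c_k W_k` and jumps `exp l - 1`. -/
def levyMart (W : ℝ≥0 → Ω → Fin d → ℝ) (c : Fin d → ℝ) (p : Ω → ℝ → Option Z) (ν : Measure Z)
    (V : Set Z) (l : Z → ℝ) (t : ℝ≥0) (ω : Ω) : ℝ :=
  noise W c p 0 t 1 (fun z => Real.exp (l z) - 1) ω - t * ∫ z in V, (Real.exp (l z) - 1) ∂ν

lemma noise_sub_noise {ω : Ω} {V : Set Z} (hω : LocFinite (p ω) V) {f : Z → ℝ}
    (hf0 : ∀ z ∉ V, f z = 0) (c : Fin d → ℝ) (α : ℝ) {s t : ℝ≥0} (hst : s ≤ t) :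
    noise W c p 0 t α f ω - noise W c p 0 s α f ω = noise W c p s t α f ω := by
  have := incSum_add_incSum hω hf0 (s := 0) (t := s) (u := t) zero_le hst
  unfold noise
  rw [← this]
  ring

lemma exp_sub_one_sub_le {x : ℝ} (hx : 0 ≤ x) : Real.exp x - 1 - x ≤ x ^ 2 * Real.exp x := by
  have h1 : Real.exp x - 1 ≤ x * Real.exp x := by
    have := Real.add_one_le_exp (-x)
    have h2 : Real.exp (-x) * Real.exp x = 1 := by rw [← Real.exp_add]; simp
    nlinarith [Real.exp_pos x]
  nlinarith [Real.exp_pos x, Real.add_one_le_exp x]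

lemma TendstoInMeasure.const_mul' (a : ℝ) {f : ℕ → Ω → ℝ} {g : Ω → ℝ}
    (hfg : TendstoInMeasure P f atTop g) :
    TendstoInMeasure P (fun k ω => a * f k ω) atTop (fun ω => a * g ω) := by
  rcases eq_or_ne a 0 with rfl | ha
  · simpa using tendstoInMeasure_const (P := P) (fun _ : Ω => (0 : ℝ))
  · rw [tendstoInMeasure_iff_norm] at hfg ⊢
    intro ε hε
    refine (hfg (ε / |a|) (by positivity)).congr fun k => ?_
    congr 1; ext ω
    simp only [mem_ofPred_eq, ← mul_sub, norm_mul, Real.norm_eq_abs]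
    rw [div_le_iff₀ (abs_pos.2 ha), mul_comm]

section Limit

variable [IsProbabilityMeasure P] [SFinite ν]

lemma logLevy_sub {c : Fin d → ℝ} {V : Set Z} (hp : IsPoissonPointProcess 𝓕 P ν p)
    (hV : MeasurableSet V) (hfin : ν V ≠ ∞) {l : Z → ℝ} (hl0 : ∀ z ∉ V, l z = 0)
    {s t : ℝ≥0} (hst : s ≤ t) :
    ∀ᵐ ω ∂P, logLevy W c p ν V l t ω - logLevy W c p ν V l s ω
      = noise W c p s t 1 l ω
        - ((t : ℝ) - s) * ((∑ k, c k ^ 2) / 2 + ∫ z in V, (Real.exp (l z) - 1) ∂ν) ∧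
      levyMart W c p ν V l t ω - levyMart W c p ν V l s ω
      = noise W c p s t 1 (fun z => Real.exp (l z) - 1) ω
        - ((t : ℝ) - s) * ∫ z in V, (Real.exp (l z) - 1) ∂ν := by
  filter_upwards [hp.ae_locFinite hV hfin] with ω hω
  have h1 := noise_sub_noise (W := W) hω hl0 c 1 hst
  have h2 := noise_sub_noise (W := W) hω (f := fun z => Real.exp (l z) - 1)
    (fun z hz => by simp [hl0 z hz]) c 1 hst
  unfold logLevy levyMart
  rw [← h1, ← h2]
  constructor <;> ring

/-- Limits of pairs of compound Poisson processes with drift. -/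
theorem isExpPair_of_tendstoInMeasure (hW : IsBrownianMotion 𝓕 P W)
    (hp : IsPoissonPointProcess 𝓕 P ν p)
    (hWp : Indep (processSigma W) (pointSigma p) P) (c : Fin d → ℝ)
    {V : ℕ → Set Z} (hV : ∀ k, MeasurableSet (V k)) (hfin : ∀ k, ν (V k) ≠ ∞)
    {l : ℕ → Z → ℝ} (hl : ∀ k, Measurable (l k)) (hl0 : ∀ k, ∀ z ∉ V k, l k z = 0)
    (hlC : ∀ k, ∃ C, ∀ z, |l k z| ≤ C) {v : ℝ}
    (hv : ∀ k, ∑ k, c k ^ 2 + ∫ z in V k, (Real.exp (l k z) - 1) ^ 2 ∂ν ≤ v)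
    {Y R : ℝ≥0 → Ω → ℝ}
    (hY : ∀ t, TendstoInMeasure P (fun k => logLevy W c p ν (V k) (l k) t) atTop (Y t))
    (hR : ∀ t, TendstoInMeasure P (fun k => levyMart W c p ν (V k) (l k) t) atTop (R t)) :
    IsExpPair 𝓕 P Y R (v + v ^ 2 * Real.exp v) := by
  set vk : ℕ → ℝ := fun k => ∑ k, c k ^ 2 + ∫ z in V k, (Real.exp (l k z) - 1) ^ 2 ∂ν with hvk
  have hvk0 : ∀ k, 0 ≤ vk k := fun k => add_nonneg (Finset.sum_nonneg fun _ _ => sq_nonneg _)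
    (integral_nonneg fun _ => sq_nonneg _)
  have hv0 : 0 ≤ v := (hvk0 0).trans (hv 0)
  have hγm : ∀ k, Measurable fun z => Real.exp (l k z) - 1 := fun k => (hl k).exp.sub_const 1
  have hγ0 : ∀ k, ∀ z ∉ V k, Real.exp (l k z) - 1 = 0 := fun k z hz => by simp [hl0 k z hz]
  have hYm : ∀ k t, AEStronglyMeasurable[𝓕 t] (logLevy W c p ν (V k) (l k) t) P := fun k t =>
    (noise_aestronglyMeasurable hW hp c (hV k) (hfin k) (hl k) (hl0 k) zero_le 1).sub
      aestronglyMeasurable_const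
  have hRm : ∀ k t, AEStronglyMeasurable[𝓕 t] (levyMart W c p ν (V k) (l k) t) P := fun k t =>
    (noise_aestronglyMeasurable hW hp c (hV k) (hfin k) (hγm k) (hγ0 k) zero_le 1).sub
      aestronglyMeasurable_const
  have hYa : ∀ t, AEStronglyMeasurable[𝓕 t] (Y t) P := fun t =>
    aestronglyMeasurable_sub_of_tendstoInMeasure (fun k => hYm k t) (hY t)
  have hRa : ∀ t, AEStronglyMeasurable[𝓕 t] (R t) P := fun t =>
    aestronglyMeasurable_sub_of_tendstoInMeasure (fun k => hRm k t) (hR t)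
  have hdY : ∀ s t, TendstoInMeasure P (fun k ω => logLevy W c p ν (V k) (l k) t ω
      - logLevy W c p ν (V k) (l k) s ω) atTop (fun ω => Y t ω - Y s ω) := fun s t =>
    TendstoInMeasure.sub' (hY t) (hY s)
  have hdR : ∀ s t, TendstoInMeasure P (fun k ω => levyMart W c p ν (V k) (l k) t ω
      - levyMart W c p ν (V k) (l k) s ω) atTop (fun ω => R t ω - R s ω) := fun s t =>
    TendstoInMeasure.sub' (hR t) (hR s)
  have hmom : ∀ k (s t : ℝ≥0), s ≤ t →
      (MemLp (fun ω => levyMart W c p ν (V k) (l k) t ω - levyMart W c p ν (V k) (l k) s ω) 2 P ∧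
        ∫ ω, (levyMart W c p ν (V k) (l k) t ω - levyMart W c p ν (V k) (l k) s ω) ∂P = 0 ∧
        ∫ ω, (levyMart W c p ν (V k) (l k) t ω - levyMart W c p ν (V k) (l k) s ω) ^ 2 ∂P
          = ((t : ℝ) - s) * vk k) ∧
      (MemLp (fun ω => Real.exp (logLevy W c p ν (V k) (l k) t ω - logLevy W c p ν (V k) (l k) s ω)
          - 1 - (levyMart W c p ν (V k) (l k) t ω - levyMart W c p ν (V k) (l k) s ω)) 2 P ∧
        ∫ ω, (Real.exp (logLevy W c p ν (V k) (l k) t ω - logLevy W c p ν (V k) (l k) s ω)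
          - 1 - (levyMart W c p ν (V k) (l k) t ω - levyMart W c p ν (V k) (l k) s ω)) ∂P = 0 ∧
        ∫ ω, (Real.exp (logLevy W c p ν (V k) (l k) t ω - logLevy W c p ν (V k) (l k) s ω)
          - 1 - (levyMart W c p ν (V k) (l k) t ω - levyMart W c p ν (V k) (l k) s ω)) ^ 2 ∂P
          = Real.exp (((t : ℝ) - s) * vk k) - 1 - ((t : ℝ) - s) * vk k) := by
    intro k s t hst
    obtain ⟨⟨a1, a2, a3⟩, b1, b2, b3⟩ := expPair_moments hW hp hWp c (hV k) (hfin k) hst (hl k)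
      (hl0 k) (hlC k) rfl (v := vk k) rfl (fun _ => rfl) (fun _ => rfl)
    have hae := logLevy_sub (W := W) (c := c) hp (hV k) (hfin k) (hl0 k) hst
    have e1 : ∀ φ : ℝ → ℝ → ℝ, (fun ω => φ (noise W c p s t 1 (l k) ω - ((t : ℝ) - s) *
        ((∑ k, c k ^ 2) / 2 + ∫ z in V k, (Real.exp (l k z) - 1) ∂ν))
        (noise W c p s t 1 (fun z => Real.exp (l k z) - 1) ω
          - ((t : ℝ) - s) * ∫ z in V k, (Real.exp (l k z) - 1) ∂ν))
        =ᵐ[P] fun ω => φ (logLevy W c p ν (V k) (l k) t ω - logLevy W c p ν (V k) (l k) s ω)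
          (levyMart W c p ν (V k) (l k) t ω - levyMart W c p ν (V k) (l k) s ω) := by
      intro φ
      filter_upwards [hae] with ω hω
      rw [hω.1, hω.2]
    refine ⟨⟨a1.ae_eq (e1 fun _ b => b), ?_, ?_⟩, b1.ae_eq (e1 fun a b => Real.exp a - 1 - b), ?_, ?_⟩
    · rw [← a2]; exact (integral_congr_ae (e1 fun _ b => b)).symm
    · rw [← a3]; exact (integral_congr_ae (e1 fun _ b => b ^ 2)).symm
    · rw [← b2]; exact (integral_congr_ae (e1 fun a b => Real.exp a - 1 - b)).symm
    · rw [← b3]; exact (integral_congr_ae (e1 fun a b => (Real.exp a - 1 - b) ^ 2)).symm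
  have hsqR : ∀ s t : ℝ≥0, s ≤ t → MemLp (fun ω => R t ω - R s ω) 2 P ∧
      ∫ ω, (R t ω - R s ω) ^ 2 ∂P ≤ ((t : ℝ) - s) * v := fun s t hst =>
    memLp_two_of_tendstoInMeasure (fun k => (hmom k s t hst).1.1) (fun k => by
      rw [(hmom k s t hst).1.2.2]
      exact mul_le_mul_of_nonneg_left (hv k) (sub_nonneg.2 (NNReal.coe_le_coe.2 hst))) (hdR s t)
  -- The exponential is not uniformly continuous, so the limit is taken along a subsequence on which
  -- both increments converge almost surely. A subsequence suffices, because the moment bounds hold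
  -- for every `k`.
  have hKlim : ∀ s t : ℝ≥0, s ≤ t → ∃ ns : ℕ → ℕ, TendstoInMeasure P (fun j ω =>
      Real.exp (logLevy W c p ν (V (ns j)) (l (ns j)) t ω - logLevy W c p ν (V (ns j)) (l (ns j)) s ω)
        - 1 - (levyMart W c p ν (V (ns j)) (l (ns j)) t ω
          - levyMart W c p ν (V (ns j)) (l (ns j)) s ω)) atTop
      (fun ω => Real.exp (Y t ω - Y s ω) - 1 - (R t ω - R s ω)) := by
    intro s t _
    obtain ⟨n1, hn1, h1⟩ := (hdY s t).exists_seq_tendsto_ae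
    have hR' : TendstoInMeasure P (fun j ω => levyMart W c p ν (V (n1 j)) (l (n1 j)) t ω
        - levyMart W c p ν (V (n1 j)) (l (n1 j)) s ω) atTop (fun ω => R t ω - R s ω) :=
      fun ε hε => (hdR s t ε hε).comp hn1.tendsto_atTop
    obtain ⟨n2, hn2, h2⟩ := hR'.exists_seq_tendsto_ae
    refine ⟨fun j => n1 (n2 j), tendstoInMeasure_of_tendsto_ae (fun j => ?_) ?_⟩
    · have hYm' := fun k t => (hYm k t).mono (𝓕.le t)
      have hRm' := fun k t => (hRm k t).mono (𝓕.le t)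
      exact ((Real.continuous_exp.comp_aestronglyMeasurable ((hYm' _ t).sub (hYm' _ s))).sub
        aestronglyMeasurable_const).sub ((hRm' _ t).sub (hRm' _ s))
    · filter_upwards [h1, h2] with ω g1 g2
      exact (((Real.continuous_exp.tendsto _).comp (g1.comp hn2.tendsto_atTop)).sub_const 1).sub g2
  have hKbd : ∀ k (s t : ℝ≥0), s ≤ t →
      Real.exp (((t : ℝ) - s) * vk k) - 1 - ((t : ℝ) - s) * vk k
        ≤ (((t : ℝ) - s) * v) ^ 2 * Real.exp (((t : ℝ) - s) * v) := by
    intro k s t hst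
    have h0 : 0 ≤ (t : ℝ) - s := sub_nonneg.2 (NNReal.coe_le_coe.2 hst)
    have h1 : ((t : ℝ) - s) * vk k ≤ ((t : ℝ) - s) * v := mul_le_mul_of_nonneg_left (hv k) h0
    refine (exp_sub_one_sub_le (mul_nonneg h0 (hvk0 k))).trans ?_
    have := mul_nonneg h0 (hvk0 k)
    gcongr
  have hsqK : ∀ s t : ℝ≥0, s ≤ t →
      (MemLp (fun ω => Real.exp (Y t ω - Y s ω) - 1 - (R t ω - R s ω)) 2 P ∧
      ∫ ω, (Real.exp (Y t ω - Y s ω) - 1 - (R t ω - R s ω)) ^ 2 ∂P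
        ≤ (((t : ℝ) - s) * v) ^ 2 * Real.exp (((t : ℝ) - s) * v)) ∧
      ∫ ω, (Real.exp (Y t ω - Y s ω) - 1 - (R t ω - R s ω)) ∂P = 0 := by
    intro s t hst
    obtain ⟨ns, hns⟩ := hKlim s t hst
    have hb := fun j => (hmom (ns j) s t hst).2.2.2.le.trans (hKbd (ns j) s t hst)
    refine ⟨memLp_two_of_tendstoInMeasure (fun j => (hmom (ns j) s t hst).2.1) hb hns, ?_⟩
    have := tendsto_integral_of_tendstoInMeasure (fun j => (hmom (ns j) s t hst).2.1) hb hns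
    simp_rw [fun j => (hmom (ns j) s t hst).2.2.1] at this
    exact (tendsto_nhds_unique this tendsto_const_nhds)
  -- One constant serves both estimates: `v` for the variance of `R`, and `v² exp v` for the defect
  -- over steps of length at most `1`.
  have hvle : v ≤ v + v ^ 2 * Real.exp v := by have := Real.exp_pos v; nlinarith [sq_nonneg v]
  refine ⟨by positivity, hYa, hRa, ?_, fun s t hst => (hsqR s t hst).1, ?_, ?_,
    fun s t hst => (hsqK s t hst).1.1, fun s t hst => (hsqK s t hst).2, ?_⟩
  · intro s t hst
    refine indepPast_pair_of_charIndep (𝓕.le s)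
      (((hYa t).mono (𝓕.le t)).sub ((hYa s).mono (𝓕.le s)))
      (((hRa t).mono (𝓕.le t)).sub ((hRa s).mono (𝓕.le s))) fun a b => ?_
    -- A combination of the two increments is again a single noise plus a constant, so the
    -- factorization for one noise yields the independence of the pair.
    have hlim : TendstoInMeasure P (fun k ω => noise W c p s t (a + b)
        (fun z => a * l k z + b * (Real.exp (l k z) - 1)) ω
        + (-(a * (((t : ℝ) - s) * ((∑ k, c k ^ 2) / 2 + ∫ z in V k, (Real.exp (l k z) - 1) ∂ν)))
          - b * (((t : ℝ) - s) * ∫ z in V k, (Real.exp (l k z) - 1) ∂ν))) atTop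
        (fun ω => a * (Y t ω - Y s ω) + b * (R t ω - R s ω)) := by
      refine TendstoInMeasure.congr_ev (TendstoInMeasure.add'
        (TendstoInMeasure.const_mul' a (hdY s t)) (TendstoInMeasure.const_mul' b (hdR s t))) (Eventually.of_forall fun k => ?_)
      filter_upwards [logLevy_sub (W := W) (c := c) hp (hV k) (hfin k) (hl0 k) hst,
        hp.ae_locFinite (hV k) (hfin k)] with ω hω hfω
      rw [hω.1, hω.2]
      have h1 : noise W c p s t (a + b) (fun z => a * l k z + b * (Real.exp (l k z) - 1)) ω
          = a * noise W c p s t 1 (l k) ω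
            + b * noise W c p s t 1 (fun z => Real.exp (l k z) - 1) ω := by
        unfold noise
        rw [incSum_add hfω (f := fun z => a * l k z) (g := fun z => b * (Real.exp (l k z) - 1))
          (fun z hz => by simp [hl0 k z hz]) (fun z hz => by simp [hl0 k z hz]),
          incSum_const_mul hfω (hl0 k), incSum_const_mul hfω (hγ0 k)]
        ring
      rw [h1]
      ring
    refine CharIndep.of_tendstoInMeasure (𝓕.le s) (fun k => ?_) (fun k => ?_) hlim
    · exact (charIndep_noise hW hp hWp c (hV k) (hfin k) hst (a + b)
        (((hl k).const_mul a).add ((hγm k).const_mul b))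
        (fun z hz => by simp [hl0 k z hz])).add_const _
    · exact ((noise_aestronglyMeasurable hW hp c (hV k) (hfin k)
        (((hl k).const_mul a).add ((hγm k).const_mul b))
        (fun z hz => by simp [hl0 k z hz]) hst (a + b)).mono (𝓕.le t)).add
        aestronglyMeasurable_const
  · intro s t hst
    have := tendsto_integral_of_tendstoInMeasure (fun k => (hmom k s t hst).1.1)
      (V := ((t : ℝ) - s) * v) (fun k => by
        rw [(hmom k s t hst).1.2.2]
        exact mul_le_mul_of_nonneg_left (hv k) (sub_nonneg.2 (NNReal.coe_le_coe.2 hst))) (hdR s t)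
    simp_rw [fun k => (hmom k s t hst).1.2.1] at this
    exact (tendsto_nhds_unique this tendsto_const_nhds)
  · intro s t hst
    refine (hsqR s t hst).2.trans ?_
    rw [mul_comm]
    exact mul_le_mul_of_nonneg_right hvle (sub_nonneg.2 (NNReal.coe_le_coe.2 hst))
  · intro s t hst h1
    have h0 : 0 ≤ (t : ℝ) - s := sub_nonneg.2 (NNReal.coe_le_coe.2 hst)
    refine (hsqK s t hst).1.2.trans ?_
    calc (((t : ℝ) - s) * v) ^ 2 * Real.exp (((t : ℝ) - s) * v)
        ≤ (((t : ℝ) - s) * v) ^ 2 * Real.exp (1 * v) := by gcongr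
      _ = (v ^ 2 * Real.exp v) * ((t : ℝ) - s) ^ 2 := by rw [one_mul]; ring
      _ ≤ _ := by
          gcongr
          linarith

end Limit

end

/-! ### Jump sizes of prices and log-prices, and their truncations. -/

section

variable {Ω Z : Type*} {mΩ : MeasurableSpace Ω} [MeasurableSpace Z] {P : Measure Ω}
  {𝓕 : Filtration ℝ≥0 mΩ} {ν : Measure Z} {p : Ω → ℝ → Option Z} {d : ℕ}
  {W : ℝ≥0 → Ω → Fin d → ℝ}

/-- Integrability of jump sizes `γ` of prices and `l = log (1 + γ)` of log-prices. -/
structure IsJumpSize (ν : Measure Z) (Z₀ : Set Z) (γ l : Z → ℝ) : Prop where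
  meas_set : MeasurableSet Z₀
  compl_lt : ν Z₀ᶜ < ∞
  meas : Measurable γ
  meas_log : Measurable l
  exp_eq : ∀ z, Real.exp (l z) = 1 + γ z
  sq : IntegrableOn (fun z => γ z ^ 2) Z₀ ν
  log : IntegrableOn (fun z => l z - γ z) Z₀ ν

/-- The jumps of size `|l| ≤ K` which lie off `Z₀` or satisfy `|f| > 1 / (k + 1)`. -/
def midJumps (Z₀ : Set Z) (f l : Z → ℝ) (K : ℝ) (k : ℕ) : Set Z :=
  {z | |l z| ≤ K ∧ (z ∉ Z₀ ∨ 1 / ((k : ℝ) + 1) < |f z|)}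

lemma abs_le_exp_mul_abs_exp_sub_one {x K : ℝ} (hx : |x| ≤ K) :
    |x| ≤ Real.exp K * |Real.exp x - 1| := by
  have hK1 : 1 ≤ Real.exp K := Real.one_le_exp ((abs_nonneg x).trans hx)
  rcases le_total 0 x with h | h
  · have h1 := Real.add_one_le_exp x
    rw [abs_of_nonneg h, abs_of_nonneg (by linarith)]
    nlinarith
  · have h1 := Real.add_one_le_exp (-x)
    have h2 : Real.exp (-x) * Real.exp x = 1 := by rw [← Real.exp_add]; simp
    have h3 : Real.exp x ≤ 1 := Real.exp_le_one_iff.2 h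
    have h4 : Real.exp (-x) ≤ Real.exp K := Real.exp_le_exp.2 (by rwa [abs_of_nonpos h] at hx)
    rw [abs_of_nonpos h, abs_of_nonpos (by linarith)]
    nlinarith [Real.exp_pos x]

namespace IsJumpSize

variable {Z₀ : Set Z} {γ l : Z → ℝ}

lemma eq_exp_sub_one (h : IsJumpSize ν Z₀ γ l) (z : Z) : γ z = Real.exp (l z) - 1 := by
  rw [h.exp_eq]; ring

/-- Away from zero `|γ|` cannot be small, and near zero `l` and `γ` are comparable. This transfers
the square integrability of `γ` on `Z₀` to truncations of `l`. -/
lemma min_abs_log_le (h : IsJumpSize ν Z₀ γ l) (z : Z) : min |l z| 1 ≤ Real.exp 1 * |γ z| := by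
  rw [h.eq_exp_sub_one]
  rcases le_total |l z| 1 with h1 | h1
  · rw [min_eq_left h1]
    exact abs_le_exp_mul_abs_exp_sub_one h1
  · rw [min_eq_right h1]
    have e1 : (2 : ℝ) ≤ Real.exp 1 := by have := Real.add_one_le_exp (1 : ℝ); linarith
    rcases le_total 0 (l z) with h2 | h2
    · rw [abs_of_nonneg h2] at h1
      have := Real.add_one_le_exp (l z)
      rw [abs_of_nonneg (by linarith)]
      nlinarith
    · rw [abs_of_nonpos h2] at h1
      have h3 : Real.exp (l z) ≤ Real.exp (-1) := Real.exp_le_exp.2 (by linarith)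
      have h4 : Real.exp (-1) * Real.exp 1 = 1 := by rw [← Real.exp_add]; simp
      rw [abs_of_nonpos (by nlinarith [Real.exp_pos (-1)])]
      nlinarith [Real.exp_pos (-1)]

lemma measure_lt_abs_ne_top (h : IsJumpSize ν Z₀ γ l) {ε : ℝ} (hε : 0 < ε) :
    ν {z | z ∉ Z₀ ∨ ε < |γ z|} ≠ ∞ := by
  have h1 : ν (Z₀ ∩ {z | ε < |γ z|}) < ∞ := by
    have := Integrable.measure_norm_ge_lt_top h.sq (ε := ε ^ 2) (by positivity)
    rw [Measure.restrict_apply' h.meas_set] at this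
    refine lt_of_le_of_lt (measure_mono ?_) this
    rintro z ⟨hz, hz'⟩
    refine ⟨?_, hz⟩
    simp only [mem_ofPred_eq] at hz' ⊢
    rw [Real.norm_eq_abs, abs_pow]
    exact pow_le_pow_left₀ hε.le hz'.le 2
  refine ne_top_of_le_ne_top (ENNReal.add_lt_top.2 ⟨h.compl_lt, h1⟩).ne
    ((measure_mono ?_).trans (measure_union_le _ _))
  intro z hz
  by_cases hz0 : z ∈ Z₀
  · exact Or.inr ⟨hz0, hz.resolve_left (not_not.2 hz0)⟩
  · exact Or.inl hz0

lemma measure_lt_abs_log_ne_top (h : IsJumpSize ν Z₀ γ l) {ε : ℝ} (hε : 0 < ε) :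
    ν {z | z ∉ Z₀ ∨ ε < |l z|} ≠ ∞ := by
  have hpos : 0 < min ε 1 / (2 * Real.exp 1) := by positivity
  refine ne_top_of_le_ne_top (h.measure_lt_abs_ne_top hpos) (measure_mono ?_)
  rintro z (hz | hz)
  · exact Or.inl hz
  · right
    have h1 := h.min_abs_log_le z
    have h2 : min ε 1 ≤ min |l z| 1 := min_le_min_right _ hz.le
    have h3 : 0 < min ε 1 := by positivity
    rw [div_lt_iff₀ (by positivity)]
    nlinarith [Real.exp_pos 1]

lemma measurableSet_large (h : IsJumpSize ν Z₀ γ l) (K : ℝ) : MeasurableSet {z | K < |l z|} :=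
  measurableSet_lt measurable_const h.meas_log.abs

lemma measure_large_ne_top (h : IsJumpSize ν Z₀ γ l) {K : ℝ} (hK : 0 < K) :
    ν {z | K < |l z|} ≠ ∞ :=
  ne_top_of_le_ne_top (h.measure_lt_abs_log_ne_top hK) (measure_mono fun _ hz => Or.inr hz)

lemma measurableSet_midJumps (h : IsJumpSize ν Z₀ γ l) {f : Z → ℝ} (hf : Measurable f) (K : ℝ)
    (k : ℕ) : MeasurableSet (midJumps Z₀ f l K k) :=
  (measurableSet_le h.meas_log.abs measurable_const).inter
    (h.meas_set.compl.union (measurableSet_lt measurable_const hf.abs))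

lemma measure_midJumps_ne_top (h : IsJumpSize ν Z₀ γ l) (K : ℝ) (k : ℕ) :
    ν (midJumps Z₀ γ l K k) ≠ ∞ :=
  ne_top_of_le_ne_top (h.measure_lt_abs_ne_top (ε := 1 / ((k : ℝ) + 1)) (by positivity))
    (measure_mono fun _ hz => hz.2)

lemma measure_midJumps_log_ne_top (h : IsJumpSize ν Z₀ γ l) (K : ℝ) (k : ℕ) :
    ν (midJumps Z₀ l l K k) ≠ ∞ :=
  ne_top_of_le_ne_top (h.measure_lt_abs_log_ne_top (ε := 1 / ((k : ℝ) + 1)) (by positivity))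
    (measure_mono fun _ hz => hz.2)

lemma integrableOn_of_finite (h : IsJumpSize ν Z₀ γ l) {U : Set Z} (hU : ν U ≠ ∞) :
    IntegrableOn γ (Z₀ ∩ U) ν := by
  have : IsFiniteMeasure (ν.restrict (Z₀ ∩ U)) := ⟨by
    rw [Measure.restrict_apply_univ]
    exact (measure_mono inter_subset_right).trans_lt hU.lt_top⟩
  have h2 : MemLp γ 2 (ν.restrict (Z₀ ∩ U)) :=
    (memLp_two_iff_integrable_sq h.meas.aestronglyMeasurable).2
      (h.sq.mono_set inter_subset_left)
  exact h2.integrable one_le_two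

lemma integrableOn_log_of_finite (h : IsJumpSize ν Z₀ γ l) {U : Set Z} (hU : ν U ≠ ∞) :
    IntegrableOn l (Z₀ ∩ U) ν := by
  refine ((h.log.mono_set (inter_subset_left (t := U))).add
    (h.integrableOn_of_finite hU)).congr (ae_of_all _ fun z => ?_)
  simp

/-- Where `|l| ≤ K`, the mean value estimate `|l| ≤ exp K * |γ|` holds. -/
lemma integrableOn_log_sq (h : IsJumpSize ν Z₀ γ l) (K : ℝ) :
    IntegrableOn (fun z => l z ^ 2) (Z₀ ∩ {z | |l z| ≤ K}) ν := by
  refine Integrable.mono' ((h.sq.mono_set inter_subset_left).const_mul (Real.exp K ^ 2))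
    (h.meas_log.pow_const 2).aestronglyMeasurable ?_
  refine (ae_restrict_iff' (h.meas_set.inter (measurableSet_le h.meas_log.abs
    measurable_const))).2 (ae_of_all _ fun z hz => ?_)
  rw [Real.norm_eq_abs, abs_of_nonneg (sq_nonneg _), ← mul_pow, ← sq_abs]
  conv_rhs => rw [← sq_abs, abs_mul, Real.abs_exp]
  refine pow_le_pow_left₀ (abs_nonneg _) ?_ 2
  rw [h.eq_exp_sub_one]
  exact abs_le_exp_mul_abs_exp_sub_one hz.2

end IsJumpSize

/-! ### Cutting off the large jumps -/

section Cut

variable [IsProbabilityMeasure P] [SFinite ν] {Z₀ : Set Z} {γ l : Z → ℝ}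

/-- The part of a jump integral due to the jumps with `|l| ≤ K`. -/
lemma IsJumpIntegral.tendsto_midJumps (hp : IsPoissonPointProcess 𝓕 P ν p)
    {f J : _} (hJ : IsJumpIntegral P ν Z₀ p f J) (hZ₀ : MeasurableSet Z₀) (hf : Measurable f)
    (hl : Measurable l) (K : ℝ)
    (hfin : ∀ k : ℕ, ν {z | z ∉ Z₀ ∨ 1 / ((k : ℝ) + 1) < |f z|} ≠ ∞)
    (hint : ∀ U, ν U ≠ ∞ → IntegrableOn f (Z₀ ∩ U) ν)
    (hsub : ∀ᶠ k : ℕ in atTop, {z | K < |l z|} ⊆ {z | z ∉ Z₀ ∨ 1 / ((k : ℝ) + 1) < |f z|})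
    (t : ℝ≥0) :
    TendstoInMeasure P (fun (k : ℕ) ω => incSum (p ω) ((midJumps Z₀ f l K k).indicator f) 0 t
        - t * ∫ z in Z₀ ∩ midJumps Z₀ f l K k, f z ∂ν) atTop
      (fun ω => J t ω - (incSum (p ω) ({z | K < |l z|}.indicator f) 0 t
        - t * ∫ z in Z₀ ∩ {z | K < |l z|}, f z ∂ν)) := by
  refine TendstoInMeasure.congr_ev (TendstoInMeasure.sub' (hJ.limit t)
    (tendstoInMeasure_const _)) ?_
  filter_upwards [hsub] with k hk
  set U : Set Z := {z | z ∉ Z₀ ∨ 1 / ((k : ℝ) + 1) < |f z|} with hU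
  set B : Set Z := {z | K < |l z|} with hB
  set M := midJumps Z₀ f l K k with hM
  have hBm : MeasurableSet B := measurableSet_lt measurable_const hl.abs
  have hUm : MeasurableSet U := hZ₀.compl.union (measurableSet_lt measurable_const hf.abs)
  have hMm : MeasurableSet M := (measurableSet_le hl.abs measurable_const).inter hUm
  -- For the indices at hand the cutoff loses no large jump, so the approximating sums split exactly
  -- into the fixed large jumps and the intermediate ones.
  have hUBM : U = B ∪ M := by
    ext z
    constructor
    · intro hz
      by_cases hzB : K < |l z|
      · exact Or.inl hzB
      · exact Or.inr ⟨not_lt.1 hzB, hz⟩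
    · rintro (hz | hz)
      · exact hk hz
      · exact hz.2
  have hdisj : Disjoint B M := by
    rw [Set.disjoint_left]
    intro z hz hz'
    exact absurd hz'.1 (not_le.2 hz)
  have hint2 : ∫ z in Z₀ ∩ {z | 1 / ((k : ℝ) + 1) < |f z|}, f z ∂ν
      = ∫ z in Z₀ ∩ B, f z ∂ν + ∫ z in Z₀ ∩ M, f z ∂ν := by
    have h1 : Z₀ ∩ {z | 1 / ((k : ℝ) + 1) < |f z|} = (Z₀ ∩ B) ∪ (Z₀ ∩ M) := by
      rw [← inter_union_distrib_left, ← hUBM]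
      ext z
      simp only [hU, mem_inter_iff, mem_ofPred_eq]
      tauto
    rw [h1]
    refine setIntegral_union (hdisj.mono inter_subset_right inter_subset_right) (hZ₀.inter hMm)
      (hint B (ne_top_of_le_ne_top (hfin k) (measure_mono hk)))
      (hint M (ne_top_of_le_ne_top (hfin k) (measure_mono fun z hz => hz.2)))
  filter_upwards [hp.ae_locFinite hUm (hfin k)] with ω hω
  rw [jumpSum_eq_incSum (hp.dom_pos ω), hint2]
  have h2 : U.indicator f = fun z => B.indicator f z + M.indicator f z := by
    rw [hUBM, indicator_union_of_disjoint hdisj]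
  rw [h2, incSum_add hω (f := B.indicator f) (g := M.indicator f)
    (fun z hz => indicator_of_notMem (fun h => hz (hk h)) _)
    (fun z hz => indicator_of_notMem (fun h => hz h.2) _)]
  ring

/-- Replacing the cutoff `|l| > 1 / (k + 1)` by `|γ| > 1 / (k + 1)`. -/
lemma IsJumpSize.tendsto_cutoff_sub (h : IsJumpSize ν Z₀ γ l) (hW : IsBrownianMotion 𝓕 P W)
    (hp : IsPoissonPointProcess 𝓕 P ν p) (hWp : Indep (processSigma W) (pointSigma p) P)
    {K : ℝ} (hK : 0 ≤ K) (t : ℝ≥0) :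
    TendstoInMeasure P (fun (k : ℕ) ω =>
      (incSum (p ω) ((midJumps Z₀ γ l K k).indicator l) 0 t
        - t * ∫ z in Z₀ ∩ midJumps Z₀ γ l K k, l z ∂ν)
      - (incSum (p ω) ((midJumps Z₀ l l K k).indicator l) 0 t
        - t * ∫ z in Z₀ ∩ midJumps Z₀ l l K k, l z ∂ν)) atTop (fun _ => 0) := by
  set M : ℕ → Set Z := midJumps Z₀ γ l K with hM
  set M' : ℕ → Set Z := midJumps Z₀ l l K with hM'
  have hMm := h.measurableSet_midJumps h.meas K
  have hMm' := h.measurableSet_midJumps h.meas_log K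
  have hMf := h.measure_midJumps_ne_top K
  have hMf' := h.measure_midJumps_log_ne_top K
  set g : ℕ → Z → ℝ := fun k z => (M k).indicator l z - (M' k).indicator l z with hg
  have hgm : ∀ k, Measurable (g k) := fun k =>
    (h.meas_log.indicator (hMm k)).sub (h.meas_log.indicator (hMm' k))
  have hg0 : ∀ k, ∀ z ∉ M k ∪ M' k, g k z = 0 := fun k z hz => by
    have h1 : z ∉ M k := fun h => hz (Or.inl h)
    have h2 : z ∉ M' k := fun h => hz (Or.inr h)
    simp [hg, h1, h2]
  have hbd : ∀ (N : Set Z), (∀ z ∈ N, |l z| ≤ K) → ∀ z, |N.indicator l z| ≤ K := by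
    intro N hN z
    by_cases hz : z ∈ N
    · simpa [hz] using hN z hz
    · simpa [hz] using hK
  have hb1 : ∀ k z, |(M k).indicator l z| ≤ K := fun k => hbd _ fun z hz => hz.1
  have hb2 : ∀ k z, |(M' k).indicator l z| ≤ K := fun k => hbd _ fun z hz => hz.1
  have hUm : ∀ k, MeasurableSet (M k ∪ M' k) := fun k => (hMm k).union (hMm' k)
  have hUf : ∀ k, ν (M k ∪ M' k) ≠ ∞ := fun k => (measure_union_lt_top (hMf k).lt_top
    (hMf' k).lt_top).ne
  have hmom := fun k => compensated_incSum_moments hW hp hWp (hUm k) (hUf k)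
    (zero_le (a := t)) (hgm k) (hg0 k) ⟨K + K, fun z => (abs_sub _ _).trans
      (add_le_add (hb1 k z) (hb2 k z))⟩
  -- Off `Z₀` neither cutoff acts, so the two truncations differ only on `Z₀`, where `l` is square
  -- integrable below `K`.
  have hgZ : ∀ k, ∀ z ∉ Z₀ ∩ {z | |l z| ≤ K}, g k z = 0 := by
    intro k z hz
    by_cases h1 : |l z| ≤ K
    · have h2 : z ∉ Z₀ := fun h => hz ⟨h, h1⟩
      have h3 : z ∈ M k := ⟨h1, Or.inl h2⟩
      have h4 : z ∈ M' k := ⟨h1, Or.inl h2⟩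
      simp [hg, h3, h4]
    · have h3 : z ∉ M k := fun h => h1 h.1
      have h4 : z ∉ M' k := fun h => h1 h.1
      simp [hg, h3, h4]
  have hgsq : ∀ k z, g k z ^ 2 ≤ l z ^ 2 := by
    intro k z
    by_cases h1 : z ∈ M k <;> by_cases h2 : z ∈ M' k <;> simp [hg, h1, h2, sq_nonneg]
  -- The functions `l` and `γ` have the same zeros. Elsewhere both cutoffs are eventually passed and
  -- the difference vanishes; `l²` dominates, and the isometry turns this into convergence in
  -- probability.
  have hlim0 : Tendsto (fun k => ∫ z in Z₀ ∩ {z | |l z| ≤ K}, g k z ^ 2 ∂ν) atTop (𝓝 0) := by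
    rw [← integral_zero Z ℝ (μ := ν.restrict (Z₀ ∩ {z | |l z| ≤ K}))]
    refine tendsto_integral_of_dominated_convergence (fun z => l z ^ 2)
      (fun k => ((hgm k).pow_const 2).aestronglyMeasurable) (h.integrableOn_log_sq K)
      (fun k => ae_of_all _ fun z => ?_) (ae_of_all _ fun z => ?_)
    · rw [Real.norm_eq_abs, abs_of_nonneg (sq_nonneg _)]
      exact hgsq k z
    · by_cases hz : l z = 0
      · have : ∀ k, g k z = 0 := fun k => by
          have := hgsq k z
          rw [hz] at this
          nlinarith [sq_nonneg (g k z)]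
        simp [this]
      · have hγ0 : γ z ≠ 0 := by
          rw [h.eq_exp_sub_one]
          intro h0
          exact hz (by rw [sub_eq_zero, Real.exp_eq_one_iff] at h0; exact h0)
        have hinv : Tendsto (fun k : ℕ => 1 / ((k : ℝ) + 1)) atTop (𝓝 0) :=
          tendsto_one_div_add_atTop_nhds_zero_nat
        refine tendsto_const_nhds.congr' ?_
        filter_upwards [hinv.eventually (gt_mem_nhds (abs_pos.2 hz)),
          hinv.eventually (gt_mem_nhds (abs_pos.2 hγ0))] with k h1 h2
        by_cases hzK : |l z| ≤ K
        · have h3 : z ∈ M k := ⟨hzK, Or.inr h2⟩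
          have h4 : z ∈ M' k := ⟨hzK, Or.inr h1⟩
          simp [hg, h3, h4]
        · rw [hgZ k z fun h => hzK h.2]; simp
  have hcut : ∀ k (φ : ℝ → ℝ), φ 0 = 0 → ∫ z in M k ∪ M' k, φ (g k z) ∂ν
      = ∫ z in Z₀ ∩ {z | |l z| ≤ K}, φ (g k z) ∂ν := by
    intro k φ hφ
    rw [setIntegral_eq_integral_of_forall_compl_eq_zero fun z hz => by rw [hg0 k z hz, hφ],
      setIntegral_eq_integral_of_forall_compl_eq_zero fun z hz => by rw [hgZ k z hz, hφ]]
  have hsq0 := tendstoInMeasure_zero_of_sq (fun k => (hmom k).1) (by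
    simp_rw [fun k => (hmom k).2.2, fun k => hcut k (fun x => x ^ 2) (by simp)]
    simpa using hlim0.const_mul ((t : ℝ) - (0 : ℝ≥0)))
  refine TendstoInMeasure.congr_ev hsq0 (Eventually.of_forall fun k => ?_)
  have hi1 : IntegrableOn l (Z₀ ∩ M k) ν := h.integrableOn_log_of_finite (hMf k)
  have hi2 : IntegrableOn l (Z₀ ∩ M' k) ν := h.integrableOn_log_of_finite (hMf' k)
  have hm1 := h.meas_set.inter (hMm k)
  have hm2 := h.meas_set.inter (hMm' k)
  have hintg : ∫ z in M k ∪ M' k, g k z ∂ν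
      = ∫ z in Z₀ ∩ M k, l z ∂ν - ∫ z in Z₀ ∩ M' k, l z ∂ν := by
    rw [setIntegral_eq_integral_of_forall_compl_eq_zero (hg0 k), ← integral_indicator hm1,
      ← integral_indicator hm2, ← integral_sub (hi1.integrable_indicator hm1)
      (hi2.integrable_indicator hm2)]
    congr 1
    ext z
    by_cases hz : z ∈ Z₀
    · by_cases h1 : z ∈ M k <;> by_cases h2 : z ∈ M' k <;> simp [hg, h1, h2, hz]
    · rw [hgZ k z fun h => hz h.1]
      simp [hz]
  filter_upwards [hp.ae_locFinite (hUm k) (hUf k)] with ω hω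
  rw [hintg, hg, incSum_sub hω (f := (M k).indicator l) (g := (M' k).indicator l)
    (fun z hz => indicator_of_notMem (fun h => hz (Or.inl h)) _)
    (fun z hz => indicator_of_notMem (fun h => hz (Or.inr h)) _)]
  simp only [NNReal.coe_zero, sub_zero]
  ring

end Cut

end

/-! ### Limits of the truncated Lévy pairs in terms of the given jump integrals. -/

section

lemma eq_of_eqOn_dense {f g : ℝ≥0 → ℝ} (hf : ∀ t, ContinuousWithinAt f (Ici t) t)
    (hg : ∀ t, ContinuousWithinAt g (Ici t) t) {D : Set ℝ≥0} (hD : Dense D)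
    (h : ∀ t ∈ D, f t = g t) (t : ℝ≥0) : f t = g t := by
  have h1 : t ∈ closure (Ioi t ∩ D) := by
    have h2 : Ioi t ⊆ closure (Ioi t ∩ D) := hD.open_subset_closure_inter isOpen_Ioi
    have h3 : t ∈ closure (Ioi t) := by rw [closure_Ioi]; exact self_mem_Ici
    exact closure_minimal h2 isClosed_closure h3
  have := mem_closure_iff_nhdsWithin_neBot.1 h1
  have hsub : 𝓝[Ioi t ∩ D] t ≤ 𝓝[Ici t] t :=
    nhdsWithin_mono t fun x hx => (mem_Ioi.1 hx.1).le
  refine tendsto_nhds_unique ((hf t).tendsto.mono_left hsub) (((hg t).tendsto.mono_left hsub).congr' ?_)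
  filter_upwards [self_mem_nhdsWithin] with u hu
  exact (h u hu.2).symm

variable {Ω Z : Type*} {mΩ : MeasurableSpace Ω} [MeasurableSpace Z] {P : Measure Ω}
  {𝓕 : Filtration ℝ≥0 mΩ} {ν : Measure Z} {p : Ω → ℝ → Option Z} {d : ℕ}
  {W : ℝ≥0 → Ω → Fin d → ℝ}

lemma incSum_eq_zero {q : ℝ → Option Z} {f : Z → ℝ} {s t : ℝ≥0}
    (h : ∀ r : ℝ, r ≤ t → ∀ z, q r = some z → f z = 0) : incSum q f s t = 0 := by
  unfold incSum
  refine finsum_mem_eq_zero_of_forall_eq_zero fun r hr => ?_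
  cases hq : q r with
  | none => rfl
  | some z => exact h r hr.2 z hq

lemma exists_bound_incSum {q : ℝ → Option Z} {V : Set Z} (h : LocFinite q V) {f : Z → ℝ}
    (hf : ∀ z ∉ V, f z = 0) (t : ℝ≥0) : ∃ C, ∀ u ≤ t, |incSum q f 0 u| ≤ C := by
  refine ⟨∑ r ∈ (h.finite_Ioc 0 t).toFinset, |(q r).elim 0 f|, fun u hu => ?_⟩
  rw [incSum_eq_sum h hf]
  refine (Finset.abs_sum_le_sum_abs _ _).trans (Finset.sum_le_sum_of_subset_of_nonneg ?_
    fun _ _ _ => abs_nonneg _)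
  intro r hr
  simp only [Set.Finite.mem_toFinset, mem_ofPred_eq] at hr ⊢
  exact ⟨⟨hr.1.1, hr.1.2.trans (NNReal.coe_le_coe.2 hu)⟩, hr.2⟩

lemma IsBrownianMotion.ae_linComb (hW : IsBrownianMotion 𝓕 P W) (c : Fin d → ℝ) :
    ∀ᵐ ω ∂P, Continuous (fun t => linComb W c t ω) ∧ linComb W c 0 ω = 0 := by
  filter_upwards [ae_all_iff.2 fun k => (hW.component k).cont,
    ae_all_iff.2 fun k => (hW.component k).eval_zero_ae_eq_zero] with ω h1 h2
  refine ⟨continuous_finsetSum _ fun k _ => (h1 k).const_smul (c k), ?_⟩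
  exact Finset.sum_eq_zero fun k _ => by
    have := h2 k
    simp only [this, mul_zero]

lemma IsJumpIntegral.ae_zero [IsFiniteMeasure P] {Z₀ : Set Z} {f : Z → ℝ} {J : ℝ≥0 → Ω → ℝ}
    (hp : IsPoissonPointProcess 𝓕 P ν p) (hJ : IsJumpIntegral P ν Z₀ p f J) :
    ∀ᵐ ω ∂P, J 0 ω = 0 := by
  have h := hJ.limit 0
  have h0 : ∀ (k : ℕ), (fun ω => jumpSum (p ω) {z | z ∉ Z₀ ∨ 1 / ((k : ℝ) + 1) < |f z|} f 0
        - ((0 : ℝ≥0) : ℝ) * ∫ z in Z₀ ∩ {z | 1 / ((k : ℝ) + 1) < |f z|}, f z ∂ν) = fun _ => 0 := by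
    intro k
    ext ω
    rw [jumpSum_eq_incSum (hp.dom_pos ω), incSum_self]
    simp
  have h : TendstoInMeasure P (fun (_ : ℕ) (_ : Ω) => (0 : ℝ)) atTop (J 0) :=
    TendstoInMeasure.congr_ev h (Eventually.of_forall fun k => ae_of_all _ fun ω =>
      congrFun (h0 k) ω)
  filter_upwards [tendstoInMeasure_ae_unique h (tendstoInMeasure_const fun _ => 0)] with ω hω
  exact hω

section Levy

variable [IsProbabilityMeasure P] [SFinite ν] {Z₀ : Set Z} {γ l : Z → ℝ}

lemma indicator_midJumps_exp (h : IsJumpSize ν Z₀ γ l) (U : Set Z) :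
    (fun z => Real.exp (U.indicator l z) - 1) = U.indicator γ := by
  ext z
  by_cases hz : z ∈ U
  · simp [hz, h.eq_exp_sub_one]
  · simp [hz]

lemma IsJumpSize.integrableOn_compl (h : IsJumpSize ν Z₀ γ l) (K : ℝ) :
    IntegrableOn γ (Z₀ᶜ ∩ {z | |l z| ≤ K}) ν ∧
    IntegrableOn (fun z => γ z ^ 2) (Z₀ᶜ ∩ {z | |l z| ≤ K}) ν := by
  have hfin : IsFiniteMeasure (ν.restrict (Z₀ᶜ ∩ {z | |l z| ≤ K})) := ⟨by
    rw [Measure.restrict_apply_univ]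
    exact (measure_mono inter_subset_left).trans_lt h.compl_lt⟩
  have hm : MeasurableSet (Z₀ᶜ ∩ {z | |l z| ≤ K}) :=
    h.meas_set.compl.inter (measurableSet_le h.meas_log.abs measurable_const)
  have hb : ∀ z ∈ Z₀ᶜ ∩ {z | |l z| ≤ K}, |γ z| ≤ Real.exp K + 1 := by
    intro z hz
    rw [h.eq_exp_sub_one]
    refine (abs_sub _ _).trans ?_
    rw [Real.abs_exp, abs_one]
    gcongr
    exact (le_abs_self _).trans hz.2
  refine ⟨Integrable.of_bound h.meas.aestronglyMeasurable (Real.exp K + 1)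
    ((ae_restrict_iff' hm).2 (ae_of_all _ hb)),
    Integrable.of_bound (h.meas.pow_const 2).aestronglyMeasurable ((Real.exp K + 1) ^ 2)
    ((ae_restrict_iff' hm).2 (ae_of_all _ fun z hz => ?_))⟩
  rw [Real.norm_eq_abs, abs_pow]
  exact pow_le_pow_left₀ (abs_nonneg _) (hb z hz) 2

/-- The cutoff acts on `Z₀` only, so the compensator off `Z₀` is the same for all `k`. -/
lemma IsJumpSize.setIntegral_midJumps (h : IsJumpSize ν Z₀ γ l) (K : ℝ) (k : ℕ) :
    ∫ z in midJumps Z₀ γ l K k, (Real.exp ((midJumps Z₀ γ l K k).indicator l z) - 1) ∂ν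
      = ∫ z in Z₀ ∩ midJumps Z₀ γ l K k, γ z ∂ν + ∫ z in Z₀ᶜ ∩ {z | |l z| ≤ K}, γ z ∂ν := by
  set M := midJumps Z₀ γ l K k
  have hM := h.measurableSet_midJumps h.meas K k
  have e0 := congrFun (indicator_midJumps_exp h M)
  simp_rw [e0]
  rw [setIntegral_congr_fun hM (g := γ) fun z hz => indicator_of_mem hz γ]
  have h1 : M = (Z₀ ∩ M) ∪ (Z₀ᶜ ∩ {z | |l z| ≤ K}) := by
    ext z
    simp only [M, midJumps, mem_union, mem_inter_iff, mem_compl_iff, mem_ofPred_eq]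
    tauto
  refine (congrArg (fun U => ∫ z in U, γ z ∂ν) h1).trans ?_
  refine setIntegral_union ?_ (h.meas_set.compl.inter (measurableSet_le h.meas_log.abs
    measurable_const)) (h.integrableOn_of_finite (h.measure_midJumps_ne_top K k))
    (h.integrableOn_compl K).1
  exact disjoint_compl_right.mono inter_subset_left inter_subset_left

/-- The bound is uniform in `k` and supplies the variance constant of the limiting pair. -/
lemma IsJumpSize.sq_midJumps_le (h : IsJumpSize ν Z₀ γ l) (K : ℝ) (k : ℕ) :
    ∫ z in midJumps Z₀ γ l K k, (Real.exp ((midJumps Z₀ γ l K k).indicator l z) - 1) ^ 2 ∂ν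
      ≤ ∫ z in Z₀ ∪ (Z₀ᶜ ∩ {z | |l z| ≤ K}), γ z ^ 2 ∂ν := by
  have e0 := congrFun (indicator_midJumps_exp h (midJumps Z₀ γ l K k))
  simp_rw [e0]
  rw [setIntegral_congr_fun (h.measurableSet_midJumps h.meas K k) (g := fun z => γ z ^ 2)
    fun z hz => by simp only [indicator_of_mem hz γ]]
  refine setIntegral_mono_set (h.sq.union (h.integrableOn_compl K).2)
    (ae_of_all _ fun z => sq_nonneg _) (Eventually.of_forall fun z hz => ?_)
  by_cases hz0 : z ∈ Z₀
  · exact Or.inl hz0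
  · exact Or.inr ⟨hz0, hz.1⟩

/-- A jump with `|l| > K ≥ 1` has `|γ| ≥ exp (-1)`, so it passes the cutoff in `γ` as soon as `1 /
(k + 1)` is below `exp (-1)`. -/
lemma IsJumpSize.large_subset (h : IsJumpSize ν Z₀ γ l) {K : ℝ} (hK : 1 ≤ K) :
    ∀ᶠ k : ℕ in atTop, {z | K < |l z|} ⊆ {z | z ∉ Z₀ ∨ 1 / ((k : ℝ) + 1) < |γ z|} := by
  have hinv : Tendsto (fun k : ℕ => 1 / ((k : ℝ) + 1)) atTop (𝓝 0) :=
    tendsto_one_div_add_atTop_nhds_zero_nat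
  filter_upwards [hinv.eventually (gt_mem_nhds (Real.exp_pos (-1)))] with k hk z hz
  right
  have h1 := h.min_abs_log_le z
  rw [min_eq_right (hK.trans hz.le)] at h1
  have h2 : Real.exp (-1) * Real.exp 1 = 1 := by rw [← Real.exp_add]; simp
  refine hk.trans_le ?_
  nlinarith [Real.exp_pos 1, Real.exp_pos (-1)]

/-- The given integral compensates jumps in `Z₀` only, whereas the martingale compensates all jumps
with `|l| ≤ K`. The last term is the missing drift from jumps off `Z₀`. -/
lemma tendsto_levyMart (h : IsJumpSize ν Z₀ γ l) 
    (hp : IsPoissonPointProcess 𝓕 P ν p) (c : Fin d → ℝ) {G : ℝ≥0 → Ω → ℝ}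
    (hG : IsJumpIntegral P ν Z₀ p γ G) {K : ℝ} (hK : 1 ≤ K) (t : ℝ≥0) :
    TendstoInMeasure P (fun k => levyMart W c p ν (midJumps Z₀ γ l K k)
        ((midJumps Z₀ γ l K k).indicator l) t) atTop
      (fun ω => linComb W c t ω - linComb W c 0 ω
        + (G t ω - (incSum (p ω) ({z | K < |l z|}.indicator γ) 0 t
          - t * ∫ z in Z₀ ∩ {z | K < |l z|}, γ z ∂ν))
        - t * ∫ z in Z₀ᶜ ∩ {z | |l z| ≤ K}, γ z ∂ν) := by
  have h1 := hG.tendsto_midJumps hp h.meas_set h.meas h.meas_log K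
    (fun k => h.measure_lt_abs_ne_top (by positivity)) (fun U hU => h.integrableOn_of_finite hU)
    (h.large_subset hK) t
  refine TendstoInMeasure.congr_ev (TendstoInMeasure.sub' (TendstoInMeasure.add'
    (tendstoInMeasure_const fun ω => linComb W c t ω - linComb W c 0 ω) h1)
    (tendstoInMeasure_const _)) (Eventually.of_forall fun k => ae_of_all _ fun ω => ?_)
  rw [levyMart, h.setIntegral_midJumps, noise, indicator_midJumps_exp h]
  ring

/-- Both members of the pair must be truncated along the same sets, those cut by `|γ|`, although `L`
is a limit along cutoffs by `|l|`. `IsJumpSize.tendsto_cutoff_sub` makes the change, and the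
compensators combine into the integral of `l - γ`, which converges by domination. -/
lemma tendsto_logLevy (h : IsJumpSize ν Z₀ γ l) (hW : IsBrownianMotion 𝓕 P W)
    (hp : IsPoissonPointProcess 𝓕 P ν p) (hWp : Indep (processSigma W) (pointSigma p) P)
    (c : Fin d → ℝ) {L : ℝ≥0 → Ω → ℝ}
    (hL : IsJumpIntegral P ν Z₀ p l L) {K : ℝ} (hK : 1 ≤ K) (t : ℝ≥0) :
    TendstoInMeasure P (fun k => logLevy W c p ν (midJumps Z₀ γ l K k)
        ((midJumps Z₀ γ l K k).indicator l) t) atTop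
      (fun ω => linComb W c t ω - linComb W c 0 ω
        + (L t ω - (incSum (p ω) ({z | K < |l z|}.indicator l) 0 t
          - t * ∫ z in Z₀ ∩ {z | K < |l z|}, l z ∂ν))
        - t * ((∑ k, c k ^ 2) / 2 - ∫ z in Z₀ ∩ {z | |l z| ≤ K}, (l z - γ z) ∂ν
          + ∫ z in Z₀ᶜ ∩ {z | |l z| ≤ K}, γ z ∂ν)) := by
  have h1 := hL.tendsto_midJumps hp h.meas_set h.meas_log h.meas_log K
    (fun k => h.measure_lt_abs_log_ne_top (by positivity))
    (fun U hU => h.integrableOn_log_of_finite hU)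
    (Eventually.of_forall fun k z hz => Or.inr (lt_of_le_of_lt (le_trans
      (div_le_one_of_le₀ (by linarith [k.cast_nonneg (α := ℝ)]) (by positivity)) hK) hz)) t
  have h2 := h.tendsto_cutoff_sub hW hp hWp (zero_le_one.trans hK) t
  have h3 : Tendsto (fun k => ∫ z in Z₀ ∩ midJumps Z₀ γ l K k, (l z - γ z) ∂ν) atTop
      (𝓝 (∫ z in Z₀ ∩ {z | |l z| ≤ K}, (l z - γ z) ∂ν)) := by
    have hm : ∀ k, MeasurableSet (Z₀ ∩ midJumps Z₀ γ l K k) := fun k =>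
      h.meas_set.inter (h.measurableSet_midJumps h.meas K k)
    have hm' : MeasurableSet (Z₀ ∩ {z | |l z| ≤ K}) :=
      h.meas_set.inter (measurableSet_le h.meas_log.abs measurable_const)
    simp_rw [fun k => (integral_indicator (hm k) (f := fun z => l z - γ z) (μ := ν)).symm,
      (integral_indicator hm' (f := fun z => l z - γ z) (μ := ν)).symm]
    refine tendsto_integral_of_dominated_convergence (Z₀.indicator fun z => |l z - γ z|)
      (fun k => ((h.meas_log.sub h.meas).indicator (hm k)).aestronglyMeasurable)
      ((integrable_indicator_iff h.meas_set).2 h.log.abs) (fun k => ae_of_all _ fun z => ?_)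
      (ae_of_all _ fun z => ?_)
    · by_cases hz : z ∈ Z₀ ∩ midJumps Z₀ γ l K k
      · rw [indicator_of_mem hz, indicator_of_mem hz.1, Real.norm_eq_abs]
      · rw [indicator_of_notMem hz, norm_zero]
        exact indicator_nonneg (fun _ _ => abs_nonneg _) z
    · by_cases hz : γ z = 0
      · have hl0 : l z = 0 := by
          have := h.eq_exp_sub_one z
          rw [hz] at this
          exact Real.exp_eq_one_iff _ |>.1 (by linarith)
        have : ∀ U : Set Z, U.indicator (fun z => l z - γ z) z = 0 := fun U => by
          by_cases hU : z ∈ U <;> simp [hU, hl0, hz]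
        simp [this]
      · refine tendsto_const_nhds.congr' ?_
        have hinv : Tendsto (fun k : ℕ => 1 / ((k : ℝ) + 1)) atTop (𝓝 0) :=
          tendsto_one_div_add_atTop_nhds_zero_nat
        filter_upwards [hinv.eventually (gt_mem_nhds (abs_pos.2 hz))] with k hk
        by_cases hz' : z ∈ Z₀ ∩ {z | |l z| ≤ K}
        · rw [indicator_of_mem hz', indicator_of_mem (show z ∈ Z₀ ∩ midJumps Z₀ γ l K k from
            ⟨hz'.1, hz'.2, Or.inr hk⟩)]
        · rw [indicator_of_notMem hz', indicator_of_notMem (fun hz'' => hz' ⟨hz''.1, hz''.2.1⟩)]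
  have h4 := tendstoInMeasure_of_tendsto (P := P) (h3.const_mul (t : ℝ))
  refine TendstoInMeasure.congr_right (ae_of_all _ fun ω => ?_) (TendstoInMeasure.congr_ev (TendstoInMeasure.add' (TendstoInMeasure.add'
    (TendstoInMeasure.add' (tendstoInMeasure_const fun ω => linComb W c t ω - linComb W c 0 ω) h1)
    h2) (TendstoInMeasure.sub' h4 (tendstoInMeasure_const fun _ => t * ((∑ k, c k ^ 2) / 2
      + ∫ z in Z₀ᶜ ∩ {z | |l z| ≤ K}, γ z ∂ν)))) (g := fun k => logLevy W c p ν
        (midJumps Z₀ γ l K k) ((midJumps Z₀ γ l K k).indicator l) t)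
        (Eventually.of_forall fun k => ae_of_all _ fun ω => ?_))
  rotate_left
  · have hi1 := h.integrableOn_log_of_finite (h.measure_midJumps_ne_top K k)
    have hi2 := h.integrableOn_of_finite (h.measure_midJumps_ne_top K k)
    simp only
    rw [logLevy, h.setIntegral_midJumps, noise, integral_sub hi1 hi2]
    ring
  · simp only
    ring

end Levy

end

/-! ### The stochastic exponential formula. -/

section

variable {Ω Z : Type*} {mΩ : MeasurableSpace Ω} [MeasurableSpace Z] {P : Measure Ω}
  {𝓕 : Filtration ℝ≥0 mΩ} {ν : Measure Z} {p : Ω → ℝ → Option Z} {d : ℕ}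
  {W : ℝ≥0 → Ω → Fin d → ℝ}

lemma IsStochIntegral.ae_zero {H R I : ℝ≥0 → Ω → ℝ} (h : IsStochIntegral P H R I) :
    ∀ᵐ ω ∂P, I 0 ω = 0 := by
  have h1 := h 0 (fun _ => 0) (fun _ _ => 0) ⟨fun _ => rfl, fun _ => rfl,
    fun _ => monotone_const, fun ε _ => Eventually.of_forall fun k j hj => absurd hj (by simp)⟩
  simp only [Finset.range_zero, Finset.sum_empty] at h1
  filter_upwards [tendstoInMeasure_ae_unique h1 (tendstoInMeasure_const fun _ => 0)] with ω hω
  exact hω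

variable [IsProbabilityMeasure P] [SFinite ν] {Z₀ : Set Z} {γ l : Z → ℝ}

/-- The stochastic exponential on the event that all jumps up to time `t` satisfy `|l| ≤ K`. -/
lemma stochExp_eq_of_bounded_jumps (h : IsJumpSize ν Z₀ γ l) (hW : IsBrownianMotion 𝓕 P W)
    (hp : IsPoissonPointProcess 𝓕 P ν p) (hWp : Indep (processSigma W) (pointSigma p) P)
    (c : Fin d → ℝ) {G L : ℝ≥0 → Ω → ℝ} (hG : IsJumpIntegral P ν Z₀ p γ G)
    (hL : IsJumpIntegral P ν Z₀ p l L) {x S : ℝ≥0 → Ω → ℝ}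
    (hxm : ∀ s, AEStronglyMeasurable[𝓕 s] (x s) P)
    (hx : ∀ᵐ ω ∂P, ∀ t : ℝ≥0, ∃ C : ℝ, ∀ u w : ℝ≥0, u ≤ w → w ≤ t →
      |x w ω - x u ω| ≤ C * (w - u))
    (hSm : ∀ s, AEStronglyMeasurable[𝓕 s] (S s) P) (hS : ∀ᵐ ω ∂P, IsCadlag (fun t => S t ω))
    {s₀ : ℝ} (hint : IsStochIntegral P S (fun t ω => x t ω + linComb W c t ω + G t ω)
      (fun t ω => S t ω - s₀)) {K : ℝ} (hK : 1 ≤ K) (t : ℝ≥0) :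
    ∀ᵐ ω ∂P, (∀ r : ℝ, r ≤ t → ∀ z, p ω r = some z → |l z| ≤ K) →
      S t ω = s₀ * Real.exp (x t ω - x 0 ω + linComb W c t ω - t * ((∑ k, c k ^ 2) / 2)
        + L t ω + t * ∫ z in Z₀, (l z - γ z) ∂ν) := by
  set Bg : Set Z := {z | K < |l z|} with hBg
  set D : ℝ := ∫ z in Z₀ᶜ ∩ {z | |l z| ≤ K}, γ z ∂ν with hD
  set κ : ℝ := ∫ z in Z₀ ∩ Bg, γ z ∂ν with hκ
  have hBm : MeasurableSet Bg := h.measurableSet_large K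
  have hBfin : ν Bg ≠ ∞ := h.measure_large_ne_top (zero_lt_one.trans_le hK)
  have hpair := isExpPair_of_tendstoInMeasure hW hp hWp c
    (fun k => h.measurableSet_midJumps h.meas K k) (fun k => h.measure_midJumps_ne_top K k)
    (l := fun k => (midJumps Z₀ γ l K k).indicator l)
    (fun k => h.meas_log.indicator (h.measurableSet_midJumps h.meas K k))
    (fun k z hz => indicator_of_notMem hz l)
    (fun k => ⟨K, fun z => by
      by_cases hz : z ∈ midJumps Z₀ γ l K k
      · rw [indicator_of_mem hz]; exact hz.1
      · rw [indicator_of_notMem hz, abs_zero]; linarith⟩)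
    (fun k => add_le_add_right (h.sq_midJumps_le K k) (∑ k, c k ^ 2))
    (tendsto_logLevy h hW hp hWp c hL hK) (tendsto_levyMart h hp c hG hK)
  have hS0 : ∀ᵐ ω ∂P, S 0 ω = s₀ := by
    filter_upwards [hint.ae_zero] with ω hω using sub_eq_zero.1 hω
  have hlin := hW.ae_linComb (P := P) c
  have hx' : ∀ᵐ ω ∂P, ∀ t : ℝ≥0, ∃ C : ℝ, ∀ u w : ℝ≥0, u ≤ w → w ≤ t →
      |(x w ω - w * (κ - D)) - (x u ω - u * (κ - D))| ≤ C * (w - u) := by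
    filter_upwards [hx] with ω hω t
    obtain ⟨C, hC⟩ := hω t
    refine ⟨C + |κ - D|, fun u w huw hwt => ?_⟩
    have h1 := hC u w huw hwt
    have h2 : (0 : ℝ) ≤ w - u := sub_nonneg.2 (NNReal.coe_le_coe.2 huw)
    calc _ = |(x w ω - x u ω) - (w - u) * (κ - D)| := by congr 1; ring
      _ ≤ |x w ω - x u ω| + |(w - u) * (κ - D)| := abs_sub _ _
      _ ≤ _ := by rw [abs_mul, abs_of_nonneg h2]; linarith
  -- On the event the large jumps are absent, and `linComb + G` differs from the limiting martingale
  -- only by the linear drift with slope `κ - D`. Moving this drift into `x` leaves the return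
  -- unchanged.
  have key := hpair.eq_exp (x := fun t ω => x t ω - t * (κ - D)) (S := S)
    (fun s => (hxm s).sub aestronglyMeasurable_const) hx' hSm hS ?_
    (A := {ω | ∀ r : ℝ, r ≤ t → ∀ z, p ω r = some z → |l z| ≤ K}) (t := t) ?_
  · filter_upwards [key, hS0, hlin, hL.ae_zero hp] with ω h1 h2 h3 h4 hA
    rw [h1 hA, h2, h3.2, h4, incSum_self, incSum_eq_zero fun r hr z hz =>
      indicator_of_notMem (s := Bg) (fun h' => not_lt.2 (hA r hr z hz) h') l]
    congr 2
    -- Off the truncation level, `l` and `γ` are separately integrable on `Z₀`. Their integrals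
    -- there cancel the compensators of the removed jumps, so the final formula does not depend on
    -- `K`.
    have e1 : ∫ z in Z₀, (l z - γ z) ∂ν = ∫ z in Z₀ ∩ {z | |l z| ≤ K}, (l z - γ z) ∂ν
        + (∫ z in Z₀ ∩ Bg, l z ∂ν - κ) := by
      rw [hκ, ← integral_sub, ← setIntegral_union, ← inter_union_distrib_left]
      · congr 2
        ext z
        simp [hBg, le_or_gt]
      · refine Disjoint.inter_left' _ (Disjoint.inter_right' _ ?_)
        exact Set.disjoint_left.2 fun z hz hz' =>
          not_lt.2 (show |l z| ≤ K from hz) (show K < |l z| from hz')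
      · exact h.meas_set.inter hBm
      · exact h.log.mono_set inter_subset_left
      · exact h.log.mono_set inter_subset_left
      · exact h.integrableOn_log_of_finite hBfin
      · exact h.integrableOn_of_finite hBfin
    rw [e1]
    simp only [NNReal.coe_zero]
    ring
  · filter_upwards [hlin, hL.cadlag, hp.ae_locFinite hBm hBfin] with ω h1 h2 h3 t
    obtain ⟨C1, hC1⟩ := h2.bounded t
    obtain ⟨C2, hC2⟩ := exists_bound_incSum h3 (f := Bg.indicator l)
      (fun z hz => indicator_of_notMem hz l) t
    obtain ⟨C3, hC3⟩ := (isCompact_Icc (a := (0 : ℝ≥0)) (b := t)).exists_bound_of_continuousOn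
      h1.1.continuousOn
    set a1 := ∫ z in Z₀ ∩ Bg, l z ∂ν
    set a2 := (∑ k, c k ^ 2) / 2 - ∫ z in Z₀ ∩ {z | |l z| ≤ K}, (l z - γ z) ∂ν + D
    refine ⟨C3 + (C1 + (C2 + t * |a1|)) + t * |a2|, fun u hu => ?_⟩
    have b1 := hC1 u hu
    have b2 := hC2 u hu
    have b3 := hC3 u ⟨zero_le, hu⟩
    have hb : ∀ a : ℝ, |(u : ℝ) * a| ≤ t * |a| := fun a => by
      rw [abs_mul, NNReal.abs_eq]
      exact mul_le_mul_of_nonneg_right (NNReal.coe_le_coe.2 hu) (abs_nonneg a)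
    rw [h1.2, sub_zero]
    refine (abs_sub _ _).trans (add_le_add ((abs_add_le _ _).trans (add_le_add b3
      ((abs_sub _ _).trans (add_le_add b1 ((abs_sub _ _).trans (add_le_add b2 (hb a1))))))) (hb a2))
  · intro u hu n τ hτ ε hε
    have h1 := TendstoInMeasure.congr_right (g' := fun ω => S u ω - S 0 ω) (by
      filter_upwards [hS0] with ω hω
      rw [hω]) (hint u n τ hτ)
    rw [tendstoInMeasure_iff_norm] at h1
    refine tendsto_of_tendsto_of_tendsto_of_le_of_le tendsto_const_nhds (h1 ε hε)
      (fun _ => zero_le) (fun k => measure_mono ?_)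
    rintro ω ⟨hA, hω⟩
    simp only [mem_ofPred_eq, Real.norm_eq_abs] at hω hA ⊢
    convert hω using 3
    refine Finset.sum_congr rfl fun j hj => ?_
    -- All partition points lie below `t`, where the event excludes large jumps, so on the event the
    -- two families of Riemann sums coincide.
    have hz : ∀ i, i ≤ n k → incSum (p ω) (Bg.indicator γ) 0 (τ k i) = 0 := fun i hi =>
      incSum_eq_zero fun r hr z hz => indicator_of_notMem (s := Bg) (fun h' => not_lt.2 (hA r
        (hr.trans (NNReal.coe_le_coe.2 (((hτ.mono k hi).trans_eq (hτ.finish k)).trans hu))) z hz)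
        h') γ
    rw [hz _ (Finset.mem_range.1 hj).le, hz _ (Finset.mem_range.1 hj)]
    ring

/-- Only finitely many jumps up to time `t` have `|l| > 1`, so every path admits some level `K`. -/
lemma exists_bound_jumps {q : ℝ → Option Z} (hq : LocFinite q {z | 1 < |l z|}) (t : ℝ≥0) :
    ∃ K : ℕ, ∀ r : ℝ, r ≤ t → ∀ z, q r = some z → |l z| ≤ (K : ℝ) + 1 := by
  obtain ⟨C, hC⟩ : ∃ C, ∀ r ∈ (hq t).toFinset, (q r).elim 0 (fun z => |l z|) ≤ C :=
    ⟨_, fun r hr => Finset.single_le_sum (f := fun r => (q r).elim 0 (fun z => |l z|))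
      (fun r _ => by cases q r <;> simp) hr⟩
  obtain ⟨K, hK⟩ := exists_nat_ge C
  refine ⟨K, fun r hr z hz => ?_⟩
  by_cases h1 : 1 < |l z|
  · have := hC r (by simpa using ⟨hr, z, h1, hz⟩)
    rw [hz] at this
    exact (this.trans hK).trans (by linarith)
  · have : (0 : ℝ) ≤ K := K.cast_nonneg
    linarith

/-- The stochastic exponential of a Lévy process with random Lipschitz drift. -/
theorem stochExp_eq (h : IsJumpSize ν Z₀ γ l) (hW : IsBrownianMotion 𝓕 P W)
    (hp : IsPoissonPointProcess 𝓕 P ν p) (hWp : Indep (processSigma W) (pointSigma p) P)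
    (c : Fin d → ℝ) {G L : ℝ≥0 → Ω → ℝ} (hG : IsJumpIntegral P ν Z₀ p γ G)
    (hL : IsJumpIntegral P ν Z₀ p l L) {x S : ℝ≥0 → Ω → ℝ}
    (hxm : ∀ s, AEStronglyMeasurable[𝓕 s] (x s) P)
    (hx : ∀ᵐ ω ∂P, ∀ t : ℝ≥0, ∃ C : ℝ, ∀ u w : ℝ≥0, u ≤ w → w ≤ t →
      |x w ω - x u ω| ≤ C * (w - u))
    (hxc : ∀ᵐ ω ∂P, Continuous fun t => x t ω)
    (hSm : ∀ s, AEStronglyMeasurable[𝓕 s] (S s) P) (hS : ∀ᵐ ω ∂P, IsCadlag (fun t => S t ω))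
    {s₀ : ℝ} (hint : IsStochIntegral P S (fun t ω => x t ω + linComb W c t ω + G t ω)
      (fun t ω => S t ω - s₀)) :
    ∀ᵐ ω ∂P, ∀ t : ℝ≥0,
      S t ω = s₀ * Real.exp (x t ω - x 0 ω + linComb W c t ω - t * ((∑ k, c k ^ 2) / 2)
        + L t ω + t * ∫ z in Z₀, (l z - γ z) ∂ν) := by
  obtain ⟨D, hDc, hD⟩ := TopologicalSpace.exists_countable_dense ℝ≥0
  -- The exceptional set depends on `t` and `K`. Countably many of each are treated first, and right
  -- continuity extends the identity to all times.
  have h1 : ∀ᵐ ω ∂P, ∀ t ∈ D, ∀ K : ℕ,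
      (∀ r : ℝ, r ≤ t → ∀ z, p ω r = some z → |l z| ≤ (K : ℝ) + 1) →
      S t ω = s₀ * Real.exp (x t ω - x 0 ω + linComb W c t ω - t * ((∑ k, c k ^ 2) / 2)
        + L t ω + t * ∫ z in Z₀, (l z - γ z) ∂ν) :=
    (ae_ball_iff hDc).2 fun t _ => ae_all_iff.2 fun K =>
      stochExp_eq_of_bounded_jumps h hW hp hWp c hG hL hxm hx hSm hS hint
        (by linarith [K.cast_nonneg (α := ℝ)]) t
  filter_upwards [h1, hp.ae_locFinite (h.measurableSet_large 1)
    (h.measure_large_ne_top zero_lt_one), hxc, hS, hL.cadlag, hW.ae_linComb c]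
    with ω h1 h2 h3 h4 h5 h6
  refine eq_of_eqOn_dense (fun t => (h4 t).1) (fun t => ?_) hD fun t ht => ?_
  · have hid : Continuous fun t : ℝ≥0 => (t : ℝ) := NNReal.continuous_coe
    have hc : Continuous fun t : ℝ≥0 => x t ω - x 0 ω + linComb W c t ω
        - t * ((∑ k, c k ^ 2) / 2) :=
      ((h3.sub continuous_const).add h6.1).sub (hid.mul continuous_const)
    refine ContinuousWithinAt.mul continuousWithinAt_const
      (Real.continuous_exp.continuousAt.comp_continuousWithinAt ?_)
    exact (hc.continuousWithinAt.add (h5 t).1).add (hid.mul continuous_const).continuousWithinAt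
  · obtain ⟨K, hK⟩ := exists_bound_jumps h2 t
    exact h1 t ht K hK

end

/-! ### Uniform smallness of the compensated small jumps on dyadic points. -/

section

variable {Ω Z : Type*} {mΩ : MeasurableSpace Ω} [MeasurableSpace Z] {P : Measure Ω}
  {𝓕 : Filtration ℝ≥0 mΩ} {ν : Measure Z} {p : Ω → ℝ → Option Z} {d : ℕ}
  {W : ℝ≥0 → Ω → Fin d → ℝ}

/-- The jumps which lie off `Z₀` or are larger than `1 / (k + 1)`. -/
def bigJumps (Z₀ : Set Z) (l : Z → ℝ) (k : ℕ) : Set Z :=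
  {z | z ∉ Z₀ ∨ 1 / ((k : ℝ) + 1) < |l z|}

lemma bigJumps_mono (Z₀ : Set Z) (l : Z → ℝ) : Monotone (bigJumps Z₀ l) := by
  intro k m hkm z hz
  refine hz.imp_right fun h => lt_of_le_of_lt ?_ h
  exact one_div_le_one_div_of_le (by positivity) (by simpa using hkm)

/-- The part of the jump integral `L` due to the jumps in `Z₀` of size at most `1 / (k + 1)`. -/
def smallJumpPart (p : Ω → ℝ → Option Z) (ν : Measure Z) (Z₀ : Set Z) (l : Z → ℝ)
    (L : ℝ≥0 → Ω → ℝ) (k : ℕ) (t : ℝ≥0) (ω : Ω) : ℝ :=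
  L t ω - (incSum (p ω) ((bigJumps Z₀ l k).indicator l) 0 t
    - t * ∫ z in Z₀ ∩ {z | 1 / ((k : ℝ) + 1) < |l z|}, l z ∂ν)

/-- The points `t j / 2 ^ n`. -/
def dyadicPt (t : ℝ≥0) (n j : ℕ) : ℝ≥0 := t * j / 2 ^ n

lemma dyadicPt_zero (t : ℝ≥0) (n : ℕ) : dyadicPt t n 0 = 0 := by simp [dyadicPt]

lemma dyadicPt_last (t : ℝ≥0) (n : ℕ) : dyadicPt t n (2 ^ n) = t := by
  simp [dyadicPt]

lemma dyadicPt_mono (t : ℝ≥0) (n : ℕ) : Monotone (dyadicPt t n) := by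
  intro i j hij
  unfold dyadicPt
  gcongr

lemma dyadicPt_le {t : ℝ≥0} {n j : ℕ} (hj : j ≤ 2 ^ n) : dyadicPt t n j ≤ t :=
  (dyadicPt_mono t n hj).trans_eq (dyadicPt_last t n)

lemma dyadicPt_double (t : ℝ≥0) (n j : ℕ) : dyadicPt t (n + 1) (2 * j) = dyadicPt t n j := by
  unfold dyadicPt
  push_cast
  rw [pow_succ]
  field_simp

lemma dyadicPt_succ_sub (t : ℝ≥0) (n j : ℕ) :
    (dyadicPt t n (j + 1) : ℝ) - dyadicPt t n j = t / 2 ^ n := by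
  unfold dyadicPt
  push_cast
  ring

lemma tendsto_div_two_pow (t : ℝ) : Tendsto (fun n : ℕ => t / 2 ^ n) atTop (𝓝 0) := by
  have := (tendsto_pow_atTop_nhds_zero_of_lt_one (r := (1 / 2 : ℝ)) (by norm_num)
    (by norm_num)).const_mul t
  simpa [div_eq_mul_inv] using this

variable [IsProbabilityMeasure P] [SFinite ν] {Z₀ : Set Z} {γ l : Z → ℝ}

lemma IsJumpSize.measurableSet_bigJumps (h : IsJumpSize ν Z₀ γ l) (k : ℕ) :
    MeasurableSet (bigJumps Z₀ l k) :=
  h.meas_set.compl.union (measurableSet_lt measurable_const h.meas_log.abs)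

lemma IsJumpSize.measure_bigJumps_ne_top (h : IsJumpSize ν Z₀ γ l) (k : ℕ) :
    ν (bigJumps Z₀ l k) ≠ ∞ :=
  h.measure_lt_abs_log_ne_top (by positivity)

lemma inter_bigJumps (Z₀ : Set Z) (l : Z → ℝ) (k : ℕ) :
    Z₀ ∩ bigJumps Z₀ l k = Z₀ ∩ {z | 1 / ((k : ℝ) + 1) < |l z|} := by
  ext z
  simp only [bigJumps, mem_inter_iff, mem_ofPred_eq]
  tauto

/-- Every mark off `Z₀` is already a big jump, so the difference of two levels lies in `Z₀` and its
sum is fully compensated. The limit is an increment of a martingale with bounded jumps. -/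
lemma IsJumpSize.tendsto_smallJumpPart (h : IsJumpSize ν Z₀ γ l)
    (hp : IsPoissonPointProcess 𝓕 P ν p) {L : ℝ≥0 → Ω → ℝ} (hL : IsJumpIntegral P ν Z₀ p l L)
    (k : ℕ) {s t : ℝ≥0} (hst : s ≤ t) :
    TendstoInMeasure P (fun (m : ℕ) ω =>
      incSum (p ω) ((bigJumps Z₀ l m \ bigJumps Z₀ l k).indicator l) s t
        - ((t : ℝ) - s) * ∫ z in bigJumps Z₀ l m \ bigJumps Z₀ l k,
          (bigJumps Z₀ l m \ bigJumps Z₀ l k).indicator l z ∂ν) atTop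
      (fun ω => smallJumpPart p ν Z₀ l L k t ω - smallJumpPart p ν Z₀ l L k s ω) := by
  have hpart : ∀ t : ℝ≥0, TendstoInMeasure P (fun (m : ℕ) ω =>
      incSum (p ω) ((bigJumps Z₀ l m \ bigJumps Z₀ l k).indicator l) 0 t
        - (t : ℝ) * ∫ z in bigJumps Z₀ l m \ bigJumps Z₀ l k, l z ∂ν) atTop
      (smallJumpPart p ν Z₀ l L k t) := by
    intro t
    refine TendstoInMeasure.congr_ev (TendstoInMeasure.sub' (hL.limit t)
      (tendstoInMeasure_const _)) ?_
    filter_upwards [eventually_ge_atTop k] with m hm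
    have hsub := bigJumps_mono Z₀ l hm
    filter_upwards [hp.ae_locFinite (h.measurableSet_bigJumps m) (h.measure_bigJumps_ne_top m)]
      with ω hω
    rw [jumpSum_eq_incSum (hp.dom_pos ω), ← inter_bigJumps, ← inter_bigJumps]
    change incSum (p ω) ((bigJumps Z₀ l m).indicator l) 0 t - _ - _ = _
    set U := bigJumps Z₀ l m
    set V := bigJumps Z₀ l k
    have hd : U \ V = (Z₀ ∩ U) \ (Z₀ ∩ V) := by
      ext z
      have : z ∉ Z₀ → z ∈ V := fun hz => Or.inl hz
      simp only [Set.mem_sdiff, mem_inter_iff]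
      tauto
    have h1 : (U \ V).indicator l = fun z => U.indicator l z - V.indicator l z := by
      rw [indicator_sdiff hsub]; rfl
    rw [h1, incSum_sub hω (f := U.indicator l) (g := V.indicator l)
      (fun z hz => indicator_of_notMem hz _)
      (fun z hz => indicator_of_notMem (fun hz' => hz (hsub hz')) _), hd,
      setIntegral_sdiff (h.meas_set.inter (h.measurableSet_bigJumps k))
      (h.integrableOn_log_of_finite (h.measure_bigJumps_ne_top m))
      (inter_subset_inter_right _ hsub)]
    ring
  refine TendstoInMeasure.congr_ev (TendstoInMeasure.sub' (hpart t) (hpart s))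
    (Eventually.of_forall fun m => ?_)
  filter_upwards [hp.ae_locFinite (h.measurableSet_bigJumps m) (h.measure_bigJumps_ne_top m)]
    with ω hω
  rw [← incSum_add_incSum hω (f := (bigJumps Z₀ l m \ bigJumps Z₀ l k).indicator l)
    (fun z hz => indicator_of_notMem (fun hz' => hz hz'.1) _) zero_le hst,
    setIntegral_congr_fun ((h.measurableSet_bigJumps m).diff (h.measurableSet_bigJumps k))
      fun z hz => indicator_of_mem hz l]
  ring

/-- Each approximation is measurable both for the past at `t` and for the points after `s`, and both
properties survive limits in probability. The former gives adaptedness, the latter independence of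
the past at `s`; mean and variance pass to the limit by the uniform second moment bound. -/
lemma IsJumpSize.smallJumpPart_increment (h : IsJumpSize ν Z₀ γ l) (hW : IsBrownianMotion 𝓕 P W)
    (hp : IsPoissonPointProcess 𝓕 P ν p) (hWp : Indep (processSigma W) (pointSigma p) P)
    {L : ℝ≥0 → Ω → ℝ} (hL : IsJumpIntegral P ν Z₀ p l L)
    (k : ℕ) {s t : ℝ≥0} (hst : s ≤ t) {ξ : Ω → ℝ}
    (hξ : ξ = fun ω => smallJumpPart p ν Z₀ l L k t ω - smallJumpPart p ν Z₀ l L k s ω) :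
    AEStronglyMeasurable[𝓕 t] ξ P ∧ IndepPast P (𝓕 s) ξ ∧ MemLp ξ 2 P ∧ ∫ ω, ξ ω ∂P = 0 ∧
    ∫ ω, ξ ω ^ 2 ∂P ≤ ((t : ℝ) - s) * ∫ z in Z₀ ∩ {z | |l z| ≤ 1 / ((k : ℝ) + 1)}, l z ^ 2 ∂ν := by
  have hlim := h.tendsto_smallJumpPart hp hL k hst
  rw [← hξ] at hlim
  set D : ℕ → Set Z := fun m => bigJumps Z₀ l m \ bigJumps Z₀ l k with hD
  have hDm : ∀ m, MeasurableSet (D m) := fun m =>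
    (h.measurableSet_bigJumps m).diff (h.measurableSet_bigJumps k)
  have hDf : ∀ m, ν (D m) ≠ ∞ := fun m =>
    ne_top_of_le_ne_top (h.measure_bigJumps_ne_top m) (measure_mono sdiff_subset)
  have hDs : ∀ m, D m ⊆ Z₀ ∩ {z | |l z| ≤ 1 / ((k : ℝ) + 1)} := by
    intro m z hz
    have h2 := hz.2
    simp only [bigJumps, mem_ofPred_eq, not_or, not_not, not_lt] at h2
    exact h2
  have hf : ∀ m, Measurable ((D m).indicator l) := fun m => h.meas_log.indicator (hDm m)
  have hf0 : ∀ m, ∀ z ∉ D m, (D m).indicator l z = 0 := fun m z hz => indicator_of_notMem hz l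
  have hmom := fun m => compensated_incSum_moments hW hp hWp (hDm m) (hDf m) hst (hf m) (hf0 m)
    ⟨1 / ((k : ℝ) + 1), fun z => by
      by_cases hz : z ∈ D m
      · rw [indicator_of_mem hz]; exact (hDs m hz).2
      · rw [indicator_of_notMem hz, abs_zero]; positivity⟩
  have hst' : (0 : ℝ) ≤ t - s := sub_nonneg.2 (NNReal.coe_le_coe.2 hst)
  have hvar : ∀ m, ∫ ω, (incSum (p ω) ((D m).indicator l) s t
      - ((t : ℝ) - s) * ∫ z in D m, (D m).indicator l z ∂ν) ^ 2 ∂P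
      ≤ ((t : ℝ) - s) * ∫ z in Z₀ ∩ {z | |l z| ≤ 1 / ((k : ℝ) + 1)}, l z ^ 2 ∂ν := by
    intro m
    rw [(hmom m).2.2]
    refine mul_le_mul_of_nonneg_left ?_ hst'
    rw [setIntegral_congr_fun (hDm m) (g := fun z => l z ^ 2)
      fun z hz => by simp only [indicator_of_mem hz l]]
    exact setIntegral_mono_set (h.integrableOn_log_sq _) (ae_of_all _ fun z => sq_nonneg _)
      (LE.le.eventuallyLE (hDs m))
  have hL2 := memLp_two_of_tendstoInMeasure (fun m => (hmom m).1) hvar hlim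
  refine ⟨?_, ?_, hL2.1, ?_, hL2.2⟩
  · exact aestronglyMeasurable_sub_of_tendstoInMeasure (fun m =>
      (incSum_aestronglyMeasurable_past hp (hDm m) (hDf m) (hf m) (hf0 m) s t).sub
        aestronglyMeasurable_const) hlim
  · exact indepPast_of_indep (hp.indep_past s).symm
      (aestronglyMeasurable_sub_of_tendstoInMeasure (fun m =>
        (incSum_aestronglyMeasurable_futurePoints hp (hDm m) (hDf m) (hf m) (hf0 m) s t).sub
        aestronglyMeasurable_const) hlim)
  · have := tendsto_integral_of_tendstoInMeasure (fun m => (hmom m).1) hvar hlim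
    simp_rw [fun m => (hmom m).2.1] at this
    exact (tendsto_nhds_unique this tendsto_const_nhds)

lemma IsJumpSize.tendsto_small_sq (h : IsJumpSize ν Z₀ γ l) :
    Tendsto (fun k : ℕ => ∫ z in Z₀ ∩ {z | |l z| ≤ 1 / ((k : ℝ) + 1)}, l z ^ 2 ∂ν) atTop
      (𝓝 0) := by
  have hm : ∀ k : ℕ, MeasurableSet (Z₀ ∩ {z | |l z| ≤ 1 / ((k : ℝ) + 1)}) := fun k =>
    h.meas_set.inter (measurableSet_le h.meas_log.abs measurable_const)
  simp_rw [fun k => (integral_indicator (hm k) (f := fun z => l z ^ 2) (μ := ν)).symm]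
  have hm1 : MeasurableSet (Z₀ ∩ {z | |l z| ≤ 1}) :=
    h.meas_set.inter (measurableSet_le h.meas_log.abs measurable_const)
  rw [← integral_zero Z ℝ (μ := ν)]
  refine tendsto_integral_of_dominated_convergence
    ((Z₀ ∩ {z | |l z| ≤ 1}).indicator fun z => l z ^ 2)
    (fun k => ((h.meas_log.pow_const 2).indicator (hm k)).aestronglyMeasurable)
    ((integrable_indicator_iff hm1).2 (h.integrableOn_log_sq 1))
    (fun k => ae_of_all _ fun z => ?_) (ae_of_all _ fun z => ?_)
  · rw [Real.norm_eq_abs, abs_of_nonneg (indicator_nonneg (fun _ _ => sq_nonneg _) z)]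
    refine indicator_le_indicator_of_subset (inter_subset_inter_right _ fun z hz => ?_)
      (fun _ => sq_nonneg _) z
    refine le_trans (show |l z| ≤ _ from hz) (div_le_one_of_le₀ ?_ (by positivity))
    linarith [k.cast_nonneg (α := ℝ)]
  · by_cases hz : l z = 0
    · have : ∀ U : Set Z, U.indicator (fun z => l z ^ 2) z = 0 := fun U => by
        by_cases hU : z ∈ U <;> simp [hU, hz]
      simp [this]
    · refine tendsto_const_nhds.congr' ?_
      have hinv : Tendsto (fun k : ℕ => 1 / ((k : ℝ) + 1)) atTop (𝓝 0) :=
        tendsto_one_div_add_atTop_nhds_zero_nat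
      filter_upwards [hinv.eventually (gt_mem_nhds (abs_pos.2 hz))] with k hk
      rw [indicator_of_notMem fun hz' => absurd hz'.2 (not_le.2 hk)]

/-- Almost surely the small jumps part is uniformly small on dyadic points, for suitable
arbitrarily fine cutoffs. -/
lemma IsJumpSize.ae_smallJumpPart_le (h : IsJumpSize ν Z₀ γ l) (hW : IsBrownianMotion 𝓕 P W)
    (hp : IsPoissonPointProcess 𝓕 P ν p) (hWp : Indep (processSigma W) (pointSigma p) P)
    {L : ℝ≥0 → Ω → ℝ} (hL : IsJumpIntegral P ν Z₀ p l L) (t : ℝ≥0) :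
    ∀ᵐ ω ∂P, ∀ η : ℝ, 0 < η → ∃ k : ℕ, 1 / ((k : ℝ) + 1) ≤ η ∧ ∀ n j, j ≤ 2 ^ n →
      |smallJumpPart p ν Z₀ l L k (dyadicPt t n j) ω| ≤ η := by
  set M := smallJumpPart p ν Z₀ l L with hM
  set C : ℕ → ℝ := fun k => ∫ z in Z₀ ∩ {z | |l z| ≤ 1 / ((k : ℝ) + 1)}, l z ^ 2 ∂ν with hC
  have hbound : ∀ (η : ℝ), 0 < η → ∀ k, P (⋃ n : ℕ, {ω | ∃ j ≤ 2 ^ n,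
      η ≤ |M k (dyadicPt t n j) ω - M k 0 ω|}) ≤ ENNReal.ofReal (t * C k / η ^ 2) := by
    intro η hη k
    -- Dyadic grids are nested, so the events increase, and a maximal inequality whose bound does
    -- not depend on `n` covers all dyadic points at once.
    have hmono : Monotone fun n : ℕ => {ω | ∃ j ≤ 2 ^ n,
        η ≤ |M k (dyadicPt t n j) ω - M k 0 ω|} := by
      refine monotone_nat_of_le_succ fun n ω => ?_
      rintro ⟨j, hj, hω⟩
      refine ⟨2 * j, by rw [pow_succ]; linarith, ?_⟩
      rwa [dyadicPt_double]
    rw [hmono.measure_iUnion]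
    refine iSup_le fun n => ?_
    have hinc := fun i => h.smallJumpPart_increment hW hp hWp hL k
      (dyadicPt_mono t n (Nat.le_succ i)) rfl
    have hmax := measure_max_partial_sums_le (P := P) (m := fun i => 𝓕 (dyadicPt t n i))
      (fun i j hij => 𝓕.mono (dyadicPt_mono t n hij)) (fun i => 𝓕.le _)
      (fun i => (hinc i).1) (fun i => (hinc i).2.2.1) (fun i => (hinc i).2.1)
      (fun i => (hinc i).2.2.2.1) (fun i => (hinc i).2.2.2.2) (2 ^ n) hη
    rw [← ENNReal.ofReal_toReal (measure_ne_top P _)]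
    refine ENNReal.ofReal_le_ofReal ((le_of_eq ?_).trans (hmax.trans (le_of_eq ?_)))
    · change P.real _ = _
      congr 1
      ext ω
      simp only [mem_ofPred_eq, Nat.succ_eq_add_one,
        Finset.sum_range_sub (fun i => smallJumpPart p ν Z₀ l L k (dyadicPt t n i) ω),
        dyadicPt_zero, hM]
    · simp only [Nat.succ_eq_add_one, dyadicPt_succ_sub, Finset.sum_const, Finset.card_range,
        nsmul_eq_mul, hC]
      generalize ∫ z in Z₀ ∩ {z | |l z| ≤ 1 / ((k : ℝ) + 1)}, l z ^ 2 ∂ν = c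
      push_cast
      field_simp
  -- Failure for all `k ≥ i` is contained in failure for each single one, and those probabilities
  -- tend to zero. One good cutoff per level suffices, and it may depend on the path.
  have hzero : ∀ i : ℕ, ∀ᵐ ω ∂P, ∃ k ≥ i, ω ∉ ⋃ n : ℕ, {ω | ∃ j ≤ 2 ^ n,
      1 / ((i : ℝ) + 1) ≤ |M k (dyadicPt t n j) ω - M k 0 ω|} := by
    intro i
    rw [ae_iff]
    refine le_antisymm ?_ zero_le
    have hlim : Tendsto (fun k => ENNReal.ofReal (t * C k / (1 / ((i : ℝ) + 1)) ^ 2)) atTop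
        (𝓝 0) := by
      have := ((h.tendsto_small_sq.const_mul (t : ℝ)).div_const ((1 / ((i : ℝ) + 1)) ^ 2))
      rw [mul_zero, zero_div] at this
      rw [← ENNReal.ofReal_zero]
      exact ENNReal.tendsto_ofReal this
    refine ge_of_tendsto hlim ?_
    filter_upwards [eventually_ge_atTop i] with k hk
    refine (measure_mono ?_).trans (hbound _ (by positivity) k)
    intro ω hω
    simp only [mem_ofPred_eq, not_exists, not_and, not_not] at hω
    exact hω k hk
  filter_upwards [ae_all_iff.2 hzero, hL.ae_zero hp] with ω hω h0 η hη
  obtain ⟨i, hi⟩ := exists_nat_one_div_lt hη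
  obtain ⟨k, hk, hk'⟩ := hω i
  refine ⟨k, le_trans (one_div_le_one_div_of_le (by positivity) (by simpa using hk)) hi.le,
    fun n j hj => ?_⟩
  have hM0 : M k 0 ω = 0 := by simp [hM, smallJumpPart, h0, incSum_self]
  simp only [mem_iUnion, mem_ofPred_eq, not_exists, not_and, not_le, hM0, sub_zero] at hk'
  exact (hk' n j hj).le.trans hi.le

end

/-! ### Reading the jumps off a path from its dyadic increments. -/

section

section Paths

variable {Z : Type*} [MeasurableSpace Z]

lemma incSum_eq_single {q : ℝ → Option Z} {f : Z → ℝ} {s t : ℝ≥0} {r : ℝ} {z : Z}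
    (hr : r ∈ Ioc (s : ℝ) t) (hz : q r = some z)
    (h : ∀ r' ∈ Ioc (s : ℝ) t, r' ≠ r → (q r').elim 0 f = 0) : incSum q f s t = f z := by
  unfold incSum
  rw [finsum_mem_def, finsum_eq_single _ r, indicator_of_mem hr, hz]
  · rfl
  · intro r' hr'
    by_cases h' : r' ∈ Ioc (s : ℝ) t
    · rw [indicator_of_mem h', h r' h' hr']
    · rw [indicator_of_notMem h']

lemma sum_incSum {q : ℝ → Option Z} {V : Set Z} (h : LocFinite q V) {f : Z → ℝ}
    (hf : ∀ z ∉ V, f z = 0) {τ : ℕ → ℝ≥0} (hτ : Monotone τ) (n : ℕ) :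
    ∑ j ∈ Finset.range n, incSum q f (τ j) (τ (j + 1)) = incSum q f (τ 0) (τ n) := by
  induction n with
  | zero => rw [Finset.range_zero, Finset.sum_empty, incSum_self]
  | succ n ih =>
    rw [Finset.sum_range_succ, ih, incSum_add_incSum h hf (hτ (zero_le)) (hτ n.le_succ)]

lemma incSum_nonneg {q : ℝ → Option Z} {V : Set Z} (h : LocFinite q V) {f : Z → ℝ}
    (hf0 : ∀ z ∉ V, f z = 0) (hf : ∀ z, 0 ≤ f z) (s t : ℝ≥0) : 0 ≤ incSum q f s t := by
  rw [incSum_eq_sum h hf0]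
  refine Finset.sum_nonneg fun r _ => ?_
  cases q r <;> simp [hf]

/-- If a path is, up to arbitrarily small errors on dyadic points, the sum of a continuous path
and of its large jumps `l (q r)`, then sums of functions of dyadic increments converge to the sum
over the jumps. -/
lemma tendsto_sum_increments {q : ℝ → Option Z} {l : Z → ℝ} {y : ℝ≥0 → ℝ} {t : ℝ≥0} {g : ℝ → ℝ}
    {δ Λ : ℝ} (hδ : 0 < δ) (hΛ : 0 ≤ Λ) (hg : ∀ x, |x| ≤ δ → g x = 0)
    (hgL : ∀ x x', |g x - g x'| ≤ Λ * |x - x'|)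
    (happ : ∀ η : ℝ, 0 < η → ∃ V : Set Z, {z | δ / 2 < |l z|} ⊆ V ∧ LocFinite q V ∧
      ∃ φ : ℝ≥0 → ℝ, Continuous φ ∧ ∀ n j, j ≤ 2 ^ n →
        |y (dyadicPt t n j) - φ (dyadicPt t n j)
          - incSum q (V.indicator l) 0 (dyadicPt t n j)| ≤ η) :
    Tendsto (fun n => ∑ j ∈ Finset.range (2 ^ n),
      g (y (dyadicPt t n (j + 1)) - y (dyadicPt t n j))) atTop (𝓝 (incSum q (g ∘ l) 0 t)) := by
  -- The level is `δ / 2`, below the threshold `δ` of `g`: an interval whose only jump is at most `δ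
  -- / 2` has an increment at most `δ / 2 + 3 η ≤ δ`, which `g` kills.
  set V' : Set Z := {z | δ / 2 < |l z|} with hV'
  have hV'f : LocFinite q V' := by
    obtain ⟨V, h1, h2, -⟩ := happ 1 one_pos
    exact h2.mono h1
  have hg' : ∀ z ∉ V', (g ∘ l) z = 0 := fun z hz =>
    hg _ (by have := not_lt.1 (show ¬ δ / 2 < |l z| from hz); linarith)
  -- Counts the jumps above `δ / 2`. Errors are charged only to intervals containing one of them,
  -- and their number up to `t` is finite whatever `η`.
  set o : Z → ℝ := V'.indicator fun _ => 1 with ho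
  have ho0 : ∀ z, 0 ≤ o z := fun z => indicator_nonneg (fun _ _ => zero_le_one) z
  have ho' : ∀ z ∉ V', o z = 0 := fun z hz => indicator_of_notMem hz _
  set N := incSum q o 0 t with hN
  have hN0 : 0 ≤ N := incSum_nonneg hV'f ho' ho0 0 t
  rw [Metric.tendsto_nhds]
  intro ε hε
  set η : ℝ := min (δ / 6) (ε / (3 * (Λ * N + 1))) with hη
  have hΛN : 0 < Λ * N + 1 := by positivity
  have hη0 : 0 < η := lt_min (by positivity) (by positivity)
  have hη1 : 3 * η ≤ δ / 2 := by have := min_le_left (δ / 6) (ε / (3 * (Λ * N + 1))); linarith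
  have hη2 : 3 * η * (Λ * N) < ε := by
    have h1 : η ≤ ε / (3 * (Λ * N + 1)) := min_le_right _ _
    rw [le_div_iff₀ (by positivity)] at h1
    nlinarith
  obtain ⟨V, hVV, hVf, φ, hφ, happ'⟩ := happ η hη0
  have hunif := isCompact_Icc.uniformContinuousOn_of_continuous (hφ.continuousOn (s := Icc 0 t))
  obtain ⟨ρ, hρ, hρ'⟩ := Metric.uniformContinuousOn_iff.1 hunif η hη0
  set F := (hVf t).toFinset with hF
  have hsmall := tendsto_div_two_pow (t : ℝ)
  -- Once the mesh is smaller than every gap between the points in `V`, each dyadic interval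
  -- contains at most one of them.
  have hsep : ∀ᶠ n : ℕ in atTop, ∀ r ∈ F, ∀ r' ∈ F, r ≠ r' → (t : ℝ) / 2 ^ n < |r - r'| := by
    refine (Filter.eventually_all_finset F).2 fun r _ => (Filter.eventually_all_finset F).2
      fun r' _ => ?_
    by_cases h : r = r'
    · exact Eventually.of_forall fun n h' => absurd h h'
    · filter_upwards [hsmall.eventually (gt_mem_nhds (abs_pos.2 (sub_ne_zero.2 h)))] with n hn _
      exact hn
  filter_upwards [hsep, hsmall.eventually (gt_mem_nhds hρ)] with n hn1 hn2
  have hterm : ∀ j ∈ Finset.range (2 ^ n),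
      |g (y (dyadicPt t n (j + 1)) - y (dyadicPt t n j))
        - incSum q (g ∘ l) (dyadicPt t n j) (dyadicPt t n (j + 1))|
        ≤ 3 * η * Λ * incSum q o (dyadicPt t n j) (dyadicPt t n (j + 1)) := by
    intro j hj
    have hj1 : j + 1 ≤ 2 ^ n := Finset.mem_range.1 hj
    have b1 := happ' n (j + 1) hj1
    have b2 := happ' n j (Nat.le_of_succ_le hj1)
    have hmesh := dyadicPt_succ_sub t n j
    have hle : dyadicPt t n j ≤ dyadicPt t n (j + 1) := dyadicPt_mono t n j.le_succ
    have hut : dyadicPt t n (j + 1) ≤ t := dyadicPt_le hj1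
    have b3 : |φ (dyadicPt t n (j + 1)) - φ (dyadicPt t n j)| ≤ η := by
      have := hρ' (dyadicPt t n (j + 1)) ⟨zero_le, hut⟩ (dyadicPt t n j)
        ⟨zero_le, hle.trans hut⟩ (by
          rw [NNReal.dist_eq, hmesh, abs_of_nonneg (by positivity)]; exact hn2)
      rw [Real.dist_eq] at this
      exact this.le
    have hsplit := incSum_add_incSum hVf (f := V.indicator l)
      (fun z hz => indicator_of_notMem hz l) (zero_le (a := dyadicPt t n j)) hle
    set u := dyadicPt t n j
    set w := dyadicPt t n (j + 1)
    have herr : |y w - y u - incSum q (V.indicator l) u w| ≤ 3 * η := by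
      rw [abs_le] at b1 b2 b3 ⊢
      constructor <;> linarith [b1.1, b1.2, b2.1, b2.2, b3.1, b3.2]
    have hmem : ∀ r ∈ Ioc (u : ℝ) w, ∀ z ∈ V, q r = some z → r ∈ F := fun r hr z hz hq => by
      rw [hF, Set.Finite.mem_toFinset]
      exact ⟨hr.2.trans (NNReal.coe_le_coe.2 hut), z, hz, hq⟩
    by_cases hex : ∃ r ∈ Ioc (u : ℝ) w, ∃ z ∈ V, q r = some z
    · obtain ⟨r, hr, z, hz, hq⟩ := hex
      have honly : ∀ f : Z → ℝ, (∀ z ∉ V, f z = 0) → incSum q f u w = f z := by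
        intro f hf
        refine incSum_eq_single hr hq fun r' hr' hne => ?_
        cases hq' : q r' with
        | none => rfl
        | some z' =>
          refine hf z' fun hz' => ?_
          have h1 := hn1 r' (hmem r' hr' z' hz' hq') r (hmem r hr z hz hq) hne
          have h2 : |r' - r| ≤ t / 2 ^ n := by
            rw [← hmesh, abs_le]
            constructor <;> linarith [hr.1, hr.2, hr'.1, hr'.2]
          linarith
      rw [honly (g ∘ l) fun z hz => hg' z fun h => hz (hVV h),
        honly o fun z hz => ho' z fun h => hz (hVV h)]
      rw [honly (V.indicator l) fun z hz => indicator_of_notMem hz l, indicator_of_mem hz] at herr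
      by_cases hz' : z ∈ V'
      · rw [ho, indicator_of_mem hz', mul_one]
        refine (hgL _ _).trans ?_
        rw [mul_comm (3 * η)]
        exact mul_le_mul_of_nonneg_left herr hΛ
      · rw [hg' z hz', ho' z hz']
        have h1 : |l z| ≤ δ / 2 := not_lt.1 (show ¬ δ / 2 < |l z| from hz')
        rw [hg]
        · simp
        · rw [abs_le] at herr h1 ⊢
          constructor <;> linarith [herr.1, herr.2, h1.1, h1.2]
    · push Not at hex
      have hnone : ∀ f : Z → ℝ, (∀ z ∉ V, f z = 0) → incSum q f u w = 0 := by
        intro f hf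
        unfold incSum
        refine finsum_mem_eq_zero_of_forall_eq_zero fun r hr => ?_
        cases hq : q r with
        | none => rfl
        | some z => exact hf z fun hz => hex r hr z hz hq
      rw [hnone (g ∘ l) fun z hz => hg' z fun h => hz (hVV h),
        hnone o fun z hz => ho' z fun h => hz (hVV h)]
      rw [hnone (V.indicator l) fun z hz => indicator_of_notMem hz l, sub_zero] at herr
      rw [hg _ (by linarith)]
      simp
  rw [Real.dist_eq]
  have hs1 := sum_incSum hV'f hg' (dyadicPt_mono t n) (2 ^ n)
  have hs2 := sum_incSum hV'f ho' (dyadicPt_mono t n) (2 ^ n)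
  rw [dyadicPt_zero, dyadicPt_last] at hs1 hs2
  rw [← hs1, ← Finset.sum_sub_distrib]
  calc _ ≤ ∑ j ∈ Finset.range (2 ^ n),
      3 * η * Λ * incSum q o (dyadicPt t n j) (dyadicPt t n (j + 1)) :=
        (Finset.abs_sum_le_sum_abs _ _).trans (Finset.sum_le_sum hterm)
    _ = 3 * η * (Λ * N) := by rw [← Finset.mul_sum, hs2, hN]; ring
    _ < ε := hη2

end Paths

lemma abs_clip_sub_le (δ x x' : ℝ) : |clip δ x - clip δ x'| ≤ |x - x'| := by
  unfold clip
  refine (abs_max_sub_max_le_max _ _ _ _).trans (max_le (by simp) ?_)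
  exact (abs_min_sub_min_le_max _ _ _ _).trans (max_le le_rfl (by simp))

end

/-! ### Reconstruction of the jump integral from the path. -/

section

/-- The part of `x` beyond `[-δ, δ]`. -/
def softCut (δ x : ℝ) : ℝ := x - clip δ x

lemma continuous_softCut (δ : ℝ) : Continuous (softCut δ) :=
  continuous_id.sub (continuous_clip δ)

lemma softCut_of_abs_le {δ x : ℝ} (h : |x| ≤ δ) : softCut δ x = 0 := by
  rw [softCut, clip_of_abs_le h, sub_self]

lemma abs_softCut_sub_le (δ x x' : ℝ) : |softCut δ x - softCut δ x'| ≤ 2 * |x - x'| := by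
  unfold softCut
  calc _ = |(x - x') - (clip δ x - clip δ x')| := by congr 1; ring
    _ ≤ |x - x'| + |clip δ x - clip δ x'| := abs_sub _ _
    _ ≤ _ := by linarith [abs_clip_sub_le δ x x']

variable {Ω Z : Type*} {mΩ : MeasurableSpace Ω} [MeasurableSpace Z] {P : Measure Ω}
  {𝓕 : Filtration ℝ≥0 mΩ} {ν : Measure Z} {p : Ω → ℝ → Option Z} {d : ℕ}
  {W : ℝ≥0 → Ω → Fin d → ℝ}

lemma aestronglyMeasurable_sub_sum {ι : Type*} {m : MeasurableSpace Ω} (s : Finset ι)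
    {f : ι → Ω → ℝ} (hf : ∀ i ∈ s, AEStronglyMeasurable[m] (f i) P) :
    AEStronglyMeasurable[m] (fun ω => ∑ i ∈ s, f i ω) P := by
  classical
  induction s using Finset.induction_on with
  | empty => exact aestronglyMeasurable_const
  | insert i s hi ih =>
    simp_rw [Finset.sum_insert hi]
    exact (hf i (Finset.mem_insert_self i s)).add
      (ih fun j hj => hf j (Finset.mem_insert_of_mem hj))

section Recover

variable [IsProbabilityMeasure P] [SFinite ν] {Z₀ : Set Z} {γ l : Z → ℝ}

/-- The variance is `t` times the integral over `Z₀` of a square at most `min |l| (1 / (k + 1))`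
squared. The domination by `exp 1 * |γ|` gives an integrable majorant, and the cutoff sends the
integrand to zero. -/
lemma IsJumpSize.tendsto_clip_compensated (h : IsJumpSize ν Z₀ γ l) (hW : IsBrownianMotion 𝓕 P W)
    (hp : IsPoissonPointProcess 𝓕 P ν p) (hWp : Indep (processSigma W) (pointSigma p) P)
    (t : ℝ≥0) :
    TendstoInMeasure P (fun (k : ℕ) ω =>
      incSum (p ω) ((Z₀ ∩ bigJumps Z₀ l k).indicator fun z => clip (1 / ((k : ℝ) + 1)) (l z)) 0 t
        - ((t : ℝ) - (0 : ℝ≥0)) * ∫ z in Z₀ ∩ bigJumps Z₀ l k,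
          (Z₀ ∩ bigJumps Z₀ l k).indicator (fun z => clip (1 / ((k : ℝ) + 1)) (l z)) z ∂ν)
      atTop (fun _ => 0) := by
  set U : ℕ → Set Z := fun k => Z₀ ∩ bigJumps Z₀ l k with hU
  set f : ℕ → Z → ℝ := fun k => (U k).indicator fun z => clip (1 / ((k : ℝ) + 1)) (l z) with hf
  have hUm : ∀ k, MeasurableSet (U k) := fun k => h.meas_set.inter (h.measurableSet_bigJumps k)
  have hUf : ∀ k, ν (U k) ≠ ∞ := fun k =>
    ne_top_of_le_ne_top (h.measure_bigJumps_ne_top k) (measure_mono inter_subset_right)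
  have hfm : ∀ k, Measurable (f k) := fun k =>
    ((continuous_clip _).measurable.comp h.meas_log).indicator (hUm k)
  have hpos : ∀ k : ℕ, (0 : ℝ) ≤ 1 / ((k : ℝ) + 1) := fun k => by positivity
  have hb : ∀ k z, |f k z| ≤ min |l z| (1 / ((k : ℝ) + 1)) := by
    intro k z
    by_cases hz : z ∈ U k
    · simp only [hf, indicator_of_mem hz]
      exact (abs_clip (hpos k) _).le
    · simp only [hf, indicator_of_notMem hz, abs_zero]
      exact le_min (abs_nonneg _) (hpos k)
  have hmom := fun k => compensated_incSum_moments hW hp hWp (hUm k) (hUf k)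
    (zero_le (a := t)) (hfm k) (fun z hz => indicator_of_notMem hz _)
    ⟨1 / ((k : ℝ) + 1), fun z => (hb k z).trans (min_le_right _ _)⟩
  refine tendstoInMeasure_zero_of_sq (fun k => (hmom k).1) ?_
  refine Tendsto.congr (fun k => ((hmom k).2.2).symm) ?_
  have hext : ∀ k, ∫ z in U k, f k z ^ 2 ∂ν = ∫ z in Z₀, f k z ^ 2 ∂ν := fun k =>
    (setIntegral_eq_of_subset_of_forall_sdiff_eq_zero h.meas_set inter_subset_left
      fun z hz => by simp only [hf, indicator_of_notMem (show z ∉ U k from hz.2)]; ring).symm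
  simp_rw [hext]
  have hle1 : ∀ k : ℕ, 1 / ((k : ℝ) + 1) ≤ 1 := fun k =>
    div_le_one_of_le₀ (by linarith [k.cast_nonneg (α := ℝ)]) (by positivity)
  have hlim : Tendsto (fun k => ∫ z in Z₀, f k z ^ 2 ∂ν) atTop (𝓝 0) := by
    rw [← integral_zero Z ℝ (μ := ν.restrict Z₀)]
    refine tendsto_integral_of_dominated_convergence (fun z => Real.exp 1 ^ 2 * γ z ^ 2)
      (fun k => ((hfm k).pow_const 2).aestronglyMeasurable) (h.sq.const_mul _)
      (fun k => ae_of_all _ fun z => ?_) (ae_of_all _ fun z => ?_)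
    · rw [Real.norm_eq_abs, abs_pow, ← mul_pow, ← sq_abs (Real.exp 1 * γ z), abs_mul, Real.abs_exp]
      exact pow_le_pow_left₀ (abs_nonneg _) ((hb k z).trans
        ((min_le_min_left _ (hle1 k)).trans (h.min_abs_log_le z))) 2
    · have h0 : Tendsto (fun k => f k z) atTop (𝓝 0) :=
        squeeze_zero_norm (fun k => (hb k z).trans (min_le_right _ _))
          tendsto_one_div_add_atTop_nhds_zero_nat
      simpa using h0.pow 2
  simpa using hlim.const_mul ((t : ℝ) - (0 : ℝ≥0))

/-- Jump integrals are limits of compensated sums with a continuous cutoff of the jumps. -/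
lemma IsJumpSize.tendsto_softCut (h : IsJumpSize ν Z₀ γ l) (hW : IsBrownianMotion 𝓕 P W)
    (hp : IsPoissonPointProcess 𝓕 P ν p) (hWp : Indep (processSigma W) (pointSigma p) P)
    {L : ℝ≥0 → Ω → ℝ} (hL : IsJumpIntegral P ν Z₀ p l L) (t : ℝ≥0) :
    TendstoInMeasure P (fun (k : ℕ) ω =>
      incSum (p ω) (softCut (1 / ((k : ℝ) + 1)) ∘ l) 0 t
        - t * ∫ z in Z₀, softCut (1 / ((k : ℝ) + 1)) (l z) ∂ν) atTop (L t) := by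
  set δ : ℕ → ℝ := fun k => 1 / ((k : ℝ) + 1) with hδ
  set V : ℕ → Set Z := bigJumps Z₀ l with hV
  set f1 : ℕ → Z → ℝ := fun k => Z₀ᶜ.indicator fun z => clip (δ k) (l z) with hf1
  set f2 : ℕ → Z → ℝ := fun k => (Z₀ ∩ V k).indicator fun z => clip (δ k) (l z) with hf2
  have hpos : ∀ k : ℕ, (0 : ℝ) ≤ δ k := fun k => by positivity
  -- Off `Z₀` there are finitely many points up to `t` and each contributes at most `δ k`; no
  -- compensation is needed.
  have hlim1 : TendstoInMeasure P (fun k ω => incSum (p ω) (f1 k) 0 t) atTop (fun _ => 0) := by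
    refine tendstoInMeasure_of_tendsto_ae (fun k => ?_) ?_
    · exact (incSum_aestronglyMeasurable_past hp h.meas_set.compl h.compl_lt.ne
        (((continuous_clip _).measurable.comp h.meas_log).indicator h.meas_set.compl)
        (fun z hz => indicator_of_notMem hz _) 0 t).mono (𝓕.le t)
    · filter_upwards [hp.ae_locFinite h.meas_set.compl h.compl_lt.ne] with ω hω
      have := tendsto_incSum hω (f := f1) (g := fun _ => 0)
        (fun k z hz => indicator_of_notMem hz _) (fun z => ?_) 0 t
      · rwa [incSum_eq_zero (f := fun _ => 0) fun _ _ _ _ => rfl] at this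
      · refine squeeze_zero_norm (fun k => ?_) tendsto_one_div_add_atTop_nhds_zero_nat
        rw [Real.norm_eq_abs]
        by_cases hz : z ∈ Z₀ᶜ
        · simp only [hf1, indicator_of_mem hz]
          exact abs_clip_le (hpos k) _
        · simp only [hf1, indicator_of_notMem hz, abs_zero]
          exact hpos k
  have hlim2 := h.tendsto_clip_compensated hW hp hWp t
  have hlim := TendstoInMeasure.sub' (TendstoInMeasure.sub' (hL.limit t) hlim1) hlim2
  simp only [sub_zero] at hlim
  refine TendstoInMeasure.congr_ev hlim (Eventually.of_forall fun k => ?_)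
  have hVf := h.measure_bigJumps_ne_top k
  filter_upwards [hp.ae_locFinite (h.measurableSet_bigJumps k) hVf] with ω hω
  have hoff : ∀ z ∉ V k, z ∈ Z₀ ∧ |l z| ≤ δ k := by
    intro z hz
    simp only [hV, bigJumps, mem_ofPred_eq, not_or, not_not, not_lt] at hz
    exact hz
  have hV0 : ∀ z ∉ Z₀, z ∈ V k := fun z hz => Or.inl hz
  -- The soft cutoff is the hard cutoff minus the clipped values. Off `Z₀` the latter vanish path by
  -- path, and on `Z₀` they vanish after compensation.
  have hs : softCut (δ k) ∘ l = fun z => ((V k).indicator l z - f1 k z) - f2 k z := by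
    ext z
    by_cases hz : z ∈ V k
    · by_cases hz0 : z ∈ Z₀
      · have h1 : z ∉ Z₀ᶜ := fun hh => hh hz0
        simp only [hf1, hf2, indicator_of_mem hz, indicator_of_notMem h1,
          indicator_of_mem (show z ∈ Z₀ ∩ V k from ⟨hz0, hz⟩), Function.comp_apply, softCut]
        ring
      · have h1 : z ∈ Z₀ᶜ := hz0
        simp only [hf1, hf2, indicator_of_mem hz, indicator_of_mem h1,
          indicator_of_notMem (show z ∉ Z₀ ∩ V k from fun hh => hz0 hh.1), Function.comp_apply,
          softCut]
        ring
    · have h1 : z ∉ Z₀ᶜ := fun hh => hh (hoff z hz).1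
      simp only [hf1, hf2, indicator_of_notMem hz, indicator_of_notMem h1,
          indicator_of_notMem (show z ∉ Z₀ ∩ V k from fun hh => hz hh.2), Function.comp_apply,
          softCut_of_abs_le (hoff z hz).2]
      ring
  have hUm : MeasurableSet (Z₀ ∩ V k) := h.meas_set.inter (h.measurableSet_bigJumps k)
  have hint : ∫ z in Z₀, softCut (δ k) (l z) ∂ν
      = ∫ z in Z₀ ∩ V k, l z ∂ν - ∫ z in Z₀ ∩ V k, f2 k z ∂ν := by
    rw [setIntegral_eq_of_subset_of_forall_sdiff_eq_zero h.meas_set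
      (inter_subset_left (t := V k)) fun z hz =>
        softCut_of_abs_le (hoff z fun hh => hz.2 ⟨hz.1, hh⟩).2, ← integral_sub]
    · refine setIntegral_congr_fun hUm fun z hz => ?_
      simp only [hf2, indicator_of_mem hz, softCut]
    · exact h.integrableOn_log_of_finite hVf
    · have : IsFiniteMeasure (ν.restrict (Z₀ ∩ V k)) := ⟨by
        rw [Measure.restrict_apply_univ]
        exact (measure_mono inter_subset_right).trans_lt hVf.lt_top⟩
      refine Integrable.of_bound (((continuous_clip _).measurable.comp h.meas_log).indicator
        hUm).aestronglyMeasurable (δ k) (ae_of_all _ fun z => ?_)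
      rw [Real.norm_eq_abs]
      by_cases hz : z ∈ Z₀ ∩ V k
      · simp only [hf2, indicator_of_mem hz]; exact abs_clip_le (hpos k) _
      · simp only [hf2, indicator_of_notMem hz, abs_zero]; exact hpos k
  have hz1 : ∀ z ∉ V k, f1 k z = 0 := fun z hz =>
    indicator_of_notMem (fun hh : z ∈ Z₀ᶜ => hh (hoff z hz).1) _
  have hz2 : ∀ z ∉ V k, f2 k z = 0 := fun z hz => indicator_of_notMem (fun hh => hz hh.2) _
  have hz3 : ∀ z ∉ V k, (V k).indicator l z = 0 := fun z hz => indicator_of_notMem hz _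
  rw [hs, incSum_sub hω (f := fun z => (V k).indicator l z - f1 k z) (g := f2 k)
    (fun z hz => by rw [hz3 z hz, hz1 z hz, sub_zero]) hz2,
    incSum_sub hω (f := (V k).indicator l) (g := f1 k) hz3 hz1, hint,
    jumpSum_eq_incSum (hp.dom_pos ω), ← inter_bigJumps]
  change incSum (p ω) ((V k).indicator l) 0 t - _ - _ - (_ - _) = _
  simp only [NNReal.coe_zero, sub_zero]
  ring

/-- The jump part of a semimartingale with known continuous part is a functional of its path. -/
theorem IsJumpSize.aestronglyMeasurable_jumpIntegral (h : IsJumpSize ν Z₀ γ l)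
    (hW : IsBrownianMotion 𝓕 P W) (hp : IsPoissonPointProcess 𝓕 P ν p)
    (hWp : Indep (processSigma W) (pointSigma p) P)
    {L : ℝ≥0 → Ω → ℝ} (hL : IsJumpIntegral P ν Z₀ p l L) {y φ : ℝ≥0 → Ω → ℝ}
    (hφ : ∀ᵐ ω ∂P, Continuous fun t => φ t ω) (hy : ∀ᵐ ω ∂P, ∀ t, y t ω = φ t ω + L t ω)
    {m : MeasurableSpace Ω} {t : ℝ≥0} (hm : ∀ u ≤ t, AEStronglyMeasurable[m] (y u) P) :
    AEStronglyMeasurable[m] (L t) P := by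
  refine aestronglyMeasurable_sub_of_tendstoInMeasure (fun k => ?_)
    (h.tendsto_softCut hW hp hWp hL t)
  suffices hk : AEStronglyMeasurable[m] (fun ω =>
      incSum (p ω) (softCut (1 / ((k : ℝ) + 1)) ∘ l) 0 t) P from hk.sub aestronglyMeasurable_const
  set δ : ℝ := 1 / ((k : ℝ) + 1) with hδ
  have hδ0 : 0 < δ := by positivity
  refine aestronglyMeasurable_sub_of_tendsto_ae (f := fun n ω => ∑ j ∈ Finset.range (2 ^ n),
    softCut δ (y (dyadicPt t n (j + 1)) ω - y (dyadicPt t n j) ω)) (fun n => ?_) ?_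
  · refine aestronglyMeasurable_sub_sum (Finset.range (2 ^ n))
      (f := fun j ω => softCut δ (y (dyadicPt t n (j + 1)) ω - y (dyadicPt t n j) ω)) fun j hj => ?_
    exact (continuous_softCut δ).comp_aestronglyMeasurable
      ((hm _ (dyadicPt_le (Finset.mem_range.1 hj))).sub
      (hm _ (dyadicPt_le (Finset.mem_range.1 hj).le)))
  · filter_upwards [hφ, hy, h.ae_smallJumpPart_le hW hp hWp hL t, ae_all_iff.2 fun i =>
      hp.ae_locFinite (h.measurableSet_bigJumps i) (h.measure_bigJumps_ne_top i)]
      with ω h1 h2 h3 h4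
    -- A soft rather than hard threshold is needed here: dyadic increments only approximate the
    -- jumps, and `softCut` is Lipschitz with constant `2` as well as zero near the origin.
    refine tendsto_sum_increments (q := p ω) (l := l) (y := fun u => y u ω) (g := softCut δ) hδ0
      zero_le_two (fun x hx => softCut_of_abs_le hx) (abs_softCut_sub_le δ) fun η hη => ?_
    -- The bound `η` controls the error on dyadic points, and `δ / 2` guarantees that all jumps
    -- above that size belong to the big ones.
    obtain ⟨i, hi, hi'⟩ := h3 (min η (δ / 2)) (lt_min hη (by positivity))
    refine ⟨bigJumps Z₀ l i, fun z hz => Or.inr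
      ((hi.trans (min_le_right _ _)).trans_lt hz), h4 i, fun u => φ u ω
        - u * ∫ z in Z₀ ∩ {z | 1 / ((i : ℝ) + 1) < |l z|}, l z ∂ν,
        h1.sub (NNReal.continuous_coe.mul continuous_const), fun n j hj => ?_⟩
    refine le_trans (le_of_eq ?_) ((hi' n j hj).trans (min_le_left _ _))
    rw [h2, smallJumpPart]
    congr 1
    ring

end Recover

section Congr

/-- The number of points with mark in `N`, over all times, is Poisson with parameter zero. -/
lemma IsPoissonPointProcess.ae_notMem_of_null (hp : IsPoissonPointProcess 𝓕 P ν p) {N : Set Z}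
    [SFinite ν] (hNm : MeasurableSet N) (hN : ν N = 0) : ∀ᵐ ω ∂P, ∀ r z, p ω r = some z → z ∉ N := by
  have hB : MeasurableSet ((univ : Set ℝ) ×ˢ N) := MeasurableSet.univ.prod hNm
  have hI : intensity ν (univ ×ˢ N) = 0 := by
    rw [intensity, Measure.prod_prod, hN, mul_zero]
  have hlaw := hp.poisson _ hB (by rw [hI]; exact ENNReal.zero_ne_top)
  have h0 : ∀ᵐ k ∂(P.map fun ω => pointCount (p ω) (univ ×ˢ N)), k = 0 := by
    rw [hlaw.map_eq]
    refine (ae_map_iff (p := fun k : ℕ∞ => k = 0) measurable_from_top.aemeasurable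
      (MeasurableSet.singleton 0)).2 ?_
    rw [hI]
    have hi := integral_exp_mul_poissonMeasure 0 1
    -- A nonnegative function with zero mean that vanishes only at `k = 0` shows that the law is
    -- concentrated there.
    have hz : ∫ k : ℕ, (Real.exp (1 * k) - 1) ∂(poissonMeasure 0) = 0 := by
      rw [integral_sub hi.1 (integrable_const _), hi.2]; simp
    have hnn : ∀ k : ℕ, 0 ≤ Real.exp (1 * k) - 1 := fun k => by
      have := Real.one_le_exp (x := 1 * k) (by positivity); linarith
    have := (integral_eq_zero_iff_of_nonneg hnn (hi.1.sub (integrable_const _))).1 hz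
    filter_upwards [this] with k hk
    have h1 : Real.exp (1 * k) = 1 := by simpa [sub_eq_zero] using hk
    have h2 := Real.exp_eq_one_iff _ |>.1 h1
    exact_mod_cast (by simpa using h2 : (k : ℝ) = 0)
  filter_upwards [ae_of_ae_map hlaw.aemeasurable h0] with ω hω r z hz hzN
  rw [pointCount, Set.encard_eq_zero] at hω
  exact hω.subset ⟨z, hz, mem_univ _, hzN⟩

/-- Almost surely no point carries a mark where the two integrands differ. This permits replacing
jump sizes by versions that satisfy their constraints for every mark. -/
lemma IsJumpIntegral.congr_ae [SFinite ν] (hp : IsPoissonPointProcess 𝓕 P ν p) {Z₀ : Set Z}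
    {f g : Z → ℝ} (hfg : f =ᵐ[ν] g) {J : ℝ≥0 → Ω → ℝ} (hJ : IsJumpIntegral P ν Z₀ p f J) :
    IsJumpIntegral P ν Z₀ p g J := by
  refine ⟨hJ.measurable, hJ.cadlag, fun t => TendstoInMeasure.congr_ev (hJ.limit t)
    (Eventually.of_forall fun k => ?_)⟩
  -- Neither integrand is assumed measurable, so the set of disagreement is enlarged to a measurable
  -- null set.
  set N := toMeasurable ν {z | f z ≠ g z}
  have hN : ν N = 0 := by rw [measure_toMeasurable]; exact hfg
  have hNs : ∀ z ∉ N, f z = g z := fun z hz => by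
    by_contra hne
    exact hz (subset_toMeasurable _ _ hne)
  have hint : ∫ z in Z₀ ∩ {z | 1 / ((k : ℝ) + 1) < |f z|}, f z ∂ν
      = ∫ z in Z₀ ∩ {z | 1 / ((k : ℝ) + 1) < |g z|}, g z ∂ν := by
    have h1 : (Z₀ ∩ {z | 1 / ((k : ℝ) + 1) < |f z|} : Set Z)
        =ᵐ[ν] (Z₀ ∩ {z | 1 / ((k : ℝ) + 1) < |g z|} : Set Z) := by
      filter_upwards [hfg] with z hz
      change (z ∈ Z₀ ∧ 1 / ((k : ℝ) + 1) < |f z|) = (z ∈ Z₀ ∧ 1 / ((k : ℝ) + 1) < |g z|)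
      rw [hz]
    rw [setIntegral_congr_set h1]
    exact integral_congr_ae (ae_restrict_of_ae hfg)
  filter_upwards [hp.ae_notMem_of_null (measurableSet_toMeasurable ν _) hN] with ω hω
  rw [hint]
  congr 1
  refine finsum_mem_congr ?_ ?_
  · ext r
    simp only [mem_ofPred_eq]
    refine and_congr_right fun _ => exists_congr fun z => ?_
    constructor
    · rintro ⟨h1, h2⟩
      rw [hNs z (hω r z h2)] at h1
      exact ⟨h1, h2⟩
    · rintro ⟨h1, h2⟩
      rw [← hNs z (hω r z h2)] at h1
      exact ⟨h1, h2⟩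
  · rintro r ⟨-, z, -, hz⟩
    rw [hz]
    exact hNs z (hω r z hz)

end Congr

end

section

variable {Ω : Type*} {mΩ : MeasurableSpace Ω} {P : Measure Ω}

/-! ### Augmentation, independence and conditional expectations -/

lemma sup_eq_generateFrom_inter (m₁ m₂ : MeasurableSpace Ω) :
    m₁ ⊔ m₂ = MeasurableSpace.generateFrom
      {s | ∃ A B, MeasurableSet[m₁] A ∧ MeasurableSet[m₂] B ∧ s = A ∩ B} := by
  refine le_antisymm (sup_le ?_ ?_) (MeasurableSpace.generateFrom_le ?_)
  · intro A hA
    exact MeasurableSpace.measurableSet_generateFrom ⟨A, univ, hA, MeasurableSet.univ, by simp⟩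
  · intro B hB
    exact MeasurableSpace.measurableSet_generateFrom ⟨univ, B, MeasurableSet.univ, hB, by simp⟩
  · rintro s ⟨A, B, hA, hB, rfl⟩
    exact MeasurableSet.inter (m := m₁ ⊔ m₂) ((le_sup_left : m₁ ≤ m₁ ⊔ m₂) A hA)
      ((le_sup_right : m₂ ≤ m₁ ⊔ m₂) B hB)

lemma isPiSystem_inter_measurableSet (m₁ m₂ : MeasurableSpace Ω) :
    IsPiSystem {s | ∃ A B, MeasurableSet[m₁] A ∧ MeasurableSet[m₂] B ∧ s = A ∩ B} := by
  rintro s ⟨A, B, hA, hB, rfl⟩ s' ⟨A', B', hA', hB', rfl⟩ -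
  exact ⟨A ∩ A', B ∩ B', MeasurableSet.inter hA hA', MeasurableSet.inter hB hB',
    inter_inter_inter_comm _ _ _ _⟩

/-- The σ-algebra of measurable sets which agree almost surely with a set of `m`. -/
@[reducible] def aeSigma (P : Measure Ω) (m : MeasurableSpace Ω) : MeasurableSpace Ω where
  MeasurableSet' A := MeasurableSet[mΩ] A ∧ ∃ B, MeasurableSet[m] B ∧ A =ᵐ[P] B
  measurableSet_empty := ⟨@MeasurableSet.empty Ω mΩ, ∅, @MeasurableSet.empty Ω m, ae_eq_refl _⟩
  measurableSet_compl := by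
    rintro A ⟨hA, B, hB, hAB⟩
    exact ⟨hA.compl, Bᶜ, MeasurableSet.compl hB, hAB.compl⟩
  measurableSet_iUnion := by
    intro A hA
    choose h1 B hB hAB using hA
    exact ⟨MeasurableSet.iUnion h1, ⋃ i, B i, MeasurableSet.iUnion hB,
      Filter.EventuallyEq.countable_iUnion hAB⟩

/-- The generated σ-algebra becomes usable through this description: every augmented set differs
from a set of `m` by null sets, and conversely such a set is obtained from one of `m` by removing
and adding measurable null sets. -/
lemma augment_eq_aeSigma {m : MeasurableSpace Ω} (hm : m ≤ mΩ) : augment P m = aeSigma P m := by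
  refine le_antisymm (sup_le (fun A hA => ⟨hm A hA, A, hA, ae_eq_refl _⟩)
    (MeasurableSpace.generateFrom_le ?_)) ?_
  · rintro A ⟨hA, hA0⟩
    exact ⟨hA, ∅, MeasurableSet.empty, ae_eq_empty.2 hA0⟩
  · rintro A ⟨hA, B, hB, hAB⟩
    have hnull : ∀ N, MeasurableSet[mΩ] N → P N = 0 → MeasurableSet[augment P m] N :=
      fun N h1 h2 => (le_sup_right : _ ≤ augment P m) N
        (MeasurableSpace.measurableSet_generateFrom ⟨h1, h2⟩)
    have hd := ae_eq_set.1 hAB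
    have hB' : MeasurableSet[augment P m] B := (le_sup_left : m ≤ augment P m) B hB
    have e : A = (B \ (B \ A)) ∪ (A \ B) := by
      ext ω
      simp only [mem_union, Set.mem_sdiff]
      tauto
    rw [e]
    exact MeasurableSet.union (m := augment P m) (MeasurableSet.diff hB'
      (hnull _ ((hm B hB).diff hA) hd.2)) (hnull _ (hA.diff (hm B hB)) hd.1)

lemma augment_le {m : MeasurableSpace Ω} (hm : m ≤ mΩ) : augment P m ≤ mΩ := by
  rw [augment_eq_aeSigma hm]
  exact fun A hA => hA.1

lemma augment_mono {m m' : MeasurableSpace Ω} (h : m ≤ m') : augment P m ≤ augment P m' :=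
  sup_le_sup_right h _

lemma augment_augment {m : MeasurableSpace Ω} : augment P (augment P m) = augment P m := by
  unfold augment
  rw [sup_assoc, sup_idem]

lemma measurable_augment {m : MeasurableSpace Ω} (hm : m ≤ mΩ) {f : Ω → ℝ} (hf : Measurable[mΩ] f)
    (hf' : AEStronglyMeasurable[m] f P) : Measurable[augment P m] f := by
  intro s hs
  rw [augment_eq_aeSigma hm]
  refine ⟨hf hs, hf'.mk f ⁻¹' s, hf'.stronglyMeasurable_mk.measurable hs, ?_⟩
  filter_upwards [hf'.ae_eq_mk] with ω hω
  change (f ω ∈ s) = (hf'.mk f ω ∈ s)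
  rw [hω]

lemma measurable_augment_pi {ι : Type*} {m : MeasurableSpace Ω} (hm : m ≤ mΩ) {f : Ω → ι → ℝ}
    (hf : Measurable[mΩ] f) (hf' : ∀ i, AEStronglyMeasurable[m] (fun ω => f ω i) P) :
    Measurable[augment P m] f :=
  (@measurable_pi_iff Ω ι (fun _ => ℝ) (augment P m) _ f).2 fun i =>
    measurable_augment hm ((measurable_pi_apply i).comp hf) (hf' i)

section CondExp

variable [IsProbabilityMeasure P]

/-- Integrals over an augmented set equal integrals over a set of `m` agreeing with it almost
surely, so the smaller conditional expectation satisfies the defining property of the larger. -/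
lemma condExp_augment {m : MeasurableSpace Ω} (hm : m ≤ mΩ) {f : Ω → ℝ} (hf : Integrable f P) :
    P[f | augment P m] =ᵐ[P] P[f | m] := by
  refine (ae_eq_condExp_of_forall_setIntegral_eq (augment_le hm) hf
    (fun _ _ _ => integrable_condExp.integrableOn) (fun s hs _ => ?_)
    (stronglyMeasurable_condExp.mono le_sup_left).aestronglyMeasurable).symm
  rw [augment_eq_aeSigma hm] at hs
  obtain ⟨-, B, hB, hsB⟩ := hs
  rw [setIntegral_congr_set hsB, setIntegral_congr_set hsB, setIntegral_condExp hm hf hB]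

lemma indep_augment {m m' : MeasurableSpace Ω} (hm : m ≤ mΩ) (hm' : m' ≤ mΩ)
    (h : Indep m m' P) : Indep (augment P m) (augment P m') P := by
  rw [augment_eq_aeSigma hm, augment_eq_aeSigma hm', Indep_iff]
  rintro A A' ⟨-, B, hB, hAB⟩ ⟨-, B', hB', hAB'⟩
  rw [measure_congr (hAB.inter hAB'), measure_congr hAB, measure_congr hAB']
  exact (Indep_iff _ _ _).1 h B B' hB hB'

/-- On intersections `A ∩ B`, which form a π-system, the factorization is obtained by splitting off
`A` first and then separating `B` from `C`. -/
lemma indep_sup_left {m₁ m₂ m₃ : MeasurableSpace Ω} (h₁ : m₁ ≤ mΩ) (h₂ : m₂ ≤ mΩ) (h₃ : m₃ ≤ mΩ)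
    (h : Indep m₁ (m₂ ⊔ m₃) P) (h' : Indep m₂ m₃ P) : Indep (m₁ ⊔ m₂) m₃ P := by
  refine IndepSets.indep (sup_le h₁ h₂) h₃ (isPiSystem_inter_measurableSet m₁ m₂)
    (@MeasurableSpace.isPiSystem_measurableSet Ω m₃) (sup_eq_generateFrom_inter m₁ m₂)
    (@MeasurableSpace.generateFrom_measurableSet Ω m₃).symm ?_
  rw [IndepSets_iff]
  rintro s C ⟨A, B, hA, hB, rfl⟩ hC
  have hB' : MeasurableSet[m₂ ⊔ m₃] B := (le_sup_left : m₂ ≤ m₂ ⊔ m₃) B hB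
  have hC' : MeasurableSet[m₂ ⊔ m₃] C := (le_sup_right : m₃ ≤ m₂ ⊔ m₃) C hC
  rw [inter_assoc, (Indep_iff _ _ _).1 h A (B ∩ C) hA (MeasurableSet.inter hB' hC'),
    (Indep_iff _ _ _).1 h' B C hB hC, (Indep_iff _ _ _).1 h A B hA hB', mul_assoc]

/-- Information independent of everything else does not change a conditional expectation. -/
lemma condExp_sup_of_indep {m m' m₁ m₂ : MeasurableSpace Ω} (hm : m ≤ mΩ) (hm' : m' ≤ mΩ)
    (h : Indep m m' P) (h₁ : m₁ ≤ m) (h₂ : m₂ ≤ m') {f : Ω → ℝ} (hf : Integrable f P)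
    (hfm : StronglyMeasurable[m] f) : P[f | m₁ ⊔ m₂] =ᵐ[P] P[f | m₁] := by
  have hle1 := h₁.trans hm
  have hle2 := h₂.trans hm'
  have hle : m₁ ⊔ m₂ ≤ mΩ := sup_le hle1 hle2
  -- On `A ∩ B` the event `B` contributes only its probability. Applied to `f` and to its
  -- conditional expectation, this gives equality on the generating π-system.
  have hprod : ∀ g : Ω → ℝ, StronglyMeasurable[m] g → ∀ A B, MeasurableSet[m₁] A →
      MeasurableSet[m₂] B → ∫ ω in A ∩ B, g ω ∂P = (∫ ω in A, g ω ∂P) * P.real B := by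
    intro g hg A B hA hB
    have hA' := hle1 A hA
    have hB' := hle2 B hB
    have hind : IndepFun (A.indicator g) (B.indicator fun _ => (1 : ℝ)) P :=
      indep_of_indep_of_le_left (indep_of_indep_of_le_right h
        ((@measurable_const ℝ Ω _ m' 1).indicator (h₂ B hB)).comap_le)
        (hg.measurable.indicator (h₁ A hA)).comap_le
    have := hind.integral_mul_eq_mul_integral
      ((hg.mono hm).indicator hA').aestronglyMeasurable
      ((stronglyMeasurable_const (β := ℝ)).indicator hB').aestronglyMeasurable
    rw [integral_indicator hA', integral_indicator hB', setIntegral_const, smul_eq_mul,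
      mul_one] at this
    rw [← this, ← integral_indicator (hA'.inter hB')]
    congr 1
    ext ω
    rw [Pi.mul_apply]
    by_cases h1 : ω ∈ A <;> by_cases h2 : ω ∈ B <;> simp [h1, h2]
  refine (ae_eq_condExp_of_forall_setIntegral_eq hle hf
    (fun _ _ _ => integrable_condExp.integrableOn) (fun s hs _ => ?_)
    (stronglyMeasurable_condExp.mono le_sup_left).aestronglyMeasurable).symm
  have hgi : Integrable (P[f | m₁]) P := integrable_condExp
  induction s, hs using MeasurableSpace.induction_on_inter
    (sup_eq_generateFrom_inter m₁ m₂) (isPiSystem_inter_measurableSet m₁ m₂) with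
  | empty => simp
  | basic s hs =>
    obtain ⟨A, B, hA, hB, rfl⟩ := hs
    rw [hprod f hfm A B hA hB, hprod _ (stronglyMeasurable_condExp.mono h₁) A B hA hB,
      setIntegral_condExp hle1 hf hA]
  | compl s hs ih =>
    have hs' := hle s hs
    have e1 := integral_add_compl hs' hf
    have e2 := integral_add_compl hs' hgi
    have e3 : ∫ ω, (P[f | m₁]) ω ∂P = ∫ ω, f ω ∂P := integral_condExp hle1
    have ih' := ih (measure_lt_top _ _)
    linarith
  | iUnion s hd hs ih =>
    rw [integral_iUnion (fun i => hle _ (hs i)) hd hgi.integrableOn,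
      integral_iUnion (fun i => hle _ (hs i)) hd hf.integrableOn]
    exact tsum_congr fun i => ih i (measure_lt_top _ _)

end CondExp

end

section

/-! ### Integrals along paths and linear equations -/

lemma tendsto_riemannSum {h : ℝ → ℝ} (hc : Continuous h) (t : ℝ≥0) :
    Tendsto (fun n => ∑ j ∈ Finset.range (2 ^ n), (t : ℝ) / 2 ^ n * h (dyadicPt t n j)) atTop
      (𝓝 (∫ u in (0 : ℝ)..t, h u)) := by
  rw [Metric.tendsto_nhds]
  intro ε hε
  have hε' : 0 < ε / (t + 1) := by positivity
  obtain ⟨ρ, hρ, hρ'⟩ := Metric.uniformContinuousOn_iff.1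
    (isCompact_Icc.uniformContinuousOn_of_continuous (hc.continuousOn (s := Icc (0 : ℝ) t))) _ hε'
  filter_upwards [(tendsto_div_two_pow (t : ℝ)).eventually (gt_mem_nhds hρ)] with n hn
  have hsum := intervalIntegral.sum_integral_adjacent_intervals (μ := volume) (f := h)
    (a := fun j => (dyadicPt t n j : ℝ)) (n := 2 ^ n) fun k _ => hc.intervalIntegrable _ _
  rw [dyadicPt_zero, dyadicPt_last, NNReal.coe_zero] at hsum
  rw [Real.dist_eq, ← hsum, ← Finset.sum_sub_distrib]
  have hterm : ∀ j ∈ Finset.range (2 ^ n), |(t : ℝ) / 2 ^ n * h (dyadicPt t n j)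
      - ∫ u in (dyadicPt t n j : ℝ)..dyadicPt t n (j + 1), h u| ≤ ε / (t + 1) * (t / 2 ^ n) := by
    intro j hj
    have hmesh := dyadicPt_succ_sub t n j
    have hle : (dyadicPt t n j : ℝ) ≤ dyadicPt t n (j + 1) :=
      NNReal.coe_le_coe.2 (dyadicPt_mono t n j.le_succ)
    have hut : (dyadicPt t n (j + 1) : ℝ) ≤ t :=
      NNReal.coe_le_coe.2 (dyadicPt_le (Finset.mem_range.1 hj))
    have e : (t : ℝ) / 2 ^ n * h (dyadicPt t n j)
        = ∫ _ in (dyadicPt t n j : ℝ)..dyadicPt t n (j + 1), h (dyadicPt t n j) := by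
      rw [intervalIntegral.integral_const, hmesh, smul_eq_mul]
    rw [e, ← intervalIntegral.integral_sub (by simp) (hc.intervalIntegrable _ _)]
    have := intervalIntegral.norm_integral_le_of_norm_le_const
      (f := fun u => h (dyadicPt t n j) - h u) (C := ε / (t + 1))
      (a := (dyadicPt t n j : ℝ)) (b := dyadicPt t n (j + 1)) fun u hu => by
        rw [uIoc_of_le hle] at hu
        have h0 : (0 : ℝ) ≤ dyadicPt t n j := NNReal.coe_nonneg _
        have := hρ' (dyadicPt t n j) ⟨h0, hle.trans hut⟩ u ⟨h0.trans hu.1.le, hu.2.trans hut⟩ (by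
          rw [Real.dist_eq, abs_sub_comm, abs_of_nonneg (by linarith [hu.1])]
          linarith [hu.2])
        exact this.le
    rwa [hmesh, abs_of_nonneg (by positivity)] at this
  calc _ ≤ ∑ j ∈ Finset.range (2 ^ n), ε / (t + 1) * (t / 2 ^ n) :=
        (Finset.abs_sum_le_sum_abs _ _).trans (Finset.sum_le_sum hterm)
    _ = ε / (t + 1) * t := by
        rw [Finset.sum_const, Finset.card_range, nsmul_eq_mul]
        push_cast
        field_simp
    _ < ε := by
        rw [div_mul_eq_mul_div, div_lt_iff₀ (by positivity)]
        linarith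

variable {Ω : Type*} {mΩ : MeasurableSpace Ω} {P : Measure Ω}

lemma aestronglyMeasurable_integral_path {m : MeasurableSpace Ω} {y : ℝ≥0 → Ω → ℝ}
    (hc : ∀ᵐ ω ∂P, Continuous fun t => y t ω) {t : ℝ≥0}
    (hm : ∀ u ≤ t, AEStronglyMeasurable[m] (y u) P) :
    AEStronglyMeasurable[m] (fun ω => ∫ u in (0 : ℝ)..t, y u.toNNReal ω) P := by
  refine aestronglyMeasurable_sub_of_tendsto_ae (f := fun n ω =>
    ∑ j ∈ Finset.range (2 ^ n), (t : ℝ) / 2 ^ n * y (dyadicPt t n j) ω) (fun n => ?_) ?_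
  · exact aestronglyMeasurable_sub_sum _ fun j hj =>
      (hm _ (dyadicPt_le (Finset.mem_range.1 hj).le)).const_mul _
  · filter_upwards [hc] with ω hω
    have := tendsto_riemannSum (h := fun u : ℝ => y u.toNNReal ω)
      (hω.comp continuous_real_toNNReal) t
    simpa only [Real.toNNReal_coe] using this

lemma continuous_integral_path {h : ℝ → ℝ} (hc : Continuous h) :
    Continuous fun t : ℝ≥0 => ∫ u in (0 : ℝ)..t, h u :=
  (intervalIntegral.continuous_primitive (fun _ _ => hc.intervalIntegrable _ _) 0).comp
    NNReal.continuous_coe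

lemma exists_lipschitz_integral_path {h : ℝ → ℝ} (hc : Continuous h) (t : ℝ≥0) :
    ∃ C : ℝ, ∀ u w : ℝ≥0, u ≤ w → w ≤ t →
      |(∫ v in (0 : ℝ)..w, h v) - ∫ v in (0 : ℝ)..u, h v| ≤ C * (w - u) := by
  obtain ⟨C, hC⟩ := (isCompact_Icc (a := (0 : ℝ)) (b := t)).exists_bound_of_continuousOn
    hc.continuousOn
  refine ⟨C, fun u w huw hwt => ?_⟩
  have huw' : (u : ℝ) ≤ w := NNReal.coe_le_coe.2 huw
  rw [intervalIntegral.integral_interval_sub_left (hc.intervalIntegrable _ _)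
    (hc.intervalIntegrable _ _)]
  have := intervalIntegral.norm_integral_le_of_norm_le_const (f := h) (C := C)
    (a := (u : ℝ)) (b := w) fun v hv => by
      rw [uIoc_of_le huw'] at hv
      exact hC v ⟨u.coe_nonneg.trans hv.1.le, hv.2.trans (NNReal.coe_le_coe.2 hwt)⟩
  rwa [abs_of_nonneg (sub_nonneg.2 huw')] at this

/-- The induction step of Picard's iteration: each integration gains one power and one factorial
factor, which forces convergence on any bounded interval. -/
lemma abs_integral_le_pow {h : ℝ → ℝ} {c β : ℝ} {k : ℕ} {t : ℝ≥0}
    (hh : ∀ u : ℝ≥0, u ≤ t → |h u| ≤ β * (c * ((β * u) ^ k / k.factorial))) :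
    |∫ u in (0 : ℝ)..t, h u| ≤ c * ((β * t) ^ (k + 1) / (k + 1).factorial) := by
  have h1 := intervalIntegral.norm_integral_le_of_norm_le (f := h) (μ := volume)
    (g := fun u => β * (c * ((β * u) ^ k / k.factorial))) (a := 0) (b := (t : ℝ)) t.coe_nonneg
    (ae_of_all _ fun u hu => by
      have := hh u.toNNReal (Real.toNNReal_le_iff_le_coe.2 hu.2)
      rwa [Real.coe_toNNReal _ hu.1.le] at this)
    ((by fun_prop : Continuous fun u : ℝ =>
      β * (c * ((β * u) ^ k / k.factorial))).intervalIntegrable _ _)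
  refine (Real.norm_eq_abs _ ▸ h1).trans (le_of_eq ?_)
  have e : (fun u : ℝ => β * (c * ((β * u) ^ k / k.factorial)))
      = fun u => (β ^ (k + 1) * c / k.factorial) * u ^ k := by
    ext u
    rw [mul_pow, pow_succ]
    ring
  rw [e, intervalIntegral.integral_const_mul, integral_pow, Nat.factorial_succ, mul_pow]
  push_cast
  have : (k.factorial : ℝ) ≠ 0 := by positivity
  field_simp
  ring

lemma tendsto_mul_pow_div_factorial (c x : ℝ) :
    Tendsto (fun k : ℕ => c * (x ^ k / k.factorial)) atTop (𝓝 0) := by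
  simpa using (FloorSemiring.tendsto_pow_div_factorial_atTop x).const_mul c

/-- Picard iterates for `X = V + ∫ (b + B X) du`. -/
def picard {ι : Type*} [Fintype ι] (b : ι → ℝ) (B : Matrix ι ι ℝ) (V : ℝ≥0 → Ω → ι → ℝ) :
    ℕ → ℝ≥0 → Ω → ι → ℝ
  | 0 => V
  | k + 1 => fun t ω i =>
      V t ω i + ∫ u in (0 : ℝ)..t, (b i + ∑ j, B i j * picard b B V k u.toNNReal ω j)

/-- Solutions of linear equations are measurable functionals of the forcing term. -/
lemma aestronglyMeasurable_linearEquation {ι : Type*} [Fintype ι] {b : ι → ℝ} {B : Matrix ι ι ℝ}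
    {V X : ℝ≥0 → Ω → ι → ℝ} {m : MeasurableSpace Ω}
    (hX : ∀ᵐ ω ∂P, ∀ i, Continuous fun t => X t ω i)
    (hV : ∀ᵐ ω ∂P, ∀ i, Continuous fun t => V t ω i)
    (hVm : ∀ t i, AEStronglyMeasurable[m] (fun ω => V t ω i) P)
    (heq : ∀ᵐ ω ∂P, ∀ (t : ℝ≥0) i,
      X t ω i = V t ω i + ∫ u in (0 : ℝ)..t, (b i + ∑ j, B i j * X u.toNNReal ω j))
    (t : ℝ≥0) (i : ι) : AEStronglyMeasurable[m] (fun ω => X t ω i) P := by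
  have hcomp : ∀ {y : ℝ≥0 → ι → ℝ}, (∀ i, Continuous fun t => y t i) → ∀ i,
      Continuous fun t : ℝ≥0 => b i + ∑ j, B i j * y t j := fun hy i =>
    continuous_const.add (continuous_finsetSum _ fun j _ => continuous_const.mul (hy j))
  have hpc : ∀ k, ∀ᵐ ω ∂P, ∀ i, Continuous fun t => picard b B V k t ω i := by
    intro k
    induction k with
    | zero => exact hV
    | succ k ih =>
      filter_upwards [ih, hV] with ω h1 h2 i
      exact (h2 i).add (continuous_integral_path ((hcomp h1 i).comp continuous_real_toNNReal))
  have hpm : ∀ k t i, AEStronglyMeasurable[m] (fun ω => picard b B V k t ω i) P := by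
    intro k
    induction k with
    | zero => exact hVm
    | succ k ih =>
      intro t i
      refine (hVm t i).add (aestronglyMeasurable_integral_path
        (y := fun u ω => b i + ∑ j, B i j * picard b B V k u ω j) ?_ fun u _ => ?_)
      · filter_upwards [hpc k] with ω hω using hcomp hω i
      · exact aestronglyMeasurable_const.add (aestronglyMeasurable_sub_sum _ fun j _ =>
          (ih u j).const_mul _)
  refine aestronglyMeasurable_sub_of_tendsto_ae (fun k => hpm k t i) ?_
  filter_upwards [hX, hV, heq, ae_all_iff.2 hpc] with ω h1 h2 h3 h4
  -- The sum of all entries dominates every row sum, so a single constant serves all components.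
  set β : ℝ := ∑ i, ∑ j, |B i j| with hβ
  have hcont : Continuous fun u => ∑ i, |V u ω i - X u ω i| :=
    continuous_finsetSum _ fun i _ => ((h2 i).sub (h1 i)).abs
  obtain ⟨M, hM⟩ := (isCompact_Icc (a := (0 : ℝ≥0)) (b := t)).exists_bound_of_continuousOn
    hcont.continuousOn
  have hbound : ∀ k, ∀ u ≤ t, ∀ i, |picard b B V k u ω i - X u ω i|
      ≤ M * ((β * u) ^ k / k.factorial) := by
    intro k
    induction k with
    | zero =>
      intro u hu i
      have := hM u ⟨zero_le, hu⟩
      rw [Real.norm_eq_abs, abs_of_nonneg (Finset.sum_nonneg fun _ _ => abs_nonneg _)] at this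
      simp only [pow_zero, Nat.factorial_zero, Nat.cast_one, div_one, mul_one]
      exact (Finset.single_le_sum (f := fun i => |V u ω i - X u ω i|)
        (fun i _ => abs_nonneg _) (Finset.mem_univ i)).trans this
    | succ k ih =>
      intro u hu i
      have e : picard b B V (k + 1) u ω i - X u ω i = ∫ v in (0 : ℝ)..u,
          ∑ j, B i j * (picard b B V k v.toNNReal ω j - X v.toNNReal ω j) := by
        rw [h3 u i, picard, add_sub_add_left_eq_sub, ← intervalIntegral.integral_sub]
        · congr 1
          ext v
          simp_rw [mul_sub, Finset.sum_sub_distrib]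
          ring
        · exact ((hcomp (h4 k) i).comp continuous_real_toNNReal).intervalIntegrable _ _
        · exact ((hcomp h1 i).comp continuous_real_toNNReal).intervalIntegrable _ _
      rw [e]
      refine abs_integral_le_pow fun v hv => ?_
      rw [Real.toNNReal_coe]
      have hnn : 0 ≤ M * ((β * v) ^ k / k.factorial) :=
        (abs_nonneg _).trans (ih v (hv.trans hu) i)
      calc _ ≤ ∑ j, |B i j| * (M * ((β * v) ^ k / k.factorial)) := by
            refine (Finset.abs_sum_le_sum_abs _ _).trans (Finset.sum_le_sum fun j _ => ?_)
            rw [abs_mul]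
            exact mul_le_mul_of_nonneg_left (ih v (hv.trans hu) j) (abs_nonneg _)
        _ = (∑ j, |B i j|) * (M * ((β * v) ^ k / k.factorial)) := by rw [← Finset.sum_mul]
        _ ≤ _ := mul_le_mul_of_nonneg_right (Finset.single_le_sum
            (f := fun i => ∑ j, |B i j|) (fun i _ => Finset.sum_nonneg fun _ _ => abs_nonneg _)
            (Finset.mem_univ i)) hnn
  rw [tendsto_iff_norm_sub_tendsto_zero]
  exact squeeze_zero (fun _ => norm_nonneg _) (fun k => hbound k t le_rfl i)
    (tendsto_mul_pow_div_factorial M (β * t))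

/-- The time is rounded up to a multiple of `1 / (n + 1)`. The resulting step functions are
measurable and converge by right continuity; the `+ 1` after the floor keeps the approximation at or
above the time. -/
lemma IsCadlag.measurable {y : ℝ≥0 → ℝ} (h : IsCadlag y) : Measurable fun u : ℝ => y u.toNNReal := by
  have hpt : ∀ (n : ℕ), Measurable fun u : ℝ => y ((⌊u.toNNReal * (n + 1)⌋₊ + 1 : ℕ) / (n + 1)) := by
    intro n
    exact (measurable_from_nat (f := fun j : ℕ => y ((j + 1 : ℕ) / (n + 1)))).comp
      (Nat.measurable_floor.comp (measurable_real_toNNReal.mul_const _))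
  refine measurable_of_tendsto_metrizable hpt (tendsto_pi_nhds.2 fun u => ?_)
  set x := u.toNNReal
  have hpos : ∀ n : ℕ, (0 : ℝ≥0) < n + 1 := fun n => by positivity
  have hlow : ∀ n : ℕ, x ≤ (⌊x * (n + 1)⌋₊ + 1 : ℕ) / (n + 1) := fun n => by
    rw [le_div_iff₀ (hpos n)]
    push_cast
    exact (Nat.lt_floor_add_one _).le
  have hup : ∀ n : ℕ, ((⌊x * (n + 1)⌋₊ + 1 : ℕ) : ℝ≥0) / (n + 1) ≤ x + 1 / (n + 1) := fun n => by
    rw [div_le_iff₀ (hpos n), add_mul, div_mul_cancel₀ _ (hpos n).ne']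
    push_cast
    gcongr
    exact Nat.floor_le zero_le
  have hlim : Tendsto (fun n : ℕ => ((⌊x * (n + 1)⌋₊ + 1 : ℕ) : ℝ≥0) / (n + 1)) atTop (𝓝 x) := by
    refine tendsto_of_tendsto_of_tendsto_of_le_of_le tendsto_const_nhds ?_ hlow hup
    have : Tendsto (fun n : ℕ => 1 / ((n : ℝ≥0) + 1)) atTop (𝓝 0) := by
      rw [← NNReal.tendsto_coe]
      push_cast
      exact tendsto_one_div_add_atTop_nhds_zero_nat
    simpa using tendsto_const_nhds.add this
  exact (h x).1.tendsto.comp (tendsto_nhdsWithin_iff.2 ⟨hlim, Eventually.of_forall hlow⟩)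

/-- The money market account is deterministic. -/
lemma IsCadlag.eq_exp_of_integral_eq {y : ℝ≥0 → ℝ} (h : IsCadlag y) {s a : ℝ}
    (heq : ∀ t : ℝ≥0, y t = s + ∫ u in (0 : ℝ)..t, a * y u.toNNReal) (t : ℝ≥0) :
    y t = s * Real.exp (a * t) := by
  obtain ⟨M, hM⟩ := h.bounded t
  have hint : ∀ u ≤ t, IntervalIntegrable (fun v : ℝ => a * y v.toNNReal) volume 0 u := by
    intro u hu
    rw [intervalIntegrable_iff_integrableOn_Ioc_of_le u.coe_nonneg]
    refine Integrable.of_bound (h.measurable.const_mul a).aestronglyMeasurable (|a| * M)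
      ((ae_restrict_iff' measurableSet_Ioc).2 (ae_of_all _ fun v hv => ?_))
    rw [Real.norm_eq_abs, abs_mul]
    exact mul_le_mul_of_nonneg_left (hM _ (Real.toNNReal_le_iff_le_coe.2
      (hv.2.trans (NNReal.coe_le_coe.2 hu)))) (abs_nonneg _)
  have hE : ∀ u : ℝ, ∫ v in (0 : ℝ)..u, a * (s * Real.exp (a * v)) = s * Real.exp (a * u) - s := by
    intro u
    have hd : ∀ v : ℝ, HasDerivAt (fun v => s * Real.exp (a * v)) (a * (s * Real.exp (a * v))) v := by
      intro v
      exact ((((hasDerivAt_id v).const_mul a).exp).const_mul s).congr_deriv (by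
        simp only [id]; ring)
    rw [intervalIntegral.integral_eq_sub_of_hasDerivAt (fun v _ => hd v)
      ((by fun_prop : Continuous fun v : ℝ => a * (s * Real.exp (a * v))).intervalIntegrable _ _)]
    simp
  set C : ℝ := M + |s| * Real.exp (|a| * t) with hC
  have hbound : ∀ k : ℕ, ∀ u ≤ t, |y u - s * Real.exp (a * u)| ≤ C * ((|a| * u) ^ k / k.factorial) := by
    intro k
    induction k with
    | zero =>
      intro u hu
      simp only [pow_zero, Nat.factorial_zero, Nat.cast_one, div_one, mul_one]
      refine (abs_sub _ _).trans (add_le_add (hM u hu) ?_)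
      rw [abs_mul, Real.abs_exp]
      refine mul_le_mul_of_nonneg_left (Real.exp_le_exp.2 ?_) (abs_nonneg _)
      refine (le_abs_self _).trans ?_
      rw [abs_mul, NNReal.abs_eq]
      exact mul_le_mul_of_nonneg_left (NNReal.coe_le_coe.2 hu) (abs_nonneg _)
    | succ k ih =>
      intro u hu
      have e : y u - s * Real.exp (a * u) = ∫ v in (0 : ℝ)..u,
          a * (y v.toNNReal - s * Real.exp (a * v)) := by
        have := hE u
        simp_rw [mul_sub]
        rw [intervalIntegral.integral_sub (hint u hu)
          ((by fun_prop : Continuous fun v : ℝ => a * (s * Real.exp (a * v))).intervalIntegrable _ _),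
          hE u, heq u]
        ring
      rw [e]
      refine abs_integral_le_pow fun v hv => ?_
      rw [abs_mul, Real.toNNReal_coe]
      exact mul_le_mul_of_nonneg_left (ih v (hv.trans hu)) (abs_nonneg _)
  have h0 : |y t - s * Real.exp (a * t)| ≤ 0 :=
    ge_of_tendsto (tendsto_mul_pow_div_factorial C (|a| * t))
      (Eventually.of_forall fun k => hbound k t le_rfl)
  exact sub_eq_zero.1 (abs_nonpos_iff.1 h0)

end

/-! ### Histories, the factor process and the price of one security. -/

section

variable {Ω Z : Type*} {mΩ : MeasurableSpace Ω} [MeasurableSpace Z] {P : Measure Ω}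
  {𝓕 : Filtration ℝ≥0 mΩ} {ν : Measure Z} {p : Ω → ℝ → Option Z} {d : ℕ}
  {W : ℝ≥0 → Ω → Fin d → ℝ}

lemma history_le {E : Type*} [MeasurableSpace E] {Y : ℝ≥0 → Ω → E} {t : ℝ≥0}
    {m : MeasurableSpace Ω} (h : ∀ u ≤ t, Measurable[m] (Y u)) : history Y t ≤ m :=
  iSup₂_le fun u hu => (h u hu).comap_le

lemma measurable_history {E : Type*} [MeasurableSpace E] (Y : ℝ≥0 → Ω → E) {u t : ℝ≥0}
    (h : u ≤ t) : Measurable[history Y t] (Y u) :=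
  (comap_measurable _).mono
    (le_iSup₂_of_le (f := fun u _ => MeasurableSpace.comap (Y u) inferInstance) u h le_rfl) le_rfl

lemma history_mono {E : Type*} [MeasurableSpace E] (Y : ℝ≥0 → Ω → E) {u t : ℝ≥0}
    (h : u ≤ t) : history Y u ≤ history Y t :=
  history_le fun _ hv => measurable_history Y (hv.trans h)

lemma pointSigma_le (hp : IsPoissonPointProcess 𝓕 P ν p) : pointSigma p ≤ mΩ :=
  iSup₂_le fun B hB => (hp.measurable_count B hB).comap_le

lemma processSigma_le {E : Type*} [MeasurableSpace E] {Y : ℝ≥0 → Ω → E}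
    (h : ∀ t, Measurable (Y t)) : processSigma Y ≤ mΩ :=
  iSup_le fun t => (h t).comap_le

/-- Setting `γ` to zero on the null set where `γ ≤ -1` makes `1 + γ'` positive everywhere, so that
`exp l = 1 + γ'` holds for every mark. -/
lemma exists_isJumpSize {Z₀ : Set Z} (hZ₀ : MeasurableSet Z₀) (hν : ν Z₀ᶜ < ∞) {γ : Z → ℝ}
    (hγ : Measurable γ) (hgt : ∀ᵐ z ∂ν, -1 < γ z) (hsq : IntegrableOn (fun z => γ z ^ 2) Z₀ ν)
    (hlog : IntegrableOn (fun z => Real.log (1 + γ z) - γ z) Z₀ ν) :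
    ∃ γ' l : Z → ℝ, IsJumpSize ν Z₀ γ' l ∧ γ =ᵐ[ν] γ' ∧ (fun z => Real.log (1 + γ z)) =ᵐ[ν] l := by
  set γ' : Z → ℝ := {z | -1 < γ z}.indicator γ with hγ'
  have hm : Measurable γ' := hγ.indicator (measurableSet_lt measurable_const hγ)
  have hae : γ =ᵐ[ν] γ' := by
    filter_upwards [hgt] with z hz
    rw [hγ', indicator_of_mem (show z ∈ {z | -1 < γ z} from hz)]
  have hae' : (fun z => Real.log (1 + γ z)) =ᵐ[ν] fun z => Real.log (1 + γ' z) := by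
    filter_upwards [hae] with z hz
    rw [hz]
  refine ⟨γ', fun z => Real.log (1 + γ' z), ⟨hZ₀, hν, hm, (hm.const_add 1).log, fun z => ?_,
    hsq.congr (ae_restrict_of_ae ?_), hlog.congr (ae_restrict_of_ae ?_)⟩, hae, hae'⟩
  · refine Real.exp_log ?_
    by_cases hz : z ∈ {z | -1 < γ z}
    · rw [hγ', indicator_of_mem hz]
      have : -1 < γ z := hz
      linarith
    · rw [hγ', indicator_of_notMem hz]
      norm_num
  · filter_upwards [hae] with z hz
    rw [hz]
  · filter_upwards [hae] with z hz
    rw [hz]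

/-- The approximating sums involve nothing but counts of the point process. This places the jump
part on the independent side of the filtering argument. -/
lemma IsJumpIntegral.aestronglyMeasurable_pointSigma [IsProbabilityMeasure P] [SFinite ν]
    {Z₀ : Set Z} {γ l : Z → ℝ} (h : IsJumpSize ν Z₀ γ l) (hp : IsPoissonPointProcess 𝓕 P ν p)
    {L : ℝ≥0 → Ω → ℝ} (hL : IsJumpIntegral P ν Z₀ p l L) (t : ℝ≥0) :
    AEStronglyMeasurable[pointSigma p] (L t) P := by
  refine aestronglyMeasurable_sub_of_tendstoInMeasure (fun k => ?_) (hL.limit t)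
  simp_rw [fun ω => jumpSum_eq_incSum (hp.dom_pos ω)]
  suffices hk : AEStronglyMeasurable[pointSigma p] (fun ω =>
      incSum (p ω) ((bigJumps Z₀ l k).indicator l) 0 t) P from hk.sub aestronglyMeasurable_const
  exact hp.incSum_aestronglyMeasurable (h.measurableSet_bigJumps k) (h.measure_bigJumps_ne_top k)
    (h.meas_log.indicator (h.measurableSet_bigJumps k)) (fun z hz => indicator_of_notMem hz l)
    fun B hB _ => measurable_pointCount_pointSigma hB

section Factor

variable {n m : ℕ} {b : Fin n → ℝ} {B : Matrix (Fin n) (Fin n) ℝ} {Lam : Matrix (Fin n) (Fin d) ℝ}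
  {X : ℝ≥0 → Ω → EuclideanSpace ℝ (Fin n)}

lemma continuous_affine_path {y : ℝ≥0 → EuclideanSpace ℝ (Fin n)} (hy : Continuous y) (α : ℝ)
    (c : Fin n → ℝ) : Continuous fun t : ℝ≥0 => α + ∑ j, c j * y t j :=
  continuous_const.add (continuous_finsetSum _ fun j _ => continuous_const.mul
    ((EuclideanSpace.proj (𝕜 := ℝ) j).continuous.comp hy))

lemma IsFactorProcess.aestronglyMeasurable_integral (hX : IsFactorProcess 𝓕 P b B Lam W X)
    {m : MeasurableSpace Ω} {t : ℝ≥0} (hm : ∀ u ≤ t, ∀ j,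
      AEStronglyMeasurable[m] (fun ω => X u ω j) P) (α : ℝ) (c : Fin n → ℝ) :
    AEStronglyMeasurable[m]
      (fun ω => ∫ u in (0 : ℝ)..t, (α + ∑ j, c j * X u.toNNReal ω j)) P := by
  refine aestronglyMeasurable_integral_path (y := fun u ω => α + ∑ j, c j * X u ω j) ?_
    fun u hu => ?_
  · filter_upwards [hX.continuous] with ω hω using continuous_affine_path hω α c
  · exact aestronglyMeasurable_const.add (aestronglyMeasurable_sub_sum _ fun j _ =>
      (hm u hu j).const_mul _)

lemma IsFactorProcess.aestronglyMeasurable_component (hX : IsFactorProcess 𝓕 P b B Lam W X)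
    (t : ℝ≥0) (j : Fin n) : AEStronglyMeasurable[𝓕 t] (fun ω => X t ω j) P :=
  ((EuclideanSpace.proj (𝕜 := ℝ) j).continuous.measurable.comp
    (hX.adapted t)).aestronglyMeasurable

/-- The factor process is a functional of its initial value and of the Brownian motion. -/
lemma IsFactorProcess.aestronglyMeasurable_initial_sup (hX : IsFactorProcess 𝓕 P b B Lam W X)
    (hW : IsBrownianMotion 𝓕 P W) (t : ℝ≥0) (j : Fin n) :
    AEStronglyMeasurable[MeasurableSpace.comap (X 0) inferInstance ⊔ processSigma W]
      (fun ω => X t ω j) P := by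
  refine aestronglyMeasurable_linearEquation (X := fun t ω j => X t ω j) (b := b) (B := B)
    (V := fun t ω i => X 0 ω i + linComb W (Lam i) t ω) ?_ ?_ (fun t i => ?_) ?_ t j
  · filter_upwards [hX.continuous] with ω hω i
    exact (EuclideanSpace.proj (𝕜 := ℝ) i).continuous.comp hω
  · filter_upwards [ae_all_iff.2 fun i => hW.ae_linComb (P := P) (Lam i)] with ω hω i
    exact continuous_const.add (hω i).1
  · have h1 : Measurable[MeasurableSpace.comap (X 0) inferInstance] fun ω => X 0 ω i :=
      (EuclideanSpace.proj (𝕜 := ℝ) i).continuous.measurable.comp (comap_measurable _)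
    have h2 : Measurable[processSigma W] (linComb W (Lam i) t) :=
      IsBrownianMotion.measurable_linComb_processSigma (Lam i) t
    have h3 := (h1.mono (le_sup_left (b := processSigma W)) le_rfl).add
      (h2.mono (le_sup_right (a := MeasurableSpace.comap (X 0) inferInstance)) le_rfl)
    exact h3.aestronglyMeasurable
  · filter_upwards [hX.sde] with ω hω t i
    rw [hω t i, linComb]
    ring

variable [IsProbabilityMeasure P] [SFinite ν] {Z₀ : Set Z} {γ l : Z → ℝ}

/-- The price of a single security is an exponential. -/
lemma price_eq_exp (hX : IsFactorProcess 𝓕 P b B Lam W X) (h : IsJumpSize ν Z₀ γ l)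
    (hW : IsBrownianMotion 𝓕 P W)
    (hp : IsPoissonPointProcess 𝓕 P ν p) (hWp : Indep (processSigma W) (pointSigma p) P)
    (σ : Fin d → ℝ) {G L : ℝ≥0 → Ω → ℝ} (hG : IsJumpIntegral P ν Z₀ p γ G)
    (hL : IsJumpIntegral P ν Z₀ p l L) {S : ℝ≥0 → Ω → ℝ}
    (hSm : ∀ s, AEStronglyMeasurable[𝓕 s] (S s) P) (hS : ∀ᵐ ω ∂P, IsCadlag (fun t => S t ω))
    {s₀ α : ℝ} {c : Fin n → ℝ} (hint : IsStochIntegral P S (fun t ω =>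
      (∫ u in (0 : ℝ)..t, (α + ∑ j, c j * X u.toNNReal ω j)) + linComb W σ t ω + G t ω)
      (fun t ω => S t ω - s₀)) :
    ∀ᵐ ω ∂P, ∀ t : ℝ≥0, S t ω = s₀ * Real.exp
      ((∫ u in (0 : ℝ)..t, ∑ j, c j * X u.toNNReal ω j) + linComb W σ t ω
        + (α - (∑ k, σ k ^ 2) / 2 + ∫ z in Z₀, (l z - γ z) ∂ν) * t + L t ω) := by
  have key := stochExp_eq h hW hp hWp σ hG hL
    (x := fun t ω => ∫ u in (0 : ℝ)..t, (α + ∑ j, c j * X u.toNNReal ω j)) (S := S) (s₀ := s₀)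
    (fun s => hX.aestronglyMeasurable_integral (fun u hu j =>
      (hX.aestronglyMeasurable_component u j).mono (𝓕.mono hu)) α c) ?_ ?_ hSm hS hint
  · filter_upwards [key, hX.continuous] with ω h1 h2 t
    have h3 : ∫ u in (0 : ℝ)..t, (α + ∑ j, c j * X u.toNNReal ω j)
        = α * t + ∫ u in (0 : ℝ)..t, ∑ j, c j * X u.toNNReal ω j := by
      have hc : Continuous fun u : ℝ => ∑ j, c j * X u.toNNReal ω j := by
        simpa only [zero_add, Function.comp_def] using
          (continuous_affine_path h2 0 c).comp continuous_real_toNNReal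
      rw [intervalIntegral.integral_add (by simp) (hc.intervalIntegrable _ _),
        intervalIntegral.integral_const]
      simp [mul_comm]
    rw [h1 t, h3, NNReal.coe_zero, intervalIntegral.integral_same]
    congr 2
    ring
  · filter_upwards [hX.continuous] with ω hω t
    exact exists_lipschitz_integral_path
      ((continuous_affine_path hω α c).comp continuous_real_toNNReal) t
  · filter_upwards [hX.continuous] with ω hω
    exact continuous_integral_path ((continuous_affine_path hω α c).comp continuous_real_toNNReal)

end Factor

end

end JumpMarket

end

/-! ### Assembly of the exponential formula, the recovery of the jumps and the filtering identity.
-/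

theorem mainTheorem11
    {Ω Z : Type*} {mΩ : MeasurableSpace Ω} (P : Measure Ω) [IsProbabilityMeasure P]
    (𝓕 : Filtration ℝ≥0 mΩ)
    [TopologicalSpace Z] [PolishSpace Z] [MeasurableSpace Z] [BorelSpace Z]
    {n m d : ℕ}
    -- the driving noises
    (W : ℝ≥0 → Ω → Fin d → ℝ) (hW : JumpMarket.IsBrownianMotion 𝓕 P W)
    (ν : Measure Z) [SigmaFinite ν]
    (p : Ω → ℝ → Option Z) (hp : JumpMarket.IsPoissonPointProcess 𝓕 P ν p)
    (hWp : Indep (JumpMarket.processSigma W) (JumpMarket.pointSigma p) P)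
    (Z₀ : Set Z) (hZ₀ : MeasurableSet Z₀) (hνZ₀ : ν Z₀ᶜ < ∞)
    -- the factor process
    (b : Fin n → ℝ) (B : Matrix (Fin n) (Fin n) ℝ) (Lam : Matrix (Fin n) (Fin d) ℝ)
    (X : ℝ≥0 → Ω → EuclideanSpace ℝ (Fin n))
    (hX : JumpMarket.IsFactorProcess 𝓕 P b B Lam W X)
    (m₀ : EuclideanSpace ℝ (Fin n)) (P₀ : Matrix (Fin n) (Fin n) ℝ) (hP₀ : P₀.PosSemidef)
    (hX₀ : HasLaw (X 0) (multivariateGaussian m₀ P₀) P)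
    (hX₀ind : Indep (MeasurableSpace.comap (X 0) inferInstance)
      (JumpMarket.processSigma W ⊔ JumpMarket.pointSigma p) P)
    -- the jump sizes of the prices
    (γ : Z → Fin m → ℝ) (hγ : Measurable γ)
    (hγ_gt : ∀ i, ∀ᵐ z ∂ν, -1 < γ z i)
    (hγ_sq : ∀ i, IntegrableOn (fun z => γ z i ^ 2) Z₀ ν)
    (hγ_log : ∀ i, IntegrableOn (fun z => Real.log (1 + γ z i) - γ z i) Z₀ ν)
    -- the prices
    (a₀ : ℝ) (a : Fin m → ℝ) (A : Matrix (Fin m) (Fin n) ℝ) (Sig : Matrix (Fin m) (Fin d) ℝ)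
    (G : Fin m → ℝ≥0 → Ω → ℝ)
    (hG : ∀ i, JumpMarket.IsJumpIntegral P ν Z₀ p (fun z => γ z i) (G i))
    (s : Fin (m + 1) → ℝ) (hs : ∀ i : Fin m, 0 < s i.succ)
    (S : ℝ≥0 → Ω → Fin (m + 1) → ℝ)
    (hS : JumpMarket.IsPriceProcess 𝓕 P a₀ s
      (JumpMarket.cumulativeReturn a A Sig X W G) S)
    -- the processes `Y¹` and `Y²`
    (Y₁ : ℝ≥0 → Ω → Fin m → ℝ) (hY₁ : JumpMarket.IsContinuousPart P A Sig X W Y₁)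
    (L : Fin m → ℝ≥0 → Ω → ℝ)
    (hL : ∀ i, JumpMarket.IsJumpIntegral P ν Z₀ p (fun z => Real.log (1 + γ z i)) (L i))
    (Y₂ : ℝ≥0 → Ω → Fin m → ℝ)
    (hY₂ : JumpMarket.IsJumpPart P s (JumpMarket.logDrift ν Z₀ a Sig γ) L Y₂) :
    -- the prices are positive and `Y = log S` splits as `Y¹ + Y²`
    (∀ᵐ ω ∂P, ∀ (t : ℝ≥0) (i : Fin m),
      0 < S t ω i.succ ∧ Real.log (S t ω i.succ) = Y₁ t ω i + Y₂ t ω i) ∧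
    -- (i) both parts are adapted to the augmented price filtration
    (∀ t : ℝ≥0,
      Measurable[JumpMarket.augment P (JumpMarket.history S t)] (Y₁ t) ∧
      Measurable[JumpMarket.augment P (JumpMarket.history S t)] (Y₂ t)) ∧
    -- (ii) the conditional expectations agree, with and without augmentation
    (∀ (t : ℝ≥0) (f : EuclideanSpace ℝ (Fin n) → ℝ), Measurable f → (∃ C, ∀ x, |f x| ≤ C) →
      P[fun ω => f (X t ω) | JumpMarket.history S t] =ᵐ[P]
        P[fun ω => f (X t ω) | JumpMarket.history Y₁ t] ∧
      P[fun ω => f (X t ω) | JumpMarket.augment P (JumpMarket.history S t)] =ᵐ[P]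
        P[fun ω => f (X t ω) | JumpMarket.augment P (JumpMarket.history Y₁ t)]) := by
  have hjump : ∀ i, ∃ γ' l : Z → ℝ, JumpMarket.IsJumpSize ν Z₀ γ' l ∧
      (fun z => γ z i) =ᵐ[ν] γ' ∧ (fun z => Real.log (1 + γ z i)) =ᵐ[ν] l := fun i =>
    JumpMarket.exists_isJumpSize hZ₀ hνZ₀ ((measurable_pi_apply i).comp hγ) (hγ_gt i) (hγ_sq i)
      (hγ_log i)
  choose γ' l hl hγγ' hll using hjump
  have hG' := fun i => (hG i).congr_ae hp (hγγ' i)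
  have hL' := fun i => (hL i).congr_ae hp (hll i)
  have hdrift : ∀ i, ∫ z in Z₀, (l i z - γ' i z) ∂ν
      = ∫ z in Z₀, (Real.log (1 + γ z i) - γ z i) ∂ν := fun i => by
    refine integral_congr_ae (ae_restrict_of_ae ?_)
    filter_upwards [hγγ' i, hll i] with z h1 h2
    rw [← h1, ← h2]
  have hprice : ∀ᵐ ω ∂P, ∀ (t : ℝ≥0) (i : Fin m),
      S t ω i.succ = Real.exp (Y₁ t ω i + Y₂ t ω i) := by
    have h1 : ∀ i : Fin m, ∀ᵐ ω ∂P, ∀ t : ℝ≥0, S t ω i.succ = s i.succ * Real.exp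
        ((∫ u in (0 : ℝ)..t, ∑ j, A i j * X u.toNNReal ω j) + JumpMarket.linComb W (Sig i) t ω
          + (a i - (∑ k, Sig i k ^ 2) / 2 + ∫ z in Z₀, (l i z - γ' i z) ∂ν) * t + L i t ω) :=
      fun i => JumpMarket.price_eq_exp hX (hl i) hW hp hWp (Sig i) (hG' i) (hL' i)
        (S := fun t ω => S t ω i.succ) (fun t => (((measurable_pi_apply i.succ).comp
          (hS.adapted t))).aestronglyMeasurable)
        (by filter_upwards [hS.cadlag] with ω hω using hω i.succ) (hS.risky i)
    filter_upwards [ae_all_iff.2 h1, hY₁.eq, hY₂.eq] with ω h1 h2 h3 t i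
    rw [h1 i t, h2 t i, h3 t i, JumpMarket.logDrift, hdrift]
    -- The initial price enters the exponent as the initial value of `Y²`; this is where its
    -- positivity matters.
    nth_rewrite 1 [← Real.exp_log (hs i)]
    rw [← Real.exp_add, JumpMarket.linComb, Matrix.mul_apply]
    simp only [Matrix.transpose_apply, ← pow_two]
    congr 1
    ring
  have hlogS : ∀ᵐ ω ∂P, ∀ (t : ℝ≥0) (i : Fin m),
      0 < S t ω i.succ ∧ Real.log (S t ω i.succ) = Y₁ t ω i + Y₂ t ω i := by
    filter_upwards [hprice] with ω hω t i
    rw [hω t i, Real.log_exp]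
    exact ⟨Real.exp_pos _, rfl⟩
  have hleS : ∀ t, JumpMarket.history S t ≤ mΩ := fun t =>
    JumpMarket.history_le fun u _ => (hS.adapted u).mono (𝓕.le u) le_rfl
  have hle1 : ∀ t, JumpMarket.history Y₁ t ≤ mΩ := fun t =>
    JumpMarket.history_le fun u _ => hY₁.measurable u
  have hle2 : ∀ t, JumpMarket.history Y₂ t ≤ mΩ := fun t =>
    JumpMarket.history_le fun u _ => hY₂.measurable u
  have hlogm : ∀ t i, ∀ u ≤ t, AEStronglyMeasurable[JumpMarket.history S t]
      (fun ω => Real.log (S u ω (Fin.succ i))) P := fun t i u hu =>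
    (Measurable.log ((measurable_pi_apply i.succ).comp
      (JumpMarket.measurable_history S hu))).aestronglyMeasurable
  -- the jump parts are recovered from the jumps of the prices
  have hLm : ∀ t i, AEStronglyMeasurable[JumpMarket.history S t] (L i t) P := by
    intro t i
    -- The observed path is `log S`, and its continuous part `φ` collects `Y¹`, the initial value
    -- and the drift. Only continuity of `φ` is asked for, not its adaptedness to the prices.
    refine (hl i).aestronglyMeasurable_jumpIntegral hW hp hWp (hL' i)
      (y := fun u ω => Real.log (S u ω i.succ))
      (φ := fun u ω => (∫ v in (0 : ℝ)..u, (0 + ∑ j, A i j * X v.toNNReal ω j))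
        + JumpMarket.linComb W (Sig i) u ω + (Real.log (s i.succ)
          + JumpMarket.logDrift ν Z₀ a Sig γ i * u)) ?_ ?_ (hlogm t i)
    · filter_upwards [hX.continuous, hW.ae_linComb (P := P) (Sig i)] with ω h1 h2
      exact ((JumpMarket.continuous_integral_path ((JumpMarket.continuous_affine_path h1 0
        (A i)).comp continuous_real_toNNReal)).add h2.1).add
        (continuous_const.add (continuous_const.mul NNReal.continuous_coe))
    · filter_upwards [hlogS, hY₁.eq, hY₂.eq] with ω h1 h2 h3 u
      rw [(h1 u i).2, h2 u i, h3 u i, JumpMarket.linComb]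
      simp only [zero_add]
      ring
  have hY2m : ∀ t i, AEStronglyMeasurable[JumpMarket.history S t] (fun ω => Y₂ t ω i) P := by
    intro t i
    refine ((hLm t i).const_add (Real.log (s i.succ)
      + JumpMarket.logDrift ν Z₀ a Sig γ i * t)).congr ?_
    filter_upwards [hY₂.eq] with ω hω
    exact (hω t i).symm
  have hY1m : ∀ t i, AEStronglyMeasurable[JumpMarket.history S t] (fun ω => Y₁ t ω i) P := by
    intro t i
    refine ((hlogm t i t le_rfl).sub (hY2m t i)).congr ?_
    filter_upwards [hlogS] with ω hω
    simp only [Pi.sub_apply, (hω t i).2]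
    ring
  have hadapt : ∀ t : ℝ≥0,
      Measurable[JumpMarket.augment P (JumpMarket.history S t)] (Y₁ t) ∧
      Measurable[JumpMarket.augment P (JumpMarket.history S t)] (Y₂ t) := fun t =>
    ⟨JumpMarket.measurable_augment_pi (hleS t) (hY₁.measurable t) (hY1m t),
    JumpMarket.measurable_augment_pi (hleS t) (hY₂.measurable t) (hY2m t)⟩
  refine ⟨hlogS, hadapt, fun t f hf ⟨C, hC⟩ => ?_⟩
  -- the price filtration is generated by the two parts
  have hleH : JumpMarket.history Y₁ t ⊔ JumpMarket.history Y₂ t ≤ mΩ := sup_le (hle1 t) (hle2 t)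
  have haug : JumpMarket.augment P (JumpMarket.history S t) = JumpMarket.augment P (JumpMarket.history Y₁ t ⊔ JumpMarket.history Y₂ t) := by
    refine le_antisymm ?_ ?_
    · refine (JumpMarket.augment_mono ?_).trans_eq JumpMarket.augment_augment
      refine JumpMarket.history_le fun u hu =>
        JumpMarket.measurable_augment_pi hleH ((hS.adapted u).mono (𝓕.le u) le_rfl) fun k => ?_
      refine Fin.cases ?_ (fun i => ?_) k
      -- The money market account is almost surely constant in `ω`, so it carries no information.
      · refine ⟨fun _ => s 0 * Real.exp (a₀ * u), stronglyMeasurable_const, ?_⟩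
        filter_upwards [hS.money, hS.cadlag] with ω h1 h2
        exact (h2 0).eq_exp_of_integral_eq h1 u
      · have e1 : Measurable[JumpMarket.history Y₁ t ⊔ JumpMarket.history Y₂ t] fun ω => Y₁ u ω i := ((measurable_pi_apply i).comp
          (JumpMarket.measurable_history Y₁ hu)).mono le_sup_left le_rfl
        have e2 : Measurable[JumpMarket.history Y₁ t ⊔ JumpMarket.history Y₂ t] fun ω => Y₂ u ω i := ((measurable_pi_apply i).comp
          (JumpMarket.measurable_history Y₂ hu)).mono le_sup_right le_rfl
        refine (Measurable.exp (e1.add e2)).aestronglyMeasurable.congr ?_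
        filter_upwards [hprice] with ω hω
        exact (hω u i).symm
    · refine (JumpMarket.augment_mono (sup_le ?_ ?_)).trans_eq JumpMarket.augment_augment
      · exact JumpMarket.history_le fun u hu => (hadapt u).1.mono
          (JumpMarket.augment_mono (JumpMarket.history_mono S hu)) le_rfl
      · exact JumpMarket.history_le fun u hu => (hadapt u).2.mono
          (JumpMarket.augment_mono (JumpMarket.history_mono S hu)) le_rfl
  -- independence of the jump part from the factors and the continuous part
  have hXm : ∀ u, Measurable (X u) := fun u => (hX.adapted u).mono (𝓕.le u) le_rfl
  have hWle : JumpMarket.processSigma W ≤ mΩ :=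
    JumpMarket.processSigma_le fun u => (hW.adapted u).mono (𝓕.le u) le_rfl
  have hple := JumpMarket.pointSigma_le hp
  have h_le : MeasurableSpace.comap (X 0) inferInstance ⊔ JumpMarket.processSigma W ≤ mΩ := sup_le (hXm 0).comap_le hWle
  -- `X t` and the histories of the two parts are measurable for these σ-algebras only up to null
  -- sets, so the independence is transferred to the augmentations, where true inclusions hold.
  have hindep : Indep (JumpMarket.augment P (MeasurableSpace.comap (X 0) inferInstance ⊔ JumpMarket.processSigma W)) (JumpMarket.augment P (JumpMarket.pointSigma p)) P :=
    JumpMarket.indep_augment h_le hple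
      (JumpMarket.indep_sup_left (hXm 0).comap_le hWle hple hX₀ind hWp)
  have hX𝒢 : ∀ (u : ℝ≥0) (j : Fin n), AEStronglyMeasurable[MeasurableSpace.comap (X 0) inferInstance ⊔ JumpMarket.processSigma W] (fun ω => X u ω j) P :=
    hX.aestronglyMeasurable_initial_sup hW
  have hXt : Measurable[JumpMarket.augment P (MeasurableSpace.comap (X 0) inferInstance ⊔ JumpMarket.processSigma W)] (X t) := by
    have h1 : Measurable[JumpMarket.augment P (MeasurableSpace.comap (X 0) inferInstance ⊔ JumpMarket.processSigma W)] fun ω j => X t ω j :=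
      JumpMarket.measurable_augment_pi h_le
        ((WithLp.measurable_ofLp 2 (Fin n → ℝ)).comp (hXm t)) (hX𝒢 t)
    exact (WithLp.measurable_toLp 2 (Fin n → ℝ)).comp h1
  have h1le : JumpMarket.history Y₁ t ≤ JumpMarket.augment P (MeasurableSpace.comap (X 0) inferInstance ⊔ JumpMarket.processSigma W) := by
    refine JumpMarket.history_le fun u _ =>
      JumpMarket.measurable_augment_pi h_le (hY₁.measurable u) fun i => ?_
    refine ((hX.aestronglyMeasurable_integral (t := u) (fun v _ j => hX𝒢 v j) 0 (A i)).add
      ((JumpMarket.IsBrownianMotion.measurable_linComb_processSigma (W := W) (Sig i) u).mono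
        (le_sup_right (a := MeasurableSpace.comap (X 0) inferInstance)) le_rfl).aestronglyMeasurable).congr ?_
    filter_upwards [hY₁.eq] with ω hω
    simp only [Pi.add_apply, zero_add, JumpMarket.linComb]
    exact (hω u i).symm
  have h2le : JumpMarket.history Y₂ t ≤ JumpMarket.augment P (JumpMarket.pointSigma p) := by
    refine JumpMarket.history_le fun u _ =>
      JumpMarket.measurable_augment_pi hple (hY₂.measurable u) fun i => ?_
    refine (((hL' i).aestronglyMeasurable_pointSigma (hl i) hp u).const_add
      (Real.log (s i.succ) + JumpMarket.logDrift ν Z₀ a Sig γ i * u)).congr ?_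
    filter_upwards [hY₂.eq] with ω hω
    exact (hω u i).symm
  have hfX : Measurable[JumpMarket.augment P (MeasurableSpace.comap (X 0) inferInstance ⊔ JumpMarket.processSigma W)] fun ω => f (X t ω) := hf.comp hXt
  have hint : Integrable (fun ω => f (X t ω)) P :=
    Integrable.of_bound (hf.comp (hXm t)).aestronglyMeasurable C (ae_of_all _ fun ω => hC _)
  have hce : P[fun ω => f (X t ω) | JumpMarket.history Y₁ t ⊔ JumpMarket.history Y₂ t] =ᵐ[P] P[fun ω => f (X t ω) | JumpMarket.history Y₁ t] :=
    JumpMarket.condExp_sup_of_indep (JumpMarket.augment_le h_le) (JumpMarket.augment_le hple)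
      hindep h1le h2le hint hfX.stronglyMeasurable
  have hS_aug := JumpMarket.condExp_augment (P := P) (hleS t) hint
  have h1_aug := JumpMarket.condExp_augment (P := P) (hle1 t) hint
  have hH_aug := JumpMarket.condExp_augment (P := P) hleH hint
  -- Both augmentations coincide, so the conditional expectation given the prices is that given the
  -- two parts, from which the jump part drops out.
  rw [← haug] at hH_aug
  exact ⟨hS_aug.symm.trans (hH_aug.trans hce), hH_aug.trans (hce.trans h1_aug.symm)⟩
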